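/- **Theorem (effectively propositional orthologic).** Fix countably infinite sets of variables and of constant symbols. A signature $\Sigma$ consists of finitely many predicate symbols with arities and a finite non-empty set of constants; there are no function symbols. Atoms are $p(u_1,\dots,u_s)$ with $p$ a predicate symbol of arity $s$ and each $u_i$ a variable or a constant of $\Sigma$; formulas are built from atoms with $\wedge,\vee,\neg$; a sequent is a set of at most two annotated formulas $\varphi^L$, $\varphi^R$. Orthologic is the sequent calculus whose rules are, for all formulas $\varphi,\psi$ and all sets $\Gamma,\Delta$ of at most one annotated formula, Hyp ($\varphi^L,\varphi^R$), Cut (from $\Gamma,\psi^R$ and $\psi^L,\Delta$ infer $\Gamma,\Delta$), Weakening (from $\Gamma$ infer $\Gamma,\Delta$), LeftAnd (from $\Gamma,\varphi^L$ or from $\Gamma,\psi^L$ infer $\Gamma,(\varphi\wedge\psi)^L$), RightAnd (from $\Gamma,\varphi^R$ and $\Gamma,\psi^R$ infer $\Gamma,(\varphi\wedge\psi)^R$), the dual rules LeftOr and RightOr for $\vee$, LeftNot (from $\Gamma,\varphi^R$ infer $\Gamma,(\neg\varphi)^L$), RightNot (from $\Gamma,\varphi^L$ infer $\Gamma,(\neg\varphi)^R$),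 and every given axiom sequent. The problem EPR-OL-D asks, given a finite set $A$ of sequents (the axioms) and a sequent $S$ (the goal) over a signature $\Sigma$, whether $S$ is derivable in orthologic from $A^*$, the set of all instances of members of $A$ under substitutions of variables by variables or constants of $\Sigma$. Let $d=d(A)$ be the maximal number of distinct variables in a sequent of $A$ ($0$ if $A=\emptyset$), and let $n$ be the total size of $(A,S)$: the number of occurrences of predicate symbols, variables, constants and connectives in the sequents of $A$ and in $S$, plus one for each of these sequents. Then EPR-OL-D is decidable in time $O(n^{3(d+1)})$ on a word RAM with words of $O((d+1)\log n)$ bits. Precisely: there are a single word-RAM program and absolute constants $C,k$ such that for every signature $\Sigma$, every instance $(A,S)$ over $\Sigma$ and every word length $w$ with $2^w\ge (n+1)^{k(d+1)}$ and such that all numbers in the input encoding of $(A,S)$ are less than $2^w$, the program halts on $(A,S)$ after at most $C\,n^{3(d+1)}$ steps with the correct answer. (So the time is polynomial in $n^{d}$ when $d\ge 1$, and cubic in $n$ when $d=0$.) -/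

import Mathlib

namespace EPROL

/-! ### Orthologic over an arbitrary set of atoms -/

/-- Formulas built from atoms in `α` with negation, conjunction and disjunction. -/
inductive Formula (α : Type) : Type
  | atom (a : α) : Formula α
  | neg (φ : Formula α) : Formula α
  | conj (φ ψ : Formula α) : Formula α
  | disj (φ ψ : Formula α) : Formula α

/-- Annotated formulas: `L φ` is `φ` on the left, `R φ` is `φ` on the right of a sequent. -/
inductive Annotated (α : Type) : Type
  | L (φ : Formula α) : Annotated α
  | R (φ : Formula α) : Annotated α

/-- A sequent, written down as `Γ, Δ` where each of `Γ` and `Δ` is empty or one annotated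
formula. The sequent meant is the set `Sequent.toSet` of at most two annotated formulas. -/
structure Sequent (α : Type) : Type where
  fst : Option (Annotated α)
  snd : Option (Annotated α)

/-- The set of annotated formulas `Γ ∪ Δ`. -/
def Sequent.toSet {α : Type} (S : Sequent α) : Set (Annotated α) :=
  {x | S.fst = some x ∨ S.snd = some x}

/-- `sq Γ Δ` is the set `Γ ∪ Δ`. -/
def sq {α : Type} (Γ Δ : Option (Annotated α)) : Set (Annotated α) :=
  (Sequent.mk Γ Δ).toSet

open Annotated Formula in
/-- `Provable A S`: the sequent `S` has a derivation in the sequent calculus of orthologic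
(with the Cut rule) from the possibly infinite set of axioms `A`. Sequents are sets of at most
two annotated formulas, and `Γ`, `Δ` range over sets of at most one annotated formula.
The rules for a conjunction on the left and a disjunction on the right come in two versions,
because the two arguments of a connective are not ordered. -/
inductive Provable {α : Type} (A : Set (Set (Annotated α))) : Set (Annotated α) → Prop
  | hyp (φ : Formula α) : Provable A (sq (some (L φ)) (some (R φ)))
  | cut (Γ Δ : Option (Annotated α)) (ψ : Formula α) :
      Provable A (sq Γ (some (R ψ))) → Provable A (sq (some (L ψ)) Δ) → Provable A (sq Γ Δ)
  | weaken (Γ Δ : Option (Annotated α)) : Provable A (sq Γ none) → Provable A (sq Γ Δ)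
  | leftAnd₁ (Γ : Option (Annotated α)) (φ ψ : Formula α) :
      Provable A (sq Γ (some (L φ))) → Provable A (sq Γ (some (L (conj φ ψ))))
  | leftAnd₂ (Γ : Option (Annotated α)) (φ ψ : Formula α) :
      Provable A (sq Γ (some (L ψ))) → Provable A (sq Γ (some (L (conj φ ψ))))
  | rightAnd (Γ : Option (Annotated α)) (φ ψ : Formula α) :
      Provable A (sq Γ (some (R φ))) → Provable A (sq Γ (some (R ψ))) →
        Provable A (sq Γ (some (R (conj φ ψ))))
  | leftOr (Γ : Option (Annotated α)) (φ ψ : Formula α) :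
      Provable A (sq Γ (some (L φ))) → Provable A (sq Γ (some (L ψ))) →
        Provable A (sq Γ (some (L (disj φ ψ))))
  | rightOr₁ (Γ : Option (Annotated α)) (φ ψ : Formula α) :
      Provable A (sq Γ (some (R φ))) → Provable A (sq Γ (some (R (disj φ ψ))))
  | rightOr₂ (Γ : Option (Annotated α)) (φ ψ : Formula α) :
      Provable A (sq Γ (some (R ψ))) → Provable A (sq Γ (some (R (disj φ ψ))))
  | leftNot (Γ : Option (Annotated α)) (φ : Formula α) :
      Provable A (sq Γ (some (R φ))) → Provable A (sq Γ (some (L (neg φ))))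
  | rightNot (Γ : Option (Annotated α)) (φ : Formula α) :
      Provable A (sq Γ (some (L φ))) → Provable A (sq Γ (some (R (neg φ))))
  | ax (Γ Δ : Option (Annotated α)) : sq Γ Δ ∈ A → Provable A (sq Γ Δ)

/-! ### Effectively propositional orthologic -/

/-- A predicate signature: finitely many predicate symbols with arities, and a finite
non-empty set of constants, taken from the countably infinite set `ℕ` of constant symbols. -/
structure Signature : Type where
  numPreds : ℕ
  arity : Fin numPreds → ℕ
  consts : Finset ℕ
  consts_nonempty : consts.Nonempty

/-- The arguments of predicates: variables (the set of variables is `ℕ`) and constants of the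
signature. There are no function symbols. -/
inductive Arg (Sg : Signature) : Type
  | var (v : ℕ) : Arg Sg
  | const (c : {c : ℕ // c ∈ Sg.consts}) : Arg Sg

/-- Atomic formulas over the signature. -/
structure Atom (Sg : Signature) : Type where
  pred : Fin Sg.numPreds
  args : Fin (Sg.arity pred) → Arg Sg

/-! #### Substitution of variables by variables or constants -/

def Arg.subst {Sg : Signature} (σ : ℕ → Arg Sg) : Arg Sg → Arg Sg
  | .var v => σ v
  | .const c => .const c

def Atom.subst {Sg : Signature} (σ : ℕ → Arg Sg) (a : Atom Sg) : Atom Sg :=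
  ⟨a.pred, fun i => (a.args i).subst σ⟩

def Formula.subst {Sg : Signature} (σ : ℕ → Arg Sg) : Formula (Atom Sg) → Formula (Atom Sg)
  | .atom a => .atom (a.subst σ)
  | .neg φ => .neg (φ.subst σ)
  | .conj φ ψ => .conj (φ.subst σ) (ψ.subst σ)
  | .disj φ ψ => .disj (φ.subst σ) (ψ.subst σ)

def Annotated.subst {Sg : Signature} (σ : ℕ → Arg Sg) : Annotated (Atom Sg) → Annotated (Atom Sg)
  | .L φ => .L (φ.subst σ)
  | .R φ => .R (φ.subst σ)

/-- The expansion `A*` of a set `A` of sequents: all instances of its members. -/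
def expansion {Sg : Signature} (A : Set (Set (Annotated (Atom Sg)))) :
    Set (Set (Annotated (Atom Sg))) :=
  {T | ∃ S ∈ A, ∃ σ : ℕ → Arg Sg, T = Annotated.subst σ '' S}

/-! #### Variables and degree -/

def Arg.vars {Sg : Signature} : Arg Sg → Finset ℕ
  | .var v => {v}
  | .const _ => ∅

def Atom.vars {Sg : Signature} (a : Atom Sg) : Finset ℕ :=
  Finset.univ.biUnion fun i => (a.args i).vars

def Formula.vars {Sg : Signature} : Formula (Atom Sg) → Finset ℕ
  | .atom a => a.vars
  | .neg φ => φ.vars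
  | .conj φ ψ => φ.vars ∪ ψ.vars
  | .disj φ ψ => φ.vars ∪ ψ.vars

def Annotated.vars {Sg : Signature} : Annotated (Atom Sg) → Finset ℕ
  | .L φ => φ.vars
  | .R φ => φ.vars

/-- The variables of a part `Γ` of a sequent that is empty or one annotated formula. -/
def optVars {Sg : Signature} : Option (Annotated (Atom Sg)) → Finset ℕ
  | none => ∅
  | some a => a.vars

/-- The degree of a sequent: the number of distinct variables in it. -/
def Sequent.degree {Sg : Signature} (S : Sequent (Atom Sg)) : ℕ :=
  (optVars S.fst ∪ optVars S.snd).card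

/-! #### Size: the number of symbols -/

/-- Number of symbols: one for each connective, predicate symbol, variable and constant. -/
def Formula.size {Sg : Signature} : Formula (Atom Sg) → ℕ
  | .atom a => 1 + Sg.arity a.pred
  | .neg φ => 1 + φ.size
  | .conj φ ψ => 1 + φ.size + ψ.size
  | .disj φ ψ => 1 + φ.size + ψ.size

def Annotated.size {Sg : Signature} : Annotated (Atom Sg) → ℕ
  | .L φ => φ.size
  | .R φ => φ.size

def optSize {Sg : Signature} : Option (Annotated (Atom Sg)) → ℕ
  | none => 0
  | some a => a.size

/-- The size of a sequent: the symbols of its formulas, and one for the sequent itself (so that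
an empty sequent in a list counts as well). -/
def Sequent.size {Sg : Signature} (S : Sequent (Atom Sg)) : ℕ :=
  1 + optSize S.fst + optSize S.snd

/-! #### Encoding as a list of natural numbers -/

def Arg.encode {Sg : Signature} : Arg Sg → List ℕ
  | .var v => [0, v]
  | .const c => [1, c.1]

def Atom.encode {Sg : Signature} (a : Atom Sg) : List ℕ :=
  [a.pred.1, Sg.arity a.pred] ++ (List.ofFn a.args).flatMap Arg.encode

/-- Formulas are encoded in prefix notation. -/
def Formula.encode {Sg : Signature} : Formula (Atom Sg) → List ℕ
  | .atom a => [0] ++ a.encode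
  | .neg φ => [1] ++ φ.encode
  | .conj φ ψ => [2] ++ φ.encode ++ ψ.encode
  | .disj φ ψ => [3] ++ φ.encode ++ ψ.encode

def Annotated.encode {Sg : Signature} : Annotated (Atom Sg) → List ℕ
  | .L φ => [1] ++ φ.encode
  | .R φ => [2] ++ φ.encode

def optEncode {Sg : Signature} : Option (Annotated (Atom Sg)) → List ℕ
  | none => [0]
  | some a => a.encode

def Sequent.encode {Sg : Signature} (S : Sequent (Atom Sg)) : List ℕ :=
  optEncode S.fst ++ optEncode S.snd

/-! #### The deduction problem -/

/-- An EPR deduction instance over a signature: a finite set of axioms, given as a list, and a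
goal. -/
structure Instance (Sg : Signature) : Type where
  axs : List (Sequent (Atom Sg))
  goal : Sequent (Atom Sg)

/-- The set of axioms. -/
def Instance.axSet {Sg : Signature} (I : Instance Sg) : Set (Set (Annotated (Atom Sg))) :=
  {T | ∃ S ∈ I.axs, T = S.toSet}

/-- The instance is valid if its goal is derivable in orthologic from all instances of its
axioms. -/
def Instance.Valid {Sg : Signature} (I : Instance Sg) : Prop :=
  Provable (expansion I.axSet) I.goal.toSet

/-- The maximal number of distinct variables in an axiom (`0` if there are no axioms). -/
def Instance.degree {Sg : Signature} (I : Instance Sg) : ℕ :=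
  (I.axs.map Sequent.degree).foldr max 0

/-- The size of an instance: the total number of symbols in axioms and goal. -/
def Instance.size {Sg : Signature} (I : Instance Sg) : ℕ :=
  (I.axs.map Sequent.size).sum + I.goal.size

/-- The input given to an algorithm. The signature is not part of it: the arity of a predicate
symbol is written next to each of its occurrences. -/
def Instance.encode {Sg : Signature} (I : Instance Sg) : List ℕ :=
  I.goal.encode ++ [I.axs.length] ++ I.axs.flatMap Sequent.encode

/-! ### The word RAM

A machine with finitely many registers (those which the program mentions) and a random access
memory. Registers and memory cells hold words of `w` bits, that is, numbers below `2 ^ w`, and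
memory is addressed by words. Programs are built from the usual machine instructions with
sequencing, branching and loops; every instruction and every test takes one unit of time. -/

/-- The arithmetic operations on words. -/
inductive Op : Type
  | add
  | sub
  | mul
  | div

/-- Results are reduced modulo `2 ^ w`; subtraction is truncated at `0`, division rounds down,
and division by zero gives `0`. -/
def Op.eval (w : ℕ) : Op → ℕ → ℕ → ℕ
  | .add, x, y => (x + y) % 2 ^ w
  | .sub, x, y => (x - y) % 2 ^ w
  | .mul, x, y => (x * y) % 2 ^ w
  | .div, x, y => (x / y) % 2 ^ w

/-- Tests compare the contents of two registers. -/
inductive Test : Type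
  | lt (a b : ℕ) : Test
  | eq (a b : ℕ) : Test

/-- Programs. The numbers `r`, `a`, `b` are names of registers. -/
inductive Cmd : Type
  | skip : Cmd
  /-- `r := c` -/
  | const (r c : ℕ) : Cmd
  /-- `r := a ∘ b` -/
  | arith (o : Op) (r a b : ℕ) : Cmd
  /-- `r := mem[a]` -/
  | load (r a : ℕ) : Cmd
  /-- `mem[a] := r` -/
  | store (a r : ℕ) : Cmd
  | seq (p q : Cmd) : Cmd
  | branch (b : Test) (p q : Cmd) : Cmd
  | loop (b : Test) (p : Cmd) : Cmd

structure State : Type where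
  reg : ℕ → ℕ
  mem : ℕ → ℕ

/-- The initial state: the input is in memory from address `0` on, its length is in register
`0`, and everything else is `0`. -/
def State.init (input : List ℕ) : State where
  reg := fun r => if r = 0 then input.length else 0
  mem := fun i => input.getD i 0

def State.setReg (s : State) (r x : ℕ) : State :=
  { s with reg := Function.update s.reg r x }

def State.setMem (s : State) (i x : ℕ) : State :=
  { s with mem := Function.update s.mem i x }

def Test.Holds (s : State) : Test → Prop
  | .lt a b => s.reg a < s.reg b
  | .eq a b => s.reg a = s.reg b

/-- `Exec w p s t s'`: on the machine with words of `w` bits, the program `p`, started in state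
`s`, halts after exactly `t` steps in state `s'`. -/
inductive Exec (w : ℕ) : Cmd → State → ℕ → State → Prop
  | skip (s : State) : Exec w .skip s 1 s
  | const (r c : ℕ) (s : State) : Exec w (.const r c) s 1 (s.setReg r (c % 2 ^ w))
  | arith (o : Op) (r a b : ℕ) (s : State) :
      Exec w (.arith o r a b) s 1 (s.setReg r (o.eval w (s.reg a) (s.reg b)))
  | load (r a : ℕ) (s : State) : Exec w (.load r a) s 1 (s.setReg r (s.mem (s.reg a)))
  | store (a r : ℕ) (s : State) : Exec w (.store a r) s 1 (s.setMem (s.reg a) (s.reg r))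
  | seq {p q : Cmd} {s s₁ s₂ : State} {t₁ t₂ : ℕ} :
      Exec w p s t₁ s₁ → Exec w q s₁ t₂ s₂ → Exec w (.seq p q) s (t₁ + t₂) s₂
  | branchTrue {b : Test} {p q : Cmd} {s s' : State} {t : ℕ} :
      b.Holds s → Exec w p s t s' → Exec w (.branch b p q) s (t + 1) s'
  | branchFalse {b : Test} {p q : Cmd} {s s' : State} {t : ℕ} :
      ¬ b.Holds s → Exec w q s t s' → Exec w (.branch b p q) s (t + 1) s'
  | loopTrue {b : Test} {p : Cmd} {s s₁ s₂ : State} {t₁ t₂ : ℕ} :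
      b.Holds s → Exec w p s t₁ s₁ → Exec w (.loop b p) s₁ t₂ s₂ →
        Exec w (.loop b p) s (t₁ + t₂ + 1) s₂
  | loopFalse {b : Test} {p : Cmd} {s : State} :
      ¬ b.Holds s → Exec w (.loop b p) s 1 s

/-- The machine is deterministic, so the running time and the final state are well defined. -/
theorem Exec.deterministic {w : ℕ} {p : Cmd} {s s₁ s₂ : State} {t₁ t₂ : ℕ}
    (h₁ : Exec w p s t₁ s₁) (h₂ : Exec w p s t₂ s₂) : t₁ = t₂ ∧ s₁ = s₂ := by
  induction h₁ generalizing t₂ s₂ with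
  | skip | const | arith | load | store => cases h₂; exact ⟨rfl, rfl⟩
  | seq _ _ ih₁ ih₂ =>
    cases h₂ with
    | seq a b =>
      obtain ⟨rfl, rfl⟩ := ih₁ a
      obtain ⟨rfl, rfl⟩ := ih₂ b
      exact ⟨rfl, rfl⟩
  | branchTrue hb _ ih =>
    cases h₂ with
    | branchTrue _ a => obtain ⟨rfl, rfl⟩ := ih a; exact ⟨rfl, rfl⟩
    | branchFalse hn _ => exact absurd hb hn
  | branchFalse hn _ ih =>
    cases h₂ with
    | branchTrue hb _ => exact absurd hb hn
    | branchFalse _ a => obtain ⟨rfl, rfl⟩ := ih a; exact ⟨rfl, rfl⟩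
  | loopTrue hb _ _ ih₁ ih₂ =>
    cases h₂ with
    | loopTrue _ a c =>
      obtain ⟨rfl, rfl⟩ := ih₁ a
      obtain ⟨rfl, rfl⟩ := ih₂ c
      exact ⟨rfl, rfl⟩
    | loopFalse hn => exact absurd hb hn
  | loopFalse hn =>
    cases h₂ with
    | loopTrue hb _ _ => exact absurd hb hn
    | loopFalse _ => exact ⟨rfl, rfl⟩

end EPROL

set_option linter.constructorNameAsVariable false

namespace EPROL

/-! ### A language of for-loops with named variables and arrays, compiled to the word RAM -/

/-! Call an item an annotated formula φ^L or φ^R, where φ occurs as a subformula of the goal or of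
an instance of an axiom; one more item, `0`, stands for the absence of a formula. If only the m
arguments found in the goal and the axioms are substituted, there are at most len · m^d occurrences,
with len the length of the encoding, hence M = O(n^(d+1)) items. A sequent made of items is a pair
of items. The claim is that the goal is derivable iff its pair lies in the closure of the axiom
instances and the hypotheses for atoms under symmetry, weakening, cut on items and introduction of
items. At most M² pairs are processed, each in time O(M), so the closure takes time O(M³).

Soundness (`Tables.Correct.sound`) reads every closure rule as a rule of the calculus. Completeness
has two obstacles: a derivation may cut with formulas which are not items, and axioms may be
instantiated with arguments which do not occur in the instance.

The first obstacle is met by a model instead of cut elimination. The closed relation D is an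
orthogonality on the items; formulas are interpreted by sets of items equal to their double polar,
negation being the polar and conjunction the intersection. All rules, cuts with arbitrary formulas
included, are sound in this model (`Provable.sequentHolds`). The atoms are valued so that each
represented formula φ is interpreted by the set of all x with D x φ^R (`Saturated.interp_eq`); this
uses only cuts and introductions on items, which D admits by construction. So the axioms hold, hence
so does a derivable goal, and evaluating it at its own items puts its pair into D.

The second obstacle is met by a retraction f of all arguments onto those of the instance. Valuing an
atom like its image under f makes the instance of an axiom under σ mean the same as its instance
under f ∘ σ, and the latter is in the tables (`Parsed.ax_complete`). Both directions together are
`Tables.Correct.closure_iff_valid`.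

The decision program is written in a small language of for-loops whose weakest preconditions also
count time; `Stmt.exec_code` transfers them to the word RAM. A substitution is a number c < m^d, its
digits in base m being the numbers of the arguments which replace the variables of an axiom. The
node c · len + p is position p under the substitution c. Instances are never written out: a table
tells for each node where in the input its symbol is found. One pass from right to left finds the
ends of formulas, one pass from left to right marks the formulas, lists the arguments and numbers
the variables. This costs O(len³), the comparison of all pairs of atoms O(N² · len) for N nodes, and
the saturation O(M³). In the saturation a rule with two premises fires when the later of them is
taken from the queue, which is why one visit to each pair suffices (`SatInv.complete`). The final
constants come from `time_le` and `Instance.word_bound`. -/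

/-- The variables of the decision program. -/
inductive Var : Type
  | len | p | q | e | m | nv | d | k | i | s | t | r | j | idx | it | a | ar | f | c | x | y | p'
  | bad | N | M | MM | CN | u | u' | ax | ay | tl | h | z | yb | w | ed
  deriving DecidableEq

/-- The arrays of the decision program. -/
inductive Arr : Type
  | E | END | KD | J | T | VV | AXA | AXB | POW | G | IK | IA | IB | BAR | D | Q
  deriving DecidableEq

/-- The values of the variables and the contents of the arrays. -/
structure Store : Type where
  var : Var → ℕ
  arr : Arr → ℕ → ℕ

namespace Store

def set (σ : Store) (x : Var) (n : ℕ) : Store :=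
  { σ with var := Function.update σ.var x n }

def put (σ : Store) (a : Arr) (i n : ℕ) : Store :=
  { σ with arr := Function.update σ.arr a (Function.update (σ.arr a) i n) }

@[simp] theorem set_arr (σ : Store) (x : Var) (n : ℕ) : (σ.set x n).arr = σ.arr := rfl

@[simp] theorem put_var (σ : Store) (a : Arr) (i n : ℕ) : (σ.put a i n).var = σ.var := rfl

@[simp] theorem set_var_self (σ : Store) (x : Var) (n : ℕ) : (σ.set x n).var x = n := by
  simp [set]

theorem set_var (σ : Store) (x y : Var) (n : ℕ) :
    (σ.set x n).var y = if y = x then n else σ.var y := by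
  simp [set, Function.update_apply]

theorem put_arr (σ : Store) (a b : Arr) (i n : ℕ) :
    (σ.put a i n).arr b = if b = a then Function.update (σ.arr a) i n else σ.arr b := by
  simp [put, Function.update_apply]

end Store

inductive Expr : Type
  | lit (n : ℕ) : Expr
  | var (x : Var) : Expr
  | bin (o : Op) (a b : Expr) : Expr
  | read (a : Arr) (i : Expr) : Expr

namespace Expr

instance : Add Expr := ⟨bin .add⟩
instance : Sub Expr := ⟨bin .sub⟩
instance : Mul Expr := ⟨bin .mul⟩
instance : Div Expr := ⟨bin .div⟩
instance (n : ℕ) : OfNat Expr n := ⟨lit n⟩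
instance : Coe Var Expr := ⟨var⟩

end Expr

/-- The operations on natural numbers, without a bound on the word length. -/
def Op.ideal : Op → ℕ → ℕ → ℕ
  | .add, x, y => x + y
  | .sub, x, y => x - y
  | .mul, x, y => x * y
  | .div, x, y => x / y

namespace Expr

def eval (σ : Store) : Expr → ℕ
  | lit n => n
  | var x => σ.var x
  | bin o a b => o.ideal (a.eval σ) (b.eval σ)
  | read a i => σ.arr a (i.eval σ)

/-- All numbers which come up in the evaluation are below `W`, if the arrays are interleaved in
memory from address `B` on. -/
def Safe (W B : ℕ) (σ : Store) : Expr → Prop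
  | lit n => n < W
  | var _ => True
  | bin o a b => a.Safe W B σ ∧ b.Safe W B σ ∧ o.ideal (a.eval σ) (b.eval σ) < W
  | read _ i => i.Safe W B σ ∧ B + 16 * i.eval σ + 16 < W

/-- The exact number of steps of the compiled code. A variable costs two steps because it is copied
by adding a zero that is loaded first; a read needs five steps for the address and one for the load.
-/
def cost : Expr → ℕ
  | lit _ => 1
  | var _ => 2
  | bin _ a b => a.cost + b.cost + 1
  | read _ i => i.cost + 6

@[simp] theorem zero_eq : (0 : Expr) = lit 0 := rfl
@[simp] theorem one_eq : (1 : Expr) = lit 1 := rfl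
@[simp] theorem two_eq : (2 : Expr) = lit 2 := rfl
@[simp] theorem three_eq : (3 : Expr) = lit 3 := rfl
@[simp] theorem five_eq : (5 : Expr) = lit 5 := rfl

@[simp] theorem eval_lit (σ : Store) (n : ℕ) : (lit n).eval σ = n := rfl
@[simp] theorem eval_var (σ : Store) (x : Var) : (var x).eval σ = σ.var x := rfl
@[simp] theorem eval_add (σ : Store) (a b : Expr) : (a + b).eval σ = a.eval σ + b.eval σ := rfl
@[simp] theorem eval_sub (σ : Store) (a b : Expr) : (a - b).eval σ = a.eval σ - b.eval σ := rfl
@[simp] theorem eval_mul (σ : Store) (a b : Expr) : (a * b).eval σ = a.eval σ * b.eval σ := rfl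
@[simp] theorem eval_div (σ : Store) (a b : Expr) : (a / b).eval σ = a.eval σ / b.eval σ := rfl
@[simp] theorem eval_read (σ : Store) (a : Arr) (i : Expr) :
    (read a i).eval σ = σ.arr a (i.eval σ) := rfl

variable {W B : ℕ} {σ : Store}

@[simp] theorem safe_lit {n : ℕ} : (lit n).Safe W B σ ↔ n < W := Iff.rfl
@[simp] theorem safe_var {x : Var} : (var x).Safe W B σ ↔ True := Iff.rfl
@[simp] theorem safe_add {a b : Expr} :
    (a + b).Safe W B σ ↔ a.Safe W B σ ∧ b.Safe W B σ ∧ a.eval σ + b.eval σ < W := Iff.rfl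
@[simp] theorem safe_sub {a b : Expr} :
    (a - b).Safe W B σ ↔ a.Safe W B σ ∧ b.Safe W B σ ∧ a.eval σ - b.eval σ < W := Iff.rfl
@[simp] theorem safe_mul {a b : Expr} :
    (a * b).Safe W B σ ↔ a.Safe W B σ ∧ b.Safe W B σ ∧ a.eval σ * b.eval σ < W := Iff.rfl
@[simp] theorem safe_div {a b : Expr} :
    (a / b).Safe W B σ ↔ a.Safe W B σ ∧ b.Safe W B σ ∧ a.eval σ / b.eval σ < W := Iff.rfl
@[simp] theorem safe_read {a : Arr} {i : Expr} :
    (read a i).Safe W B σ ↔ i.Safe W B σ ∧ B + 16 * i.eval σ + 16 < W := Iff.rfl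

@[simp] theorem cost_lit (n : ℕ) : (lit n).cost = 1 := rfl
@[simp] theorem cost_var (x : Var) : (var x).cost = 2 := rfl
@[simp] theorem cost_add (a b : Expr) : (a + b).cost = a.cost + b.cost + 1 := rfl
@[simp] theorem cost_sub (a b : Expr) : (a - b).cost = a.cost + b.cost + 1 := rfl
@[simp] theorem cost_mul (a b : Expr) : (a * b).cost = a.cost + b.cost + 1 := rfl
@[simp] theorem cost_div (a b : Expr) : (a / b).cost = a.cost + b.cost + 1 := rfl
@[simp] theorem cost_read (a : Arr) (i : Expr) : (read a i).cost = i.cost + 6 := rfl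

end Expr

inductive Cond : Type
  | lt (a b : Expr) : Cond
  | eq (a b : Expr) : Cond

namespace Cond

@[simp] def Holds (σ : Store) : Cond → Prop
  | lt a b => a.eval σ < b.eval σ
  | eq a b => a.eval σ = b.eval σ

@[simp] def Safe (W B : ℕ) (σ : Store) : Cond → Prop
  | lt a b => a.Safe W B σ ∧ b.Safe W B σ
  | eq a b => a.Safe W B σ ∧ b.Safe W B σ

@[simp] def cost : Cond → ℕ
  | lt a b => a.cost + b.cost
  | eq a b => a.cost + b.cost

end Cond

/-- Programs; `loop x b c` runs `c` for `x = 0, …, b - 1`. -/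
inductive Stmt : Type
  | skip : Stmt
  | assign (x : Var) (e : Expr) : Stmt
  | write (a : Arr) (i e : Expr) : Stmt
  | seq (c₁ c₂ : Stmt) : Stmt
  | ite (b : Cond) (c₁ c₂ : Stmt) : Stmt
  | loop (x b : Var) (c : Stmt) : Stmt

infixr:60 " ;; " => Stmt.seq
infix:62 " ≔ " => Stmt.assign

/-- Weakest precondition of `n` rounds from round `i` on. -/
def wpIter (F : ℕ → Store → (Store → ℕ → Prop) → Prop) :
    ℕ → ℕ → Store → (Store → ℕ → Prop) → Prop
  | 0, _, σ, P => P σ 0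
  | n + 1, i, σ, P => F i σ fun τ t => wpIter F n (i + 1) τ fun υ u => P υ (t + u + 3)

namespace Stmt

/-- `c` may change the variable `x`. -/
def writesVar : Stmt → Var → Bool
  | skip, _ => false
  | assign y _, x => x == y
  | write _ _ _, _ => false
  | seq c₁ c₂, x => c₁.writesVar x || c₂.writesVar x
  | ite _ c₁ c₂, x => c₁.writesVar x || c₂.writesVar x
  | loop y _ c, x => x == y || c.writesVar x

/-- `c` may change the array `a`. -/
def writesArr : Stmt → Arr → Bool
  | skip, _ => false
  | assign _ _, _ => false
  | write b _ _, a => a == b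
  | seq c₁ c₂, a => c₁.writesArr a || c₂.writesArr a
  | ite _ c₁ c₂, a => c₁.writesArr a || c₂.writesArr a
  | loop _ _ c, a => c.writesArr a

/-- The counter and the bound of a loop are not changed in its body. -/
def wf : Stmt → Bool
  | skip => true
  | assign _ _ => true
  | write _ _ _ => true
  | seq c₁ c₂ => c₁.wf && c₂.wf
  | ite _ c₁ c₂ => c₁.wf && c₂.wf
  | loop x b c => x != b && !c.writesVar x && !c.writesVar b && c.wf

/-- Weakest preconditions; the postcondition is about the final store and the running time. -/
def wp (W B : ℕ) : Stmt → Store → (Store → ℕ → Prop) → Prop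
  | skip, σ, P => P σ 1
  | assign x e, σ, P => e.Safe W B σ ∧ P (σ.set x (e.eval σ)) (e.cost + 2)
  | write a i e, σ, P =>
      i.Safe W B σ ∧ e.Safe W B σ ∧ B + 16 * i.eval σ + 16 < W ∧
        P (σ.put a (i.eval σ) (e.eval σ)) (i.cost + e.cost + 6)
  | seq c₁ c₂, σ, P => c₁.wp W B σ fun τ t => c₂.wp W B τ fun υ u => P υ (t + u)
  | ite b c₁ c₂, σ, P => b.Safe W B σ ∧
      (b.Holds σ → c₁.wp W B σ fun τ t => P τ (t + b.cost + 1)) ∧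
      (¬ b.Holds σ → c₂.wp W B σ fun τ t => P τ (t + b.cost + 1))
  | loop x b c, σ, P => σ.var b < W ∧
      wpIter (fun i τ R => c.wp W B (τ.set x i) R) (σ.var b) 0 σ
        fun τ t => P (τ.set x (σ.var b)) (t + 2)

/-- `τ` differs from `σ` only in what `c` may change. -/
structure Frame (c : Stmt) (σ τ : Store) : Prop where
  var : ∀ x, c.writesVar x = false → τ.var x = σ.var x
  arr : ∀ a, c.writesArr a = false → τ.arr a = σ.arr a

end Stmt

/-! ### Monotonicity, frames and proof rules for weakest preconditions. -/

theorem wpIter_mono {F : ℕ → Store → (Store → ℕ → Prop) → Prop}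
    (hF : ∀ i σ P P', (∀ τ t, P τ t → P' τ t) → F i σ P → F i σ P')
    {n i : ℕ} {σ : Store} {P P' : Store → ℕ → Prop} (h : ∀ τ t, P τ t → P' τ t)
    (hw : wpIter F n i σ P) : wpIter F n i σ P' := by
  induction n generalizing i σ P P' with
  | zero => exact h _ _ hw
  | succ n ih => exact hF _ _ _ _ (fun τ t hτ => ih (fun υ u hu => h _ _ hu) hτ) hw

namespace Stmt

variable {W B : ℕ}

theorem wp_mono (c : Stmt) {σ : Store} {P P' : Store → ℕ → Prop}
    (h : ∀ τ t, P τ t → P' τ t) (hw : c.wp W B σ P) : c.wp W B σ P' := by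
  induction c generalizing σ P P' with
  | skip => exact h _ _ hw
  | assign x e => exact ⟨hw.1, h _ _ hw.2⟩
  | write a i e => exact ⟨hw.1, hw.2.1, hw.2.2.1, h _ _ hw.2.2.2⟩
  | seq c₁ c₂ ih₁ ih₂ => exact ih₁ (fun τ t hτ => ih₂ (fun υ u hu => h _ _ hu) hτ) hw
  | ite b c₁ c₂ ih₁ ih₂ =>
    exact ⟨hw.1, fun hb => ih₁ (fun τ t => h _ _) (hw.2.1 hb),
      fun hb => ih₂ (fun τ t => h _ _) (hw.2.2 hb)⟩
  | loop x b c ih =>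
    refine ⟨hw.1, wpIter_mono ?_ (fun τ t => h _ _) hw.2⟩
    exact fun i σ P P' hP => ih hP

theorem wpIter_wp_mono {c : Stmt} {x : Var} {n i : ℕ} {σ : Store} {P P' : Store → ℕ → Prop}
    (h : ∀ τ t, P τ t → P' τ t) (hw : wpIter (fun i τ R => c.wp W B (τ.set x i) R) n i σ P) :
    wpIter (fun i τ R => c.wp W B (τ.set x i) R) n i σ P' :=
  wpIter_mono (F := fun i τ R => c.wp W B (τ.set x i) R) (fun _ _ _ _ hP => wp_mono c hP) h hw

theorem Frame.refl (c : Stmt) (σ : Store) : c.Frame σ σ := ⟨fun _ _ => rfl, fun _ _ => rfl⟩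

theorem Frame.trans {c : Stmt} {σ τ υ : Store} (h : c.Frame σ τ) (h' : c.Frame τ υ) :
    c.Frame σ υ :=
  ⟨fun x hx => (h'.var x hx).trans (h.var x hx), fun a ha => (h'.arr a ha).trans (h.arr a ha)⟩

theorem Frame.weaken {c c' : Stmt} {σ τ : Store} (h : c.Frame σ τ)
    (hv : ∀ x, c'.writesVar x = false → c.writesVar x = false)
    (ha : ∀ a, c'.writesArr a = false → c.writesArr a = false) : c'.Frame σ τ :=
  ⟨fun x hx => h.var x (hv x hx), fun a h' => h.arr a (ha a h')⟩

theorem frame_set {c : Stmt} {σ : Store} {x : Var} {n : ℕ} (h : c.writesVar x = true) :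
    c.Frame σ (σ.set x n) :=
  ⟨fun y hy => by
    rw [Store.set_var, if_neg]
    rintro rfl
    simp [h] at hy, fun _ _ => rfl⟩

/-- The frame property of the body is a hypothesis because this is the loop case in the induction
that proves `wp_frame`. -/
theorem wpIter_frame {c c' : Stmt} {x : Var}
    (hc : ∀ σ P, c.wp W B σ P → c.wp W B σ fun τ t => c.Frame σ τ ∧ P τ t)
    (hv : ∀ x, c'.writesVar x = false → c.writesVar x = false)
    (ha : ∀ a, c'.writesArr a = false → c.writesArr a = false)
    (hx : c'.writesVar x = true)
    {n i : ℕ} {σ : Store} {P : Store → ℕ → Prop}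
    (hw : wpIter (fun i τ R => c.wp W B (τ.set x i) R) n i σ P) :
    wpIter (fun i τ R => c.wp W B (τ.set x i) R) n i σ fun τ t => c'.Frame σ τ ∧ P τ t := by
  induction n generalizing i σ P with
  | zero => exact ⟨.refl _ _, hw⟩
  | succ n ih =>
    refine wp_mono c ?_ (hc _ _ hw)
    rintro τ t ⟨hf, h⟩
    refine wpIter_wp_mono ?_ (ih h)
    rintro υ u ⟨hf', h'⟩
    exact ⟨((frame_set hx).trans (hf.weaken hv ha)).trans hf', h'⟩

/-- Thanks to this, a specification only has to mention what changes: that everything else is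
preserved is decided from the syntax of the program. -/
theorem wp_frame (c : Stmt) {σ : Store} {P : Store → ℕ → Prop} (hw : c.wp W B σ P) :
    c.wp W B σ fun τ t => c.Frame σ τ ∧ P τ t := by
  induction c generalizing σ P with
  | skip => exact ⟨.refl _ _, hw⟩
  | assign x e => exact ⟨hw.1, frame_set (by simp [writesVar]), hw.2⟩
  | write a i e =>
    refine ⟨hw.1, hw.2.1, hw.2.2.1, ⟨fun _ _ => rfl, fun b hb => ?_⟩, hw.2.2.2⟩
    rw [Store.put_arr, if_neg]
    rintro rfl
    simp [writesArr] at hb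
  | seq c₁ c₂ ih₁ ih₂ =>
    refine wp_mono c₁ ?_ (ih₁ hw)
    rintro τ t ⟨hf, h⟩
    refine wp_mono c₂ ?_ (ih₂ h)
    rintro υ u ⟨hf', h'⟩
    refine ⟨(hf.weaken ?_ ?_).trans (hf'.weaken ?_ ?_), h'⟩ <;>
      simp +contextual [writesVar, writesArr]
  | ite b c₁ c₂ ih₁ ih₂ =>
    refine ⟨hw.1, fun hb => wp_mono c₁ ?_ (ih₁ (hw.2.1 hb)),
      fun hb => wp_mono c₂ ?_ (ih₂ (hw.2.2 hb))⟩ <;>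
    · rintro τ t ⟨hf, h⟩
      refine ⟨hf.weaken ?_ ?_, h⟩ <;> simp +contextual [writesVar, writesArr]
  | loop x b c ih =>
    refine ⟨hw.1, ?_⟩
    refine wpIter_wp_mono ?_
      (wpIter_frame (c' := loop x b c) (fun σ P => ih) ?_ ?_ (by simp [writesVar]) hw.2)
    · rintro τ t ⟨hf, h⟩
      exact ⟨hf.trans (frame_set (by simp [writesVar])), h⟩
    all_goals simp +contextual [writesVar, writesArr]

/-- Started in `σ`, the program `c` takes at most `T` steps and ends in a store in `P`. -/
def Spec (W B : ℕ) (c : Stmt) (σ : Store) (T : ℕ) (P : Store → Prop) : Prop :=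
  c.wp W B σ fun τ t => t ≤ T ∧ P τ

/-- The rule of consequence, with the frame available when the new postcondition is proved. -/
theorem Spec.mono {c : Stmt} {σ : Store} {T T' : ℕ} {P P' : Store → Prop}
    (h : c.Spec W B σ T P) (hT : T ≤ T') (hP : ∀ τ, c.Frame σ τ → P τ → P' τ) :
    c.Spec W B σ T' P' :=
  wp_mono c (fun _ _ h => ⟨h.2.1.trans hT, hP _ h.1 h.2.2⟩) (wp_frame c h)

theorem Spec.seq {c₁ c₂ : Stmt} {σ : Store} {T T₁ T₂ : ℕ} {P P₁ : Store → Prop}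
    (h₁ : c₁.Spec W B σ T₁ P₁)
    (h₂ : ∀ τ, c₁.Frame σ τ → P₁ τ → c₂.Spec W B τ T₂ P) (hT : T₁ + T₂ ≤ T) :
    (c₁ ;; c₂).Spec W B σ T P :=
  wp_mono c₁ (fun τ t h => wp_mono c₂ (fun υ u h' => ⟨by have := h.2.1; have := h'.1; omega, h'.2⟩)
    (h₂ τ h.1 h.2.2)) (wp_frame c₁ h₁)

theorem Spec.skip {σ : Store} {T : ℕ} {P : Store → Prop} (hT : 1 ≤ T) (hP : P σ) :
    skip.Spec W B σ T P := ⟨hT, hP⟩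

theorem Spec.assign {x : Var} {e : Expr} {σ : Store} {T : ℕ} {P : Store → Prop}
    (hs : e.Safe W B σ) (hT : e.cost + 2 ≤ T) (hP : P (σ.set x (e.eval σ))) :
    (x ≔ e).Spec W B σ T P := ⟨hs, hT, hP⟩

theorem Spec.write {a : Arr} {i e : Expr} {σ : Store} {T : ℕ} {P : Store → Prop}
    (hi : i.Safe W B σ) (hs : e.Safe W B σ) (ha : B + 16 * i.eval σ + 16 < W)
    (hT : i.cost + e.cost + 6 ≤ T) (hP : P (σ.put a (i.eval σ) (e.eval σ))) :
    (Stmt.write a i e).Spec W B σ T P := ⟨hi, hs, ha, hT, hP⟩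

theorem Spec.ite {b : Cond} {c₁ c₂ : Stmt} {σ : Store} {T T' : ℕ} {P : Store → Prop}
    (hb : b.Safe W B σ) (hT : T' + b.cost + 1 ≤ T)
    (h₁ : b.Holds σ → c₁.Spec W B σ T' P) (h₂ : ¬ b.Holds σ → c₂.Spec W B σ T' P) :
    (Stmt.ite b c₁ c₂).Spec W B σ T P :=
  ⟨hb, fun h => wp_mono c₁ (fun τ t h' => ⟨by have := h'.1; omega, h'.2⟩) (h₁ h),
    fun h => wp_mono c₂ (fun τ t h' => ⟨by have := h'.1; omega, h'.2⟩) (h₂ h)⟩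

/-- The rounds `i, …, i + n - 1` of a loop with counter `x` and body `c`. -/
def Rounds (W B : ℕ) (x : Var) (c : Stmt) (n i : ℕ) (σ : Store) (T : ℕ) (P : Store → Prop) :
    Prop :=
  wpIter (fun i τ R => c.wp W B (τ.set x i) R) n i σ fun τ t => t ≤ T ∧ P τ

theorem Rounds.zero {x : Var} {c : Stmt} {i : ℕ} {σ : Store} {T : ℕ} {P : Store → Prop}
    (h : P σ) : Rounds W B x c 0 i σ T P := ⟨Nat.zero_le _, h⟩

theorem Rounds.succ {x : Var} {c : Stmt} {n i : ℕ} {σ : Store} {T T₁ T₂ : ℕ} {P P₁ : Store → Prop}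
    (h₁ : c.Spec W B (σ.set x i) T₁ P₁)
    (h₂ : ∀ τ, c.Frame (σ.set x i) τ → P₁ τ → Rounds W B x c n (i + 1) τ T₂ P)
    (hT : T₁ + T₂ + 3 ≤ T) : Rounds W B x c (n + 1) i σ T P :=
  wp_mono c (fun τ t h => wpIter_wp_mono
    (fun υ u h' => ⟨by have := h.2.1; have := h'.1; omega, h'.2⟩) (h₂ τ h.1 h.2.2)) (wp_frame c h₁)

/-- Needed besides the rule of invariants for a loop whose state is not a function of the round
number, such as the parsing loop, which is treated by induction on what remains to be read. -/
theorem Spec.loop_of_rounds {x b : Var} {c : Stmt} {σ : Store} {T T' : ℕ} {P P' : Store → Prop}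
    (hb : σ.var b < W) (h : Rounds W B x c (σ.var b) 0 σ T' P') (hT : T' + 2 ≤ T)
    (hP : ∀ τ, (loop x b c).Frame σ τ → P' τ → P (τ.set x (σ.var b))) :
    (loop x b c).Spec W B σ T P := by
  refine ⟨hb, ?_⟩
  refine wpIter_wp_mono ?_
    (wpIter_frame (c' := loop x b c) (fun σ P => wp_frame c) ?_ ?_ (by simp [writesVar]) h)
  · rintro τ t ⟨hf, ht, h⟩
    exact ⟨by omega, hP τ hf h⟩
  all_goals simp +contextual [writesVar, writesArr]

/-- The rule of invariants for loops. -/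
theorem Spec.loop {x b : Var} {c : Stmt} {σ : Store} {T T₀ : ℕ} {P : Store → Prop}
    (Inv : ℕ → Store → Prop) (hb : σ.var b < W) (h₀ : Inv 0 σ)
    (hI : ∀ i τ, i < σ.var b → (Stmt.loop x b c).Frame σ τ → Inv i τ →
      c.Spec W B (τ.set x i) T₀ (Inv (i + 1)))
    (hT : σ.var b * (T₀ + 3) + 2 ≤ T)
    (hP : ∀ τ, (Stmt.loop x b c).Frame σ τ → Inv (σ.var b) τ → P (τ.set x (σ.var b))) :
    (Stmt.loop x b c).Spec W B σ T P := by
  refine Spec.loop_of_rounds (P' := Inv (σ.var b)) hb ?_ hT hP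
  suffices H : ∀ n i τ, i + n = σ.var b → (Stmt.loop x b c).Frame σ τ → Inv i τ →
      Rounds W B x c n i τ (n * (T₀ + 3)) (Inv (σ.var b)) from H _ 0 σ (by simp) (.refl _ _) h₀
  intro n
  induction n with
  | zero => intro i τ hi _ h; exact Rounds.zero (by simpa [← hi] using h)
  | succ n ih =>
    intro i τ hi hf h
    refine Rounds.succ (hI i τ (by omega) hf h) (fun υ hf' h' => ih (i + 1) υ (by omega) ?_ h')
      (by rw [Nat.succ_mul]; omega)
    refine (hf.trans (frame_set (by simp [writesVar]))).trans (hf'.weaken ?_ ?_) <;>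
      simp +contextual [writesVar, writesArr]

end Stmt

end EPROL

namespace EPROL

/-! ### Compilation -/

/-- Variables live in even registers; register `1` holds the base address of the arrays, and the odd
registers from `3` on are temporary. The first constructor `len` gets register `0`, where the
machine puts the length of the input and where the answer is read. -/
def Var.reg (x : Var) : ℕ := 2 * x.ctorIdx

/-- The registers for intermediate results. -/
def tmp (t : ℕ) : ℕ := 2 * t + 3

theorem Var.reg_inj {x y : Var} : x.reg = y.reg ↔ x = y := by
  refine ⟨fun h => ?_, fun h => h ▸ rfl⟩
  have h' : x.ctorIdx = y.ctorIdx := by unfold Var.reg at h; omega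
  rw [← Var.ofNat_ctorIdx x, ← Var.ofNat_ctorIdx y, h']

theorem Arr.ctorIdx_inj {a b : Arr} (h : a.ctorIdx = b.ctorIdx) : a = b := by
  rw [← Arr.ofNat_ctorIdx a, ← Arr.ofNat_ctorIdx b, h]

theorem Arr.ctorIdx_lt (a : Arr) : a.ctorIdx < 16 := by
  cases a <;> decide

/-- Address computation: replaces the index in register `tmp t` by the address. -/
def addressCode (a : Arr) (t : ℕ) : Cmd :=
  .seq (.const (tmp (t + 1)) 16) (.seq (.arith .mul (tmp t) (tmp t) (tmp (t + 1)))
    (.seq (.const (tmp (t + 1)) a.ctorIdx) (.seq (.arith .add (tmp t) (tmp t) (tmp (t + 1)))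
      (.arith .add (tmp t) 1 (tmp t)))))

namespace Expr

/-- The temporaries form a stack: the result is left in `tmp t`, and only temporaries from number
`t` on are overwritten. -/
def code : Expr → ℕ → Cmd
  | lit n, t => .const (tmp t) n
  | var x, t => .seq (.const (tmp t) 0) (.arith .add (tmp t) x.reg (tmp t))
  | bin o a b, t => .seq (a.code t) (.seq (b.code (t + 1)) (.arith o (tmp t) (tmp t) (tmp (t + 1))))
  | read a i, t => .seq (i.code t) (.seq (addressCode a t) (.load (tmp t) (tmp t)))

end Expr

def Cond.code : Cond → Cmd × Test
  | lt a b => (.seq (a.code 0) (b.code 1), .lt (tmp 0) (tmp 1))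
  | eq a b => (.seq (a.code 0) (b.code 1), .eq (tmp 0) (tmp 1))

namespace Stmt

def code : Stmt → Cmd
  | skip => .skip
  | assign x e => .seq (e.code 0) (.seq (.const (tmp 1) 0) (.arith .add x.reg (tmp 0) (tmp 1)))
  | write a i e => .seq (e.code 0) (.seq (i.code 1) (.seq (addressCode a 1) (.store (tmp 1) (tmp 0))))
  | seq c₁ c₂ => .seq c₁.code c₂.code
  | ite b c₁ c₂ => .seq b.code.1 (.branch b.code.2 c₁.code c₂.code)
  | loop x b c => .seq (.const x.reg 0) (.loop (.lt x.reg b.reg)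
      (.seq c.code (.seq (.const (tmp 0) 1) (.arith .add x.reg x.reg (tmp 0)))))

end Stmt

/-- The state `s` of the machine represents the store `σ`, with arrays from address `B` on. -/
structure Represents (w B : ℕ) (s : State) (σ : Store) : Prop where
  base : s.reg 1 = B
  var : ∀ x : Var, s.reg x.reg = σ.var x
  arr : ∀ (a : Arr) i, s.mem (B + 16 * i + a.ctorIdx) = σ.arr a i
  var_lt : ∀ x : Var, σ.var x < 2 ^ w
  arr_lt : ∀ (a : Arr) i, σ.arr a i < 2 ^ w

theorem Var.reg_ne_tmp (x : Var) (t : ℕ) : x.reg ≠ tmp t := by unfold Var.reg tmp; omega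

theorem Var.reg_ne_one (x : Var) : x.reg ≠ 1 := by unfold Var.reg; omega

theorem tmp_inj {t u : ℕ} : tmp t = tmp u ↔ t = u := by unfold tmp; omega

@[simp] theorem State.setReg_mem (s : State) (r n : ℕ) : (s.setReg r n).mem = s.mem := rfl
@[simp] theorem State.setMem_reg (s : State) (r n : ℕ) : (s.setMem r n).reg = s.reg := rfl

theorem State.setReg_reg (s : State) (r q n : ℕ) :
    (s.setReg r n).reg q = if q = r then n else s.reg q := by
  simp [State.setReg, Function.update_apply]

theorem State.setMem_mem (s : State) (r q n : ℕ) :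
    (s.setMem r n).mem q = if q = r then n else s.mem q := by
  simp [State.setMem, Function.update_apply]

theorem Represents.tmp {w B : ℕ} {s : State} {σ : Store} (h : Represents w B s σ) (t n : ℕ) :
    Represents w B (s.setReg (tmp t) n) σ where
  base := by rw [State.setReg_reg, if_neg (by unfold EPROL.tmp; omega), h.base]
  var x := by rw [State.setReg_reg, if_neg (x.reg_ne_tmp t), h.var]
  arr a i := h.arr a i
  var_lt := h.var_lt
  arr_lt := h.arr_lt

theorem Represents.set {w B : ℕ} {s : State} {σ : Store} (h : Represents w B s σ) (x : Var) {n : ℕ}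
    (hn : n < 2 ^ w) : Represents w B (s.setReg x.reg n) (σ.set x n) where
  base := by rw [State.setReg_reg, if_neg x.reg_ne_one.symm, h.base]
  var y := by simp only [State.setReg_reg, Store.set_var, Var.reg_inj, h.var]
  arr a i := h.arr a i
  var_lt y := by rw [Store.set_var]; split_ifs; exacts [hn, h.var_lt y]
  arr_lt := h.arr_lt

/-- There are sixteen arrays, and each owns one residue class modulo `16` of the addresses counted
from `B`. So cells of different arrays never coincide and no array needs a bound on its length. -/
theorem Represents.put {w B : ℕ} {s : State} {σ : Store} (h : Represents w B s σ) (a : Arr) (i : ℕ) {n : ℕ}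
    (hn : n < 2 ^ w) : Represents w B (s.setMem (B + 16 * i + a.ctorIdx) n) (σ.put a i n) where
  base := h.base
  var y := h.var y
  arr b j := by
    have ha := a.ctorIdx_lt
    have hb := b.ctorIdx_lt
    rw [State.setMem_mem, Store.put_arr]
    by_cases hab : b = a
    · subst hab
      simp only [if_true, Function.update_apply, ← h.arr]
      congr 1
      simp
    · rw [if_neg hab, if_neg, h.arr]
      intro h'
      exact hab (Arr.ctorIdx_inj (by omega))
  var_lt := h.var_lt
  arr_lt b j := by
    rw [Store.put_arr]
    split_ifs
    · rw [Function.update_apply]; split_ifs; exacts [hn, h.arr_lt _ _]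
    · exact h.arr_lt _ _

variable {w B : ℕ}

theorem Exec.cast {c : Cmd} {s s' : State} {t u : ℕ} (h : Exec w c s t s') (e : t = u) :
    Exec w c s u s' := e ▸ h

theorem Exec.cast_state {c : Cmd} {s s' s'' : State} {t : ℕ} (h : Exec w c s t s')
    (e : s' = s'') : Exec w c s t s'' := e ▸ h

/-- The final state is a chain of changes to temporaries, in the form to which `Represents.tmp`
applies; what is left in the scratch register is irrelevant. -/
theorem exec_addressCode (a : Arr) {t n : ℕ} {s : State} (hB : s.reg 1 = B)
    (ht : s.reg (tmp t) = n) (h : B + 16 * n + 16 < 2 ^ w) :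
    ∃ u v, Exec w (addressCode a t) s 5
      (((s.setReg (tmp (t + 1)) u).setReg (tmp (t + 1)) v).setReg (tmp t) (B + 16 * n + a.ctorIdx)) := by
  have ha := a.ctorIdx_lt
  refine ⟨16, a.ctorIdx, ?_⟩
  have e := Exec.seq (Exec.const (w := w) (tmp (t + 1)) 16 s)
    (.seq (.arith .mul (tmp t) (tmp t) (tmp (t + 1)) _)
    (.seq (.const (tmp (t + 1)) a.ctorIdx _) (.seq (.arith .add (tmp t) (tmp t) (tmp (t + 1)) _)
      (.arith .add (tmp t) 1 (tmp t) _))))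
  have h1 : ∀ t, (1 = tmp t) = False := fun t => by simp [tmp]
  have h2 : ∀ t, (tmp t = tmp (t+1)) = False := fun t => by simp [tmp]
  have h3 : ∀ t, (tmp (t+1) = tmp t) = False := fun t => by simp [tmp]
  have e1 : 16 % 2 ^ w = 16 := Nat.mod_eq_of_lt (by omega)
  have e2 : a.ctorIdx % 2 ^ w = a.ctorIdx := Nat.mod_eq_of_lt (by omega)
  have e3 : n * 16 % 2 ^ w = n * 16 := Nat.mod_eq_of_lt (by omega)
  have e4 : (n * 16 + a.ctorIdx) % 2 ^ w = n * 16 + a.ctorIdx := Nat.mod_eq_of_lt (by omega)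
  have e5 : (B + (n * 16 + a.ctorIdx)) % 2 ^ w = B + 16 * n + a.ctorIdx := by
    rw [Nat.mod_eq_of_lt (by omega)]; omega
  simp only [Op.eval, State.setReg_reg, ht, hB, h1, h2, h3, if_true, if_false, e1, e2, e3, e4, e5]
    at e
  refine e.cast_state ?_
  simp only [State.setReg, State.mk.injEq, and_true]
  funext q
  simp only [Function.update_apply]
  split_ifs <;> simp_all

/-- The preservation of the lower temporaries keeps the left operand of an operation alive while the
right one is evaluated. -/
theorem Expr.exec_code {σ : Store} (e : Expr) (t : ℕ) {s : State} (hr : Represents w B s σ)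
    (hs : e.Safe (2 ^ w) B σ) :
    ∃ s', Exec w (e.code t) s e.cost s' ∧ Represents w B s' σ ∧ s'.reg (tmp t) = e.eval σ ∧
      s'.mem = s.mem ∧ ∀ u < t, s'.reg (tmp u) = s.reg (tmp u) := by
  induction e generalizing t s with
  | lit n =>
    refine ⟨_, .const _ _ _, hr.tmp _ _, ?_, rfl, fun u hu => ?_⟩
    · rw [State.setReg_reg, if_pos rfl]; exact Nat.mod_eq_of_lt hs
    · rw [State.setReg_reg, if_neg (by rw [tmp_inj]; omega)]
  | var x =>
    refine ⟨_, .seq (.const _ _ _) (.arith _ _ _ _ _), (hr.tmp _ _).tmp _ _, ?_, rfl,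
      fun u hu => ?_⟩
    · simp only [State.setReg_reg, if_true, if_neg (x.reg_ne_tmp t), Op.eval, hr.var]
      simp [Expr.eval, Nat.mod_eq_of_lt (hr.var_lt x)]
    · simp only [State.setReg_reg, if_neg (show ¬ tmp u = tmp t by rw [tmp_inj]; omega)]
  | bin o a b iha ihb =>
    obtain ⟨s₁, h₁, hr₁, hv₁, hm₁, hu₁⟩ := iha t hr hs.1
    obtain ⟨s₂, h₂, hr₂, hv₂, hm₂, hu₂⟩ := ihb (t + 1) hr₁ hs.2.1
    refine ⟨_, .cast (.seq h₁ (.seq h₂ (.arith _ _ _ _ _))) (by simp only [cost]; omega),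
      hr₂.tmp _ _, ?_, hm₂.trans hm₁, fun u hu => ?_⟩
    · rw [State.setReg_reg, if_pos rfl, hv₂, hu₂ t (by omega), hv₁]
      have := hs.2.2
      cases o <;> exact Nat.mod_eq_of_lt this
    · rw [State.setReg_reg, if_neg (by rw [tmp_inj]; omega), hu₂ u (by omega), hu₁ u hu]
  | read a i ih =>
    obtain ⟨s₁, h₁, hr₁, hv₁, hm₁, hu₁⟩ := ih t hr hs.1
    obtain ⟨u, v, h₂⟩ := exec_addressCode (w := w) a hr₁.base hv₁ hs.2
    refine ⟨_, .cast (.seq h₁ (.seq h₂ (.load _ _ _))) (by simp only [cost]),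
      (((hr₁.tmp _ _).tmp _ _).tmp _ _).tmp _ _, ?_, hm₁, fun u hu => ?_⟩
    · rw [State.setReg_reg, if_pos rfl, State.setReg_reg, if_pos rfl]
      exact hr₁.arr a _
    · simp only [State.setReg_reg, tmp_inj]
      rw [if_neg (by omega), if_neg (by omega), if_neg (by omega), if_neg (by omega), hu₁ u hu]

theorem Expr.Safe.eval_lt {s : State} {σ : Store} (hr : Represents w B s σ) {e : Expr}
    (hs : e.Safe (2 ^ w) B σ) : e.eval σ < 2 ^ w := by
  cases e with
  | lit n => exact hs
  | var x => exact hr.var_lt x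
  | bin o a b => exact hs.2.2
  | read a i => exact hr.arr_lt _ _

theorem Cond.exec_code {σ : Store} (b : Cond) {s : State} (hr : Represents w B s σ)
    (hs : b.Safe (2 ^ w) B σ) :
    ∃ s', Exec w b.code.1 s b.cost s' ∧ Represents w B s' σ ∧ (b.code.2.Holds s' ↔ b.Holds σ) := by
  cases b with
  | lt a b | eq a b =>
    obtain ⟨s₁, h₁, hr₁, hv₁, -, -⟩ := a.exec_code 0 hr hs.1
    obtain ⟨s₂, h₂, hr₂, hv₂, -, hu₂⟩ := b.exec_code 1 hr₁ hs.2
    refine ⟨s₂, .seq h₁ h₂, hr₂, ?_⟩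
    simp only [Cond.code, Test.Holds, Cond.Holds, hv₂, hu₂ 0 (by omega), hv₁]

/-- The compiled program simulates the source program. -/
theorem Stmt.exec_code (c : Stmt) (hc : c.wf = true) {σ : Store} {P : Store → ℕ → Prop}
    {s : State} (hr : Represents w B s σ) (h : c.wp (2 ^ w) B σ P) :
    ∃ s' σ' t, Exec w c.code s t s' ∧ Represents w B s' σ' ∧ c.Frame σ σ' ∧ P σ' t := by
  induction c generalizing σ P s with
  | skip => exact ⟨s, σ, 1, .skip _, hr, .refl _ _, h⟩
  | assign x e =>
    obtain ⟨s₁, h₁, hr₁, hv₁, -, -⟩ := e.exec_code 0 hr h.1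
    have he := h.1.eval_lt hr
    refine ⟨_, _, _, .cast (.seq h₁ (.seq (.const _ _ _) (.arith _ _ _ _ _))) rfl, ?_,
      (frame_set (by simp [writesVar])), h.2⟩
    simp only [State.setReg_reg, if_true, if_neg (show ¬ tmp 0 = tmp 1 by simp [tmp]), hv₁, Op.eval]
    rw [show (e.eval σ + 0 % 2 ^ w) % 2 ^ w = e.eval σ by simp [Nat.mod_eq_of_lt he]]
    exact (hr₁.tmp _ _).set _ he
  | write a i e =>
    obtain ⟨s₁, h₁, hr₁, hv₁, -, -⟩ := e.exec_code 0 hr h.2.1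
    obtain ⟨s₂, h₂, hr₂, hv₂, -, hu₂⟩ := i.exec_code 1 hr₁ h.1
    obtain ⟨u, v, h₃⟩ := exec_addressCode (w := w) a hr₂.base hv₂ h.2.2.1
    refine ⟨_, _, _, .cast (.seq h₁ (.seq h₂ (.seq h₃ (.store _ _ _)))) ?_, ?_, ?_, h.2.2.2⟩
    · omega
    · simp only [State.setReg_reg, if_true, tmp_inj, hu₂ 0 (by omega), hv₁]
      exact (((hr₂.tmp _ _).tmp _ _).tmp _ _).put _ _ (h.2.1.eval_lt hr)
    · refine ⟨fun _ _ => rfl, fun b hb => ?_⟩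
      rw [Store.put_arr, if_neg]
      rintro rfl
      simp [writesArr] at hb
  | seq c₁ c₂ ih₁ ih₂ =>
    simp only [wf, Bool.and_eq_true] at hc
    obtain ⟨s₁, σ₁, t₁, h₁, hr₁, hf₁, hP₁⟩ := ih₁ hc.1 hr h
    obtain ⟨s₂, σ₂, t₂, h₂, hr₂, hf₂, hP₂⟩ := ih₂ hc.2 hr₁ hP₁
    refine ⟨s₂, σ₂, _, .seq h₁ h₂, hr₂, (hf₁.weaken ?_ ?_).trans (hf₂.weaken ?_ ?_), hP₂⟩ <;>
      simp +contextual [writesVar, writesArr]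
  | ite b c₁ c₂ ih₁ ih₂ =>
    simp only [wf, Bool.and_eq_true] at hc
    obtain ⟨s₀, h₀, hr₀, hb⟩ := b.exec_code hr h.1
    by_cases hh : b.Holds σ
    · obtain ⟨s₁, σ₁, t₁, h₁, hr₁, hf₁, hP₁⟩ := ih₁ hc.1 hr₀ (h.2.1 hh)
      refine ⟨s₁, σ₁, _, .cast (.seq h₀ (.branchTrue (hb.2 hh) h₁)) ?_, hr₁, hf₁.weaken ?_ ?_, hP₁⟩
      · omega
      all_goals simp +contextual [writesVar, writesArr]
    · obtain ⟨s₁, σ₁, t₁, h₁, hr₁, hf₁, hP₁⟩ := ih₂ hc.2 hr₀ (h.2.2 hh)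
      refine ⟨s₁, σ₁, _, .cast (.seq h₀ (.branchFalse (mt hb.1 hh) h₁)) ?_, hr₁, hf₁.weaken ?_ ?_,
        hP₁⟩
      · omega
      all_goals simp +contextual [writesVar, writesArr]
  | loop x b c ih =>
    simp only [wf, Bool.and_eq_true, bne_iff_ne, Bool.not_eq_true'] at hc
    obtain ⟨⟨⟨hxb, hx⟩, hbv⟩, hc⟩ := hc
    obtain ⟨hn, hw⟩ := h
    -- A round costs three steps beyond its body: the successful test, loading `1`, and the
    -- increment. The failing test at the end and the initial reset of the counter are the two
    -- further steps in `wp`.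
    have key : ∀ n i τ (P : Store → ℕ → Prop) s, i + n = σ.var b → τ.var b = σ.var b →
        Represents w B s (τ.set x i) →
        wpIter (fun i τ R => c.wp (2 ^ w) B (τ.set x i) R) n i τ P →
        ∃ s' σ' t, Exec w (.loop (.lt x.reg b.reg)
          (.seq c.code (.seq (.const (tmp 0) 1) (.arith .add x.reg x.reg (tmp 0))))) s (t + 1) s' ∧
          Represents w B s' (σ'.set x (σ.var b)) ∧ (Stmt.loop x b c).Frame τ σ' ∧ P σ' t := by
      intro n
      induction n with
      | zero =>
        intro i τ P s hi hb hr h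
        refine ⟨s, τ, 0, .loopFalse ?_, by simpa [← hi] using hr, .refl _ _, h⟩
        simp only [Test.Holds, hr.var, Store.set_var, if_true, if_neg (Ne.symm hxb), hb]
        omega
      | succ n ihn =>
        intro i τ P s hi hb hr h
        obtain ⟨s₁, τ₁, t₁, h₁, hr₁, hf₁, hP₁⟩ := ih hc hr h
        have hx₁ : τ₁.var x = i := by rw [hf₁.var x hx, Store.set_var_self]
        have hb₁ : τ₁.var b = σ.var b := by
          rw [hf₁.var b hbv, Store.set_var, if_neg (Ne.symm hxb), hb]
        have h1 : 1 < 2 ^ w ∨ i + 1 < 2 ^ w := Or.inr (by omega)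
        have hi1 : (i + 1 % 2 ^ w) % 2 ^ w = i + 1 := by
          rw [Nat.add_mod_mod, Nat.mod_eq_of_lt (by omega)]
        obtain ⟨s₂, τ₂, t₂, h₂, hr₂, hf₂, hP₂⟩ := ihn (i + 1) τ₁ _
          ((s₁.setReg (tmp 0) (1 % 2 ^ w)).setReg x.reg (i + 1)) (by omega) hb₁
          ((hr₁.tmp _ _).set _ (by omega)) hP₁
        have hlt : (Test.lt x.reg b.reg).Holds s := by
          simp only [Test.Holds, hr.var, Store.set_var, if_true, if_neg (Ne.symm hxb), hb]
          omega
        have h₃ : Exec w (.seq c.code (.seq (.const (tmp 0) 1) (.arith .add x.reg x.reg (tmp 0)))) s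
            (t₁ + (1 + 1)) ((s₁.setReg (tmp 0) (1 % 2 ^ w)).setReg x.reg (i + 1)) := by
          refine .seq h₁ (.seq (.const _ _ _) ((Exec.arith _ _ _ _ _).cast_state ?_))
          simp only [State.setReg_reg, if_true, if_neg (x.reg_ne_tmp 0), Op.eval, hr₁.var, hx₁, hi1]
        refine ⟨s₂, τ₂, _, .cast (.loopTrue hlt h₃ h₂) (by omega), hr₂, ?_, hP₂⟩
        refine ((frame_set (by simp [writesVar])).trans (hf₁.weaken ?_ ?_)).trans hf₂ <;>
          simp +contextual [writesVar, writesArr]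
    have hw0 : (0 : ℕ) < 2 ^ w := by positivity
    obtain ⟨s', σ', t, h', hr', hf', hP'⟩ := key (σ.var b) 0 σ _ (s.setReg x.reg (0 % 2 ^ w))
      (by omega) rfl (by simpa using hr.set x hw0) hw
    refine ⟨s', _, _, .cast (.seq (.const _ _ _) h') ?_, hr',
      hf'.trans (frame_set (by simp [writesVar])), hP'⟩
    omega

end EPROL

/-! ### Moving the input into the array `E`. -/

namespace EPROL

/-- One round of the loop which copies the input into the array `E`. -/
def copyBody : Cmd :=
  .seq (.load 11 3) (.seq (.store 9 11) (.seq (.arith .add 9 9 5) (.seq (.const 7 1)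
    (.arith .add 3 3 7))))

/-- Moves the input into the array `E`. -/
def copyCode : Cmd :=
  .seq (.const 3 0) (.seq (.arith .add 1 0 3) (.seq (.arith .add 9 0 3) (.seq (.const 5 16)
    (.loop (.lt 3 0) copyBody))))

/-- The store with which the program starts: the input in the array `E`, its length in `len`. -/
def Store.init (input : List ℕ) : Store where
  var x := if x = .len then input.length else 0
  arr a i := if a = .E then input.getD i 0 else 0

/-- The copying loop writes odd registers only, so all variables except `len` stay `0`. The targets
start right after the input and advance by sixteen: they are the cells of the array with index `0`,
and input still to be read is never overwritten. -/
structure CopyInv (input : List ℕ) (i : ℕ) (s : State) : Prop where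
  reg_zero : s.reg 0 = input.length
  reg_one : s.reg 1 = input.length
  reg_three : s.reg 3 = i
  reg_five : s.reg 5 = 16
  reg_nine : s.reg 9 = input.length + 16 * i
  reg_even : ∀ r, r ≠ 0 → s.reg (2 * r) = 0
  mem_lt : ∀ j < input.length, s.mem j = input.getD j 0
  mem_ge : ∀ j, input.length ≤ j → s.mem j =
    if (j - input.length) % 16 = 0 ∧ (j - input.length) / 16 < i then
      input.getD ((j - input.length) / 16) 0 else 0

theorem exec_copyBody {w i : ℕ} {input : List ℕ} {s : State}
    (hw : 17 * input.length + 16 < 2 ^ w) (hi : i < input.length) (h : CopyInv input i s) :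
    ∃ s', Exec w copyBody s 5 s' ∧ CopyInv input (i + 1) s' := by
  refine ⟨_, .seq (.load _ _ _) (.seq (.store _ _ _) (.seq (.arith _ _ _ _ _)
    (.seq (.const _ _ _) (.arith _ _ _ _ _)))), ?_⟩
  have e1 : 1 % 2 ^ w = 1 := Nat.mod_eq_of_lt (by omega)
  have e2 : (i + 1) % 2 ^ w = i + 1 := Nat.mod_eq_of_lt (by omega)
  have e3 : (input.length + 16 * i + 16) % 2 ^ w = input.length + 16 * (i + 1) := by
    rw [Nat.mod_eq_of_lt (by omega)]; omega
  constructor <;> simp only [State.setReg_reg, State.setMem_reg, State.setReg_mem,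
    State.setMem_mem, h.reg_zero, h.reg_one, h.reg_three, h.reg_five, h.reg_nine, Op.eval] <;>
    norm_num [e1, e2, e3]
  · intro r hr
    rw [if_neg (by omega), if_neg (by omega), if_neg (by omega), if_neg (by omega)]
    exact h.reg_even r hr
  · intro j hj
    rw [if_neg (by omega), h.mem_lt j hj]; simp
  · intro j hj
    split_ifs with h1 h2 h2
    · rw [h.mem_lt i hi]; subst h1; simp
    · subst h1; omega
    · rw [h.mem_ge j hj, if_pos ⟨h2.1, by omega⟩]; simp
    · rw [h.mem_ge j hj, if_neg]; rintro ⟨a, b⟩; exact h2 ⟨a, by omega⟩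

theorem exec_copyCode {w : ℕ} {input : List ℕ} (hw : 17 * input.length + 16 < 2 ^ w)
    (hin : ∀ x ∈ input, x < 2 ^ w) :
    ∃ t s, Exec w copyCode (.init input) t s ∧ t ≤ 6 * input.length + 5 ∧
      Represents w input.length s (.init input) := by
  have key : ∀ n i s, i + n = input.length → CopyInv input i s →
      ∃ s', Exec w (.loop (.lt 3 0) copyBody) s (6 * n + 1) s' ∧
        CopyInv input input.length s' := by
    intro n
    induction n with
    | zero =>
      intro i s hi h
      obtain rfl : i = input.length := by omega
      exact ⟨s, .loopFalse (by simp [Test.Holds, h.reg_zero, h.reg_three]), h⟩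
    | succ n ih =>
      intro i s hi h
      obtain ⟨s₁, h₁, hc₁⟩ := exec_copyBody hw (by omega) h
      obtain ⟨s₂, h₂, hc₂⟩ := ih (i + 1) s₁ (by omega) hc₁
      refine ⟨s₂, .cast (.loopTrue ?_ h₁ h₂) (by omega), hc₂⟩
      simp only [Test.Holds, h.reg_zero, h.reg_three]; omega
  have e0 : input.length % 2 ^ w = input.length := Nat.mod_eq_of_lt (by omega)
  have e1 : 16 % 2 ^ w = 16 := Nat.mod_eq_of_lt (by omega)
  have h₀ : CopyInv input 0 ((((((State.init input).setReg 3 (0 % 2 ^ w)).setReg 1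
      input.length)).setReg 9 input.length).setReg 5 (16 % 2 ^ w)) := by
    constructor <;> simp only [State.setReg_reg, State.setReg_mem, State.init, Nat.zero_mod] <;>
      norm_num [e1]
    · intro r hr
      rw [if_neg (by omega), if_neg (by omega), if_neg (by omega), if_neg hr]
    · intro j hj
      rw [List.getElem?_eq_none hj]; rfl
  obtain ⟨s, hs, hc⟩ := key input.length _ _ (by omega) h₀
  refine ⟨_, s, .seq (.const _ _ _) (.seq (s₁ := ((State.init input).setReg 3 (0 % 2 ^ w)).setReg 1
      input.length) ((Exec.arith _ _ _ _ _).cast_state ?_)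
    (.seq ((Exec.arith _ _ _ _ _).cast_state ?_) (.seq (.const _ _ _) hs))), by omega, ?_⟩
  · simp [State.setReg_reg, State.init, Op.eval, e0]
  · simp [State.setReg_reg, State.init, Op.eval, e0]
  · have hg : ∀ j, input.getD j 0 < 2 ^ w := by
      intro j
      by_cases hj : j < input.length
      · rw [List.getD_eq_getElem _ _ hj]; exact hin _ (List.getElem_mem hj)
      · rw [List.getD_eq_default _ _ (by omega)]; positivity
    refine ⟨hc.reg_one, fun x => ?_, fun a i => ?_, fun x => ?_, fun a i => ?_⟩
    · by_cases hx : x = .len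
      · subst hx; exact hc.reg_zero
      · simp only [Store.init, if_neg hx]
        refine hc.reg_even _ fun h0 => hx ?_
        have := Var.ofNat_ctorIdx x
        rw [h0] at this
        exact this.symm
    · have ha := a.ctorIdx_lt
      rw [hc.mem_ge _ (by omega)]
      have e : input.length + 16 * i + a.ctorIdx - input.length = 16 * i + a.ctorIdx := by omega
      rw [e, show (16 * i + a.ctorIdx) / 16 = i by omega]
      simp only [Store.init]
      by_cases hE : a = .E
      · subst hE
        by_cases hi : i < input.length
        · rw [if_pos ⟨by simp [Arr.ctorIdx], hi⟩, if_pos rfl]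
        · rw [if_neg (by omega), if_pos rfl, List.getD_eq_default _ _ (by omega)]
      · rw [if_neg hE, if_neg]
        rintro ⟨h0, -⟩
        exact hE (Arr.ctorIdx_inj (show a.ctorIdx = Arr.E.ctorIdx from by
          rw [show Arr.E.ctorIdx = 0 from rfl]; omega))
    · simp only [Store.init]; split_ifs
      · omega
      · positivity
    · simp only [Store.init]; split_ifs
      · exact hg i
      · positivity

end EPROL

namespace EPROL

/-! ### Closing a relation on items under the rules -/

/-- The closure of `init` under symmetry, weakening, cut and the introduction rules given by the
tables. An item stands for an annotated formula, or for no formula in the case of the item `0`;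
`dual` exchanges `φ^L` and `φ^R`, and `kind z` says whether both (`1`) or one (`2`) of the
items `left z`, `right z` is required to introduce `z`. -/
inductive Closure (M : ℕ) (kind left right dual : ℕ → ℕ) (init : ℕ → ℕ → Prop) : ℕ → ℕ → Prop
  | base {x y} : init x y → Closure M kind left right dual init x y
  | symm {x y} : Closure M kind left right dual init x y → Closure M kind left right dual init y x
  | weaken {x z} : z < M → Closure M kind left right dual init x x →
      Closure M kind left right dual init x z
  | weaken_zero {x z} : z < M → Closure M kind left right dual init x 0 →
      Closure M kind left right dual init x z
  | cut {x y z} : Closure M kind left right dual init x y →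
      Closure M kind left right dual init (dual y) z → Closure M kind left right dual init x z
  | both {x z} : z < M → kind z = 1 → Closure M kind left right dual init x (left z) →
      Closure M kind left right dual init x (right z) → Closure M kind left right dual init x z
  | either_left {x z} : z < M → kind z = 2 → Closure M kind left right dual init x (left z) →
      Closure M kind left right dual init x z
  | either_right {x z} : z < M → kind z = 2 → Closure M kind left right dual init x (right z) →
      Closure M kind left right dual init x z

/-! ### Rules for unordered sequents -/

theorem sq_comm {α : Type} (Γ Δ : Option (Annotated α)) : sq Γ Δ = sq Δ Γ := by
  ext x; simp [sq, Sequent.toSet, or_comm]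

/-- Sequents are sets, so a sequent with one formula is also a pair with equal entries. This is why
weakening may start from a pair of an item with itself. -/
theorem sq_none {α : Type} (Γ : Option (Annotated α)) : sq Γ none = sq Γ Γ := by
  ext x; simp [sq, Sequent.toSet]

/-! ### Completeness by a semantic argument -/

section Semantics

variable {α X : Type}

/-- The items which are in relation to all items of a set. -/
def polar (D : X → X → Prop) (U : Set X) : Set X := {y | ∀ x ∈ U, D x y}

/-- The interpretation of formulas by sets of items. -/
def Formula.interp (D : X → X → Prop) (v : α → Set X) : Formula α → Set X
  | .atom a => v a
  | .neg φ => polar D (φ.interp D v)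
  | .conj φ ψ => φ.interp D v ∩ ψ.interp D v
  | .disj φ ψ => polar D (polar D (φ.interp D v) ∩ polar D (ψ.interp D v))

def Annotated.interp (D : X → X → Prop) (v : α → Set X) : Annotated α → Set X
  | .L φ => φ.interp D v
  | .R φ => polar D (φ.interp D v)

def optInterp (D : X → X → Prop) (v : α → Set X) : Option (Annotated α) → Set X
  | none => Set.univ
  | some a => a.interp D v

/-- A sequent holds if the interpretations of its two formulas are in relation. -/
def SequentHolds (D : X → X → Prop) (v : α → Set X) (S : Set (Annotated α)) : Prop :=
  ∀ p q, (∀ x ∈ S, p ∈ x.interp D v ∨ q ∈ x.interp D v) → D p q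

/-- The relation is symmetric, and items in relation to themselves are in relation to all. -/
structure Orthogonality (D : X → X → Prop) : Prop where
  symm : ∀ {x y}, D x y → D y x
  weaken : ∀ {x y}, D x x → D x y

variable {D : X → X → Prop} {v : α → Set X}

/-- A set does not tell which of its formulas is which, so `SequentHolds` lets `p` and `q` serve
either formula. If one of them serves both, it is related to itself and weakening applies; if they
serve crosswise, symmetry does. -/
theorem sequentHolds_sq (hD : Orthogonality D) (Γ Δ : Option (Annotated α)) :
    SequentHolds D v (sq Γ Δ) ↔ ∀ p ∈ optInterp D v Γ, ∀ q ∈ optInterp D v Δ, D p q := by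
  constructor
  · intro h p hp q hq
    refine h p q fun x hx => ?_
    rcases hx with hx | hx
    · simp only at hx; subst hx; exact Or.inl hp
    · simp only at hx; subst hx; exact Or.inr hq
  · intro h p q hpq
    have h1 : p ∈ optInterp D v Γ ∨ q ∈ optInterp D v Γ := by
      cases Γ with
      | none => exact Or.inl trivial
      | some a => exact hpq a (Or.inl rfl)
    have h2 : p ∈ optInterp D v Δ ∨ q ∈ optInterp D v Δ := by
      cases Δ with
      | none => exact Or.inl trivial
      | some a => exact hpq a (Or.inr rfl)
    rcases h1 with h1 | h1 <;> rcases h2 with h2 | h2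
    · exact hD.weaken (h p h1 p h2)
    · exact h p h1 q h2
    · exact hD.symm (h q h1 p h2)
    · exact hD.symm (hD.weaken (h q h1 q h2))

theorem polar_anti {U U' : Set X} (h : U ⊆ U') : polar D U' ⊆ polar D U :=
  fun _ hy x hx => hy x (h hx)

theorem subset_polar_polar (hD : Orthogonality D) (U : Set X) : U ⊆ polar D (polar D U) :=
  fun _ hx _ hy => hD.symm (hy _ hx)

theorem polar_polar_polar (hD : Orthogonality D) (U : Set X) :
    polar D (polar D (polar D U)) = polar D U :=
  (polar_anti (subset_polar_polar hD U)).antisymm (subset_polar_polar hD _)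

/-- Valuations by closed sets extend to formulas. -/
theorem Formula.interp_closed (hD : Orthogonality D) (hv : ∀ a, polar D (polar D (v a)) = v a)
    (φ : Formula α) : polar D (polar D (φ.interp D v)) = φ.interp D v := by
  induction φ with
  | atom a => exact hv a
  | neg φ => exact polar_polar_polar hD _
  | conj φ ψ ih₁ ih₂ =>
    refine Set.Subset.antisymm (fun x hx => ⟨?_, ?_⟩) (subset_polar_polar hD _)
    · rw [← ih₁]; exact polar_anti (polar_anti Set.inter_subset_left) hx
    · rw [← ih₂]; exact polar_anti (polar_anti Set.inter_subset_right) hx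
  | disj φ ψ => exact polar_polar_polar hD _

/-- Orthologic is sound for the interpretation by closed sets of items. -/
theorem Provable.sequentHolds (hD : Orthogonality D) (hv : ∀ a, polar D (polar D (v a)) = v a)
    {A : Set (Set (Annotated α))} (hA : ∀ S ∈ A, SequentHolds D v S) {S : Set (Annotated α)}
    (h : Provable A S) : SequentHolds D v S := by
  induction h with
  | hyp φ =>
    rw [sequentHolds_sq hD]
    exact fun p hp q hq => hq p hp
  | cut Γ Δ ψ _ _ ih₁ ih₂ =>
    rw [sequentHolds_sq hD] at *
    intro p hp q hq
    refine ih₂ p ?_ q hq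
    -- The first premise only puts `p` into the double polar of `ψ`; closedness of the
    -- interpretation is what makes a cut with an arbitrary formula sound.
    change p ∈ ψ.interp D v
    rw [← ψ.interp_closed hD hv]
    exact fun x hx => hD.symm (ih₁ p hp x hx)
  | weaken Γ Δ _ ih =>
    rw [sequentHolds_sq hD] at *
    exact fun p hp q _ => ih p hp q trivial
  | leftAnd₁ Γ φ ψ _ ih =>
    rw [sequentHolds_sq hD] at *
    exact fun p hp q hq => ih p hp q hq.1
  | leftAnd₂ Γ φ ψ _ ih =>
    rw [sequentHolds_sq hD] at *
    exact fun p hp q hq => ih p hp q hq.2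
  | rightAnd Γ φ ψ _ _ ih₁ ih₂ =>
    rw [sequentHolds_sq hD] at *
    intro p hp q hq
    refine hq p ⟨?_, ?_⟩
    · rw [← φ.interp_closed hD hv]; exact fun x hx => hD.symm (ih₁ p hp x hx)
    · rw [← ψ.interp_closed hD hv]; exact fun x hx => hD.symm (ih₂ p hp x hx)
  | leftOr Γ φ ψ _ _ ih₁ ih₂ =>
    rw [sequentHolds_sq hD] at *
    intro p hp q hq
    exact hq p ⟨fun x hx => hD.symm (ih₁ p hp x hx), fun x hx => hD.symm (ih₂ p hp x hx)⟩
  | rightOr₁ Γ φ ψ _ ih =>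
    rw [sequentHolds_sq hD] at *
    exact fun p hp q hq => ih p hp q fun x hx => hq x fun y hy => hD.symm (hy.1 x hx)
  | rightOr₂ Γ φ ψ _ ih =>
    rw [sequentHolds_sq hD] at *
    exact fun p hp q hq => ih p hp q fun x hx => hq x fun y hy => hD.symm (hy.2 x hx)
  | leftNot Γ φ _ ih =>
    rw [sequentHolds_sq hD] at *
    exact ih
  | rightNot Γ φ _ ih =>
    rw [sequentHolds_sq hD] at *
    refine fun p hp q hq => ih p hp q ?_
    change q ∈ φ.interp D v
    rw [← φ.interp_closed hD hv]; exact hq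
  | ax Γ Δ hmem => exact hA _ hmem

/-- `node l r φ`: the items `l` and `r` represent `φ^L` and `φ^R`. The relation `D` is closed under
cuts with represented formulas and under the introduction of represented formulas. -/
structure Saturated (D : X → X → Prop) (node : X → X → Formula α → Prop) : Prop
    extends Orthogonality D where
  atom : ∀ {l r l' r' a}, node l r (.atom a) → node l' r' (.atom a) → D l r'
  cut : ∀ {l r φ x y}, node l r φ → D x r → D l y → D x y
  neg : ∀ {l r φ}, node l r (.neg φ) → ∃ l₁ r₁, node l₁ r₁ φ ∧
    (∀ x, D x r₁ → D x l) ∧ (∀ x, D x l₁ → D x r)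
  conj : ∀ {l r φ ψ}, node l r (.conj φ ψ) → ∃ l₁ r₁ l₂ r₂, node l₁ r₁ φ ∧ node l₂ r₂ ψ ∧
    (∀ x, D x l₁ → D x l) ∧ (∀ x, D x l₂ → D x l) ∧ (∀ x, D x r₁ → D x r₂ → D x r)
  disj : ∀ {l r φ ψ}, node l r (.disj φ ψ) → ∃ l₁ r₁ l₂ r₂, node l₁ r₁ φ ∧ node l₂ r₂ ψ ∧
    (∀ x, D x r₁ → D x r) ∧ (∀ x, D x r₂ → D x r) ∧ (∀ x, D x l₁ → D x l₂ → D x l)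

variable {node : X → X → Formula α → Prop}

/-- The valuation which makes the represented atoms equal to what they represent. -/
def atomInterp (D : X → X → Prop) (node : X → X → Formula α → Prop) (a : α) : Set X :=
  polar D {r | ∃ l, node l r (.atom a)}

/-- Hypotheses are required of the relation only for atoms. For compound formulas they follow by
introducing the connective on one side and then on the other. -/
theorem Saturated.hyp (hD : Saturated D node) {l r : X} {φ : Formula α} (h : node l r φ) :
    D l r := by
  induction φ generalizing l r with
  | atom a => exact hD.atom h h
  | neg φ ih =>
    obtain ⟨l₁, r₁, h₁, hl, hr⟩ := hD.neg h
    exact hr _ (hD.symm (hl _ (ih h₁)))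
  | conj φ ψ ih₁ ih₂ =>
    obtain ⟨l₁, r₁, l₂, r₂, h₁, h₂, hl₁, hl₂, hr⟩ := hD.conj h
    exact hr _ (hD.symm (hl₁ _ (hD.symm (ih₁ h₁)))) (hD.symm (hl₂ _ (hD.symm (ih₂ h₂))))
  | disj φ ψ ih₁ ih₂ =>
    obtain ⟨l₁, r₁, l₂, r₂, h₁, h₂, hr₁, hr₂, hl⟩ := hD.disj h
    exact hD.symm (hl _ (hD.symm (hr₁ _ (ih₁ h₁))) (hD.symm (hr₂ _ (ih₂ h₂))))

/-- One inclusion tests the polar at `l`, which is related to `r` by `Saturated.hyp`; the other is a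
cut with `φ`. -/
theorem Saturated.polar_left (hD : Saturated D node) {l r : X} {φ : Formula α} (h : node l r φ) :
    polar D {x | D x r} = {x | D x l} := by
  ext y
  exact ⟨fun hy => hD.symm (hy l (hD.hyp h)), fun hy x hx => hD.cut h hx (hD.symm hy)⟩

theorem Saturated.polar_right (hD : Saturated D node) {l r : X} {φ : Formula α} (h : node l r φ) :
    polar D {x | D x l} = {x | D x r} := by
  ext y
  exact ⟨fun hy => hD.symm (hy r (hD.symm (hD.hyp h))),
    fun hy x hx => hD.symm (hD.cut h hy (hD.symm hx))⟩

/-- The interpretation of a represented formula. -/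
theorem Saturated.interp_eq (hD : Saturated D node) {l r : X} {φ : Formula α} (h : node l r φ) :
    φ.interp D (atomInterp D node) = {x | D x r} := by
  have hO := hD.toOrthogonality
  induction φ generalizing l r with
  | atom a =>
    ext x
    refine ⟨fun hx => hD.symm (hx r ⟨l, h⟩), ?_⟩
    -- The same atom may be represented by many nodes; a cut at the given node moves from `r` to any
    -- other right item `r'` of the atom.
    rintro hx r' ⟨l', h'⟩
    exact hD.symm (hD.cut h hx (hD.atom h h'))
  | neg φ ih =>
    obtain ⟨l₁, r₁, h₁, hl, hr⟩ := hD.neg h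
    rw [Formula.interp, ih h₁, hD.polar_left h₁]
    ext x
    exact ⟨hr x, fun hx => hD.cut h hx (hD.symm (hl l₁ (hD.hyp h₁)))⟩
  | conj φ ψ ih₁ ih₂ =>
    obtain ⟨l₁, r₁, l₂, r₂, h₁, h₂, hl₁, hl₂, hr⟩ := hD.conj h
    rw [Formula.interp, ih₁ h₁, ih₂ h₂]
    ext x
    exact ⟨fun hx => hr x hx.1 hx.2, fun hx =>
      ⟨hD.cut h hx (hD.symm (hl₁ _ (hD.symm (hD.hyp h₁)))),
        hD.cut h hx (hD.symm (hl₂ _ (hD.symm (hD.hyp h₂))))⟩⟩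
  | disj φ ψ ih₁ ih₂ =>
    obtain ⟨l₁, r₁, l₂, r₂, h₁, h₂, hr₁, hr₂, hl⟩ := hD.disj h
    rw [Formula.interp, ih₁ h₁, ih₂ h₂, hD.polar_left h₁, hD.polar_left h₂]
    -- The disjunction is the polar of this intersection, so once the intersection is known to be
    -- the set belonging to `l`, `polar_right` gives the claim.
    have e : {x | D x l₁} ∩ {x | D x l₂} = {x | D x l} := by
      ext x
      refine ⟨fun hx => hl x hx.1 hx.2, fun hx => ⟨?_, ?_⟩⟩
      · exact hD.symm (hD.cut h (hr₁ _ (hD.hyp h₁)) (hD.symm hx))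
      · exact hD.symm (hD.cut h (hr₂ _ (hD.hyp h₂)) (hD.symm hx))
    rw [e, hD.polar_right h]

theorem Saturated.atomInterp_closed (hD : Saturated D node) (a : α) :
    polar D (polar D (atomInterp D node a)) = atomInterp D node a :=
  polar_polar_polar hD.toOrthogonality _

end Semantics

end EPROL

namespace EPROL

/-! ### Tables describing the instances of the axioms and the goal -/

def Formula.map {α β : Type} (g : α → β) : Formula α → Formula β
  | .atom a => .atom (g a)
  | .neg φ => .neg (φ.map g)
  | .conj φ ψ => .conj (φ.map g) (ψ.map g)
  | .disj φ ψ => .disj (φ.map g) (ψ.map g)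

def Annotated.map {α β : Type} (g : α → β) : Annotated α → Annotated β
  | .L φ => .L (φ.map g)
  | .R φ => .R (φ.map g)

def Arg.tag {Sg : Signature} : Arg Sg → ℕ
  | .var _ => 0
  | .const _ => 1

def Arg.val {Sg : Signature} : Arg Sg → ℕ
  | .var v => v
  | .const c => c.1

theorem Arg.ext_tag_val {Sg : Signature} {a b : Arg Sg} (h : a.tag = b.tag) (h' : a.val = b.val) :
    a = b := by
  cases a with
  | var v =>
    cases b with
    | var u => exact congrArg Arg.var h'
    | const c => exact absurd h (show (0 : ℕ) ≠ 1 by decide)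
  | const c =>
    cases b with
    | var u => exact absurd h (show (1 : ℕ) ≠ 0 by decide)
    | const c' => exact congrArg Arg.const (Subtype.ext h')

/-- Unlike a substitution, `f` may move constants. It will be the retraction of all arguments onto
those which occur in the instance. -/
def Atom.mapArgs {Sg : Signature} (f : Arg Sg → Arg Sg) (a : Atom Sg) : Atom Sg :=
  ⟨a.pred, fun i => f (a.args i)⟩

theorem Atom.ext_args {Sg : Signature} {a b : Atom Sg} (h : a.pred = b.pred)
    (h' : ∀ (i : ℕ) (ha : i < Sg.arity a.pred) (hb : i < Sg.arity b.pred),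
      a.args ⟨i, ha⟩ = b.args ⟨i, hb⟩) : a = b := by
  obtain ⟨p, u⟩ := a
  obtain ⟨q, v⟩ := b
  obtain rfl : p = q := h
  congr 1
  funext i
  exact h' i.1 i.2 i.2

/-- The tables computed by the program. A node is a number `c * len + p`, where `p` is the position
of a formula in the input and `c < count` is the code of a substitution. The items `2 * x + 1` and
`2 * x + 2` stand for the formula at the node `x` on the left and on the right. -/
structure Tables : Type where
  /-- the length of the input -/
  len : ℕ
  /-- the number of substitutions -/
  count : ℕ
  /-- the number of axioms -/
  axCount : ℕ
  /-- the input -/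
  tok : ℕ → ℕ
  /-- the end of the formula at a position -/
  ending : ℕ → ℕ
  /-- the main symbol of the formula at a position, and `0` at other positions -/
  sym : ℕ → ℕ
  /-- where in the input the symbol at a node is found after substitution -/
  src : ℕ → ℕ
  kind : ℕ → ℕ
  left : ℕ → ℕ
  right : ℕ → ℕ
  dual : ℕ → ℕ
  /-- the first parts of the goal and the axioms: `0` or `2 * p + 1` or `2 * p + 2` -/
  partA : ℕ → ℕ
  /-- the second parts of the goal and the axioms -/
  partB : ℕ → ℕ

namespace Tables

variable {Sg : Signature} (T : Tables)

def nodes : ℕ := T.len * T.count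

def items : ℕ := 2 * T.nodes + 1

def ArgAt (q : ℕ) (a : Arg Sg) : Prop := T.tok q = a.tag ∧ T.tok (q + 1) = a.val

/-- The formula `φ` is represented at position `p` under the substitution with code `c`. -/
def Rep (c : ℕ) : ℕ → Formula (Atom Sg) → Prop
  | p, .atom a => p < T.len ∧ T.sym p = 1 ∧ T.tok (T.src (c * T.len + p + 1)) = a.pred ∧
      T.tok (T.src (c * T.len + p + 2)) = Sg.arity a.pred ∧
      ∀ i : Fin (Sg.arity a.pred), T.ArgAt (T.src (c * T.len + p + 3 + 2 * i)) (a.args i)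
  | p, .neg φ => p < T.len ∧ T.sym p = 2 ∧ Rep c (p + 1) φ
  | p, .conj φ ψ => p < T.len ∧ T.sym p = 3 ∧ Rep c (p + 1) φ ∧ Rep c (T.ending (p + 1)) ψ
  | p, .disj φ ψ => p < T.len ∧ T.sym p = 4 ∧ Rep c (p + 1) φ ∧ Rep c (T.ending (p + 1)) ψ

/-- The code `n` of a part of a sequent represents the part `Γ` under the substitution `c`. -/
def PartRep (c n : ℕ) : Option (Annotated (Atom Sg)) → Prop
  | none => n = 0
  | some (.L φ) => ∃ p, n = 2 * p + 1 ∧ T.Rep c p φ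
  | some (.R φ) => ∃ p, n = 2 * p + 2 ∧ T.Rep c p φ

/-- The item for the part of a sequent with code `n` under the substitution `c`. -/
def item (c n : ℕ) : ℕ := if n = 0 then 0 else n + 2 * (c * T.len)

/-- The nodes `x` and `y` carry the same atom. -/
def SameAtom (x y : ℕ) : Prop :=
  T.tok (T.src (x + 1)) = T.tok (T.src (y + 1)) ∧ T.tok (T.src (x + 2)) = T.tok (T.src (y + 2)) ∧
    ∀ i < T.tok (T.src (x + 2)),
      T.tok (T.src (x + 3 + 2 * i)) = T.tok (T.src (y + 3 + 2 * i)) ∧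
      T.tok (T.src (x + 3 + 2 * i) + 1) = T.tok (T.src (y + 3 + 2 * i) + 1)

/-- The sequents to start with: hypotheses for atoms, and instances of axioms. -/
def Start (x y : ℕ) : Prop :=
  (∃ x' < T.nodes, ∃ y' < T.nodes, T.sym (x' % T.len) = 1 ∧ T.sym (y' % T.len) = 1 ∧
    T.SameAtom x' y' ∧ x = 2 * x' + 1 ∧ y = 2 * y' + 2) ∨
  ∃ s < T.axCount, ∃ c < T.count, x = T.item c (T.partA (s + 1)) ∧ y = T.item c (T.partB (s + 1))

/-- The tables are those of the instance `I`. -/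
structure Correct (I : Instance Sg) : Prop where
  genuine : ∀ c < T.count, ∀ p < T.len, T.sym p ≠ 0 → ∃ φ : Formula (Atom Sg), T.Rep c p φ
  kind_zero : T.kind 0 = 0
  dual_zero : T.dual 0 = 0
  dual_left : ∀ x < T.nodes, T.dual (2 * x + 1) = 2 * x + 2
  dual_right : ∀ x < T.nodes, T.dual (2 * x + 2) = 2 * x + 1
  kind_le : ∀ x < T.nodes, T.sym (x % T.len) < 2 →
    T.kind (2 * x + 1) = 0 ∧ T.kind (2 * x + 2) = 0
  neg_left : ∀ x < T.nodes, T.sym (x % T.len) = 2 → T.kind (2 * x + 1) = 1 ∧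
    T.left (2 * x + 1) = 2 * (x + 1) + 2 ∧ T.right (2 * x + 1) = 2 * (x + 1) + 2
  neg_right : ∀ x < T.nodes, T.sym (x % T.len) = 2 → T.kind (2 * x + 2) = 1 ∧
    T.left (2 * x + 2) = 2 * (x + 1) + 1 ∧ T.right (2 * x + 2) = 2 * (x + 1) + 1
  bin_left : ∀ x < T.nodes, 2 < T.sym (x % T.len) → T.kind (2 * x + 1) = 5 - T.sym (x % T.len) ∧
    T.left (2 * x + 1) = 2 * (x + 1) + 1 ∧
    T.right (2 * x + 1) = 2 * (x / T.len * T.len + T.ending (x % T.len + 1)) + 1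
  bin_right : ∀ x < T.nodes, 2 < T.sym (x % T.len) → T.kind (2 * x + 2) = T.sym (x % T.len) - 2 ∧
    T.left (2 * x + 2) = 2 * (x + 1) + 2 ∧
    T.right (2 * x + 2) = 2 * (x / T.len * T.len + T.ending (x % T.len + 1)) + 2
  count_pos : 0 < T.count
  goal_fst : T.PartRep 0 (T.partA 0) I.goal.fst
  goal_snd : T.PartRep 0 (T.partB 0) I.goal.snd
  ax_sound : ∀ s < T.axCount, ∀ c < T.count, ∃ S ∈ I.axs, ∃ σ : ℕ → Arg Sg,
    T.PartRep c (T.partA (s + 1)) (S.fst.map (Annotated.subst σ)) ∧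
    T.PartRep c (T.partB (s + 1)) (S.snd.map (Annotated.subst σ))
  ax_complete : ∃ f : Arg Sg → Arg Sg,
    I.goal.fst.map (Annotated.map (Atom.mapArgs f)) = I.goal.fst ∧
    I.goal.snd.map (Annotated.map (Atom.mapArgs f)) = I.goal.snd ∧
    ∀ S ∈ I.axs, ∀ σ : ℕ → Arg Sg, ∃ s < T.axCount, ∃ c < T.count,
      T.PartRep c (T.partA (s + 1))
        ((S.fst.map (Annotated.subst σ)).map (Annotated.map (Atom.mapArgs f))) ∧
      T.PartRep c (T.partB (s + 1))
        ((S.snd.map (Annotated.subst σ)).map (Annotated.map (Atom.mapArgs f)))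

variable {T}

theorem Rep.lt {c p : ℕ} {φ : Formula (Atom Sg)} (h : T.Rep c p φ) : p < T.len := by
  cases φ <;> exact h.1

theorem Rep.sym_ne {c p : ℕ} {φ : Formula (Atom Sg)} (h : T.Rep c p φ) : T.sym p ≠ 0 := by
  cases φ <;> simp [h.2.1]

/-- The symbol at a position determines the main connective, and an atom is determined by its
predicate symbol and the tags and values of its arguments. -/
theorem Rep.unique {c p : ℕ} {φ ψ : Formula (Atom Sg)} (h : T.Rep c p φ) (h' : T.Rep c p ψ) :
    φ = ψ := by
  induction φ generalizing p ψ with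
  | atom a =>
    cases ψ with
    | atom b =>
      obtain ⟨-, -, h₁, h₂, h₃⟩ := h
      obtain ⟨-, -, h₁', h₂', h₃'⟩ := h'
      congr 1
      refine Atom.ext_args (Fin.ext (h₁.symm.trans h₁')) fun i ha hb => ?_
      exact Arg.ext_tag_val ((h₃ ⟨i, ha⟩).1.symm.trans (h₃' ⟨i, hb⟩).1)
        ((h₃ ⟨i, ha⟩).2.symm.trans (h₃' ⟨i, hb⟩).2)
    | neg _ | conj _ _ | disj _ _ => exact absurd (h.2.1.symm.trans h'.2.1) (by decide)
  | neg φ ih =>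
    cases ψ with
    | neg ψ => rw [ih h.2.2 h'.2.2]
    | atom _ | conj _ _ | disj _ _ => exact absurd (h.2.1.symm.trans h'.2.1) (by decide)
  | conj φ₁ φ₂ ih₁ ih₂ =>
    cases ψ with
    | conj ψ₁ ψ₂ => rw [ih₁ h.2.2.1 h'.2.2.1, ih₂ h.2.2.2 h'.2.2.2]
    | atom _ | neg _ | disj _ _ => exact absurd (h.2.1.symm.trans h'.2.1) (by decide)
  | disj φ₁ φ₂ ih₁ ih₂ =>
    cases ψ with
    | disj ψ₁ ψ₂ => rw [ih₁ h.2.2.1 h'.2.2.1, ih₂ h.2.2.2 h'.2.2.2]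
    | atom _ | neg _ | conj _ _ => exact absurd (h.2.1.symm.trans h'.2.1) (by decide)

theorem node_lt {c p : ℕ} (hc : c < T.count) (hp : p < T.len) : c * T.len + p < T.nodes := by
  have : (c + 1) * T.len ≤ T.count * T.len := Nat.mul_le_mul_right _ hc
  rw [Nat.succ_mul] at this
  unfold nodes
  rw [Nat.mul_comm T.len]
  omega

theorem node_mod {c p : ℕ} (hp : p < T.len) : (c * T.len + p) % T.len = p := by
  rw [Nat.add_comm, Nat.add_mul_mod_self_right, Nat.mod_eq_of_lt hp]

theorem node_div {c p : ℕ} (hp : p < T.len) : (c * T.len + p) / T.len = c := by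
  rw [Nat.add_comm, Nat.add_mul_div_right _ _ (by omega), Nat.div_eq_of_lt hp, Nat.zero_add]

theorem exists_node {x : ℕ} (hx : x < T.nodes) :
    ∃ c p, c < T.count ∧ p < T.len ∧ x = c * T.len + p := by
  have hl : 0 < T.len := by
    rcases Nat.eq_zero_or_pos T.len with h | h
    · simp [nodes, h] at hx
    · exact h
  refine ⟨x / T.len, x % T.len, Nat.div_lt_of_lt_mul hx, Nat.mod_lt _ hl, ?_⟩
  rw [Nat.mul_comm]; exact (Nat.div_add_mod _ _).symm

/-- The part of a sequent for which an item stands. -/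
inductive Denotes (T : Tables) : ℕ → Option (Annotated (Atom Sg)) → Prop
  | zero : Denotes T 0 none
  | left {c p φ} : c < T.count → T.Rep c p φ → Denotes T (2 * (c * T.len + p) + 1) (some (.L φ))
  | right {c p φ} : c < T.count → T.Rep c p φ → Denotes T (2 * (c * T.len + p) + 2) (some (.R φ))
  | junk_left {c p} : c < T.count → p < T.len → T.sym p = 0 →
      Denotes T (2 * (c * T.len + p) + 1) none
  | junk_right {c p} : c < T.count → p < T.len → T.sym p = 0 →
      Denotes T (2 * (c * T.len + p) + 2) none

theorem node_inj {c p c' p' : ℕ} (hp : p < T.len) (hp' : p' < T.len)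
    (h : c * T.len + p = c' * T.len + p') : c = c' ∧ p = p' := by
  have h1 := node_div (c := c) hp
  have h2 := node_mod (c := c) hp
  rw [h, node_div hp'] at h1
  rw [h, node_mod hp'] at h2
  exact ⟨h1.symm, h2.symm⟩

theorem Denotes.unique {z : ℕ} {Γ Δ : Option (Annotated (Atom Sg))} (h : Denotes T z Γ)
    (h' : Denotes T z Δ) : Γ = Δ := by
  generalize hz : z = z' at h'
  cases h <;> cases h' <;> first | rfl | (exfalso; omega) | skip
  · rename_i c p φ hc hφ c' p' φ' hc' hφ'
    obtain ⟨rfl, rfl⟩ := node_inj hφ.lt hφ'.lt (show c * T.len + p = c' * T.len + p' by omega)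
    rw [hφ.unique hφ']
  · rename_i c p φ hc hφ c' p' hc' hp' hs
    obtain ⟨rfl, rfl⟩ := node_inj hφ.lt hp' (show c * T.len + p = c' * T.len + p' by omega)
    exact absurd hs hφ.sym_ne
  · rename_i c p φ hc hφ c' p' φ' hc' hφ'
    obtain ⟨rfl, rfl⟩ := node_inj hφ.lt hφ'.lt (show c * T.len + p = c' * T.len + p' by omega)
    rw [hφ.unique hφ']
  · rename_i c p φ hc hφ c' p' hc' hp' hs
    obtain ⟨rfl, rfl⟩ := node_inj hφ.lt hp' (show c * T.len + p = c' * T.len + p' by omega)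
    exact absurd hs hφ.sym_ne
  · rename_i c' p' hc' hp' hs c p φ hc hφ
    obtain ⟨rfl, rfl⟩ := node_inj hφ.lt hp' (show c * T.len + p = c' * T.len + p' by omega)
    exact absurd hs hφ.sym_ne
  · rename_i c' p' hc' hp' hs c p φ hc hφ
    obtain ⟨rfl, rfl⟩ := node_inj hφ.lt hp' (show c * T.len + p = c' * T.len + p' by omega)
    exact absurd hs hφ.sym_ne

theorem Denotes.lt {z : ℕ} {Γ : Option (Annotated (Atom Sg))} (h : Denotes T z Γ) :
    z < T.items := by
  unfold items
  cases h with
  | zero => omega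
  | left hc hφ | right hc hφ => have := node_lt hc hφ.lt; omega
  | junk_left hc hp hs | junk_right hc hp hs => have := node_lt hc hp; omega

theorem Denotes.of_partRep {c n : ℕ} {Γ : Option (Annotated (Atom Sg))} (hc : c < T.count)
    (h : T.PartRep c n Γ) : Denotes T (T.item c n) Γ := by
  rcases Γ with _ | (φ | φ)
  · obtain rfl : n = 0 := h
    exact .zero
  · obtain ⟨p, rfl, h⟩ := h
    rw [show T.item c (2 * p + 1) = 2 * (c * T.len + p) + 1 by unfold item; split_ifs <;> omega]
    exact .left hc h
  · obtain ⟨p, rfl, h⟩ := h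
    rw [show T.item c (2 * p + 2) = 2 * (c * T.len + p) + 2 by unfold item; split_ifs <;> omega]
    exact .right hc h

variable {I : Instance Sg}

/-- Items are all numbers below a bound, so many belong to positions where no formula starts.
Reading these as the empty part gives a meaning to every pair in the closure, in particular to the
middle item of any cut. -/
theorem Correct.exists_denotes (hT : T.Correct I) {z : ℕ} (hz : z < T.items) :
    ∃ Γ : Option (Annotated (Atom Sg)), Denotes T z Γ := by
  unfold items at hz
  rcases Nat.eq_zero_or_pos z with rfl | h0
  · exact ⟨_, .zero⟩
  obtain ⟨x, hx⟩ : ∃ x, z = 2 * x + 1 ∨ z = 2 * x + 2 := ⟨(z - 1) / 2, by omega⟩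
  obtain ⟨c, p, hc, hp, rfl⟩ := exists_node (show x < T.nodes by omega)
  by_cases hs : T.sym p = 0
  · rcases hx with rfl | rfl
    exacts [⟨_, .junk_left hc hp hs⟩, ⟨_, .junk_right hc hp hs⟩]
  · obtain ⟨φ, hφ⟩ := hT.genuine c hc p hp hs
    rcases hx with rfl | rfl
    exacts [⟨_, .left hc hφ⟩, ⟨_, .right hc hφ⟩]

theorem provable_comm {A : Set (Set (Annotated (Atom Sg)))} {Γ Δ : Option (Annotated (Atom Sg))}
    (h : Provable A (sq Γ Δ)) : Provable A (sq Δ Γ) := sq_comm Γ Δ ▸ h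

/-- Introduction of a formula both of whose premises are derivable. -/
theorem Correct.both_sound (hT : T.Correct I) {A : Set (Set (Annotated (Atom Sg)))} {z : ℕ}
    (hz : T.kind z = 1) {Γ Δ : Option (Annotated (Atom Sg))} (hΔ : Denotes T z Δ)
    (hl : ∀ Δ', Denotes T (T.left z) Δ' → Provable A (sq Γ Δ'))
    (hr : ∀ Δ', Denotes T (T.right z) Δ' → Provable A (sq Γ Δ')) : Provable A (sq Γ Δ) := by
  cases hΔ with
  | zero => rw [hT.kind_zero] at hz; omega
  | junk_left hc hp hs =>
    rw [(hT.kind_le _ (node_lt hc hp) (by rw [node_mod hp]; omega)).1] at hz; omega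
  | junk_right hc hp hs =>
    rw [(hT.kind_le _ (node_lt hc hp) (by rw [node_mod hp]; omega)).2] at hz; omega
  | @left c p φ hc hφ =>
    have hx := node_lt hc hφ.lt
    have hm := node_mod (c := c) hφ.lt
    have hd := node_div (c := c) hφ.lt
    cases φ with
    | atom a => rw [(hT.kind_le _ hx (by rw [hm, hφ.2.1]; omega)).1] at hz; omega
    | neg φ =>
      have h := hT.neg_left _ hx (by rw [hm, hφ.2.1])
      rw [h.2.1] at hl
      exact .leftNot _ _ (hl _ (.right hc hφ.2.2))
    | conj φ ψ =>
      rw [(hT.bin_left _ hx (by rw [hm, hφ.2.1]; omega)).1, hm, hφ.2.1] at hz; omega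
    | disj φ ψ =>
      have h := hT.bin_left _ hx (by rw [hm, hφ.2.1]; omega)
      rw [h.2.1] at hl
      rw [h.2.2, hd, hm] at hr
      exact .leftOr _ _ _ (hl _ (.left hc hφ.2.2.1)) (hr _ (.left hc hφ.2.2.2))
  | @right c p φ hc hφ =>
    have hx := node_lt hc hφ.lt
    have hm := node_mod (c := c) hφ.lt
    have hd := node_div (c := c) hφ.lt
    cases φ with
    | atom a => rw [(hT.kind_le _ hx (by rw [hm, hφ.2.1]; omega)).2] at hz; omega
    | neg φ =>
      have h := hT.neg_right _ hx (by rw [hm, hφ.2.1])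
      rw [h.2.1] at hl
      exact .rightNot _ _ (hl _ (.left hc hφ.2.2))
    | conj φ ψ =>
      have h := hT.bin_right _ hx (by rw [hm, hφ.2.1]; omega)
      rw [h.2.1] at hl
      rw [h.2.2, hd, hm] at hr
      exact .rightAnd _ _ _ (hl _ (.right hc hφ.2.2.1)) (hr _ (.right hc hφ.2.2.2))
    | disj φ ψ =>
      rw [(hT.bin_right _ hx (by rw [hm, hφ.2.1]; omega)).1, hm, hφ.2.1] at hz; omega

/-- Introduction of a formula one of whose premises is derivable. -/
theorem Correct.either_sound (hT : T.Correct I) {A : Set (Set (Annotated (Atom Sg)))} {z : ℕ}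
    (hz : T.kind z = 2) {Γ Δ : Option (Annotated (Atom Sg))} (hΔ : Denotes T z Δ)
    (h' : (∀ Δ', Denotes T (T.left z) Δ' → Provable A (sq Γ Δ')) ∨
      ∀ Δ', Denotes T (T.right z) Δ' → Provable A (sq Γ Δ')) : Provable A (sq Γ Δ) := by
  cases hΔ with
  | zero => rw [hT.kind_zero] at hz; omega
  | junk_left hc hp hs =>
    rw [(hT.kind_le _ (node_lt hc hp) (by rw [node_mod hp]; omega)).1] at hz; omega
  | junk_right hc hp hs =>
    rw [(hT.kind_le _ (node_lt hc hp) (by rw [node_mod hp]; omega)).2] at hz; omega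
  | @left c p φ hc hφ =>
    have hx := node_lt hc hφ.lt
    have hm := node_mod (c := c) hφ.lt
    have hd := node_div (c := c) hφ.lt
    cases φ with
    | atom a => rw [(hT.kind_le _ hx (by rw [hm, hφ.2.1]; omega)).1] at hz; omega
    | neg φ => rw [(hT.neg_left _ hx (by rw [hm, hφ.2.1])).1] at hz; omega
    | disj φ ψ =>
      rw [(hT.bin_left _ hx (by rw [hm, hφ.2.1]; omega)).1, hm, hφ.2.1] at hz; omega
    | conj φ ψ =>
      have h := hT.bin_left _ hx (by rw [hm, hφ.2.1]; omega)
      rw [h.2.1, h.2.2, hd, hm] at h'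
      rcases h' with h' | h'
      · exact .leftAnd₁ _ _ _ (h' _ (.left hc hφ.2.2.1))
      · exact .leftAnd₂ _ _ _ (h' _ (.left hc hφ.2.2.2))
  | @right c p φ hc hφ =>
    have hx := node_lt hc hφ.lt
    have hm := node_mod (c := c) hφ.lt
    have hd := node_div (c := c) hφ.lt
    cases φ with
    | atom a => rw [(hT.kind_le _ hx (by rw [hm, hφ.2.1]; omega)).2] at hz; omega
    | neg φ => rw [(hT.neg_right _ hx (by rw [hm, hφ.2.1])).1] at hz; omega
    | conj φ ψ =>
      rw [(hT.bin_right _ hx (by rw [hm, hφ.2.1]; omega)).1, hm, hφ.2.1] at hz; omega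
    | disj φ ψ =>
      have h := hT.bin_right _ hx (by rw [hm, hφ.2.1]; omega)
      rw [h.2.1, h.2.2, hd, hm] at h'
      rcases h' with h' | h'
      · exact .rightOr₁ _ _ _ (h' _ (.right hc hφ.2.2.1))
      · exact .rightOr₂ _ _ _ (h' _ (.right hc hφ.2.2.2))

/-- A cut between an item and its dual. -/
theorem Correct.cut_sound (hT : T.Correct I) {A : Set (Set (Annotated (Atom Sg)))} {y : ℕ}
    {Γ Δ Θ : Option (Annotated (Atom Sg))} (hy : Denotes T y Θ) (h : Provable A (sq Γ Θ))
    (h' : ∀ Θ', Denotes T (T.dual y) Θ' → Provable A (sq Θ' Δ)) : Provable A (sq Γ Δ) := by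
  cases hy with
  -- The middle item denotes no formula, so the first premise is already derivable with nothing
  -- besides `Γ`.
  | zero | junk_left | junk_right => exact .weaken _ _ h
  | left hc hφ =>
    rw [hT.dual_left _ (node_lt hc hφ.lt)] at h'
    exact provable_comm (.cut _ _ _ (provable_comm (h' _ (.right hc hφ))) (provable_comm h))
  | right hc hφ =>
    rw [hT.dual_right _ (node_lt hc hφ.lt)] at h'
    exact .cut _ _ _ h (h' _ (.left hc hφ))

theorem SameAtom.eq {x y : ℕ} {a b : Atom Sg} {c p c' p' : ℕ} (hx : x = c * T.len + p)
    (hy : y = c' * T.len + p') (ha : T.Rep c p (.atom a)) (hb : T.Rep c' p' (.atom b)) :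
    T.SameAtom x y ↔ a = b := by
  subst hx hy
  obtain ⟨-, -, h₁, h₂, h₃⟩ := ha
  obtain ⟨-, -, h₁', h₂', h₃'⟩ := hb
  unfold SameAtom
  constructor
  · rintro ⟨e₁, e₂, e₃⟩
    refine Atom.ext_args (Fin.ext (h₁.symm.trans (e₁.trans h₁'))) fun i ha hb => ?_
    have e := e₃ i (by rw [h₂]; exact ha)
    exact Arg.ext_tag_val
      ((h₃ ⟨i, ha⟩).1.symm.trans (e.1.trans (h₃' ⟨i, hb⟩).1))
      ((h₃ ⟨i, ha⟩).2.symm.trans (e.2.trans (h₃' ⟨i, hb⟩).2))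
  · rintro rfl
    refine ⟨h₁.trans h₁'.symm, h₂.trans h₂'.symm, fun i hi => ?_⟩
    rw [h₂] at hi
    exact ⟨(h₃ ⟨i, hi⟩).1.trans (h₃' ⟨i, hi⟩).1.symm, (h₃ ⟨i, hi⟩).2.trans (h₃' ⟨i, hi⟩).2.symm⟩

theorem expansion_mem {S : Sequent (Atom Sg)} (hS : S ∈ I.axs) (σ : ℕ → Arg Sg) :
    sq (S.fst.map (Annotated.subst σ)) (S.snd.map (Annotated.subst σ)) ∈ expansion I.axSet := by
  refine ⟨S.toSet, ⟨S, hS, rfl⟩, σ, ?_⟩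
  ext x
  simp only [sq, Sequent.toSet, Set.mem_ofPred_eq, Option.map_eq_some_iff, Set.mem_image]
  constructor
  · rintro (⟨a, h, rfl⟩ | ⟨a, h, rfl⟩)
    exacts [⟨a, .inl h, rfl⟩, ⟨a, .inr h, rfl⟩]
  · rintro ⟨a, h | h, rfl⟩
    exacts [.inl ⟨a, h, rfl⟩, .inr ⟨a, h, rfl⟩]

theorem expansion_cases {U : Set (Annotated (Atom Sg))} (h : U ∈ expansion I.axSet) :
    ∃ S ∈ I.axs, ∃ σ : ℕ → Arg Sg,
      U = sq (S.fst.map (Annotated.subst σ)) (S.snd.map (Annotated.subst σ)) := by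
  obtain ⟨_, ⟨S, hS, rfl⟩, σ, rfl⟩ := h
  refine ⟨S, hS, σ, ?_⟩
  ext x
  simp only [sq, Sequent.toSet, Set.mem_ofPred_eq, Option.map_eq_some_iff, Set.mem_image]
  constructor
  · rintro ⟨a, h | h, rfl⟩
    exacts [.inl ⟨a, h, rfl⟩, .inr ⟨a, h, rfl⟩]
  · rintro (⟨a, h, rfl⟩ | ⟨a, h, rfl⟩)
    exacts [⟨a, .inl h, rfl⟩, ⟨a, .inr h, rfl⟩]

/-- Every pair in the closure stands for a derivable sequent. -/
theorem Correct.sound (hT : T.Correct I) {x y : ℕ}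
    (h : Closure T.items T.kind T.left T.right T.dual T.Start x y) :
    x < T.items ∧ y < T.items ∧ ∀ Γ Δ : Option (Annotated (Atom Sg)),
      Denotes T x Γ → Denotes T y Δ → Provable (expansion I.axSet) (sq Γ Δ) := by
  induction h with
  | base h =>
    rcases h with ⟨x', hx', y', hy', hsx, hsy, he, rfl, rfl⟩ | ⟨s, hs, c, hc, rfl, rfl⟩
    · refine ⟨by unfold items; omega, by unfold items; omega, ?_⟩
      obtain ⟨c, p, hc, hp, rfl⟩ := exists_node hx'
      obtain ⟨c', p', hc', hp', rfl⟩ := exists_node hy'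
      rw [node_mod hp] at hsx
      rw [node_mod hp'] at hsy
      obtain ⟨φ, hφ⟩ := hT.genuine c hc p hp (by omega)
      obtain ⟨ψ, hψ⟩ := hT.genuine c' hc' p' hp' (by omega)
      intro Γ Δ hΓ hΔ
      rw [hΓ.unique (.left hc hφ), hΔ.unique (.right hc' hψ)]
      cases φ with
      | atom a =>
        cases ψ with
        | atom b =>
          rw [(SameAtom.eq rfl rfl hφ hψ).1 he]
          exact .hyp _
        | neg _ | conj _ _ | disj _ _ => exact absurd (hsy.symm.trans hψ.2.1) (by decide)
      | neg _ | conj _ _ | disj _ _ => exact absurd (hsx.symm.trans hφ.2.1) (by decide)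
    · obtain ⟨S, hS, σ, hA, hB⟩ := hT.ax_sound s hs c hc
      have hA' := Denotes.of_partRep hc hA
      have hB' := Denotes.of_partRep hc hB
      refine ⟨hA'.lt, hB'.lt, fun Γ Δ hΓ hΔ => ?_⟩
      rw [hΓ.unique hA', hΔ.unique hB']
      exact .ax _ _ (expansion_mem hS σ)
  | symm _ ih => exact ⟨ih.2.1, ih.1, fun Γ Δ hΓ hΔ => provable_comm (ih.2.2 Δ Γ hΔ hΓ)⟩
  | weaken hz _ ih =>
    exact ⟨ih.1, hz, fun Γ Δ hΓ _ => .weaken _ _ (sq_none Γ ▸ ih.2.2 Γ Γ hΓ hΓ)⟩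
  | weaken_zero hz _ ih => exact ⟨ih.1, hz, fun Γ Δ hΓ _ => .weaken _ _ (ih.2.2 Γ _ hΓ .zero)⟩
  | cut _ _ ih₁ ih₂ =>
    refine ⟨ih₁.1, ih₂.2.1, fun Γ Δ hΓ hΔ => ?_⟩
    obtain ⟨Θ, hΘ⟩ := hT.exists_denotes ih₁.2.1
    exact hT.cut_sound hΘ (ih₁.2.2 _ _ hΓ hΘ) fun Θ' hΘ' => ih₂.2.2 _ _ hΘ' hΔ
  | both hz hk _ _ ih₁ ih₂ =>
    exact ⟨ih₁.1, hz, fun Γ Δ hΓ hΔ => hT.both_sound hk hΔ (fun _ h => ih₁.2.2 _ _ hΓ h)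
      fun _ h => ih₂.2.2 _ _ hΓ h⟩
  | either_left hz hk _ ih =>
    exact ⟨ih.1, hz, fun Γ Δ hΓ hΔ => hT.either_sound hk hΔ (.inl fun _ h => ih.2.2 _ _ hΓ h)⟩
  | either_right hz hk _ ih =>
    exact ⟨ih.1, hz, fun Γ Δ hΓ hΔ => hT.either_sound hk hΔ (.inr fun _ h => ih.2.2 _ _ hΓ h)⟩

/-! #### Completeness -/

/-- The closure as a relation on the items below `T.items`. -/
def Rel (T : Tables) (x y : Fin T.items) : Prop :=
  Closure T.items T.kind T.left T.right T.dual T.Start x y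

def Node (T : Tables) (l r : Fin T.items) (φ : Formula (Atom Sg)) : Prop :=
  ∃ c p, c < T.count ∧ T.Rep c p φ ∧ (l : ℕ) = 2 * (c * T.len + p) + 1 ∧
    (r : ℕ) = 2 * (c * T.len + p) + 2

theorem Node.exists {c p : ℕ} {φ : Formula (Atom Sg)} (hc : c < T.count) (h : T.Rep c p φ) :
    ∃ l r : Fin T.items, (l : ℕ) = 2 * (c * T.len + p) + 1 ∧ (r : ℕ) = 2 * (c * T.len + p) + 2 ∧
      Node T l r φ := by
  have h' := node_lt hc h.lt
  exact ⟨⟨2 * (c * T.len + p) + 1, by unfold items; omega⟩,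
    ⟨2 * (c * T.len + p) + 2, by unfold items; omega⟩, rfl, rfl, c, p, hc, h, rfl, rfl⟩

theorem Correct.orthogonality (_ : T.Correct I) : Orthogonality (Rel T) :=
  ⟨fun h => .symm h, fun {_ y} h => .weaken y.2 h⟩

/-- Each clause is a closure rule at the right items. For a negation the two premises in the tables
coincide, so the rule with two premises serves as a rule with one. -/
theorem Correct.saturated (hT : T.Correct I) : Saturated (Rel T) (Node (Sg := Sg) T) where
  toOrthogonality := hT.orthogonality
  atom := by
    rintro l r l' r' a ⟨c, p, hc, h, hl, hr⟩ ⟨c', p', hc', h', hl', hr'⟩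
    refine .base (.inl ⟨_, node_lt hc h.lt, _, node_lt hc' h'.lt, ?_, ?_, ?_, hl, hr'⟩)
    · rw [node_mod h.lt]; exact h.2.1
    · rw [node_mod h'.lt]; exact h'.2.1
    · exact (SameAtom.eq rfl rfl h h').2 rfl
  cut := by
    rintro l r φ x y ⟨c, p, hc, h, hl, hr⟩ h₁ h₂
    refine .cut h₁ ?_
    rw [hr, hT.dual_right _ (node_lt hc h.lt), ← hl]
    exact h₂
  neg := by
    rintro l r φ ⟨c, p, hc, h, hl, hr⟩
    obtain ⟨l₁, r₁, hl₁, hr₁, h₁⟩ := Node.exists hc h.2.2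
    have hx := node_lt hc h.lt
    have hs : T.sym ((c * T.len + p) % T.len) = 2 := by rw [node_mod h.lt]; exact h.2.1
    have hL := hT.neg_left _ hx hs
    have hR := hT.neg_right _ hx hs
    rw [← hl] at hL
    rw [← hr] at hR
    refine ⟨l₁, r₁, h₁, fun x hx => .both l.2 hL.1 ?_ ?_, fun x hx => .both r.2 hR.1 ?_ ?_⟩
    · rw [hL.2.1, ← add_assoc] at *; exact hr₁ ▸ hx
    · rw [hL.2.2, ← add_assoc] at *; exact hr₁ ▸ hx
    · rw [hR.2.1, ← add_assoc] at *; exact hl₁ ▸ hx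
    · rw [hR.2.2, ← add_assoc] at *; exact hl₁ ▸ hx
  conj := by
    rintro l r φ ψ ⟨c, p, hc, h, hl, hr⟩
    obtain ⟨l₁, r₁, hl₁, hr₁, h₁⟩ := Node.exists hc h.2.2.1
    obtain ⟨l₂, r₂, hl₂, hr₂, h₂⟩ := Node.exists hc h.2.2.2
    have hx := node_lt hc h.lt
    have hs : T.sym ((c * T.len + p) % T.len) = 3 := by rw [node_mod h.lt]; exact h.2.1
    have hL := hT.bin_left _ hx (by omega)
    have hR := hT.bin_right _ hx (by omega)
    rw [← hl, hs, node_div h.lt, node_mod h.lt, ← hl₂] at hL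
    rw [← hr, hs, node_div h.lt, node_mod h.lt, ← hr₂] at hR
    rw [add_assoc, ← hl₁] at hL
    rw [add_assoc, ← hr₁] at hR
    refine ⟨l₁, r₁, l₂, r₂, h₁, h₂, fun x hx => .either_left l.2 hL.1 (hL.2.1 ▸ hx),
      fun x hx => .either_right l.2 hL.1 (hL.2.2 ▸ hx),
      fun x hx hx' => .both r.2 hR.1 (hR.2.1 ▸ hx) (hR.2.2 ▸ hx')⟩
  disj := by
    rintro l r φ ψ ⟨c, p, hc, h, hl, hr⟩
    obtain ⟨l₁, r₁, hl₁, hr₁, h₁⟩ := Node.exists hc h.2.2.1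
    obtain ⟨l₂, r₂, hl₂, hr₂, h₂⟩ := Node.exists hc h.2.2.2
    have hx := node_lt hc h.lt
    have hs : T.sym ((c * T.len + p) % T.len) = 4 := by rw [node_mod h.lt]; exact h.2.1
    have hL := hT.bin_left _ hx (by omega)
    have hR := hT.bin_right _ hx (by omega)
    rw [← hl, hs, node_div h.lt, node_mod h.lt, ← hl₂] at hL
    rw [← hr, hs, node_div h.lt, node_mod h.lt, ← hr₂] at hR
    rw [add_assoc, ← hl₁] at hL
    rw [add_assoc, ← hr₁] at hR
    refine ⟨l₁, r₁, l₂, r₂, h₁, h₂, fun x hx => .either_left r.2 hR.1 (hR.2.1 ▸ hx),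
      fun x hx => .either_right r.2 hR.1 (hR.2.2 ▸ hx),
      fun x hx hx' => .both l.2 hL.1 (hL.2.1 ▸ hx) (hL.2.2 ▸ hx')⟩

theorem _root_.EPROL.Formula.interp_map {α β X : Type} (D : X → X → Prop) (v : β → Set X) (g : α → β)
    (φ : Formula α) : (φ.map g).interp D v = φ.interp D fun a => v (g a) := by
  induction φ <;> simp_all [Formula.map, Formula.interp]

theorem _root_.EPROL.optInterp_map {α β X : Type} (D : X → X → Prop) (v : β → Set X) (g : α → β)
    (Γ : Option (Annotated α)) :
    optInterp D v (Γ.map (Annotated.map g)) = optInterp D (fun a => v (g a)) Γ := by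
  rcases Γ with _ | (φ | φ) <;>
    simp [optInterp, Annotated.interp, Annotated.map, Formula.interp_map]

/-- The interpretation of a represented part contains its item, and whatever is related to the item
is related to the whole interpretation. -/
theorem Correct.interp_part (hT : T.Correct I) {c n : ℕ} (hc : c < T.count)
    {Γ : Option (Annotated (Atom Sg))} (h : T.PartRep c n Γ) :
    ∃ i : Fin T.items, (i : ℕ) = T.item c n ∧
      i ∈ optInterp (Rel T) (atomInterp (Rel T) (Node T)) Γ ∧
      ∀ x ∈ optInterp (Rel T) (atomInterp (Rel T) (Node T)) Γ, ∀ y, Rel T i y → Rel T x y := by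
  have hS := hT.saturated
  refine ⟨⟨_, (Denotes.of_partRep hc h).lt⟩, rfl, ?_⟩
  rcases Γ with _ | (φ | φ)
  · obtain rfl : n = 0 := h
    refine ⟨trivial, fun x _ y hy => ?_⟩
    exact Closure.symm (.weaken_zero x.2 (.symm hy))
  · obtain ⟨p, rfl, h⟩ := h
    obtain ⟨l, r, hl, hr, hn⟩ := Node.exists hc h
    have e : (⟨_, (Denotes.of_partRep hc (Γ := some (.L φ)) ⟨p, rfl, h⟩).lt⟩ : Fin T.items) = l := by
      ext; rw [hl]; simp only [item]; split_ifs <;> omega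
    rw [e]
    simp only [optInterp, Annotated.interp, hS.interp_eq hn, Set.mem_ofPred_eq]
    exact ⟨hS.hyp hn, fun x hx y hy => hS.cut hn hx hy⟩
  · obtain ⟨p, rfl, h⟩ := h
    obtain ⟨l, r, hl, hr, hn⟩ := Node.exists hc h
    have e : (⟨_, (Denotes.of_partRep hc (Γ := some (.R φ)) ⟨p, rfl, h⟩).lt⟩ : Fin T.items) = r := by
      ext; rw [hr]; simp only [item]; split_ifs <;> omega
    rw [e]
    simp only [optInterp, Annotated.interp, hS.interp_eq hn, hS.polar_left hn, Set.mem_ofPred_eq]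
    exact ⟨hS.symm (hS.hyp hn), fun x hx y hy => hS.symm (hS.cut hn (hS.symm hy) (hS.symm hx))⟩

/-- The closure decides the instance. -/
theorem Correct.closure_iff_valid (hT : T.Correct I) :
    Closure T.items T.kind T.left T.right T.dual T.Start (T.partA 0) (T.partB 0) ↔ I.Valid := by
  -- The goal is not substituted, so its items are taken at the substitution with code `0`, where
  -- the shift vanishes.
  have hg : ∀ n, T.item 0 n = n := fun n => by unfold item; split_ifs <;> omega
  constructor
  · intro h
    have h₁ := Denotes.of_partRep hT.count_pos hT.goal_fst
    have h₂ := Denotes.of_partRep hT.count_pos hT.goal_snd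
    rw [hg] at h₁ h₂
    exact (hT.sound h).2.2 _ _ h₁ h₂
  · intro h
    obtain ⟨f, hf₁, hf₂, hf⟩ := hT.ax_complete
    have hO := hT.orthogonality
    have hS := hT.saturated
    -- Composing the valuation with `f` interprets an arbitrary instance of an axiom as one of the
    -- finitely many instances in the tables, while the goal, which `f` fixes, keeps its meaning.
    have H := Provable.sequentHolds (v := fun a => atomInterp (Rel T) (Node T) (a.mapArgs f)) hO
      (fun a => hS.atomInterp_closed _) ?_ h
    · obtain ⟨i, hi, hi', -⟩ := hT.interp_part hT.count_pos hT.goal_fst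
      obtain ⟨j, hj, hj', -⟩ := hT.interp_part hT.count_pos hT.goal_snd
      rw [hg] at hi hj
      rw [← hf₁, optInterp_map] at hi'
      rw [← hf₂, optInterp_map] at hj'
      have := (sequentHolds_sq hO I.goal.fst I.goal.snd).1 H i hi' j hj'
      rw [← hi, ← hj]
      exact this
    · intro U hU
      obtain ⟨S, hSA, σ, rfl⟩ := expansion_cases hU
      obtain ⟨s, hs, c, hc, h₁, h₂⟩ := hf S hSA σ
      obtain ⟨i, hi, -, hi'⟩ := hT.interp_part hc h₁
      obtain ⟨j, hj, -, hj'⟩ := hT.interp_part hc h₂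
      rw [optInterp_map] at hi' hj'
      rw [sequentHolds_sq hO]
      intro p hp q hq
      -- The items `i` and `j` of the two parts form a start pair; `interp_part` carries their
      -- relation over to arbitrary elements of the interpretations, one side at a time.
      refine hO.symm (hj' q hq _ (hO.symm (hi' p hp _ ?_)))
      exact .base (.inr ⟨s, hs, c, hc, hi, hj⟩)

end Tables

end EPROL

namespace EPROL

/-! ### The decision program -/

section Program

open EPROL.Var EPROL.Arr EPROL.Stmt EPROL.Expr EPROL.Cond

/-- Marks the pair `(ax, ay)` in `D` and puts it into the queue, unless it is marked. -/
def addPair : Stmt :=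
  ed ≔ var ax * var M + var ay ;;
  .ite (.eq (read D (var ed)) 0)
    (.write D (var ed) 1 ;; .write Q (var tl) (var ed) ;; tl ≔ var tl + 1)
    .skip

/-- Computes the end of the formula at `p = len - (i + 1)`. -/
def stopBody : Stmt :=
  p ≔ var len - (var i + 1) ;;
  .ite (.eq (read E (var p)) 0)
    (.ite (.lt (read E (var p + 2)) (var len))
      (.write END (var p) (var p + 3 + 2 * read E (var p + 2))) .skip)
    (.ite (.eq (read E (var p)) 1) (.write END (var p) (read END (var p + 1)))
      (.write END (var p) (read END (read END (var p + 1)))))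

def stopPhase : Stmt := .loop i len stopBody

/-- Looks for the variable at position `r + 1` in the list `VV`. -/
def searchVar : Stmt :=
  idx ≔ var nv ;;
  .loop j nv (.ite (.eq (read VV (var j)) (read E (var r + 1))) (idx ≔ var j) .skip)

/-- Numbers the variable at position `r + 1`. -/
def numberVar : Stmt :=
  searchVar ;;
  .ite (.eq (var idx) (var nv))
    (.write VV (var nv) (read E (var r + 1)) ;; nv ≔ var nv + 1) .skip ;;
  .write J (var r) (var idx + 1)

/-- Records the argument at position `r`. -/
def argStep : Stmt :=
  .write T (var m) (var r) ;; m ≔ var m + 1 ;;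
  .ite (.lt 0 (var i)) (.ite (.eq (read E (var r)) 0) numberVar .skip) .skip

/-- Records the arguments of the atom at position `q`. -/
def atomStep : Stmt :=
  ar ≔ read E (var q + 2) ;;
  .loop a ar (r ≔ var q + 3 + 2 * var a ;; argStep) ;;
  q ≔ var q + 3 + 2 * var ar

/-- Records the main symbol of the formula at position `q`. -/
def formBody : Stmt :=
  .ite (.lt (var q) (var e))
    (.write KD (var q) (read E (var q) + 1) ;;
      .ite (.eq (read E (var q)) 0) atomStep (q ≔ var q + 1))
    .skip

/-- The side is encoded by `1` or `2`, which is exactly what makes `2 * p + 1` or `2 * p + 2` the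
code of a part. A part has at most `len` symbols to visit; the rounds after its end are idle. -/
def scanPart : Stmt :=
  t ≔ read E (var q) ;; q ≔ var q + 1 ;;
  .ite (.eq (var t) 0) (it ≔ 0)
    (it ≔ 2 * var q + var t ;; e ≔ read END (var q) ;; .loop f len formBody)

/-- The list of variables is emptied for every sequent, so `d` becomes the largest number of
variables numbered in one sequent, not their total number. -/
def scanSequent : Stmt :=
  nv ≔ 0 ;; scanPart ;; .write AXA (var i) (var it) ;; scanPart ;; .write AXB (var i) (var it) ;;
  .ite (.lt (var d) (var nv)) (d ≔ var nv) .skip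

/-- Number `0` is reserved for the goal, whose variables are never substituted; axiom number `s` is
scanned with `i = s + 1`. -/
def scanPhase : Stmt :=
  i ≔ 0 ;; scanSequent ;; k ≔ read E (var q) ;; q ≔ var q + 1 ;;
  .loop s k (i ≔ var s + 1 ;; scanSequent)

def powPhase : Stmt :=
  .write POW 0 1 ;; .loop j d (.write POW (var j + 1) (read POW (var j) * var m)) ;;
  CN ≔ read POW (var d) ;; N ≔ var len * var CN ;; M ≔ 2 * var N + 1 ;; MM ≔ var M * var M

/-- Where the symbol at the node `x` is found after substitution. -/
def srcStep : Stmt :=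
  .ite (.eq (read J (var p)) 0) (.write G (var x) (var p))
    (t ≔ var c / read POW (read J (var p) - 1) ;;
      .write G (var x) (read T (var t - var t / var m * var m)))

/-- The tables for the node `x` with a negation. -/
def negStep : Stmt :=
  .write IK (2 * var x + 1) 1 ;; .write IA (2 * var x + 1) (2 * (var x + 1) + 2) ;;
  .write IB (2 * var x + 1) (2 * (var x + 1) + 2) ;;
  .write IK (2 * var x + 2) 1 ;; .write IA (2 * var x + 2) (2 * (var x + 1) + 1) ;;
  .write IB (2 * var x + 2) (2 * (var x + 1) + 1)

/-- The tables for the node `x` with a conjunction or disjunction. -/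
def binStep : Stmt :=
  u ≔ var c * var len + read END (var p + 1) ;;
  .write IK (2 * var x + 1) (5 - read KD (var p)) ;;
  .write IA (2 * var x + 1) (2 * (var x + 1) + 1) ;; .write IB (2 * var x + 1) (2 * var u + 1) ;;
  .write IK (2 * var x + 2) (read KD (var p) - 2) ;;
  .write IA (2 * var x + 2) (2 * (var x + 1) + 2) ;; .write IB (2 * var x + 2) (2 * var u + 2)

def nodeBody : Stmt :=
  c ≔ var x / var len ;; p ≔ var x - var c * var len ;; srcStep ;;
  .write BAR (2 * var x + 1) (2 * var x + 2) ;; .write BAR (2 * var x + 2) (2 * var x + 1) ;;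
  .ite (.eq (read KD (var p)) 2) negStep (.ite (.lt 2 (read KD (var p))) binStep .skip)

def nodePhase : Stmt := .loop x N nodeBody

/-- Compares the arguments number `a` of the atoms at the nodes `x` and `y`. -/
def compareArg : Stmt :=
  .ite (.eq (var bad) 0)
    (r ≔ read G (var x + 3 + 2 * var a) ;; t ≔ read G (var y + 3 + 2 * var a) ;;
      .ite (.eq (read E (var r)) (read E (var t))) .skip (bad ≔ 1) ;;
      .ite (.eq (read E (var r + 1)) (read E (var t + 1))) .skip (bad ≔ 1))
    .skip

/-- Compares the atoms at the nodes `x` and `y`. -/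
def compareAtoms : Stmt :=
  bad ≔ 0 ;;
  .ite (.eq (read E (read G (var x + 1))) (read E (read G (var y + 1)))) .skip (bad ≔ 1) ;;
  .ite (.eq (read E (read G (var x + 2))) (read E (read G (var y + 2)))) .skip (bad ≔ 1) ;;
  .loop a ar compareArg

def hypInner : Stmt :=
  p' ≔ var y - var y / var len * var len ;;
  .ite (.eq (read KD (var p')) 1)
    (compareAtoms ;;
      .ite (.eq (var bad) 0) (ax ≔ 2 * var x + 1 ;; ay ≔ 2 * var y + 2 ;; addPair) .skip)
    .skip

def hypBody : Stmt :=
  p ≔ var x - var x / var len * var len ;;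
  .ite (.eq (read KD (var p)) 1)
    (ar ≔ read E (read G (var x + 2)) ;; .loop y N hypInner) .skip

def hypPhase : Stmt := .loop x N hypBody

def axBody : Stmt :=
  ax ≔ read AXA (var s + 1) ;;
  .ite (.eq (var ax) 0) .skip (ax ≔ var ax + 2 * (var c * var len)) ;;
  ay ≔ read AXB (var s + 1) ;;
  .ite (.eq (var ay) 0) .skip (ay ≔ var ay + 2 * (var c * var len)) ;;
  addPair

def axPhase : Stmt := .loop c CN (.loop s k axBody)

/-- Adds the pair `(x, z)` if it follows from `(x, y)` and marked pairs. -/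
def satInner : Stmt :=
  ay ≔ var z ;;
  .ite (.lt 0 (var w + read D (var yb * var M + var z))) addPair
    (.ite (.lt 2 (read IK (var z) + read D (var x * var M + read IA (var z)) +
      read D (var x * var M + read IB (var z)))) addPair .skip)

/-- Processes the pair `(x, y)` number `h` of the queue. -/
def satBody : Stmt :=
  .ite (.lt (var h) (var tl))
    (ed ≔ read Q (var h) ;; x ≔ var ed / var M ;; y ≔ var ed - var x * var M ;;
      ax ≔ var y ;; ay ≔ var x ;; addPair ;;
      yb ≔ read BAR (var y) ;;
      w ≔ read D (var x * var M + var x) + read D (var x * var M) ;;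
      ax ≔ var x ;; .loop z M satInner)
    .skip

/-- The queue has no duplicates and so never exceeds the number of pairs; rounds beyond its end do
nothing. -/
def satPhase : Stmt := .loop h MM satBody

/-- The answer goes into `len` because that variable is register `0`. -/
def answerPhase : Stmt := len ≔ read D (read AXA 0 * var M + read AXB 0)

/-- The decision program. -/
def decideProgram : Stmt :=
  stopPhase ;; scanPhase ;; powPhase ;; nodePhase ;; hypPhase ;; axPhase ;; satPhase ;; answerPhase

end Program

theorem decideProgram_wf : decideProgram.wf = true := by decide

end EPROL

namespace EPROL

open Stmt

variable {Sg : Signature}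

/-! ### Ends of formulas -/

/-- The list `l` is found in `E` from position `p` on. -/
def At (E : ℕ → ℕ) (p : ℕ) (l : List ℕ) : Prop := ∀ i (h : i < l.length), E (p + i) = l[i]

theorem at_nil {E : ℕ → ℕ} {p : ℕ} : At E p [] := fun _ h => absurd h (Nat.not_lt_zero _)

theorem at_cons {E : ℕ → ℕ} {p n : ℕ} {l : List ℕ} :
    At E p (n :: l) ↔ E p = n ∧ At E (p + 1) l := by
  constructor
  · intro h
    refine ⟨h 0 (by simp), fun i hi => ?_⟩
    have := h (i + 1) (by simpa using hi)
    rw [List.getElem_cons_succ] at this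
    rw [← this]; congr 1; omega
  · rintro ⟨h₀, h⟩ i hi
    cases i with
    | zero => exact h₀
    | succ i =>
      rw [List.getElem_cons_succ, ← h i (by simpa using hi)]; congr 1; omega

theorem at_append {E : ℕ → ℕ} {p : ℕ} {l l' : List ℕ} :
    At E p (l ++ l') ↔ At E p l ∧ At E (p + l.length) l' := by
  induction l generalizing p with
  | nil => simp [at_nil]
  | cons n l ih =>
    rw [List.cons_append, at_cons, at_cons, ih, and_assoc, List.length_cons]
    rw [show p + 1 + l.length = p + (l.length + 1) by omega]

theorem Formula.encode_atom (a : Atom Sg) : (Formula.atom a).encode =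
    0 :: (a.pred : ℕ) :: Sg.arity a.pred :: (List.ofFn a.args).flatMap Arg.encode := rfl

theorem Formula.encode_neg (φ : Formula (Atom Sg)) : (Formula.neg φ).encode = 1 :: φ.encode := rfl

theorem Formula.encode_conj (φ ψ : Formula (Atom Sg)) :
    (Formula.conj φ ψ).encode = 2 :: (φ.encode ++ ψ.encode) := rfl

theorem Formula.encode_disj (φ ψ : Formula (Atom Sg)) :
    (Formula.disj φ ψ).encode = 3 :: (φ.encode ++ ψ.encode) := rfl

theorem Arg.encode_eq (a : Arg Sg) : a.encode = [a.tag, a.val] := by cases a <;> rfl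

theorem length_flatMap_encode (l : List (Arg Sg)) : (l.flatMap Arg.encode).length = 2 * l.length := by
  induction l with
  | nil => rfl
  | cons a l ih =>
    rw [List.flatMap_cons, List.length_append, ih, Arg.encode_eq]; simp; omega

theorem Formula.length_encode_atom (a : Atom Sg) :
    (Formula.atom a).encode.length = 3 + 2 * Sg.arity a.pred := by
  rw [Formula.encode_atom]
  simp only [List.length_cons, length_flatMap_encode, List.length_ofFn]
  omega

theorem At.args {E : ℕ → ℕ} {p : ℕ} {l : List (Arg Sg)} (h : At E p (l.flatMap Arg.encode))
    (i : ℕ) (hi : i < l.length) : E (p + 2 * i) = l[i].tag ∧ E (p + 2 * i + 1) = l[i].val := by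
  induction l generalizing p i with
  | nil => exact absurd hi (Nat.not_lt_zero _)
  | cons a l ih =>
    rw [List.flatMap_cons, Arg.encode_eq, List.cons_append, List.cons_append, List.nil_append,
      at_cons, at_cons] at h
    cases i with
    | zero => exact ⟨h.1, h.2.1⟩
    | succ i =>
      have := ih h.2.2 i (by simpa using hi)
      rw [List.getElem_cons_succ]
      rwa [show p + 1 + 1 + 2 * i = p + 2 * (i + 1) by omega] at this

variable {W B U : ℕ}

/-- No formula need start at `p`, so `E (p + 2)` can be any word. The comparison with `len` and the
bound `hE` on the entries keep all addresses in range nevertheless. -/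
theorem stopBody_spec (hU : B + 16 * U + 16 < W) {σ : Store} (hl : 3 * σ.var .len + 8 ≤ U)
    (hi : σ.var .i < σ.var .len) (hE : ∀ p, σ.arr .END p ≤ 3 * σ.var .len + 3) {p : ℕ}
    (hp : σ.var .len - (σ.var .i + 1) = p) :
    stopBody.Spec W B σ 100 fun τ => τ.arr .END = Function.update (σ.arr .END) p
      (if σ.arr .E p = 0 then
        if σ.arr .E (p + 2) < σ.var .len then p + 3 + 2 * σ.arr .E (p + 2) else σ.arr .END p
      else if σ.arr .E p = 1 then σ.arr .END (p + 1) else σ.arr .END (σ.arr .END (p + 1))) := by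
  have h1 := hE (p + 1)
  simp [stopBody, Stmt.Spec, wp, Store.set_var, Store.put_arr, hp]
  refine ⟨by omega, by omega, fun h0 => ⟨by omega, fun h1 => ⟨by omega, by omega, ?_⟩,
    fun h1 => ?_⟩, fun h0 => ⟨by omega, fun h1 => ⟨by omega, by omega, ?_⟩,
    fun h1 => ⟨by omega, by omega, ?_⟩⟩⟩
  · simp [h0, h1]
  · simp [h0, not_lt.2 h1]
  · simp [h1]
  · simp [h0, h1]

/-- `ending` gives the ends of the formulas at positions from `lo` on. -/
def StopsFrom (Sg : Signature) (tok ending : ℕ → ℕ) (len lo : ℕ) : Prop :=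
  ∀ p, lo ≤ p → ∀ φ : Formula (Atom Sg), At tok p φ.encode → p + φ.encode.length ≤ len →
    ending p = p + φ.encode.length

/-- Subformulas start to the right of their formula, so going from right to left their ends are
known in time. Where no formula starts the entries are meaningless, but still bounded. -/
theorem stopPhase_spec (hU : B + 16 * U + 16 < W) {σ : Store} (hl : 3 * σ.var .len + 8 ≤ U)
    (h₀ : ∀ p, σ.arr .END p = 0) :
    stopPhase.Spec W B σ (103 * σ.var .len + 2) fun τ =>
      (∀ p, τ.arr .END p ≤ 3 * σ.var .len + 3) ∧
      StopsFrom Sg (σ.arr .E) (τ.arr .END) (σ.var .len) 0 := by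
  refine Spec.loop (T₀ := 100) (fun i τ => (∀ p, τ.arr .END p ≤ 3 * σ.var .len + 3) ∧
    StopsFrom Sg (σ.arr .E) (τ.arr .END) (σ.var .len) (σ.var .len - i)) (by omega) ?_ ?_ (by omega) ?_
  -- Codes of formulas are not empty, so none starts at `len` or later.
  · refine ⟨fun p => by rw [h₀]; omega, fun p hp φ _ h => ?_⟩
    have : 0 < φ.encode.length := by cases φ <;> simp [Formula.encode]
    omega
  · rintro i τ hi hf ⟨hb, hs⟩
    have hlen : τ.var .len = σ.var .len := hf.var _ (by decide)
    have hE : τ.arr .E = σ.arr .E := hf.arr _ (by decide)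
    refine (stopBody_spec hU (σ := τ.set .i i) (p := σ.var .len - (i + 1)) ?_ ?_ ?_ ?_).mono
      le_rfl ?_
    · simpa [Store.set_var, hlen] using hl
    · simpa [Store.set_var, hlen] using hi
    · simpa [Store.set_var, hlen] using hb
    · simp [Store.set_var, hlen]
    intro υ _ hυ
    simp only [Store.set_arr, Store.set_var, hE, hlen, reduceCtorEq, if_false] at hυ
    generalize hp : σ.var .len - (i + 1) = p at *
    rw [hυ]
    constructor
    · intro p'
      rw [Function.update_apply]
      split_ifs
      · omega
      · exact hb _
      · exact hb _
      · exact hb _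
      · exact hb _
    · intro p' hp' φ hφ hlt
      rw [Function.update_apply]
      by_cases hpp : p' = p
      · subst hpp
        rw [if_pos rfl]
        cases φ with
        | atom a =>
          rw [Formula.length_encode_atom] at *
          rw [Formula.encode_atom, at_cons, at_cons, at_cons] at hφ
          rw [if_pos hφ.1, hφ.2.2.1, if_pos (by omega)]
          omega
        | neg φ =>
          rw [Formula.encode_neg, at_cons] at hφ
          rw [Formula.encode_neg, List.length_cons] at *
          rw [hφ.1, if_neg one_ne_zero, if_pos rfl, hs _ (by omega) φ hφ.2 (by omega)]
          omega
        | conj φ ψ =>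
          rw [Formula.encode_conj, at_cons, at_append] at hφ
          rw [Formula.encode_conj, List.length_cons, List.length_append] at *
          rw [hφ.1, if_neg two_ne_zero, if_neg (by decide), hs _ (by omega) φ hφ.2.1 (by omega),
            hs _ (by omega) ψ hφ.2.2 (by omega)]
          omega
        | disj φ ψ =>
          rw [Formula.encode_disj, at_cons, at_append] at hφ
          rw [Formula.encode_disj, List.length_cons, List.length_append] at *
          rw [hφ.1, if_neg three_ne_zero, if_neg (by decide), hs _ (by omega) φ hφ.2.1 (by omega),
            hs _ (by omega) ψ hφ.2.2 (by omega)]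
          omega
      · rw [if_neg hpp]
        exact hs p' (by omega) φ hφ hlt
  · rintro τ _ ⟨hb, hs⟩
    rw [Nat.sub_self] at hs
    exact ⟨hb, hs⟩

end EPROL

namespace EPROL

open Stmt

variable {Sg : Signature}

/-! ### Scanning the arguments of an atom -/

/-- The argument `a` is found in `E` at position `r`. -/
def IsArg (E : ℕ → ℕ) (r : ℕ) (a : Arg Sg) : Prop := E r = a.tag ∧ E (r + 1) = a.val

/-- The arguments of a formula from left to right. -/
def Formula.argList : Formula (Atom Sg) → List (Arg Sg)
  | .atom a => List.ofFn a.args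
  | .neg φ => φ.argList
  | .conj φ ψ => φ.argList ++ ψ.argList
  | .disj φ ψ => φ.argList ++ ψ.argList

/-- The list of variables found after an argument of sequent number `i` (the goal if `i = 0`). -/
def addVar (i : ℕ) (V : List ℕ) : Arg Sg → List ℕ
  | .var v => if 0 < i ∧ v ∉ V then V ++ [v] else V
  | .const _ => V

def addVars (i : ℕ) (V : List ℕ) (l : List (Arg Sg)) : List ℕ := l.foldl (addVar i) V

/-- The array `J` gives the number of the variable at position `r`. -/
def ArgScanned (J : ℕ → ℕ) (i : ℕ) (V : List ℕ) (r : ℕ) : Arg Sg → Prop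
  | .var v => if 0 < i then ∃ j, V[j]? = some v ∧ J r = j + 1 else J r = 0
  | .const _ => J r = 0

theorem addVar_var (i : ℕ) (V : List ℕ) (v : ℕ) :
    addVar i V (.var v : Arg Sg) = if 0 < i ∧ v ∉ V then V ++ [v] else V := rfl

theorem prefix_addVar (i : ℕ) (V : List ℕ) (a : Arg Sg) : V <+: addVar i V a := by
  cases a with
  | var v => rw [addVar_var]; split_ifs; exacts [List.prefix_append _ _, List.prefix_rfl]
  | const c => exact List.prefix_rfl

theorem prefix_addVars (i : ℕ) (V : List ℕ) (l : List (Arg Sg)) : V <+: addVars i V l := by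
  induction l generalizing V with
  | nil => exact List.prefix_rfl
  | cons a l ih => exact (prefix_addVar i V a).trans (ih _)

theorem addVars_append (i : ℕ) (V : List ℕ) (l l' : List (Arg Sg)) :
    addVars i V (l ++ l') = addVars i (addVars i V l) l' := List.foldl_append

theorem length_addVar_le (i : ℕ) (V : List ℕ) (a : Arg Sg) :
    (addVar i V a).length ≤ V.length + 1 := by
  cases a with
  | var v => rw [addVar_var]; split_ifs <;> simp
  | const c => simp [addVar]

theorem length_addVars_le (i : ℕ) (V : List ℕ) (l : List (Arg Sg)) :
    (addVars i V l).length ≤ V.length + l.length := by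
  induction l generalizing V with
  | nil => exact le_rfl
  | cons a l ih =>
    have h₁ := ih (addVar i V a)
    have h₂ := length_addVar_le i V a
    simp only [List.length_cons]
    change (addVars i (addVar i V a) l).length ≤ _
    omega

/-- The list of variables grows only at its end, so numbers given to earlier occurrences remain
valid. -/
theorem ArgScanned.mono {J : ℕ → ℕ} {i r : ℕ} {V V' : List ℕ} {a : Arg Sg} (h : V <+: V')
    (ha : ArgScanned J i V r a) : ArgScanned J i V' r a := by
  cases a with
  | const c => exact ha
  | var v =>
    unfold ArgScanned at *
    split_ifs at * with hi
    · obtain ⟨j, hj, hJ⟩ := ha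
      obtain ⟨l, rfl⟩ := h
      refine ⟨j, ?_, hJ⟩
      rw [List.getElem?_append_left (List.getElem?_eq_some_iff.1 hj).1, hj]
    · exact ha

theorem ArgScanned.congr {J J' : ℕ → ℕ} {i r : ℕ} {V : List ℕ} {a : Arg Sg} (h : J' r = J r)
    (ha : ArgScanned J i V r a) : ArgScanned J' i V r a := by
  cases a with
  | const c => exact h.trans ha
  | var v => unfold ArgScanned at *; rwa [h]

theorem ArgScanned.le_length {J : ℕ → ℕ} {i r : ℕ} {V : List ℕ} {a : Arg Sg}
    (ha : ArgScanned J i V r a) : J r ≤ V.length := by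
  cases a with
  | const c => exact (show J r = 0 from ha).trans_le (Nat.zero_le _)
  | var v =>
    unfold ArgScanned at ha
    split_ifs at ha with hi
    · obtain ⟨j, hj, hJ⟩ := ha
      have := (List.getElem?_eq_some_iff.1 hj).1
      omega
    · omega

/-- Positions below `U` of the arguments in the list `l` are recorded in `T`. -/
def Records (U : ℕ) (E : ℕ → ℕ) (l : List (Arg Sg)) (σ : Store) : Prop :=
  σ.var .m = l.length ∧
    ∀ i (h : i < l.length), IsArg E (σ.arr .T i) l[i] ∧ σ.arr .T i + 1 ≤ U

/-- The variables of the present sequent found so far. -/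
def Lists (V : List ℕ) (σ : Store) : Prop :=
  σ.var .nv = V.length ∧ ∀ i (h : i < V.length), σ.arr .VV i = V[i]

variable {W B U : ℕ}

/-- The loop cannot be left early, so the whole list is searched; the default `nv`, the length of
the list, signals failure. -/
theorem searchVar_spec (hU : B + 16 * U + 16 < W) {σ : Store} {V : List ℕ} (hV : Lists V σ)
    (hVU : V.length ≤ U) (hr : σ.var .r + 1 ≤ U) :
    searchVar.Spec W B σ (40 * V.length + 40) fun τ =>
      (τ.var .idx = V.length ∧ σ.arr .E (σ.var .r + 1) ∉ V) ∨
      V[τ.var .idx]? = some (σ.arr .E (σ.var .r + 1)) := by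
  obtain ⟨hn, hV⟩ := hV
  refine Spec.seq (T₁ := 10) (T₂ := 40 * V.length + 20) (P₁ := fun τ => τ.var .idx = V.length)
    (Spec.assign trivial (by simp) (by simp [hn])) (fun τ hf hidx => ?_) (by omega)
  have hn' : τ.var .nv = V.length := (hf.var _ (by decide)).trans hn
  have hr' : τ.var .r = σ.var .r := hf.var _ (by decide)
  have hE' : τ.arr .E = σ.arr .E := hf.arr _ (by decide)
  have hV' : τ.arr .VV = σ.arr .VV := hf.arr _ (by decide)
  refine Spec.loop (T₀ := 30) (fun j υ =>
    (υ.var .idx = V.length ∧ ∀ j' (h : j' < V.length), j' < j → V[j'] ≠ σ.arr .E (σ.var .r + 1)) ∨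
      V[υ.var .idx]? = some (σ.arr .E (σ.var .r + 1))) ?_ ?_ ?_ ?_ ?_
  · omega
  · exact .inl ⟨hidx, fun _ _ h => absurd h (Nat.not_lt_zero _)⟩
  · intro j υ hj hf' hI
    have hr'' : υ.var .r = σ.var .r := (hf'.var _ (by decide)).trans hr'
    have hE'' : υ.arr .E = σ.arr .E := (hf'.arr _ (by decide)).trans hE'
    have hV'' : υ.arr .VV = σ.arr .VV := (hf'.arr _ (by decide)).trans hV'
    rw [hn'] at hj
    simp [Stmt.Spec, wp, Store.set_var, hr'', hE'', hV'', hV j hj]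
    refine ⟨by omega, fun h => .inr ((List.getElem?_eq_getElem hj).trans (congrArg some h)), fun h => ?_⟩
    rcases hI with ⟨hi, hI⟩ | hI
    · refine .inl ⟨hi, fun j' h' hlt => ?_⟩
      rcases Nat.lt_or_eq_of_le hlt with hlt | rfl
      exacts [hI j' h' hlt, h]
    · exact .inr hI
  · rw [hn']; omega
  · intro υ _ hI
    rw [hn'] at hI
    simp only [Store.set_var, reduceCtorEq, if_false]
    refine hI.imp_left fun h => ⟨h.1, fun hmem => ?_⟩
    obtain ⟨j, hj, hj'⟩ := List.getElem_of_mem hmem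
    exact h.2 j hj hj hj'

theorem numberVar_spec (hU : B + 16 * U + 16 < W) {σ : Store} {V : List ℕ} {v i : ℕ}
    (hV : Lists V σ) (hi : 0 < i) (hVU : V.length ≤ U) (hr : σ.var .r + 1 ≤ U) (hU1 : 1 ≤ U)
    (hv : σ.arr .E (σ.var .r + 1) = v) :
    numberVar.Spec W B σ (40 * V.length + 140) fun τ =>
      Lists (addVar i V (.var v : Arg Sg)) τ ∧
      ArgScanned (τ.arr .J) i (addVar i V (.var v : Arg Sg)) (σ.var .r) (.var v : Arg Sg) ∧
      ∀ r, r ≠ σ.var .r → τ.arr .J r = σ.arr .J r := by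
  refine Spec.seq (T₂ := 100) (searchVar_spec hU hV hVU hr) (fun τ hf hidx => ?_) (by omega)
  have hn' : τ.var .nv = V.length := (hf.var _ (by decide)).trans hV.1
  have hr' : τ.var .r = σ.var .r := hf.var _ (by decide)
  have hE' : τ.arr .E = σ.arr .E := hf.arr _ (by decide)
  have hV' : τ.arr .VV = σ.arr .VV := hf.arr _ (by decide)
  have hJ' : τ.arr .J = σ.arr .J := hf.arr _ (by decide)
  rw [hv] at hidx
  have hidx' : τ.var .idx ≤ V.length := by
    rcases hidx with h | h
    · exact h.1.le
    · exact (List.getElem?_eq_some_iff.1 h).1.le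
  by_cases hmem : v ∈ V
  · have hget : V[τ.var .idx]? = some v := by
      rcases hidx with h' | h'
      · exact absurd hmem h'.2
      · exact h'
    have hne : τ.var .idx ≠ V.length := by
      have := (List.getElem?_eq_some_iff.1 hget).1; omega
    rw [addVar_var, if_neg (fun h => h.2 hmem)]
    simp [Stmt.Spec, wp, Store.set_var, Store.put_arr, hr', hV', hJ', hn', Lists,
      ArgScanned, hi, hne]
    refine ⟨by omega, by omega, hV.2, hget, ?_⟩
    intro r hne; rw [Function.update_of_ne hne]
  · have heq : τ.var .idx = V.length := by
      rcases hidx with h' | h'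
      · exact h'.1
      · exact absurd (List.mem_of_getElem? h') hmem
    rw [addVar_var, if_pos ⟨hi, hmem⟩]
    simp [Stmt.Spec, wp, Store.set_var, Store.put_arr, hr', hE', hV', hJ', hn', hv, Lists,
      ArgScanned, hi, heq]
    refine ⟨by omega, by omega, by omega, by omega, ?_, ?_⟩
    · intro j hj
      rw [Function.update_apply]
      split_ifs with hjV
      · subst hjV; simp
      · rw [List.getElem_append_left (by omega), hV.2 j (by omega)]
    · intro r hne; rw [Function.update_of_ne hne]

/-- Every argument enters the list of possible replacements, but only variables of axioms get a
number. For the others nothing is written to `J`, and `hJ` supplies the entry `0`, which means that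
the symbol is left in place. -/
theorem argStep_spec (hU : B + 16 * U + 16 < W) {σ : Store} {V : List ℕ} {l : List (Arg Sg)}
    {a : Arg Sg} {E : ℕ → ℕ} (hE : σ.arr .E = E) (hV : Lists V σ) (hl : Records U E l σ)
    (ha : IsArg E (σ.var .r) a) (hJ : σ.arr .J (σ.var .r) = 0) (hVl : V.length ≤ l.length)
    (hlU : l.length + 1 ≤ U) (hr : σ.var .r + 1 ≤ U) :
    argStep.Spec W B σ (40 * V.length + 200) fun τ =>
      Records U E (l ++ [a]) τ ∧ Lists (addVar (σ.var .i) V a) τ ∧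
      ArgScanned (τ.arr .J) (σ.var .i) (addVar (σ.var .i) V a) (σ.var .r) a ∧
      ∀ r, r ≠ σ.var .r → τ.arr .J r = σ.arr .J r := by
  have hm := hl.1
  refine Spec.seq (T₁ := 20) (T₂ := 40 * V.length + 180) (P₁ := fun τ =>
    τ = σ.put .T (σ.var .m) (σ.var .r)) (Spec.write ?_ ?_ ?_ ?_ rfl) ?_ (by omega)
  · simp
  · simp
  · simp; omega
  · simp
  rintro τ - rfl
  refine Spec.seq (T₁ := 20) (T₂ := 40 * V.length + 160) (P₁ := fun τ =>
    τ = (σ.put .T (σ.var .m) (σ.var .r)).set .m (σ.var .m + 1)) (Spec.assign ?_ ?_ ?_) ?_ (by omega)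
  · simp; omega
  · simp
  · simp
  rintro τ - rfl
  have hl' : ∀ τ : Store, τ.var .m = σ.var .m + 1 →
      τ.arr .T = Function.update (σ.arr .T) (σ.var .m) (σ.var .r) → Records U E (l ++ [a]) τ := by
    intro τ h₁ h₂
    refine ⟨by simp [h₁, hm], fun j hj => ?_⟩
    rw [h₂, Function.update_apply]
    split_ifs with hjm
    · subst hjm; simpa [hm] using ⟨ha, hr⟩
    · have hj' : j < l.length := by simp at hj; omega
      rw [List.getElem_append_left hj']
      exact hl.2 j hj'
  have hl₀ := hl' ((σ.put .T (σ.var .m) (σ.var .r)).set .m (σ.var .m + 1))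
    (by simp) (by simp [Store.put_arr])
  have hV₀ : Lists V ((σ.put .T (σ.var .m) (σ.var .r)).set .m (σ.var .m + 1)) := by
    simpa [Lists, Store.set_var, Store.put_arr] using hV
  refine Spec.ite (T' := 40 * V.length + 150) (by simp; omega) (by simp) ?_ ?_
  · intro hi
    simp [Store.set_var] at hi
    refine Spec.ite (T' := 40 * V.length + 140) (by simp [Store.set_var]; omega)
      (by simp) ?_ ?_
    · intro h0
      simp [Store.set_var, Store.put_arr, hE, ha.1] at h0
      cases a with
      | const c => exact absurd h0 one_ne_zero
      | var v =>
        refine (numberVar_spec (Sg := Sg) hU (v := v) hV₀ hi (by omega) ?_ (by omega) ?_).mono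
          le_rfl ?_
        · simp [Store.set_var]; omega
        · simp [Store.set_var, Store.put_arr, hE]; exact ha.2
        · rintro τ hf ⟨h₁, h₂, h₃⟩
          refine ⟨hl' τ ?_ ?_, h₁, ?_, ?_⟩
          · rw [hf.var _ (by decide)]; simp
          · rw [hf.arr _ (by decide)]; simp [Store.put_arr]
          · simpa [Store.set_var] using h₂
          · simpa [Store.set_var, Store.put_arr] using h₃
    · intro h0
      simp [Store.set_var, Store.put_arr, hE, ha.1] at h0
      cases a with
      | var v => exact absurd rfl h0
      | const c =>
        refine Spec.skip (by omega) ⟨hl₀, hV₀, ?_, ?_⟩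
        · simpa [ArgScanned, Store.put_arr] using hJ
        · simp [Store.put_arr]
  · intro hi
    simp [Store.set_var] at hi
    refine Spec.skip (by omega) ⟨hl₀, ?_, ?_, ?_⟩
    · cases a with
      | var v => simpa [addVar, hi] using hV₀
      | const c => exact hV₀
    · cases a with
      | var v => simpa [ArgScanned, Store.put_arr, hi] using hJ
      | const c => simpa [ArgScanned, Store.put_arr] using hJ
    · simp [Store.put_arr]

-- The hypotheses `hVl` and `hlq` turn the cost of the linear search, which is proportional to the
-- number of variables found so far, into a bound by the position in the input.
set_option maxRecDepth 4000 in
theorem atomStep_spec (hU : B + 16 * U + 16 < W) {σ : Store} {V : List ℕ} {l A : List (Arg Sg)}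
    {E : ℕ → ℕ} {q : ℕ} (hE : σ.arr .E = E) (hq : σ.var .q = q) (hV : Lists V σ)
    (hl : Records U E l σ) (har : E (q + 2) = A.length) (hargs : At E (q + 3) (A.flatMap Arg.encode))
    (hJ : ∀ r, q ≤ r → σ.arr .J r = 0) (hJU : ∀ r, σ.arr .J r ≤ U)
    (hVl : V.length ≤ l.length) (hlq : 2 * l.length ≤ q) (hqU : q + 2 * A.length + 8 ≤ U) :
    atomStep.Spec W B σ (A.length * (20 * (q + 2 * A.length) + 250) + 50) fun τ =>
      τ.var .q = q + 3 + 2 * A.length ∧ Records U E (l ++ A) τ ∧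
      Lists (addVars (σ.var .i) V A) τ ∧
      (∀ j (h : j < A.length), ArgScanned (τ.arr .J) (σ.var .i)
        (addVars (σ.var .i) V A) (q + 3 + 2 * j) A[j]) ∧
      (∀ r, (r < q + 3 ∨ q + 3 + 2 * A.length ≤ r) → τ.arr .J r = σ.arr .J r) ∧
      ∀ r, τ.arr .J r ≤ U := by
  have hargs := hargs.args
  refine Spec.seq (T₁ := 15) (T₂ := A.length * (20 * (q + 2 * A.length) + 250) + 35)
    (P₁ := fun τ => τ = σ.set .ar A.length) (Spec.assign ?_ ?_ ?_) ?_ (by omega)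
  · simp; omega
  · simp
  · simp [hE, hq, har]
  rintro τ - rfl
  refine Spec.seq (T₁ := A.length * (20 * (q + 2 * A.length) + 250) + 15) (T₂ := 20)
    (P₁ := fun τ => τ.var .q = q ∧ τ.var .ar = A.length ∧ Records U E (l ++ A) τ ∧
      Lists (addVars (σ.var .i) V A) τ ∧
      (∀ j (h : j < A.length), ArgScanned (τ.arr .J) (σ.var .i)
        (addVars (σ.var .i) V A) (q + 3 + 2 * j) (A[j])) ∧
      (∀ r, (r < q + 3 ∨ q + 3 + 2 * A.length ≤ r) → τ.arr .J r = σ.arr .J r) ∧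
      ∀ r, τ.arr .J r ≤ U) ?_ ?_ (by omega)
  · refine Spec.loop (T₀ := 20 * (q + 2 * A.length) + 240) (fun b τ =>
      Records U E (l ++ A.take b) τ ∧ Lists (addVars (σ.var .i) V (A.take b)) τ ∧
      (∀ j (h : j < A.length), j < b → ArgScanned (τ.arr .J) (σ.var .i)
        (addVars (σ.var .i) V (A.take b)) (q + 3 + 2 * j) (A[j])) ∧
      (∀ r, (r < q + 3 ∨ q + 3 + 2 * b ≤ r) → τ.arr .J r = σ.arr .J r) ∧
      ∀ r, τ.arr .J r ≤ U) ?_ ?_ ?_ ?_ ?_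
    · simp; omega
    · refine ⟨by simpa [Records, Store.set_var] using hl,
        by simpa [Lists, Store.set_var, addVars] using hV,
        fun _ _ h => absurd h (Nat.not_lt_zero _), fun _ _ => rfl, hJU⟩
    · rintro b τ hb hf ⟨h₁, h₂, h₃, h₄, h₅⟩
      simp at hb
      have hEτ : τ.arr .E = E := (hf.arr _ (by decide)).trans hE
      have hqτ : τ.var .q = q := (hf.var _ (by decide)).trans (by simp [Store.set_var, hq])
      have hiτ : τ.var .i = σ.var .i := (hf.var _ (by decide)).trans (by simp [Store.set_var])
      refine Spec.seq (T₁ := 20) (T₂ := 20 * (q + 2 * A.length) + 220) (P₁ := fun υ =>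
        υ = (τ.set .a b).set .r (q + 3 + 2 * b)) (Spec.assign ?_ ?_ ?_) ?_ (by omega)
      · simp [Store.set_var, hqτ]; omega
      · simp
      · simp [Store.set_var, hqτ]
      rintro υ - rfl
      have htake : A.take (b + 1) = A.take b ++ [A[b]] := by simp
      have hlV := length_addVars_le (σ.var .i) V (A.take b)
      have hlt : (A.take b).length = b := by rw [List.length_take]; omega
      refine (argStep_spec hU (a := A[b]) (E := E) (V := addVars (σ.var .i) V (A.take b))
        (l := l ++ A.take b) ?_ ?_ ?_ ?_ ?_ ?_ ?_ ?_).mono ?_ ?_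
      · simpa using hEτ
      · simpa [Lists, Store.set_var] using h₂
      · simpa [Records, Store.set_var] using h₁
      · have := hargs b hb
        simpa [IsArg, Store.set_var] using this
      · simp [h₄ (q + 3 + 2 * b) (.inr le_rfl), hJ (q + 3 + 2 * b) (by omega)]
      · rw [List.length_append, hlt]; omega
      · rw [List.length_append, hlt]; omega
      · simp; omega
      · omega
      · rintro υ hf' ⟨g₁, g₂, g₃, g₄⟩
        simp only [Store.set_var, reduceCtorEq, if_false, if_true, hiτ] at g₂ g₃ g₄
        simp only [Store.set_arr] at g₄
        have e : addVars (σ.var .i) V (A.take (b + 1)) =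
            addVar (σ.var .i) (addVars (σ.var .i) V (A.take b)) A[b] := by
          rw [htake, addVars_append]; rfl
        refine ⟨by rw [htake, ← List.append_assoc]; exact g₁, by rw [e]; exact g₂, ?_, ?_, ?_⟩
        · intro j hj hjb
          rw [e]
          rcases Nat.lt_succ_iff_lt_or_eq.1 hjb with hjb | rfl
          · exact ((h₃ j hj hjb).mono (prefix_addVar _ _ _)).congr (g₄ _ (by omega))
          · exact g₃
        · intro r hr
          rw [g₄ r (by omega), h₄ r (by omega)]
        · intro r
          by_cases hr : r = q + 3 + 2 * b
          · subst hr
            have := g₃.le_length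
            have := length_addVar_le (σ.var .i) (addVars (σ.var .i) V (A.take b)) A[b]
            omega
          · rw [g₄ r hr]; exact h₅ r
    · simp
      have : A.length * (20 * (q + 2 * A.length) + 240 + 3) ≤
        A.length * (20 * (q + 2 * A.length) + 250) := Nat.mul_le_mul_left _ (by omega)
      omega
    · intro τ hf h
      rw [Store.set_var_self, List.take_length] at h
      obtain ⟨h₁, h₂, h₃, h₄, h₅⟩ := h
      rw [Store.set_var_self]
      refine ⟨?_, ?_, ?_, ?_, ?_, ?_, h₅⟩
      · simp [Store.set_var]; rw [hf.var _ (by decide)]; simp [Store.set_var, hq]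
      · simp [Store.set_var]; rw [hf.var _ (by decide)]; simp
      · simpa [Records, Store.set_var] using h₁
      · simpa [Lists, Store.set_var] using h₂
      · intro j hj; exact h₃ j hj hj
      · exact h₄
  · rintro τ hf ⟨h₀, h₀', h₁, h₂, h₃, h₄, h₅⟩
    refine Spec.assign ?_ ?_ ⟨?_, ?_, ?_, ?_, ?_, h₅⟩
    · simp [h₀, h₀']; omega
    · simp
    · simp [h₀, h₀']
    · simpa [Records, Store.set_var] using h₁
    · simpa [Lists, Store.set_var] using h₂
    · exact h₃
    · exact h₄

end EPROL

namespace EPROL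

open Stmt

variable {Sg : Signature}

/-! ### Scanning formulas and sequents -/

/-- The formula `φ` at position `p` has been scanned. -/
def Scanned (KD J : ℕ → ℕ) (i : ℕ) (V : List ℕ) : ℕ → Formula (Atom Sg) → Prop
  | p, .atom a => KD p = 1 ∧ (∀ r, p < r → r < p + (3 + 2 * Sg.arity a.pred) → KD r = 0) ∧
      J (p + 1) = 0 ∧ J (p + 2) = 0 ∧ ∀ j : Fin (Sg.arity a.pred), ArgScanned J i V (p + 3 + 2 * j) (a.args j)
  | p, .neg φ => KD p = 2 ∧ Scanned KD J i V (p + 1) φ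
  | p, .conj φ ψ => KD p = 3 ∧ Scanned KD J i V (p + 1) φ ∧
      Scanned KD J i V (p + 1 + φ.encode.length) ψ
  | p, .disj φ ψ => KD p = 4 ∧ Scanned KD J i V (p + 1) φ ∧
      Scanned KD J i V (p + 1 + φ.encode.length) ψ

theorem Scanned.mono {KD J : ℕ → ℕ} {i : ℕ} {V V' : List ℕ} (h : V <+: V')
    {φ : Formula (Atom Sg)} {p : ℕ} (hφ : Scanned KD J i V p φ) : Scanned KD J i V' p φ := by
  induction φ generalizing p with
  | atom a => exact ⟨hφ.1, hφ.2.1, hφ.2.2.1, hφ.2.2.2.1, fun j => (hφ.2.2.2.2 j).mono h⟩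
  | neg φ ih => exact ⟨hφ.1, ih hφ.2⟩
  | conj φ ψ ih₁ ih₂ => exact ⟨hφ.1, ih₁ hφ.2.1, ih₂ hφ.2.2⟩
  | disj φ ψ ih₁ ih₂ => exact ⟨hφ.1, ih₁ hφ.2.1, ih₂ hφ.2.2⟩

theorem Formula.length_encode_pos (φ : Formula (Atom Sg)) : 0 < φ.encode.length := by
  cases φ <;> simp [Formula.encode]

theorem Scanned.congr {KD J KD' J' : ℕ → ℕ} {i : ℕ} {V : List ℕ} {φ : Formula (Atom Sg)} {p : ℕ}
    (hK : ∀ r, p ≤ r → r < p + φ.encode.length → KD' r = KD r)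
    (hJ : ∀ r, p ≤ r → r < p + φ.encode.length → J' r = J r)
    (hφ : Scanned KD J i V p φ) : Scanned KD' J' i V p φ := by
  induction φ generalizing p with
  | atom a =>
    rw [Formula.length_encode_atom] at hK hJ
    refine ⟨(hK _ le_rfl (by omega)).trans hφ.1, fun r h₁ h₂ => ?_, ?_, ?_, fun j => ?_⟩
    · rw [hK r h₁.le h₂]; exact hφ.2.1 r h₁ h₂
    · rw [hJ _ (by omega) (by omega)]; exact hφ.2.2.1
    · rw [hJ _ (by omega) (by omega)]; exact hφ.2.2.2.1
    · exact (hφ.2.2.2.2 j).congr (hJ _ (by omega) (by omega))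
  | neg φ ih =>
    rw [Formula.encode_neg, List.length_cons] at hK hJ
    refine ⟨(hK _ le_rfl (by omega)).trans hφ.1, ih ?_ ?_ hφ.2⟩
    · intro r h₁ h₂; exact hK r (by omega) (by omega)
    · intro r h₁ h₂; exact hJ r (by omega) (by omega)
  | conj φ ψ ih₁ ih₂ =>
    rw [Formula.encode_conj, List.length_cons, List.length_append] at hK hJ
    refine ⟨(hK _ le_rfl (by omega)).trans hφ.1, ih₁ ?_ ?_ hφ.2.1, ih₂ ?_ ?_ hφ.2.2⟩
    · intro r h₁ h₂; exact hK r (by omega) (by omega)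
    · intro r h₁ h₂; exact hJ r (by omega) (by omega)
    · intro r h₁ h₂; exact hK r (by omega) (by omega)
    · intro r h₁ h₂; exact hJ r (by omega) (by omega)
  | disj φ ψ ih₁ ih₂ =>
    rw [Formula.encode_disj, List.length_cons, List.length_append] at hK hJ
    refine ⟨(hK _ le_rfl (by omega)).trans hφ.1, ih₁ ?_ ?_ hφ.2.1, ih₂ ?_ ?_ hφ.2.2⟩
    · intro r h₁ h₂; exact hK r (by omega) (by omega)
    · intro r h₁ h₂; exact hJ r (by omega) (by omega)
    · intro r h₁ h₂; exact hK r (by omega) (by omega)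
    · intro r h₁ h₂; exact hJ r (by omega) (by omega)

/-- Every marked position in a scanned formula is the position of a scanned formula. -/
theorem Scanned.exists_of_marked {E KD J : ℕ → ℕ} {i : ℕ} {V : List ℕ} {φ : Formula (Atom Sg)}
    {p r : ℕ} (hφ : Scanned KD J i V p φ) (hE : At E p φ.encode) (h₁ : p ≤ r)
    (h₂ : r < p + φ.encode.length) (hr : KD r ≠ 0) :
    ∃ ψ : Formula (Atom Sg), At E r ψ.encode ∧ r + ψ.encode.length ≤ p + φ.encode.length ∧
      Scanned KD J i V r ψ := by
  induction φ generalizing p with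
  | atom a =>
    rcases h₁.eq_or_lt with rfl | h₁
    · exact ⟨_, hE, le_rfl, hφ⟩
    rw [Formula.length_encode_atom] at h₂
    exact absurd (hφ.2.1 r h₁ h₂) hr
  | neg φ ih =>
    rcases h₁.eq_or_lt with rfl | h₁
    · exact ⟨_, hE, le_rfl, hφ⟩
    rw [Formula.encode_neg, List.length_cons] at *
    rw [at_cons] at hE
    obtain ⟨χ, h₁, h₂, h₃⟩ := ih hφ.2 hE.2 h₁ (by omega)
    exact ⟨χ, h₁, by omega, h₃⟩
  | conj φ ψ ih₁ ih₂ =>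
    rcases h₁.eq_or_lt with rfl | h₁
    · exact ⟨_, hE, le_rfl, hφ⟩
    rw [Formula.encode_conj, List.length_cons, List.length_append] at *
    rw [at_cons, at_append] at hE
    rcases lt_or_ge r (p + 1 + φ.encode.length) with h | h
    · obtain ⟨χ, h₁, h₂, h₃⟩ := ih₁ hφ.2.1 hE.2.1 h₁ h
      exact ⟨χ, h₁, by omega, h₃⟩
    · obtain ⟨χ, h₁, h₂, h₃⟩ := ih₂ hφ.2.2 hE.2.2 h (by omega)
      exact ⟨χ, h₁, by omega, h₃⟩
  | disj φ ψ ih₁ ih₂ =>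
    rcases h₁.eq_or_lt with rfl | h₁
    · exact ⟨_, hE, le_rfl, hφ⟩
    rw [Formula.encode_disj, List.length_cons, List.length_append] at *
    rw [at_cons, at_append] at hE
    rcases lt_or_ge r (p + 1 + φ.encode.length) with h | h
    · obtain ⟨χ, h₁, h₂, h₃⟩ := ih₁ hφ.2.1 hE.2.1 h₁ h
      exact ⟨χ, h₁, by omega, h₃⟩
    · obtain ⟨χ, h₁, h₂, h₃⟩ := ih₂ hφ.2.2 hE.2.2 h (by omega)
      exact ⟨χ, h₁, by omega, h₃⟩

/-- The formulas in the list found at position `p` have been scanned. -/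
def ScannedList (KD J : ℕ → ℕ) (i : ℕ) (V : List ℕ) : ℕ → List (Formula (Atom Sg)) → Prop
  | _, [] => True
  | p, φ :: Φ => Scanned KD J i V p φ ∧ ScannedList KD J i V (p + φ.encode.length) Φ

variable {W B U : ℕ}

/-- The code `l` starts at position `q`, which has been reached with the argument list `A` and the
variable list `V`. -/
structure ScanState (U : ℕ) (E : ℕ → ℕ) (q i : ℕ) (V : List ℕ) (A : List (Arg Sg)) (σ : Store) : Prop where
  arr : σ.arr .E = E
  pos : σ.var .q = q
  num : σ.var .i = i
  lists : Lists V σ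
  records : Records U E A σ
  bounded : ∀ r, σ.arr .J r ≤ U
  unmarked : ∀ r, q ≤ r → σ.arr .J r = 0 ∧ σ.arr .KD r = 0
  length_le : V.length ≤ A.length
  length_le' : 2 * A.length ≤ q

theorem ScanState.set {E : ℕ → ℕ} {q i : ℕ} {V : List ℕ} {A : List (Arg Sg)} {σ : Store}
    (h : ScanState U E q i V A σ) {x : Var} (hq : x ≠ .q) (hi : x ≠ .i) (hn : x ≠ .nv) (hm : x ≠ .m)
    (n : ℕ) : ScanState U E q i V A (σ.set x n) := by
  obtain ⟨h₁, h₂, h₃, h₄, h₅, hJU, h₆, h₇, h₈⟩ := h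
  refine ⟨h₁, ?_, ?_, ⟨?_, h₄.2⟩, ⟨?_, h₅.2⟩, hJU, h₆, h₇, h₈⟩
  · rw [Store.set_var, if_neg hq.symm, h₂]
  · rw [Store.set_var, if_neg hi.symm, h₃]
  · rw [Store.set_var, if_neg hn.symm, h₄.1]
  · rw [Store.set_var, if_neg hm.symm, h₅.1]

/-- The step over a connective. -/
theorem formBody_connective (hU : B + 16 * U + 16 < W) {σ : Store} {V : List ℕ}
    {A : List (Arg Sg)} {E : ℕ → ℕ} {q i : ℕ} (h : ScanState U E q i V A σ) (he : q < σ.var .e)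
    (heU : σ.var .e + 8 ≤ U) (h0 : 0 < E q) (h4 : E q < 4) :
    formBody.Spec W B σ 100 fun τ => ScanState U E (q + 1) i V A τ ∧
      τ.arr .KD = Function.update (σ.arr .KD) q (E q + 1) ∧ τ.arr .J = σ.arr .J := by
  simp [formBody, Stmt.Spec, wp, Store.put_arr, h.pos, h.arr, h0.ne']
  refine ⟨fun _ => ⟨by omega, by omega, by omega, ⟨by omega, by omega⟩, ?_⟩, fun h => by omega⟩
  obtain ⟨h₁, h₂, h₃, h₄, h₅, hJU, h₆, h₇, h₈⟩ := h
  refine ⟨by simpa [Store.put_arr] using h₁, by simp, by simpa [Store.set_var] using h₃,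
    by simpa [Lists, Store.set_var, Store.put_arr] using h₄,
    by simpa [Records, Store.set_var, Store.put_arr] using h₅, by simpa [Store.put_arr] using hJU,
    ?_, h₇, by omega⟩
  intro r hr
  simp [Store.put_arr, h₆ r (by omega), show r ≠ q by omega]

set_option maxRecDepth 4000 in
/-- The step over an atom. -/
theorem formBody_atom (hU : B + 16 * U + 16 < W) {σ : Store} {V : List ℕ}
    {A : List (Arg Sg)} {E : ℕ → ℕ} {q i : ℕ} (h : ScanState U E q i V A σ) {a : Atom Sg}
    (ha : At E q (Formula.atom a).encode) (he : q + (3 + 2 * Sg.arity a.pred) ≤ σ.var .e)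
    (heU : σ.var .e + 8 ≤ U) :
    formBody.Spec W B σ (Sg.arity a.pred * (20 * σ.var .e + 250) + 100) fun τ =>
      ScanState U E (q + (3 + 2 * Sg.arity a.pred)) i (addVars i V (List.ofFn a.args))
        (A ++ List.ofFn a.args) τ ∧
      τ.arr .KD = Function.update (σ.arr .KD) q 1 ∧
      (∀ j : Fin (Sg.arity a.pred), ArgScanned (τ.arr .J) i (addVars i V (List.ofFn a.args)) (q + 3 + 2 * j) (a.args j)) ∧
      ∀ r, (r < q + 3 ∨ q + (3 + 2 * Sg.arity a.pred) ≤ r) → τ.arr .J r = σ.arr .J r := by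
  rw [Formula.encode_atom, at_cons, at_cons, at_cons] at ha
  obtain ⟨ha₀, -, har, hargs⟩ := ha
  have hlen : (List.ofFn a.args).length = Sg.arity a.pred := List.length_ofFn
  have hq := h.pos
  have hE := h.arr
  refine Spec.ite (T' := Sg.arity a.pred * (20 * σ.var .e + 250) + 90) (by simp) (by simp) ?_ ?_
  swap
  · intro hc; simp [hq] at hc; omega
  intro _
  refine Spec.seq (T₁ := 20) (T₂ := Sg.arity a.pred * (20 * σ.var .e + 250) + 70)
    (P₁ := fun τ => τ = σ.put .KD q 1) (Spec.write ?_ ?_ ?_ ?_ ?_) ?_ (by omega)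
  · simp
  · simp [hq, hE, ha₀]; omega
  · simp [hq]; omega
  · simp
  · simp [hq, hE, ha₀]
  rintro τ - rfl
  obtain ⟨h₁, h₂, h₃, h₄, h₅, hJU, h₆, h₇, h₈⟩ := h
  refine Spec.ite (T' := Sg.arity a.pred * (20 * σ.var .e + 250) + 50) ?_ (by simp) ?_ ?_
  · simp [hq]; omega
  swap
  · intro hc; simp [hq, hE, ha₀, Store.put_arr] at hc
  intro _
  have hmul : Sg.arity a.pred * (20 * (q + 2 * Sg.arity a.pred) + 250) ≤
    Sg.arity a.pred * (20 * σ.var .e + 250) := Nat.mul_le_mul_left _ (by omega)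
  refine (atomStep_spec hU (σ := σ.put .KD q 1) (V := V) (l := A) (A := List.ofFn a.args)
    (E := E) (q := q) ?_ hq ?_ ?_ ?_ hargs ?_ ?_ h₇ h₈ ?_).mono ?_ ?_
  · simpa [Store.put_arr] using h₁
  · simpa [Lists, Store.put_arr] using h₄
  · simpa [Records, Store.put_arr] using h₅
  · rw [hlen]; exact har
  · intro r hr; simpa [Store.put_arr] using (h₆ r hr).1
  · simpa [Store.put_arr] using hJU
  · rw [hlen]; omega
  · rw [hlen]; omega
  · rintro τ hf ⟨g₁, g₂, g₃, g₄, g₅, g₆⟩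
    rw [hlen] at g₁ g₅
    have hi : τ.var .i = i := (hf.var _ (by decide)).trans h₃
    have hK : τ.arr .KD = Function.update (σ.arr .KD) q 1 :=
      (hf.arr _ (by decide)).trans (by simp [Store.put_arr])
    simp only [Store.put_var, h₃] at g₃ g₄
    have hle := length_addVars_le i V (List.ofFn a.args)
    rw [hlen] at hle
    refine ⟨⟨?_, by omega, hi, g₃, g₂, g₆, ?_, ?_, ?_⟩, hK, ?_, ?_⟩
    · rw [hf.arr _ (by decide)]; simpa [Store.put_arr] using h₁
    · intro r hr
      rw [g₅ r (by omega), hK, Function.update_of_ne (by omega)]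
      simpa [Store.put_arr] using h₆ r (by omega)
    · rw [List.length_append, hlen]; omega
    · rw [List.length_append, hlen]; omega
    · intro j
      have := g₄ j (by rw [hlen]; exact j.2)
      simpa using this
    · intro r hr
      rw [g₅ r (by omega)]; simp [Store.put_arr]

theorem Stmt.Rounds.mono {x : Var} {c : Stmt} {n i : ℕ} {σ : Store} {T : ℕ} {P P' : Store → Prop}
    (h : Rounds W B x c n i σ T P) (hP : ∀ τ, P τ → P' τ) : Rounds W B x c n i σ T P' :=
  wpIter_wp_mono (fun _ _ h => ⟨h.1, hP _ h.2⟩) h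

set_option maxRecDepth 4000 in
/-- The rounds of the loop in `scanPart`. -/
theorem formBody_rounds (hU : B + 16 * U + 16 < W) {E : ℕ → ℕ} {i e n b q : ℕ} {σ : Store}
    {V : List ℕ} {A : List (Arg Sg)} {Φ : List (Formula (Atom Sg))} (h : ScanState U E q i V A σ)
    (he : σ.var .e = e) (heq : q + (Φ.flatMap Formula.encode).length = e) (heU : e + 8 ≤ U)
    (hΦ : At E q (Φ.flatMap Formula.encode)) (hn : (Φ.flatMap Formula.encode).length ≤ n) :
    Rounds W B .f formBody n b σ
      (n * 200 + (Φ.flatMap Formula.argList).length * (20 * e + 250)) fun τ =>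
      ScanState U E e i (addVars i V (Φ.flatMap Formula.argList)) (A ++ Φ.flatMap Formula.argList) τ ∧
      ScannedList (τ.arr .KD) (τ.arr .J) i (addVars i V (Φ.flatMap Formula.argList)) q Φ ∧
      ∀ r < q, τ.arr .KD r = σ.arr .KD r ∧ τ.arr .J r = σ.arr .J r := by
  induction n generalizing b q σ V A Φ with
  | zero =>
    cases Φ with
    | nil =>
      obtain rfl : q = e := by simpa using heq
      exact Rounds.zero ⟨by simpa [addVars] using h, trivial, fun _ _ => ⟨rfl, rfl⟩⟩
    | cons φ Φ =>
      have := φ.length_encode_pos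
      rw [List.flatMap_cons, List.length_append] at hn
      omega
  | succ n ih =>
    have hset := h.set (x := .f) (by decide) (by decide) (by decide) (by decide) b
    have heset : (σ.set .f b).var .e = e := by simpa [Store.set_var] using he
    -- Prefix notation needs no stack: what remains to be read is a list of formulas, and reading a
    -- connective replaces the first of them by its immediate subformulas `Ψ`. The last hypothesis
    -- puts the formula together again. This covers all three connectives.
    have step : ∀ (φ : Formula (Atom Sg)) (Ψ Φ' : List (Formula (Atom Sg))), Φ = φ :: Φ' →
        E q ≠ 0 → E q < 4 → φ.encode = E q :: Ψ.flatMap Formula.encode →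
        φ.argList = Ψ.flatMap Formula.argList →
        (∀ KD J V, KD q = E q + 1 → ScannedList KD J i V (q + 1) (Ψ ++ Φ') →
          ScannedList KD J i V q (φ :: Φ')) →
        Rounds W B .f formBody (n + 1) b σ
          ((n + 1) * 200 + (Φ.flatMap Formula.argList).length * (20 * e + 250)) fun τ =>
          ScanState U E e i (addVars i V (Φ.flatMap Formula.argList))
            (A ++ Φ.flatMap Formula.argList) τ ∧
          ScannedList (τ.arr .KD) (τ.arr .J) i (addVars i V (Φ.flatMap Formula.argList)) q Φ ∧
          ∀ r < q, τ.arr .KD r = σ.arr .KD r ∧ τ.arr .J r = σ.arr .J r := by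
      rintro φ Ψ Φ' rfl h0 h4 hφ hargs hsc
      have hfl : (φ :: Φ').flatMap Formula.encode = E q :: (Ψ ++ Φ').flatMap Formula.encode := by
        rw [List.flatMap_cons, hφ, List.cons_append, List.flatMap_append]
      have hfa : (φ :: Φ').flatMap Formula.argList = (Ψ ++ Φ').flatMap Formula.argList := by
        rw [List.flatMap_cons, hargs, List.flatMap_append]
      rw [hfl] at heq hΦ hn
      rw [List.length_cons] at heq hn
      rw [hfa]
      refine Rounds.succ (formBody_connective hU hset (by omega) (by omega) (by omega) h4)
        (T₂ := n * 200 + ((Ψ ++ Φ').flatMap Formula.argList).length * (20 * e + 250)) ?_ (by omega)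
      rintro τ hf ⟨g₁, g₂, g₃⟩
      refine (ih (b := b + 1) g₁ ((hf.var _ (by decide)).trans heset) (by omega)
        (at_cons.1 hΦ).2 (by omega)).mono fun υ ⟨k₁, k₂, k₃⟩ => ⟨k₁, hsc _ _ _ ?_ k₂, ?_⟩
      · rw [(k₃ q (by omega)).1, g₂, Function.update_self]
      · intro r hr
        rw [(k₃ r (by omega)).1, (k₃ r (by omega)).2, g₂, g₃, Function.update_of_ne (by omega)]
        exact ⟨rfl, rfl⟩
    cases Φ with
    | nil =>
      obtain rfl : q = e := by simpa using heq
      -- Everything has been read, and the remaining rounds are idle.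
      refine Rounds.succ (T₁ := 50) (T₂ := n * 200)
        (P₁ := fun τ => τ = σ.set .f b) ?_ ?_ (by omega)
      · refine Spec.ite (T' := 20) (by simp) (by simp) (fun hc => ?_) fun _ => Spec.skip (by omega) rfl
        have := hset.pos
        simp [heset, this] at hc
      · rintro τ - rfl
        simpa using ih (b := b + 1) hset heset heq hΦ (by simp)
    | cons φ Φ =>
      cases φ with
      | atom a =>
        rw [List.flatMap_cons] at heq hΦ hn
        rw [List.length_append] at heq hn
        obtain ⟨hat, hΦ⟩ := at_append.1 hΦ
        rw [Formula.length_encode_atom] at heq hn hΦ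
        have hlen : (Formula.atom a).argList.length = Sg.arity a.pred := List.length_ofFn
        rw [List.flatMap_cons, List.length_append, hlen, Nat.add_mul (Sg.arity a.pred), addVars_append,
          ← List.append_assoc]
        refine Rounds.succ (formBody_atom hU hset hat (by omega) (by omega))
          (T₂ := n * 200 + (Φ.flatMap Formula.argList).length * (20 * e + 250)) ?_
          (by rw [heset]; omega)
        rintro τ hf ⟨g₁, g₂, g₃, g₄⟩
        refine (ih (b := b + 1) g₁ ((hf.var _ (by decide)).trans heset) (by omega)
          hΦ (by omega)).mono fun υ ⟨k₁, k₂, k₃⟩ => ⟨k₁, ⟨⟨?_, ?_, ?_, ?_, fun j => ?_⟩, ?_⟩, ?_⟩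
        · rw [(k₃ q (by omega)).1, g₂, Function.update_self]
        · intro r h₁ h₂
          rw [(k₃ r (by omega)).1, g₂, Function.update_of_ne (by omega)]
          exact (h.unmarked r (by omega)).2
        · rw [(k₃ _ (by omega)).2, g₄ _ (by omega)]
          exact (h.unmarked _ (by omega)).1
        · rw [(k₃ _ (by omega)).2, g₄ _ (by omega)]
          exact (h.unmarked _ (by omega)).1
        · exact ((g₃ j).mono (prefix_addVars _ _ _)).congr (k₃ _ (by omega)).2
        · rw [Formula.length_encode_atom]; exact k₂
        · intro r hr
          rw [(k₃ r (by omega)).1, (k₃ r (by omega)).2, g₂, g₄ r (by omega),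
            Function.update_of_ne (by omega)]
          exact ⟨rfl, rfl⟩
      | neg φ =>
        have h1 : E q = 1 := (at_cons.1 hΦ).1
        refine step _ [φ] Φ rfl (by omega) (by omega) ?_ ?_ ?_
        · simp [h1, Formula.encode_neg]
        · simp [Formula.argList]
        · rintro KD J V hK ⟨h₁, h₂⟩
          refine ⟨⟨by rw [hK, h1], h₁⟩, ?_⟩
          rwa [Formula.encode_neg, List.length_cons, Nat.add_comm φ.encode.length, ← Nat.add_assoc]
      | conj φ ψ =>
        have h1 : E q = 2 := (at_cons.1 hΦ).1
        refine step _ [φ, ψ] Φ rfl (by omega) (by omega) ?_ ?_ ?_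
        · simp [h1, Formula.encode_conj]
        · simp [Formula.argList]
        · rintro KD J V hK ⟨h₁, h₂, h₃⟩
          refine ⟨⟨by rw [hK, h1], h₁, h₂⟩, ?_⟩
          rw [Formula.encode_conj, List.length_cons, List.length_append]
          rwa [show q + (φ.encode.length + ψ.encode.length + 1) =
            q + 1 + φ.encode.length + ψ.encode.length by omega]
      | disj φ ψ =>
        have h1 : E q = 3 := (at_cons.1 hΦ).1
        refine step _ [φ, ψ] Φ rfl (by omega) (by omega) ?_ ?_ ?_
        · simp [h1, Formula.encode_disj]
        · simp [Formula.argList]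
        · rintro KD J V hK ⟨h₁, h₂, h₃⟩
          refine ⟨⟨by rw [hK, h1], h₁, h₂⟩, ?_⟩
          rw [Formula.encode_disj, List.length_cons, List.length_append]
          rwa [show q + (φ.encode.length + ψ.encode.length + 1) =
            q + 1 + φ.encode.length + ψ.encode.length by omega]

end EPROL

set_option maxRecDepth 4000

/-! ### Scanning one part of a sequent, and the origin of all marks. -/

namespace EPROL

open Stmt

variable {Sg : Signature}

def Annotated.formula {α : Type} : Annotated α → Formula α
  | .L φ => φ
  | .R φ => φ

/-- `1` on the left and `2` on the right. -/
def Annotated.side {α : Type} : Annotated α → ℕ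
  | .L _ => 1
  | .R _ => 2

theorem Annotated.encode_eq (a : Annotated (Atom Sg)) : a.encode = a.side :: a.formula.encode := by
  cases a <;> rfl

def optArgs : Option (Annotated (Atom Sg)) → List (Arg Sg)
  | none => []
  | some a => a.formula.argList

/-- The arguments in a sequent from left to right. -/
def Sequent.argList (S : Sequent (Atom Sg)) : List (Arg Sg) := optArgs S.fst ++ optArgs S.snd

/-- The part `Γ` of a sequent has been scanned, and its code is `n`. -/
def PartScanned (E KD J : ℕ → ℕ) (hi i : ℕ) (V : List ℕ) (n : ℕ) :
    Option (Annotated (Atom Sg)) → Prop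
  | none => n = 0
  | some a => ∃ p, n = 2 * p + a.side ∧ At E p a.formula.encode ∧
      p + a.formula.encode.length ≤ hi ∧ Scanned KD J i V p a.formula

theorem PartScanned.mono {E KD J : ℕ → ℕ} {hi i n : ℕ} {V V' : List ℕ} (hV : V <+: V')
    {Γ : Option (Annotated (Atom Sg))} (h : PartScanned E KD J hi i V n Γ) :
    PartScanned E KD J hi i V' n Γ := by
  cases Γ with
  | none => exact h
  | some a =>
    obtain ⟨p, h₁, h₂, h₃, h₄⟩ := h
    exact ⟨p, h₁, h₂, h₃, h₄.mono hV⟩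

theorem PartScanned.congr {E KD J KD' J' : ℕ → ℕ} {hi hi' i n : ℕ} {V : List ℕ}
    {Γ : Option (Annotated (Atom Sg))} (h : PartScanned E KD J hi i V n Γ)
    (hh : ∀ r < hi, KD' r = KD r ∧ J' r = J r) (hle : hi ≤ hi') :
    PartScanned E KD' J' hi' i V n Γ := by
  cases Γ with
  | none => exact h
  | some a =>
    obtain ⟨p, h₁, h₂, h₃, h₄⟩ := h
    exact ⟨p, h₁, h₂, by omega, h₄.congr (fun r _ hr => (hh r (by omega)).1)
      (fun r _ hr => (hh r (by omega)).2)⟩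

/-- Every mark before position `hi` belongs to a scanned formula. -/
def Marks (Sg : Signature) (E KD J : ℕ → ℕ) (hi d : ℕ) : Prop :=
  ∀ r < hi, KD r ≠ 0 → ∃ (i : ℕ) (V : List ℕ) (ψ : Formula (Atom Sg)), V.length ≤ d ∧
    At E r ψ.encode ∧ r + ψ.encode.length ≤ hi ∧ Scanned KD J i V r ψ

theorem Marks.mono {E KD J : ℕ → ℕ} {hi d d' : ℕ} (h : Marks Sg E KD J hi d) (hd : d ≤ d') :
    Marks Sg E KD J hi d' := fun r hr hK => by
  obtain ⟨i, V, ψ, h₁, h₂⟩ := h r hr hK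
  exact ⟨i, V, ψ, h₁.trans hd, h₂⟩

theorem Marks.extend {E KD J KD' J' : ℕ → ℕ} {hi hi' d : ℕ} (h : Marks Sg E KD J hi d)
    (hh : ∀ r < hi, KD' r = KD r ∧ J' r = J r) (hle : hi ≤ hi')
    (hm : ∀ r, hi ≤ r → r < hi' → KD' r ≠ 0 → ∃ (i : ℕ) (V : List ℕ) (ψ : Formula (Atom Sg)),
      V.length ≤ d ∧ At E r ψ.encode ∧ r + ψ.encode.length ≤ hi' ∧ Scanned KD' J' i V r ψ) :
    Marks Sg E KD' J' hi' d := by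
  intro r hr hK
  by_cases hr' : hi ≤ r
  · exact hm r hr' hr hK
  · rw [(hh r (by omega)).1] at hK
    obtain ⟨i, V, ψ, h₁, h₂, h₃, h₄⟩ := h r (by omega) hK
    exact ⟨i, V, ψ, h₁, h₂, by omega, h₄.congr (fun r _ hr => (hh r (by omega)).1)
      (fun r _ hr => (hh r (by omega)).2)⟩

variable {W B U : ℕ}

theorem Formula.length_argList_le (φ : Formula (Atom Sg)) :
    2 * φ.argList.length ≤ φ.encode.length := by
  induction φ with
  | atom a => rw [Formula.length_encode_atom, Formula.argList, List.length_ofFn]; omega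
  | neg φ ih => rw [Formula.encode_neg, List.length_cons, Formula.argList]; omega
  | conj φ ψ ih₁ ih₂ =>
    rw [Formula.encode_conj, List.length_cons, Formula.argList, List.length_append,
      List.length_append]
    omega
  | disj φ ψ ih₁ ih₂ =>
    rw [Formula.encode_disj, List.length_cons, Formula.argList, List.length_append,
      List.length_append]
    omega

/-- The bound is quadratic because a part has at most `len` arguments and each costs a search
through the variables found so far. -/
theorem scanPart_spec (hU : B + 16 * U + 16 < W) {σ : Store} {E : ℕ → ℕ} {q i len d : ℕ}
    {V : List ℕ} {A : List (Arg Sg)} {Γ : Option (Annotated (Atom Sg))}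
    (h : ScanState U E q i V A σ) (hlen : σ.var .len = len)
    (hends : StopsFrom Sg E (σ.arr .END) len 0) (hΓ : At E q (optEncode Γ))
    (hle : q + (optEncode Γ).length ≤ len) (hlU : 3 * len + 8 ≤ U)
    (hm : Marks Sg E (σ.arr .KD) (σ.arr .J) q d) (hd : (addVars i V (optArgs Γ)).length ≤ d) :
    scanPart.Spec W B σ (20 * (len * len) + 600 * len + 200) fun τ =>
      ScanState U E (q + (optEncode Γ).length) i (addVars i V (optArgs Γ)) (A ++ optArgs Γ) τ ∧
      PartScanned E (τ.arr .KD) (τ.arr .J) (q + (optEncode Γ).length) i (addVars i V (optArgs Γ))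
        (τ.var .it) Γ ∧
      (∀ r < q, τ.arr .KD r = σ.arr .KD r ∧ τ.arr .J r = σ.arr .J r) ∧
      Marks Sg E (τ.arr .KD) (τ.arr .J) (q + (optEncode Γ).length) d := by
  have hstep : ∀ t, ScanState U E (q + 1) i V A ((σ.set .t t).set .q (q + 1)) := by
    intro t
    obtain ⟨h₁, h₂, h₃, h₄, h₅, hJU, h₆, h₇, h₈⟩ := h
    exact ⟨h₁, by simp, by simpa [Store.set_var] using h₃, by simpa [Lists, Store.set_var] using h₄,
      by simpa [Records, Store.set_var] using h₅, hJU, fun r hr => h₆ r (by omega), h₇, by omega⟩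
  refine Spec.seq (T₁ := 20) (T₂ := 20 * (len * len) + 600 * len + 180)
    (P₁ := fun τ => τ = σ.set .t (E q)) (Spec.assign ?_ ?_ ?_) ?_ (by omega)
  · simp [h.pos]; omega
  · simp
  · simp [h.pos, h.arr]
  rintro _ - rfl
  refine Spec.seq (T₁ := 20) (T₂ := 20 * (len * len) + 600 * len + 160)
    (P₁ := fun τ => τ = (σ.set .t (E q)).set .q (q + 1)) (Spec.assign ?_ ?_ ?_) ?_ (by omega)
  · simp [Store.set_var, h.pos]; omega
  · simp
  · simp [Store.set_var, h.pos]
  rintro _ - rfl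
  specialize hstep (E q)
  have ht : ((σ.set .t (E q)).set .q (q + 1)).var .t = E q := by simp [Store.set_var]
  have harr : ((σ.set .t (E q)).set .q (q + 1)).arr = σ.arr := rfl
  have hl' : ((σ.set .t (E q)).set .q (q + 1)).var .len = len := by simpa [Store.set_var] using hlen
  generalize (σ.set .t (E q)).set .q (q + 1) = υ at *
  refine Spec.ite (T' := 20 * (len * len) + 600 * len + 150) (by simp; omega) (by simp) ?_ ?_
  · intro hc
    simp [ht] at hc
    cases Γ with
    | some a =>
      rw [show optEncode (some a) = a.encode from rfl, Annotated.encode_eq, at_cons] at hΓ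
      cases a <;> exact absurd (hc.symm.trans hΓ.1) (by simp [Annotated.side])
    | none =>
      refine Spec.assign (by simp; omega) (by simp) ⟨?_, by simp [PartScanned], ?_, ?_⟩
      · simpa [addVars, optArgs, optEncode] using
          hstep.set (x := .it) (by decide) (by decide) (by decide) (by decide) _
      · intro r _
        simp [harr]
      · simp only [Store.set_arr, harr]
        refine hm.extend (fun _ _ => ⟨rfl, rfl⟩) (by omega) fun r h₁ h₂ h₃ => ?_
        exact absurd (h.unmarked r h₁).2 h₃
  · intro hc
    simp [ht] at hc
    cases Γ with
    | none =>
      rw [show optEncode (none : Option (Annotated (Atom Sg))) = [0] from rfl, at_cons] at hΓ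
      exact absurd hΓ.1 hc
    | some a =>
      rw [show optEncode (some a) = a.encode from rfl, Annotated.encode_eq] at hΓ hle ⊢
      rw [at_cons] at hΓ
      rw [List.length_cons] at hle ⊢
      have hside : a.side ≤ 2 := by cases a <;> simp [Annotated.side]
      have he : υ.arr .END (q + 1) = q + (a.formula.encode.length + 1) := by
        rw [harr, hends (q + 1) (Nat.zero_le _) a.formula hΓ.2 (by omega)]; omega
      have hq := hstep.pos
      refine Spec.seq (T₁ := 30) (T₂ := 20 * (len * len) + 600 * len + 120)
        (P₁ := fun τ => τ = υ.set .it (2 * (q + 1) + a.side)) (Spec.assign ?_ ?_ ?_) ?_ (by omega)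
      · simp [ht, hq, hΓ.1]; omega
      · simp
      · simp [ht, hq, hΓ.1]
      rintro _ - rfl
      refine Spec.seq (T₁ := 30) (T₂ := 20 * (len * len) + 600 * len + 90)
        (P₁ := fun τ => τ = (υ.set .it (2 * (q + 1) + a.side)).set .e
          (q + (a.formula.encode.length + 1))) (Spec.assign ?_ ?_ ?_) ?_ (by omega)
      · simp [Store.set_var, hq]; omega
      · simp
      · simp [Store.set_var, hq, he]
      rintro _ - rfl
      have hst := (hstep.set (x := .it) (by decide) (by decide) (by decide) (by decide)
        (2 * (q + 1) + a.side)).set (x := .e) (by decide) (by decide) (by decide) (by decide)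
        (q + (a.formula.encode.length + 1))
      have hlen' : ((υ.set .it (2 * (q + 1) + a.side)).set .e
        (q + (a.formula.encode.length + 1))).var .len = len := by simpa [Store.set_var] using hl'
      have hargs : a.formula.argList.length ≤ len := by
        have := a.formula.length_argList_le; omega
      have hcost : a.formula.argList.length * (20 * (q + (a.formula.encode.length + 1)) + 250) ≤
          len * (20 * len + 250) := Nat.mul_le_mul hargs (by omega)
      have hcost' : len * (20 * len + 250) = 20 * (len * len) + 250 * len := by ring
      have hr := formBody_rounds hU (n := len) (b := 0) (e := q + (a.formula.encode.length + 1))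
        (Φ := [a.formula]) hst (by simp) (by simp; omega) (by omega) (by simpa using hΓ.2)
        (by simp; omega)
      simp only [List.flatMap_cons, List.flatMap_nil, List.append_nil] at hr
      rw [← hlen'] at hr
      refine Spec.loop_of_rounds (by omega) hr (by rw [hlen']; omega) ?_
      rintro τ hf ⟨k₁, ⟨k₂, -⟩, k₃⟩
      have hit : τ.var .it = 2 * (q + 1) + a.side :=
        (hf.var _ (by decide)).trans (by simp [Store.set_var])
      have hsame : ∀ r < q + 1, τ.arr .KD r = σ.arr .KD r ∧ τ.arr .J r = σ.arr .J r := by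
        intro r hr
        have := k₃ r hr
        simpa [harr] using this
      refine ⟨k₁.set (by decide) (by decide) (by decide) (by decide) _, ?_, ?_, ?_⟩
      · exact ⟨q + 1, by simpa [Store.set_var] using hit, hΓ.2, by omega, k₂⟩
      · intro r hr; exact hsame r (by omega)
      -- Position `q` itself holds the side and stays unmarked; every other new mark lies inside the
      -- scanned formula.
      · refine hm.extend (fun r hr => hsame r (by omega)) (by omega) fun r h₁ h₂ h₃ => ?_
        simp only [Store.set_arr] at h₃
        rcases h₁.eq_or_lt with rfl | h₁
        · rw [(hsame q (by omega)).1] at h₃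
          exact absurd (h.unmarked q le_rfl).2 h₃
        · obtain ⟨ψ, g₁, g₂, g₃⟩ := k₂.exists_of_marked hΓ.2 h₁ (by omega) h₃
          exact ⟨i, _, ψ, hd, g₁, by omega, g₃⟩

end EPROL

/-! ### Scanning a whole sequent. -/

namespace EPROL

open Stmt

variable {Sg : Signature} {W B U : ℕ}

/-- The variables of the sequent `S` in order of appearance, if its number `i` is positive. -/
def Sequent.varList (i : ℕ) (S : Sequent (Atom Sg)) : List ℕ := addVars i [] S.argList

/-- The sequent `S` with number `i` has been scanned, and `a` and `b` are the codes of its parts. -/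
def SeqScanned (E KD J : ℕ → ℕ) (hi i a b : ℕ) (S : Sequent (Atom Sg)) : Prop :=
  PartScanned E KD J hi i (S.varList i) a S.fst ∧ PartScanned E KD J hi i (S.varList i) b S.snd

/-- Position `q` has been reached with the list `A` of arguments. -/
structure BaseState (U : ℕ) (E : ℕ → ℕ) (q : ℕ) (A : List (Arg Sg)) (σ : Store) : Prop where
  arr : σ.arr .E = E
  pos : σ.var .q = q
  records : Records U E A σ
  bounded : ∀ r, σ.arr .J r ≤ U
  unmarked : ∀ r, q ≤ r → σ.arr .J r = 0 ∧ σ.arr .KD r = 0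
  length_le : 2 * A.length ≤ q

theorem scanSequent_spec (hU : B + 16 * U + 16 < W) {σ : Store} {E : ℕ → ℕ} {q i len : ℕ}
    {A : List (Arg Sg)} {S : Sequent (Atom Sg)} (h : BaseState U E q A σ) (hi : σ.var .i = i)
    (hlen : σ.var .len = len) (hends : StopsFrom Sg E (σ.arr .END) len 0) (hS : At E q S.encode)
    (hle : q + S.encode.length ≤ len) (hlU : 3 * len + 8 ≤ U) (hil : i ≤ len)
    (hm : Marks Sg E (σ.arr .KD) (σ.arr .J) q (σ.var .d)) :
    scanSequent.Spec W B σ (40 * (len * len) + 1200 * len + 600) fun τ =>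
      BaseState U E (q + S.encode.length) (A ++ S.argList) τ ∧
      SeqScanned E (τ.arr .KD) (τ.arr .J) (q + S.encode.length) i (τ.arr .AXA i) (τ.arr .AXB i) S ∧
      (∀ r < q, τ.arr .KD r = σ.arr .KD r ∧ τ.arr .J r = σ.arr .J r) ∧
      (∀ r, r ≠ i → τ.arr .AXA r = σ.arr .AXA r ∧ τ.arr .AXB r = σ.arr .AXB r) ∧
      τ.var .d = max (σ.var .d) (S.varList i).length ∧
      Marks Sg E (τ.arr .KD) (τ.arr .J) (q + S.encode.length) (τ.var .d) := by
  have hSe : S.encode = optEncode S.fst ++ optEncode S.snd := rfl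
  rw [hSe, at_append] at hS
  rw [hSe, List.length_append] at hle ⊢
  have hV : S.varList i = addVars i (addVars i [] (optArgs S.fst)) (optArgs S.snd) :=
    addVars_append _ _ _ _
  have hpre := prefix_addVars i (addVars i [] (optArgs S.fst)) (optArgs S.snd)
  rw [← hV] at hpre
  -- The variable `d` is updated only after both parts have been scanned, so the marks are bounded
  -- by its future value from the start.
  generalize hD : max (σ.var .d) (S.varList i).length = D
  have hVD : (S.varList i).length ≤ D := by omega
  refine Spec.seq (T₁ := 20) (T₂ := 40 * (len * len) + 1200 * len + 580)
    (P₁ := fun τ => τ = σ.set .nv 0) (Spec.assign ?_ ?_ ?_) ?_ (by omega)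
  · simp; omega
  · simp
  · simp
  rintro _ - rfl
  have h₀ : ScanState U E q i [] A (σ.set .nv 0) := by
    obtain ⟨h₁, h₂, h₃, hJU, h₄, h₅⟩ := h
    exact ⟨h₁, by simpa [Store.set_var] using h₂, by simpa [Store.set_var] using hi, by simp [Lists],
      by simpa [Records, Store.set_var] using h₃, hJU, h₄, by simp, h₅⟩
  have hd₀ : (σ.set .nv 0).var .d = σ.var .d := by simp [Store.set_var]
  have hl₀ : (σ.set .nv 0).var .len = len := by simpa [Store.set_var] using hlen
  rw [← Store.set_arr σ .nv 0] at hends hm ⊢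
  generalize σ.set .nv 0 = σ₀ at *
  refine Spec.seq (T₂ := 20 * (len * len) + 600 * len + 380)
    (scanPart_spec hU h₀ hl₀ hends hS.1 (by omega) hlU (hm.mono (by omega))
      (hpre.length_le.trans hVD)) ?_ (by omega)
  rintro σ₁ hf₁ ⟨h₁, ha₁, hs₁, hm₁⟩
  refine Spec.seq (T₁ := 20) (T₂ := 20 * (len * len) + 600 * len + 360)
    (P₁ := fun τ => τ = σ₁.put .AXA i (σ₁.var .it)) (Spec.write ?_ ?_ ?_ ?_ ?_) ?_ (by omega)
  · simp
  · simp
  · simp [h₁.num]; omega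
  · simp
  · simp [h₁.num]
  rintro _ - rfl
  have h₁' : ScanState U E (q + (optEncode S.fst).length) i (addVars i [] (optArgs S.fst))
      (A ++ optArgs S.fst) (σ₁.put .AXA i (σ₁.var .it)) := by
    obtain ⟨h₁, h₂, h₃, h₄, h₅, hJU, h₆, h₇, h₈⟩ := h₁
    exact ⟨by simpa [Store.put_arr] using h₁, h₂, h₃, by simpa [Lists, Store.put_arr] using h₄,
      by simpa [Records, Store.put_arr] using h₅, by simpa [Store.put_arr] using hJU,
      by simpa [Store.put_arr] using h₆, h₇, h₈⟩
  refine Spec.seq (T₂ := 160)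
    (scanPart_spec hU h₁' (len := len) (d := D) ?_ ?_ hS.2 (by omega) hlU ?_
      (by rw [← hV]; exact hVD)) ?_ (by omega)
  · rw [Store.put_var, hf₁.var _ (by decide), hl₀]
  · rw [Store.put_arr, if_neg (by decide), hf₁.arr _ (by decide)]; exact hends
  · simpa [Store.put_arr] using hm₁
  rintro σ₂ hf₂ ⟨h₂, ha₂, hs₂, hm₂⟩
  rw [← hV] at ha₂ h₂
  rw [Nat.add_assoc] at h₂ ha₂ hm₂
  simp only [Store.put_arr, reduceCtorEq, if_false] at hs₂
  have hA₂ : σ₂.arr .AXA = Function.update (σ₁.arr .AXA) i (σ₁.var .it) :=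
    (hf₂.arr _ (by decide)).trans (by simp [Store.put_arr])
  have hB₂ : σ₂.arr .AXB = σ₀.arr .AXB :=
    ((hf₂.arr _ (by decide)).trans (by simp [Store.put_arr])).trans (hf₁.arr _ (by decide))
  have hA₁ : σ₁.arr .AXA = σ₀.arr .AXA := hf₁.arr _ (by decide)
  have hd₂ : σ₂.var .d = σ.var .d :=
    ((hf₂.var _ (by decide)).trans (hf₁.var _ (by decide))).trans hd₀
  refine Spec.seq (T₁ := 20) (T₂ := 100)
    (P₁ := fun τ => τ = σ₂.put .AXB i (σ₂.var .it)) (Spec.write ?_ ?_ ?_ ?_ ?_) ?_ (by omega)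
  · simp
  · simp
  · simp [h₂.num]; omega
  · simp
  · simp [h₂.num]
  rintro _ - rfl
  have hnv := h₂.lists.1
  have hfinal : ∀ τ : Store, τ.arr = (σ₂.put .AXB i (σ₂.var .it)).arr → τ.var .q = σ₂.var .q →
      τ.var .m = σ₂.var .m → τ.var .d = D →
      BaseState U E (q + ((optEncode S.fst).length + (optEncode S.snd).length)) (A ++ S.argList) τ ∧
      SeqScanned E (τ.arr .KD) (τ.arr .J) (q + ((optEncode S.fst).length + (optEncode S.snd).length))
        i (τ.arr .AXA i) (τ.arr .AXB i) S ∧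
      (∀ r < q, τ.arr .KD r = σ₀.arr .KD r ∧ τ.arr .J r = σ₀.arr .J r) ∧
      (∀ r, r ≠ i → τ.arr .AXA r = σ₀.arr .AXA r ∧ τ.arr .AXB r = σ₀.arr .AXB r) ∧
      τ.var .d = D ∧
      Marks Sg E (τ.arr .KD) (τ.arr .J)
        (q + ((optEncode S.fst).length + (optEncode S.snd).length)) (τ.var .d) := by
    intro τ harr hq hmm hd
    obtain ⟨k₁, k₂, k₃, k₄, k₅, kJ, k₆, k₇, k₈⟩ := h₂
    rw [harr, hd]
    simp only [Store.put_arr, reduceCtorEq, if_false, if_true, hA₂, hB₂]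
    refine ⟨⟨?_, ?_, ?_, ?_, ?_, ?_⟩, ⟨?_, ?_⟩, ?_, ?_, trivial, hm₂⟩
    · rw [harr]; simpa [Store.put_arr] using k₁
    · rw [hq, k₂]
    · rw [List.append_assoc] at k₅
      have k₅' : Records U E (A ++ S.argList) σ₂ := k₅
      refine ⟨hmm.trans k₅'.1, fun j hj => ?_⟩
      rw [harr]
      simpa [Store.put_arr] using k₅'.2 j hj
    · rw [harr]; simpa [Store.put_arr] using kJ
    · rw [harr]; simpa [Store.put_arr] using k₆
    · rw [List.append_assoc] at k₈; exact k₈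
    · rw [Function.update_self]
      exact (ha₁.mono hpre).congr hs₂ (by omega)
    · rw [Function.update_self]
      exact ha₂
    · intro r hr
      rw [(hs₂ r (by omega)).1, (hs₂ r (by omega)).2, (hs₁ r hr).1, (hs₁ r hr).2]
      exact ⟨rfl, rfl⟩
    · intro r hr
      rw [Function.update_of_ne hr, Function.update_of_ne hr, hA₁]
      exact ⟨rfl, rfl⟩
  refine Spec.ite (T' := 30) (by simp) (by simp) ?_ ?_
  · intro hc
    simp [hd₂, hnv] at hc
    exact Spec.assign (by simp) (by simp) (hfinal _ rfl (by simp [Store.set_var])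
      (by simp [Store.set_var]) (by simp [hnv]; omega))
  · intro hc
    simp [hd₂, hnv] at hc
    exact Spec.skip (by omega) (hfinal _ rfl (by simp) (by simp) (by simp [hd₂]; omega))

end EPROL

/-! ### The number of variables found, and the scan of the whole input. -/

namespace EPROL

open Stmt

variable {Sg : Signature} {W B U : ℕ}

theorem addVars_zero (l : List (Arg Sg)) : addVars 0 [] l = [] := by
  induction l with
  | nil => rfl
  | cons a l ih => cases a <;> exact ih

theorem nodup_addVar {i : ℕ} {V : List ℕ} (h : V.Nodup) (a : Arg Sg) : (addVar i V a).Nodup := by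
  cases a with
  | const c => exact h
  | var v =>
    rw [addVar_var]
    split_ifs with hv
    · exact List.Nodup.append h (List.nodup_singleton v) (by simpa using hv.2)
    · exact h

theorem nodup_addVars {i : ℕ} {V : List ℕ} (h : V.Nodup) (l : List (Arg Sg)) :
    (addVars i V l).Nodup := by
  induction l generalizing V with
  | nil => exact h
  | cons a l ih => exact ih (nodup_addVar h a)

theorem mem_addVars {i : ℕ} {V : List ℕ} {l : List (Arg Sg)} {v : ℕ} (h : v ∈ addVars i V l) :
    v ∈ V ∨ Arg.var v ∈ l := by
  induction l generalizing V with
  | nil => exact .inl h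
  | cons a l ih =>
    rcases ih h with h | h
    · cases a with
      | const c => exact .inl h
      | var u =>
        rw [addVar_var] at h
        split_ifs at h with hu
        · rcases List.mem_append.1 h with h | h
          · exact .inl h
          · rw [List.mem_singleton.1 h]; exact .inr (List.mem_cons_self ..)
        · exact .inl h
    · exact .inr (List.mem_cons_of_mem _ h)

theorem Formula.mem_vars {φ : Formula (Atom Sg)} {v : ℕ} (h : Arg.var v ∈ φ.argList) :
    v ∈ φ.vars := by
  induction φ with
  | atom a =>
    obtain ⟨j, hj⟩ := List.mem_ofFn.1 h
    refine Finset.mem_biUnion.2 ⟨j, Finset.mem_univ _, ?_⟩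
    rw [hj]; exact Finset.mem_singleton_self v
  | neg φ ih => exact ih h
  | conj φ ψ ih₁ ih₂ =>
    exact Finset.mem_union.2 ((List.mem_append.1 h).imp ih₁ ih₂)
  | disj φ ψ ih₁ ih₂ =>
    exact Finset.mem_union.2 ((List.mem_append.1 h).imp ih₁ ih₂)

theorem mem_optVars {Γ : Option (Annotated (Atom Sg))} {v : ℕ} (h : Arg.var v ∈ optArgs Γ) :
    v ∈ optVars Γ := by
  cases Γ with
  | none => simp [optArgs] at h
  | some a => cases a <;> exact Formula.mem_vars h

/-- The list has no repetitions and contains only variables of the sequent. The converse inequality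
is not needed: a smaller exponent could only save time. -/
theorem Sequent.length_varList_le (i : ℕ) (S : Sequent (Atom Sg)) :
    (S.varList i).length ≤ S.degree := by
  change (addVars i [] S.argList).length ≤ _
  rw [← List.toFinset_card_of_nodup (nodup_addVars List.nodup_nil _)]
  refine Finset.card_le_card fun v hv => ?_
  rcases mem_addVars (List.mem_toFinset.1 hv) with h | h
  · exact absurd h List.not_mem_nil
  · exact Finset.mem_union.2 ((List.mem_append.1 h).imp mem_optVars mem_optVars)

theorem Instance.degree_le (I : Instance Sg) {S : Sequent (Atom Sg)} (hS : S ∈ I.axs) :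
    S.degree ≤ I.degree := by
  unfold Instance.degree
  generalize I.axs = l at *
  induction l with
  | nil => exact absurd hS List.not_mem_nil
  | cons S' l ih =>
    rw [List.map_cons, List.foldr_cons]
    rcases List.mem_cons.1 hS with rfl | h
    · exact le_max_left _ _
    · exact (ih h).trans (le_max_right _ _)

theorem Sequent.length_encode_pos (S : Sequent (Atom Sg)) : 0 < S.encode.length := by
  have : ∀ Γ : Option (Annotated (Atom Sg)), 0 < (optEncode Γ).length := by
    intro Γ
    cases Γ with
    | none => simp [optEncode]
    | some a => simp [optEncode, Annotated.encode_eq]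
  have := this S.fst
  simp only [Sequent.encode, List.length_append]
  omega

theorem length_le_flatMap_encode (l : List (Sequent (Atom Sg))) :
    l.length ≤ (l.flatMap Sequent.encode).length := by
  induction l with
  | nil => exact le_rfl
  | cons S l ih =>
    have := S.length_encode_pos
    rw [List.flatMap_cons, List.length_append, List.length_cons]
    omega

/-- Where axiom number `s` starts in the input. -/
def Instance.start (I : Instance Sg) (s : ℕ) : ℕ :=
  I.goal.encode.length + 1 + ((I.axs.take s).flatMap Sequent.encode).length

/-- The goal and the first `s` axioms have been scanned. -/
structure ScanInv (U : ℕ) (I : Instance Sg) (E : ℕ → ℕ) (s : ℕ) (σ : Store) : Prop where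
  base : BaseState U E (I.start s) (I.goal.argList ++ (I.axs.take s).flatMap Sequent.argList) σ
  goal : SeqScanned E (σ.arr .KD) (σ.arr .J) (I.start s) 0 (σ.arr .AXA 0) (σ.arr .AXB 0) I.goal
  axs : ∀ j (h : j < I.axs.length), j < s → SeqScanned E (σ.arr .KD) (σ.arr .J) (I.start s) (j + 1)
    (σ.arr .AXA (j + 1)) (σ.arr .AXB (j + 1)) I.axs[j]
  marks : Marks Sg E (σ.arr .KD) (σ.arr .J) (I.start s) (σ.var .d)
  length_le : ∀ j (h : j < I.axs.length), j < s → (I.axs[j].varList (j + 1)).length ≤ σ.var .d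
  le_degree : σ.var .d ≤ I.degree

theorem SeqScanned.congr {E KD J KD' J' : ℕ → ℕ} {hi hi' i a b : ℕ} {S : Sequent (Atom Sg)}
    (h : SeqScanned E KD J hi i a b S) (hh : ∀ r < hi, KD' r = KD r ∧ J' r = J r) (hle : hi ≤ hi') :
    SeqScanned E KD' J' hi' i a b S := ⟨h.1.congr hh hle, h.2.congr hh hle⟩

theorem Instance.at_axs {I : Instance Sg} {E : ℕ → ℕ} (h : At E 0 I.encode) {s : ℕ}
    (hs : s < I.axs.length) : At E (I.start s) I.axs[s].encode ∧
      I.start (s + 1) = I.start s + I.axs[s].encode.length := by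
  rw [Instance.encode, at_append, at_append] at h
  have h₂ := h.2
  have e : I.axs = I.axs.take s ++ (I.axs[s] :: I.axs.drop (s + 1)) := by simp
  rw [e, List.flatMap_append, at_append, List.flatMap_cons, at_append] at h₂
  constructor
  · have := h₂.2.1
    simpa [Instance.start] using this
  · rw [Instance.start, Instance.start, List.take_succ_eq_append_getElem hs, List.flatMap_append,
      List.length_append]
    simp; omega

theorem Instance.start_le (I : Instance Sg) (s : ℕ) : I.start s ≤ I.encode.length := by
  have e : I.axs.flatMap Sequent.encode = (I.axs.take s).flatMap Sequent.encode ++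
      (I.axs.drop s).flatMap Sequent.encode := by
    rw [← List.flatMap_append, List.take_append_drop]
  rw [Instance.start, Instance.encode, e]
  simp only [List.length_append, List.length_cons, List.length_nil]
  omega

/-- There are at most `len` sequents and each costs O(len²), so the scan is cubic in the length of
the input and fits into the time bound even for degree zero. -/
theorem scanPhase_spec (hU : B + 16 * U + 16 < W) {I : Instance Sg} {σ : Store} {E : ℕ → ℕ}
    {len : ℕ} (hI : I.encode.length = len) (hE : σ.arr .E = E) (hat : At E 0 I.encode)
    (hlen : σ.var .len = len) (hends : StopsFrom Sg E (σ.arr .END) len 0) (hlU : 3 * len + 8 ≤ U)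
    (hq : σ.var .q = 0) (hm : σ.var .m = 0) (hd : σ.var .d = 0) (hJ : ∀ r, σ.arr .J r = 0)
    (hK : ∀ r, σ.arr .KD r = 0) :
    scanPhase.Spec W B σ ((len + 1) * (40 * (len * len) + 1200 * len + 700)) fun τ =>
      ScanInv U I E I.axs.length τ ∧ τ.var .k = I.axs.length := by
  generalize hT : 40 * (len * len) + 1200 * len = T₀
  have hk : I.axs.length + I.goal.encode.length + 1 ≤ len := by
    have := length_le_flatMap_encode I.axs
    rw [← hI, Instance.encode]
    simp only [List.length_append, List.length_cons, List.length_nil]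
    omega
  have hkT : I.axs.length * (T₀ + 650 + 3) ≤ len * (T₀ + 700) := Nat.mul_le_mul (by omega) (by omega)
  have hat' := hat
  rw [Instance.encode, at_append, at_append, at_cons] at hat'
  obtain ⟨⟨hg, hEk, -⟩, -⟩ := hat'
  rw [zero_add] at hEk
  refine Spec.seq (T₁ := 10) (T₂ := (len + 1) * (T₀ + 700) - 10)
    (P₁ := fun τ => τ = σ.set .i 0) (Spec.assign ?_ ?_ ?_) ?_ (by rw [Nat.succ_mul len]; omega)
  · simp; omega
  · simp
  · simp
  rintro _ - rfl
  have hb : BaseState (Sg := Sg) U E 0 [] (σ.set .i 0) :=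
    ⟨hE, by simpa [Store.set_var] using hq, ⟨by simpa [Store.set_var] using hm, by simp⟩,
      fun r => by simp [hJ], fun r _ => ⟨hJ r, hK r⟩, by simp⟩
  have hd₀ : (σ.set .i 0).var .d = 0 := by simpa [Store.set_var] using hd
  have hl₀ : (σ.set .i 0).var .len = len := by simpa [Store.set_var] using hlen
  have hi₀ : (σ.set .i 0).var .i = 0 := by simp
  rw [← Store.set_arr σ .i 0] at hends
  generalize σ.set .i 0 = σ₀ at *
  refine Spec.seq (T₂ := len * (T₀ + 700) + 60) (scanSequent_spec hU (S := I.goal) hb hi₀ hl₀ hends hg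
    (by omega) hlU (by omega) (fun r hr => absurd hr (Nat.not_lt_zero r))) ?_
    (by rw [Nat.succ_mul len]; omega)
  rintro σ₁ hf₁ ⟨hb₁, hs₁, -, -, hd₁, hm₁⟩
  rw [zero_add] at hb₁ hs₁ hm₁
  have hV₀ : (I.goal.varList 0).length = 0 := by rw [Sequent.varList, addVars_zero]; rfl
  rw [hd₀, hV₀, Nat.max_self] at hd₁
  have hpos₁ := hb₁.pos
  have hE₁ := hb₁.arr
  refine Spec.seq (T₁ := 20) (T₂ := len * (T₀ + 700) + 30)
    (P₁ := fun τ => τ = σ₁.set .k I.axs.length) (Spec.assign ?_ ?_ ?_) ?_ (by omega)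
  · simp [hpos₁]; omega
  · simp
  · simp [hpos₁, hE₁, hEk]
  rintro _ - rfl
  refine Spec.seq (T₁ := 20) (T₂ := len * (T₀ + 700) + 10)
    (P₁ := fun τ => τ = (σ₁.set .k I.axs.length).set .q (I.start 0)) (Spec.assign ?_ ?_ ?_) ?_
      (by omega)
  · simp [Store.set_var, hpos₁]; omega
  · simp
  · simp [Store.set_var, hpos₁, Instance.start]
  rintro _ - rfl
  have hinv : ScanInv U I E 0 ((σ₁.set .k I.axs.length).set .q (I.start 0)) := by
    obtain ⟨k₁, k₂, k₃, kJ, k₄, k₅⟩ := hb₁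
    have hst : I.start 0 = I.goal.encode.length + 1 := by simp [Instance.start]
    have h0 := k₄ _ le_rfl
    refine ⟨⟨k₁, by simp, ?_, kJ, fun r hr => k₄ r (by omega), ?_⟩, ?_, fun _ _ h => absurd h (by simp),
      ?_, fun _ _ h => absurd h (by simp), ?_⟩
    · simpa [Records, Store.set_var] using k₃
    · simp at k₅ ⊢; omega
    · exact hs₁.congr (fun _ _ => ⟨rfl, rfl⟩) (by omega)
    · rw [show ((σ₁.set .k I.axs.length).set .q (I.start 0)).var .d = σ₁.var .d by
        simp [Store.set_var]]
      refine hm₁.extend (fun _ _ => ⟨rfl, rfl⟩) (by omega) fun r h₁ h₂ h₃ => ?_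
      obtain rfl : r = I.goal.encode.length := by omega
      exact absurd h0.2 h₃
    · simp [Store.set_var, hd₁]
  have hk₂ : ((σ₁.set .k I.axs.length).set .q (I.start 0)).var .k = I.axs.length := by
    simp [Store.set_var]
  have hl₂ : ((σ₁.set .k I.axs.length).set .q (I.start 0)).var .len = len := by
    rw [← hl₀, ← hf₁.var _ (by decide)]; simp [Store.set_var]
  have hst₂ : StopsFrom Sg E (((σ₁.set .k I.axs.length).set .q (I.start 0)).arr .END) len 0 := by
    rw [Store.set_arr, Store.set_arr, hf₁.arr _ (by decide)]; exact hends
  generalize (σ₁.set .k I.axs.length).set .q (I.start 0) = σ₂ at *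
  refine Spec.loop (T₀ := T₀ + 650) (ScanInv U I E) (by omega) hinv ?_ (by rw [hk₂]; omega) ?_
  · intro s τ hs hf hinv
    rw [hk₂] at hs
    obtain ⟨hats, hstart⟩ := Instance.at_axs hat hs
    have hlτ : τ.var .len = len := (hf.var _ (by decide)).trans hl₂
    have hsτ : StopsFrom Sg E (τ.arr .END) len 0 := by rw [hf.arr _ (by decide)]; exact hst₂
    have hle := I.start_le (s + 1)
    refine Spec.seq (T₁ := 20) (T₂ := T₀ + 600)
      (P₁ := fun υ => υ = (τ.set .s s).set .i (s + 1)) (Spec.assign ?_ ?_ ?_) ?_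
        (by omega)
    · simp; omega
    · simp
    · simp
    rintro _ - rfl
    obtain ⟨k₁, k₂, k₃, k₄, k₅, k₆⟩ := hinv
    have hd₃ : ((τ.set .s s).set .i (s + 1)).var .d = τ.var .d := by simp [Store.set_var]
    refine (scanSequent_spec hU (S := I.axs[s]) (σ := (τ.set .s s).set .i (s + 1)) (E := E)
      (q := I.start s) (i := s + 1) (len := len)
      (A := I.goal.argList ++ (I.axs.take s).flatMap Sequent.argList) ?_ (by simp)
      (by simpa [Store.set_var] using hlτ) hsτ hats (by omega) hlU (by omega)
      (by rw [hd₃]; exact k₄)).mono (by omega) ?_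
    · obtain ⟨g₁, g₂, g₃, gJ, g₄, g₅⟩ := k₁
      exact ⟨g₁, by simpa [Store.set_var] using g₂, by simpa [Records, Store.set_var] using g₃, gJ, g₄, g₅⟩
    · rintro υ hf' ⟨g₁, g₂, g₃, g₄, g₅, g₆⟩
      simp only [Store.set_arr] at g₃ g₄
      rw [hd₃] at g₅
      rw [← hstart] at g₁ g₂ g₆
      refine ⟨?_, ?_, ?_, g₆, ?_, ?_⟩
      · rw [List.take_succ_eq_append_getElem hs, List.flatMap_append, ← List.append_assoc]
        simpa using g₁
      · rw [(g₄ 0 (by omega)).1, (g₄ 0 (by omega)).2]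
        exact k₂.congr g₃ (by omega)
      · intro j hj hjs
        rcases Nat.lt_succ_iff_lt_or_eq.1 hjs with hjs | rfl
        · rw [(g₄ (j + 1) (by omega)).1, (g₄ (j + 1) (by omega)).2]
          exact (k₃ j hj hjs).congr g₃ (by omega)
        · exact g₂
      · intro j hj hjs
        rw [g₅]
        rcases Nat.lt_succ_iff_lt_or_eq.1 hjs with hjs | rfl
        · exact (k₅ j hj hjs).trans (le_max_left _ _)
        · exact le_max_right _ _
      · rw [g₅]
        exact max_le k₆ (((I.axs[s]).length_varList_le _).trans
          (I.degree_le (List.getElem_mem hs)))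
  · intro τ hf hinv
    rw [hk₂] at hinv ⊢
    obtain ⟨k₁, k₂, k₃, k₄, k₅, k₆⟩ := hinv
    have hd₃ : (τ.set .s I.axs.length).var .d = τ.var .d := by simp [Store.set_var]
    refine ⟨⟨?_, k₂, k₃, by rw [hd₃]; exact k₄, by rw [hd₃]; exact k₅, by rw [hd₃]; exact k₆⟩, ?_⟩
    · obtain ⟨g₁, g₂, g₃, gJ, g₄, g₅⟩ := k₁
      exact ⟨g₁, by simpa [Store.set_var] using g₂, by simpa [Records, Store.set_var] using g₃, gJ, g₄, g₅⟩
    · rw [Store.set_var, if_neg (by decide), hf.var _ (by decide), hk₂]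

end EPROL

namespace EPROL

open Stmt

variable {W B U : ℕ}

/-! ### The tables of the nodes -/

theorem powPhase_spec (hU : B + 16 * U + 16 < W) {σ : Store} {len m d : ℕ} (hlen : σ.var .len = len)
    (hm : σ.var .m = m) (hd : σ.var .d = d) (hdU : d + 1 ≤ U) (hpow : ∀ j ≤ d, m ^ j ≤ U)
    (hM : (2 * (len * m ^ d) + 1) * (2 * (len * m ^ d) + 1) ≤ U) :
    powPhase.Spec W B σ (40 * d + 100) fun τ =>
      (∀ j ≤ d, τ.arr .POW j = m ^ j) ∧ τ.var .CN = m ^ d ∧ τ.var .N = len * m ^ d ∧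
      τ.var .M = 2 * (len * m ^ d) + 1 ∧
      τ.var .MM = (2 * (len * m ^ d) + 1) * (2 * (len * m ^ d) + 1) := by
  refine Spec.seq (T₁ := 10) (T₂ := 40 * d + 80) (P₁ := fun τ => τ = σ.put .POW 0 1)
    (Spec.write ?_ ?_ ?_ ?_ ?_) ?_ (by omega)
  · simp; omega
  · simp; omega
  · simp; omega
  · simp
  · simp
  rintro _ - rfl
  refine Spec.seq (T₁ := 40 * d + 10) (T₂ := 70)
    (P₁ := fun τ => ∀ j ≤ d, τ.arr .POW j = m ^ j) ?_ ?_ (by omega)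
  · refine Spec.loop (T₀ := 35) (fun j τ => ∀ j' ≤ j, τ.arr .POW j' = m ^ j') ?_ ?_ ?_ ?_ ?_
    · simp [hd]; omega
    · intro j' hj'
      obtain rfl : j' = 0 := by omega
      simp [Store.put_arr]
    · intro j τ hj hf h
      rw [Store.put_var, hd] at hj
      have hmτ : τ.var .m = m := (hf.var _ (by decide)).trans hm
      have h₁ := hpow (j + 1) (by omega)
      have h₂ := h j le_rfl
      rw [pow_succ] at h₁
      refine Spec.write ?_ ?_ ?_ ?_ ?_
      · simp; omega
      · simp [Store.set_var, hmτ, h₂]; omega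
      · simp; omega
      · simp
      · intro j' hj'
        rcases hj'.eq_or_lt with rfl | hj'
        · simp [Store.put_arr, Store.set_var, hmτ, h₂, pow_succ]
        · simp [Store.put_arr, show j' ≠ j + 1 by omega, h j' (by omega)]
    · rw [Store.put_var, hd]; omega
    · intro τ hf h
      rw [Store.put_var, hd] at h
      exact h
  · intro τ hf h
    have hdτ : τ.var .d = d := (hf.var _ (by decide)).trans hd
    have hlτ : τ.var .len = len := (hf.var _ (by decide)).trans hlen
    have hMU : 2 * (len * m ^ d) + 1 ≤ U := (Nat.le_mul_self _).trans hM
    simp [Stmt.Spec, wp, Store.set_var, hdτ, hlτ, h d le_rfl]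
    refine ⟨by omega, by omega, by omega, by omega, ?_⟩
    intro j hj; exact h j hj

/-- Where the symbol at the node `x` is found after substitution. -/
def srcAt (J POW T : ℕ → ℕ) (m len x : ℕ) : ℕ :=
  if J (x % len) = 0 then x % len else T (x / len / POW (J (x % len) - 1) % m)

theorem srcStep_spec (hU : B + 16 * U + 16 < W) {σ : Store} {len m x : ℕ}
    (hx : σ.var .x = x) (hm : σ.var .m = m) (hp : σ.var .p = x % len) (hc : σ.var .c = x / len)
    (hJ : ∀ r, σ.arr .J r ≤ U) (hxU : x ≤ U) :
    srcStep.Spec W B σ 80 fun τ => τ.arr .G =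
      Function.update (σ.arr .G) x (srcAt (σ.arr .J) (σ.arr .POW) (σ.arr .T) m len x) := by
  have h₁ := Nat.mod_le x len
  have h₂ := Nat.div_le_self x len
  have h₃ := hJ (x % len)
  have h₄ := Nat.div_le_self (x / len) (σ.arr .POW (σ.arr .J (x % len) - 1))
  have h₅ := Nat.mod_le (x / len / σ.arr .POW (σ.arr .J (x % len) - 1)) m
  have h₆ := Nat.div_mul_le_self (x / len / σ.arr .POW (σ.arr .J (x % len) - 1)) m
  have h₇ := Nat.div_le_self (x / len / σ.arr .POW (σ.arr .J (x % len) - 1)) m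
  simp [srcStep, Stmt.Spec, wp, Store.set_var, Store.put_arr, hx, hp, hc, hm, srcAt,
    ← Nat.mod_eq_sub_div_mul]
  refine ⟨by omega, fun h => ⟨by omega, by simp [h]⟩, fun h => ⟨by omega, by omega, ?_, ?_⟩⟩
  · omega
  · simp [h]

/-- With symbol `3` for conjunction and `4` for disjunction, `5 - KD` asks for one premise for a
conjunction on the left and for both for a disjunction; `KD - 2` is the dual choice on the right. -/
theorem nodeBody_spec (hU : B + 16 * U + 16 < W) {σ : Store} {len m x : ℕ}
    (hx : σ.var .x = x) (hm : σ.var .m = m) (hlen : σ.var .len = len)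
    (hJ : ∀ r, σ.arr .J r ≤ U) (hxU : 2 * x + 3 * len + 16 ≤ U)
    (hE : ∀ r, σ.arr .END r ≤ 3 * len + 3) (hK : ∀ r, σ.arr .KD r ≤ U) :
    nodeBody.Spec W B σ 500 fun τ => τ.arr .G =
      Function.update (σ.arr .G) x (srcAt (σ.arr .J) (σ.arr .POW) (σ.arr .T) m len x) ∧
      τ.arr .BAR = Function.update (Function.update (σ.arr .BAR) (2 * x + 1) (2 * x + 2))
        (2 * x + 2) (2 * x + 1) ∧
      (σ.arr .KD (x % len) < 2 → τ.arr .IK = σ.arr .IK ∧ τ.arr .IA = σ.arr .IA ∧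
        τ.arr .IB = σ.arr .IB) ∧
      (σ.arr .KD (x % len) = 2 →
        τ.arr .IK = Function.update (Function.update (σ.arr .IK) (2 * x + 1) 1) (2 * x + 2) 1 ∧
        τ.arr .IA = Function.update (Function.update (σ.arr .IA) (2 * x + 1) (2 * (x + 1) + 2))
          (2 * x + 2) (2 * (x + 1) + 1) ∧
        τ.arr .IB = Function.update (Function.update (σ.arr .IB) (2 * x + 1) (2 * (x + 1) + 2))
          (2 * x + 2) (2 * (x + 1) + 1)) ∧
      (2 < σ.arr .KD (x % len) →
        τ.arr .IK = Function.update (Function.update (σ.arr .IK) (2 * x + 1)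
          (5 - σ.arr .KD (x % len))) (2 * x + 2) (σ.arr .KD (x % len) - 2) ∧
        τ.arr .IA = Function.update (Function.update (σ.arr .IA) (2 * x + 1) (2 * (x + 1) + 1))
          (2 * x + 2) (2 * (x + 1) + 2) ∧
        τ.arr .IB = Function.update (Function.update (σ.arr .IB) (2 * x + 1)
          (2 * (x / len * len + σ.arr .END (x % len + 1)) + 1)) (2 * x + 2)
          (2 * (x / len * len + σ.arr .END (x % len + 1)) + 2)) := by
  have h₁ := Nat.mod_le x len
  have h₂ := Nat.div_le_self x len
  have h₃ := Nat.div_mul_le_self x len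
  refine Spec.seq (T₁ := 20) (T₂ := 480) (P₁ := fun τ => τ = σ.set .c (x / len))
    (Spec.assign ?_ ?_ ?_) ?_ (by omega)
  · simp [hx, hlen]; omega
  · simp
  · simp [hx, hlen]
  rintro _ - rfl
  refine Spec.seq (T₁ := 20) (T₂ := 460)
    (P₁ := fun τ => τ = (σ.set .c (x / len)).set .p (x % len)) (Spec.assign ?_ ?_ ?_) ?_ (by omega)
  · simp [Store.set_var, hx, hlen]; omega
  · simp
  · simp [Store.set_var, hx, hlen, ← Nat.mod_eq_sub_div_mul]
  rintro _ - rfl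
  refine Spec.seq (T₁ := 80) (T₂ := 380) (srcStep_spec hU (x := x) (m := m) (len := len)
    (by simpa [Store.set_var] using hx) (by simpa [Store.set_var] using hm) (by simp)
    (by simp [Store.set_var]) hJ (by omega)) ?_ (by omega)
  intro τ hf hG
  have hxτ : τ.var .x = x := (hf.var _ (by decide)).trans (by simpa [Store.set_var] using hx)
  have hlτ : τ.var .len = len := (hf.var _ (by decide)).trans (by simpa [Store.set_var] using hlen)
  have hpτ : τ.var .p = x % len := (hf.var _ (by decide)).trans (by simp)
  have hcτ : τ.var .c = x / len := (hf.var _ (by decide)).trans (by simp [Store.set_var])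
  have hKτ : τ.arr .KD = σ.arr .KD := hf.arr _ (by decide)
  have hEτ : τ.arr .END = σ.arr .END := hf.arr _ (by decide)
  have hIKτ : τ.arr .IK = σ.arr .IK := hf.arr _ (by decide)
  have hIAτ : τ.arr .IA = σ.arr .IA := hf.arr _ (by decide)
  have hIBτ : τ.arr .IB = σ.arr .IB := hf.arr _ (by decide)
  have hBτ : τ.arr .BAR = σ.arr .BAR := hf.arr _ (by decide)
  simp only [Store.set_arr] at hG
  have hE' := hE (x % len + 1)
  have hK' := hK (x % len)
  clear hf
  refine Spec.seq (T₁ := 50) (T₂ := 330) (P₁ := fun υ =>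
    υ = (τ.put .BAR (2 * x + 1) (2 * x + 2))) (Spec.write ?_ ?_ ?_ ?_ ?_) ?_ (by omega)
  · simp [hxτ]; omega
  · simp [hxτ]; omega
  · simp [hxτ]; omega
  · simp
  · simp [hxτ]
  rintro _ - rfl
  refine Spec.seq (T₁ := 50) (T₂ := 280) (P₁ := fun υ =>
    υ = (τ.put .BAR (2 * x + 1) (2 * x + 2)).put .BAR (2 * x + 2) (2 * x + 1))
    (Spec.write ?_ ?_ ?_ ?_ ?_) ?_ (by omega)
  · simp [hxτ]; omega
  · simp [hxτ]; omega
  · simp [hxτ]; omega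
  · simp
  · simp [hxτ]
  rintro _ - rfl
  refine Spec.ite (T' := 260) (by simp [hpτ]; omega) (by simp) ?_ ?_
  · intro h
    simp [Store.put_arr, hpτ, hKτ] at h
    simp [negStep, Stmt.Spec, wp, Store.put_arr, hxτ, h, hG, hBτ, hIKτ, hIAτ, hIBτ]
    omega
  · intro h
    simp [Store.put_arr, hpτ, hKτ] at h
    refine Spec.ite (T' := 240) (by simp [hpτ]; omega) (by simp) ?_ ?_
    · intro h'
      simp [Store.put_arr, hpτ, hKτ] at h'
      simp [binStep, Stmt.Spec, wp, Store.put_arr, Store.set_var, hxτ, hcτ, hlτ, hpτ, hEτ, hKτ, h,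
        h', hG, hBτ, hIKτ, hIAτ, hIBτ]
      omega
    · intro h'
      simp [Store.put_arr, hpτ, hKτ] at h'
      refine Spec.skip (by omega) ?_
      simp [Store.put_arr, h, show ¬ 2 < σ.arr .KD (x % len) by omega, hG, hBτ, hIKτ, hIAτ, hIBτ]

/-- The tables have been filled in for the nodes below `n`. -/
structure NodeTables (len m n : ℕ) (σ : Store) : Prop where
  src : ∀ x < n, σ.arr .G x = srcAt (σ.arr .J) (σ.arr .POW) (σ.arr .T) m len x
  dual_zero : σ.arr .BAR 0 = 0
  dual : ∀ x < n, σ.arr .BAR (2 * x + 1) = 2 * x + 2 ∧ σ.arr .BAR (2 * x + 2) = 2 * x + 1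
  rest : ∀ z, z = 0 ∨ 2 * n < z ∨ z ≤ 2 * n ∧ σ.arr .KD ((z - 1) / 2 % len) < 2 →
    σ.arr .IK z = 0 ∧ σ.arr .IA z = 0 ∧ σ.arr .IB z = 0
  neg : ∀ x < n, σ.arr .KD (x % len) = 2 →
    (σ.arr .IK (2 * x + 1) = 1 ∧ σ.arr .IK (2 * x + 2) = 1) ∧
    (σ.arr .IA (2 * x + 1) = 2 * (x + 1) + 2 ∧ σ.arr .IA (2 * x + 2) = 2 * (x + 1) + 1) ∧
    σ.arr .IB (2 * x + 1) = 2 * (x + 1) + 2 ∧ σ.arr .IB (2 * x + 2) = 2 * (x + 1) + 1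
  bin : ∀ x < n, 2 < σ.arr .KD (x % len) →
    (σ.arr .IK (2 * x + 1) = 5 - σ.arr .KD (x % len) ∧
      σ.arr .IK (2 * x + 2) = σ.arr .KD (x % len) - 2) ∧
    (σ.arr .IA (2 * x + 1) = 2 * (x + 1) + 1 ∧ σ.arr .IA (2 * x + 2) = 2 * (x + 1) + 2) ∧
    σ.arr .IB (2 * x + 1) = 2 * (x / len * len + σ.arr .END (x % len + 1)) + 1 ∧
    σ.arr .IB (2 * x + 2) = 2 * (x / len * len + σ.arr .END (x % len + 1)) + 2

/-- The clause `rest` carries along the zeros at items never written. They say that no introduction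
rule applies there, and keep the two premises of such items in range. -/
theorem nodePhase_spec (hU : B + 16 * U + 16 < W) {σ : Store} {len m N : ℕ}
    (hN : σ.var .N = N) (hm : σ.var .m = m) (hlen : σ.var .len = len)
    (hJ : ∀ r, σ.arr .J r ≤ U) (hNU : 2 * N + 3 * len + 16 ≤ U)
    (hE : ∀ r, σ.arr .END r ≤ 3 * len + 3) (hK : ∀ r, σ.arr .KD r ≤ U)
    (h₀ : ∀ r, σ.arr .IK r = 0 ∧ σ.arr .IA r = 0 ∧ σ.arr .IB r = 0) (hB : σ.arr .BAR 0 = 0) :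
    nodePhase.Spec W B σ (503 * N + 2) (NodeTables len m N) := by
  refine Spec.loop (T₀ := 500) (NodeTables len m) (by omega) ?_ ?_ (by rw [hN]; omega) ?_
  · exact ⟨fun _ h => absurd h (Nat.not_lt_zero _), hB, fun _ h => absurd h (Nat.not_lt_zero _),
      fun z _ => h₀ z, fun _ h => absurd h (Nat.not_lt_zero _),
      fun _ h => absurd h (Nat.not_lt_zero _)⟩
  · intro x τ hx hf h
    rw [hN] at hx
    refine (nodeBody_spec hU (σ := τ.set .x x) (x := x) (m := m) (len := len) (by simp)
      ?_ ?_ ?_ (by omega) ?_ ?_).mono le_rfl ?_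
    · rw [Store.set_var, if_neg (by decide), hf.var _ (by decide), hm]
    · rw [Store.set_var, if_neg (by decide), hf.var _ (by decide), hlen]
    · rw [Store.set_arr, hf.arr _ (by decide)]; exact hJ
    · rw [Store.set_arr, hf.arr _ (by decide)]; exact hE
    · rw [Store.set_arr, hf.arr _ (by decide)]; exact hK
    simp only [Store.set_arr]
    rintro υ hf' ⟨hG, hBAR, hlow, hneg, hbin⟩
    have hJ' : υ.arr .J = τ.arr .J := hf'.arr _ (by decide)
    have hP' : υ.arr .POW = τ.arr .POW := hf'.arr _ (by decide)
    have hT' : υ.arr .T = τ.arr .T := hf'.arr _ (by decide)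
    have hK' : υ.arr .KD = τ.arr .KD := hf'.arr _ (by decide)
    have hE' : υ.arr .END = τ.arr .END := hf'.arr _ (by decide)
    have hsame : ∀ z, z ≠ 2 * x + 1 → z ≠ 2 * x + 2 → υ.arr .IK z = τ.arr .IK z ∧
        υ.arr .IA z = τ.arr .IA z ∧ υ.arr .IB z = τ.arr .IB z := by
      intro z h₁ h₂
      rcases lt_trichotomy (τ.arr .KD (x % len)) 2 with h | h | h
      · obtain ⟨g₁, g₂, g₃⟩ := hlow h
        rw [g₁, g₂, g₃]; exact ⟨rfl, rfl, rfl⟩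
      · obtain ⟨g₁, g₂, g₃⟩ := hneg h
        rw [g₁, g₂, g₃]; simp [h₁, h₂]
      · obtain ⟨g₁, g₂, g₃⟩ := hbin h
        rw [g₁, g₂, g₃]; simp [h₁, h₂]
    obtain ⟨k₁, k₂, k₃, k₄, k₅, k₆⟩ := h
    refine ⟨?_, ?_, ?_, ?_, ?_, ?_⟩
    · intro x' hx'
      rw [hG, hJ', hP', hT']
      rcases (Nat.lt_succ_iff_lt_or_eq.1 hx') with h | rfl
      · rw [Function.update_of_ne h.ne, k₁ x' h]
      · rw [Function.update_self]
    · rw [hBAR]; simpa using k₂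
    · intro x' hx'
      rw [hBAR]
      rcases (Nat.lt_succ_iff_lt_or_eq.1 hx') with h | rfl
      · rw [Function.update_of_ne (by omega), Function.update_of_ne (by omega),
          Function.update_of_ne (by omega), Function.update_of_ne (by omega)]
        exact k₃ x' h
      · simp
    · intro z hz
      rw [hK'] at hz
      by_cases hz' : z = 2 * x + 1 ∨ z = 2 * x + 2
      · have hzx : (z - 1) / 2 = x := by omega
        rw [hzx] at hz
        obtain ⟨g₁, g₂, g₃⟩ := hlow (by omega)
        rw [g₁, g₂, g₃]
        exact k₄ z (by omega)
      · obtain ⟨g₁, g₂, g₃⟩ := hsame z (by omega) (by omega)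
        rw [g₁, g₂, g₃]
        exact k₄ z (by omega)
    · intro x' hx' hKx
      rw [hK'] at hKx
      rcases (Nat.lt_succ_iff_lt_or_eq.1 hx') with h | rfl
      · obtain ⟨g₁, g₂, g₃⟩ := hsame (2 * x' + 1) (by omega) (by omega)
        obtain ⟨g₄, g₅, g₆⟩ := hsame (2 * x' + 2) (by omega) (by omega)
        rw [g₁, g₂, g₃, g₄, g₅, g₆]
        exact k₅ x' h hKx
      · obtain ⟨g₁, g₂, g₃⟩ := hneg hKx
        rw [g₁, g₂, g₃]
        simp
    · intro x' hx' hKx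
      rw [hK'] at hKx ⊢
      rw [hE']
      rcases (Nat.lt_succ_iff_lt_or_eq.1 hx') with h | rfl
      · obtain ⟨g₁, g₂, g₃⟩ := hsame (2 * x' + 1) (by omega) (by omega)
        obtain ⟨g₄, g₅, g₆⟩ := hsame (2 * x' + 2) (by omega) (by omega)
        rw [g₁, g₂, g₃, g₄, g₅, g₆]
        exact k₆ x' h hKx
      · obtain ⟨g₁, g₂, g₃⟩ := hbin hKx
        rw [g₁, g₂, g₃]
        simp
  · intro τ _ h
    rw [hN] at h
    obtain ⟨k₁, k₂, k₃, k₄, k₅, k₆⟩ := h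
    exact ⟨k₁, k₂, k₃, k₄, k₅, k₆⟩

end EPROL

namespace EPROL

open Stmt

variable {W B U M : ℕ}

/-! ### The queue of marked pairs -/

/-- `D` marks the pairs in the queue `Q`, which has no duplicates. -/
structure Queue (M : ℕ) (σ : Store) : Prop where
  le_one : ∀ e, σ.arr .D e ≤ 1
  lt : ∀ e, σ.arr .D e = 1 → e < M * M
  queued : ∀ e, σ.arr .D e = 1 → ∃ h < σ.var .tl, σ.arr .Q h = e
  marked : ∀ h < σ.var .tl, σ.arr .D (σ.arr .Q h) = 1
  inj : ∀ h < σ.var .tl, ∀ h' < σ.var .tl, σ.arr .Q h = σ.arr .Q h' → h = h'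

theorem Queue.of_eq {σ τ : Store} (h : Queue M σ) (hD : τ.arr .D = σ.arr .D)
    (hQ : τ.arr .Q = σ.arr .Q) (ht : τ.var .tl = σ.var .tl) : Queue M τ := by
  obtain ⟨h₁, h₂, h₃, h₄, h₅⟩ := h
  constructor <;> simpa only [hD, hQ, ht]

/-- The queue is an injection into the pairs. This bounds its addresses as well as the number of
rounds of the saturation. -/
theorem Queue.tl_le {σ : Store} (h : Queue M σ) : σ.var .tl ≤ M * M := by
  have := Finset.card_le_card_of_injOn (s := Finset.range (σ.var .tl)) (t := Finset.range (M * M))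
    (σ.arr .Q) (fun i hi => by
      simp only [Finset.coe_range, Set.mem_Iio] at hi ⊢
      exact h.lt _ (h.marked i hi))
    (fun i hi j hj hij => by
      simp only [Finset.coe_range, Set.mem_Iio] at hi hj
      exact h.inj i hi j hj hij)
  simpa using this

/-- The queue of `τ` extends the queue of `σ`. -/
structure Grows (M : ℕ) (σ τ : Store) : Prop where
  queue : Queue M τ
  tl_le : σ.var .tl ≤ τ.var .tl
  eq : ∀ h < σ.var .tl, τ.arr .Q h = σ.arr .Q h
  mono : ∀ e, σ.arr .D e = 1 → τ.arr .D e = 1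

theorem Grows.refl {σ : Store} (h : Queue M σ) : Grows M σ σ :=
  ⟨h, le_rfl, fun _ _ => rfl, fun _ h => h⟩

theorem Grows.trans {σ τ υ : Store} (h : Grows M σ τ) (h' : Grows M τ υ) : Grows M σ υ :=
  ⟨h'.queue, h.tl_le.trans h'.tl_le, fun i hi => (h'.eq i (hi.trans_le h.tl_le)).trans (h.eq i hi),
    fun e he => h'.mono e (h.mono e he)⟩

theorem Grows.of_eq {σ τ : Store} (h : Queue M σ) (hD : τ.arr .D = σ.arr .D)
    (hQ : τ.arr .Q = σ.arr .Q) (ht : τ.var .tl = σ.var .tl) : Grows M σ τ :=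
  ⟨h.of_eq hD hQ ht, ht.ge, fun _ _ => by rw [hQ], fun _ h => by rwa [hD]⟩

theorem pair_lt {x y : ℕ} (hx : x < M) (hy : y < M) : x * M + y < M * M := by
  have : (x + 1) * M ≤ M * M := Nat.mul_le_mul_right _ hx
  rw [Nat.succ_mul] at this
  omega

theorem addPair_spec (hU : B + 16 * U + 16 < W) {σ : Store} {x y : ℕ} (h : Queue M σ)
    (hM : σ.var .M = M) (hx : σ.var .ax = x) (hy : σ.var .ay = y) (hxM : x < M) (hyM : y < M)
    (hMU : M * M + 1 ≤ U) :
    addPair.Spec W B σ 60 fun τ => Grows M σ τ ∧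
      τ.arr .D = Function.update (σ.arr .D) (x * M + y) 1 := by
  have hlt := pair_lt hxM hyM
  have htl := h.tl_le
  have hone := h.le_one (x * M + y)
  have key : ∀ τ : Store, σ.arr .D (x * M + y) = 0 →
      τ.arr .D = Function.update (σ.arr .D) (x * M + y) 1 →
      τ.arr .Q = Function.update (σ.arr .Q) (σ.var .tl) (x * M + y) →
      τ.var .tl = σ.var .tl + 1 → Grows M σ τ := by
    intro τ h0 hD hQ ht
    have hQ' : ∀ h < σ.var .tl, τ.arr .Q h = σ.arr .Q h := by
      intro i hi; rw [hQ, Function.update_of_ne hi.ne]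
    have hQt : τ.arr .Q (σ.var .tl) = x * M + y := by rw [hQ, Function.update_self]
    have hD' : ∀ e, e ≠ x * M + y → τ.arr .D e = σ.arr .D e := by
      intro e he; rw [hD, Function.update_of_ne he]
    have hDe : τ.arr .D (x * M + y) = 1 := by rw [hD, Function.update_self]
    have hne : ∀ i < σ.var .tl, σ.arr .Q i ≠ x * M + y := by
      intro i hi he
      have := h.marked i hi
      rw [he] at this
      omega
    refine ⟨⟨?_, ?_, ?_, ?_, ?_⟩, by omega, hQ', ?_⟩
    · intro e
      by_cases he : e = x * M + y
      · rw [he, hDe]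
      · rw [hD' e he]; exact h.le_one e
    · intro e h1
      by_cases he : e = x * M + y
      · rwa [he]
      · rw [hD' e he] at h1; exact h.lt e h1
    · intro e h1
      by_cases he : e = x * M + y
      · exact ⟨σ.var .tl, by omega, by rw [hQt, he]⟩
      · rw [hD' e he] at h1
        obtain ⟨i, hi, hi'⟩ := h.queued e h1
        exact ⟨i, by omega, by rw [hQ' i hi, hi']⟩
    · intro i hi
      rw [ht] at hi
      rcases Nat.lt_succ_iff_lt_or_eq.1 hi with hi | rfl
      · rw [hQ' i hi, hD' _ (hne i hi)]
        exact h.marked i hi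
      · rw [hQt, hDe]
    · intro i hi j hj hij
      rw [ht] at hi hj
      rcases Nat.lt_succ_iff_lt_or_eq.1 hi with hi | rfl <;>
        rcases Nat.lt_succ_iff_lt_or_eq.1 hj with hj | rfl
      · rw [hQ' i hi, hQ' j hj] at hij
        exact h.inj i hi j hj hij
      · rw [hQ' i hi, hQt] at hij
        exact absurd hij (hne i hi)
      · rw [hQ' j hj, hQt] at hij
        exact absurd hij.symm (hne j hj)
      · rfl
    · intro e h1
      rw [hD' e (by rintro rfl; omega)]; exact h1
  refine Spec.seq (T₁ := 10) (T₂ := 50) (P₁ := fun τ => τ = σ.set .ed (x * M + y))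
    (Spec.assign ?_ ?_ ?_) ?_ (by omega)
  · simp [hx, hy, hM]; omega
  · simp
  · simp [hx, hy, hM]
  rintro _ - rfl
  refine Spec.ite (T' := 35) (by simp; omega) (by simp) ?_ ?_
  · intro hc
    simp at hc
    simp [Stmt.Spec, wp, Store.put_arr, Store.set_var]
    refine ⟨by omega, by omega, by omega, by omega, key _ hc ?_ ?_ ?_⟩
    · simp [Store.put_arr]
    · simp [Store.put_arr]
    · simp
  · intro hc
    simp at hc
    refine Spec.skip (by omega) ⟨Grows.of_eq h rfl rfl (by simp [Store.set_var]), ?_⟩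
    rw [Store.set_arr, Function.update_eq_self_iff.2 (by omega)]

/-! ### Initial pairs -/

/-- The tables are in the memory. -/
structure Loaded (T : Tables) (σ : Store) : Prop where
  len : σ.var .len = T.len
  count : σ.var .CN = T.count
  nodes : σ.var .N = T.nodes
  items : σ.var .M = T.items
  pairs : σ.var .MM = T.items * T.items
  axCount : σ.var .k = T.axCount
  tok : σ.arr .E = T.tok
  sym : σ.arr .KD = T.sym
  src : σ.arr .G = T.src
  kind : σ.arr .IK = T.kind
  left : σ.arr .IA = T.left
  right : σ.arr .IB = T.right
  dual : σ.arr .BAR = T.dual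
  partA : σ.arr .AXA = T.partA
  partB : σ.arr .AXB = T.partB

/-- The phases before the answer only read the tables; the side conditions are decided from the
syntax of `c`. -/
theorem Loaded.of_frame {T : Tables} {σ τ : Store} {c : Stmt} (h : Loaded T σ) (hf : c.Frame σ τ)
    (hv : ([.len, .CN, .N, .M, .MM, .k] : List Var).all (fun x => !c.writesVar x) = true)
    (ha : ([.E, .KD, .G, .IK, .IA, .IB, .BAR, .AXA, .AXB] : List Arr).all
      (fun a => !c.writesArr a) = true) : Loaded T τ := by
  simp only [List.all_cons, List.all_nil, Bool.and_true, Bool.and_eq_true, Bool.not_eq_true'] at hv ha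
  obtain ⟨v₁, v₂, v₃, v₄, v₅, v₆⟩ := hv
  obtain ⟨a₁, a₂, a₃, a₄, a₅, a₆, a₇, a₈, a₉⟩ := ha
  obtain ⟨h₁, h₂, h₃, h₄, h₅, h₆, h₇, h₈, h₉, k₁, k₂, k₃, k₄, k₅, k₆⟩ := h
  exact ⟨(hf.var _ v₁).trans h₁, (hf.var _ v₂).trans h₂, (hf.var _ v₃).trans h₃,
    (hf.var _ v₄).trans h₄, (hf.var _ v₅).trans h₅, (hf.var _ v₆).trans h₆,
    (hf.arr _ a₁).trans h₇, (hf.arr _ a₂).trans h₈, (hf.arr _ a₃).trans h₉,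
    (hf.arr _ a₄).trans k₁, (hf.arr _ a₅).trans k₂, (hf.arr _ a₆).trans k₃,
    (hf.arr _ a₇).trans k₄, (hf.arr _ a₈).trans k₅, (hf.arr _ a₉).trans k₆⟩

theorem Loaded.set {T : Tables} {σ : Store} (h : Loaded T σ) {x : Var} (n : ℕ)
    (hx : x ∉ ([.len, .CN, .N, .M, .MM, .k] : List Var)) : Loaded T (σ.set x n) := by
  simp only [List.mem_cons, List.not_mem_nil, or_false, not_or] at hx
  obtain ⟨v₁, v₂, v₃, v₄, v₅, v₆⟩ := hx
  obtain ⟨h₁, h₂, h₃, h₄, h₅, h₆, h₇, h₈, h₉, k₁, k₂, k₃, k₄, k₅, k₆⟩ := h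
  refine ⟨?_, ?_, ?_, ?_, ?_, ?_, h₇, h₈, h₉, k₁, k₂, k₃, k₄, k₅, k₆⟩
  all_goals rw [Store.set_var, if_neg (Ne.symm ‹_›)]; assumption

variable {T : Tables}

/-- The entries of the atom at the node `x` are found below `U`. -/
structure Tables.AtomBound (T : Tables) (U x : ℕ) : Prop where
  pred : T.src (x + 1) ≤ U
  arity : T.src (x + 2) ≤ U
  arity_le : T.tok (T.src (x + 2)) ≤ T.len
  args : ∀ i < T.tok (T.src (x + 2)), T.src (x + 3 + 2 * i) + 1 ≤ U

/-- The atoms at the nodes `x` and `y` agree up to argument number `n`. -/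
def Tables.SameUpTo (T : Tables) (x y n : ℕ) : Prop :=
  T.tok (T.src (x + 1)) = T.tok (T.src (y + 1)) ∧ T.tok (T.src (x + 2)) = T.tok (T.src (y + 2)) ∧
    ∀ i < n, T.tok (T.src (x + 3 + 2 * i)) = T.tok (T.src (y + 3 + 2 * i)) ∧
      T.tok (T.src (x + 3 + 2 * i) + 1) = T.tok (T.src (y + 3 + 2 * i) + 1)

theorem compareArg_spec (hU : B + 16 * U + 16 < W) {σ : Store} {x y a : ℕ} (h : Loaded T σ)
    (hx : σ.var .x = x) (hy : σ.var .y = y) (ha : σ.var .a = a)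
    (hxb : T.AtomBound U x) (hyb : T.AtomBound U y) (haa : a < T.tok (T.src (x + 2)))
    (hxU : x + 2 * T.len + 8 ≤ U) (hyU : y + 2 * T.len + 8 ≤ U)
    (hbad : σ.var .bad = 0 ↔ T.SameUpTo x y a) :
    compareArg.Spec W B σ 120 fun τ => τ.var .bad = 0 ↔ T.SameUpTo x y (a + 1) := by
  have hsucc : T.SameUpTo x y (a + 1) ↔ T.SameUpTo x y a ∧
      T.tok (T.src (x + 3 + 2 * a)) = T.tok (T.src (y + 3 + 2 * a)) ∧
      T.tok (T.src (x + 3 + 2 * a) + 1) = T.tok (T.src (y + 3 + 2 * a) + 1) := by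
    constructor
    · rintro ⟨h₁, h₂, h₃⟩
      exact ⟨⟨h₁, h₂, fun i hi => h₃ i (by omega)⟩, h₃ a (by omega)⟩
    · rintro ⟨⟨h₁, h₂, h₃⟩, h₄⟩
      refine ⟨h₁, h₂, fun i hi => ?_⟩
      rcases Nat.lt_succ_iff_lt_or_eq.1 hi with hi | rfl
      exacts [h₃ i hi, h₄]
  have hle := hxb.arity_le
  rw [hsucc, ← hbad]
  refine Spec.ite (T' := 110) (by simp; omega) (by simp) ?_ ?_
  · intro h0
    simp at h0
    have hs := hbad.1 h0
    have hxa := hxb.args a haa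
    -- Arguments are compared only while no difference has been found. In that case the arities
    -- agree, so the atom at `y` has an argument number `a` too and its address is in range.
    have hya := hyb.args a (by rw [← hs.2.1]; exact haa)
    simp [Stmt.Spec, wp, Store.set_var, hx, hy, ha, h.src, h.tok, h0]
    refine ⟨by omega, by omega, by omega, fun h₁ => ⟨by omega, by omega, ?_⟩,
      fun h₁ => ⟨by omega, by omega, by omega, ?_⟩⟩
    · intro h₂; omega
    · intro h₂; omega
  · intro h0
    simp at h0
    exact Spec.skip (by omega) (by simp [h0])

theorem compareAtoms_spec (hU : B + 16 * U + 16 < W) {σ : Store} {x y : ℕ} (h : Loaded T σ)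
    (hx : σ.var .x = x) (hy : σ.var .y = y) (har : σ.var .ar = T.tok (T.src (x + 2)))
    (hxb : T.AtomBound U x) (hyb : T.AtomBound U y)
    (hxU : x + 2 * T.len + 8 ≤ U) (hyU : y + 2 * T.len + 8 ≤ U) :
    compareAtoms.Spec W B σ (123 * T.len + 200) fun τ => τ.var .bad = 0 ↔ T.SameAtom x y := by
  have h₁ := hxb.pred
  have h₂ := hxb.arity
  have h₃ := hyb.pred
  have h₄ := hyb.arity
  have h₅ := hxb.arity_le
  refine Spec.seq (T₁ := 10) (T₂ := 123 * T.len + 190) (P₁ := fun τ => τ = σ.set .bad 0)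
    (Spec.assign ?_ ?_ ?_) ?_ (by omega)
  · simp; omega
  · simp
  · simp
  rintro _ - rfl
  refine Spec.seq (T₁ := 60) (T₂ := 123 * T.len + 130) (P₁ := fun τ => τ.var .bad = 0 ↔
    T.tok (T.src (x + 1)) = T.tok (T.src (y + 1))) ?_ ?_ (by omega)
  · simp [Stmt.Spec, wp, Store.set_var, hx, hy, h.src, h.tok]
    omega
  intro τ hf hτ
  have hL := (h.set (x := .bad) 0 (by decide)).of_frame hf (by decide) (by decide)
  have hxτ : τ.var .x = x := (hf.var _ (by decide)).trans (by simpa [Store.set_var] using hx)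
  have hyτ : τ.var .y = y := (hf.var _ (by decide)).trans (by simpa [Store.set_var] using hy)
  have harτ : τ.var .ar = T.tok (T.src (x + 2)) :=
    (hf.var _ (by decide)).trans (by simpa [Store.set_var] using har)
  refine Spec.seq (T₁ := 60) (T₂ := 123 * T.len + 70) (P₁ := fun υ => υ.var .bad = 0 ↔
    T.SameUpTo x y 0) ?_ ?_ (by omega)
  · simp [Stmt.Spec, wp, hxτ, hyτ, hL.src, hL.tok, Tables.SameUpTo]
    refine ⟨by omega, fun h => ?_, fun h => ⟨by omega, fun _ => h⟩⟩
    rw [hτ]; simp [h]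
  intro υ hf' hυ
  have hL' := hL.of_frame hf' (by decide) (by decide)
  have hxυ : υ.var .x = x := (hf'.var _ (by decide)).trans hxτ
  have hyυ : υ.var .y = y := (hf'.var _ (by decide)).trans hyτ
  have harυ : υ.var .ar = T.tok (T.src (x + 2)) := (hf'.var _ (by decide)).trans harτ
  refine Spec.loop (T₀ := 120) (fun a ρ => ρ.var .bad = 0 ↔ T.SameUpTo x y a) (by omega) hυ ?_
    (by rw [harυ]; omega) ?_
  · intro a ρ ha hf'' hρ
    rw [harυ] at ha
    refine compareArg_spec hU (x := x) (y := y) (a := a)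
      ((hL'.of_frame hf'' (by decide) (by decide)).set (x := .a) a (by decide)) ?_ ?_ (by simp) hxb
      hyb ha hxU hyU (by simpa [Store.set_var] using hρ)
    · rw [Store.set_var, if_neg (by decide), hf''.var _ (by decide), hxυ]
    · rw [Store.set_var, if_neg (by decide), hf''.var _ (by decide), hyυ]
  · intro ρ _ hρ
    rw [harυ] at hρ
    rw [Store.set_var, if_neg (by decide)]
    exact hρ

end EPROL

/-! ### Marking the hypotheses for atoms and the instances of axioms. -/

namespace EPROL

open Stmt

variable {W B U M : ℕ} {T : Tables}

/-- The pairs in `τ` are those in `σ` and those in `S`. -/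
structure Adds (M : ℕ) (σ τ : Store) (S : ℕ → Prop) : Prop where
  grows : Grows M σ τ
  sound : ∀ e, τ.arr .D e = 1 → σ.arr .D e = 1 ∨ S e
  complete : ∀ e, S e → τ.arr .D e = 1

theorem Adds.congr {σ τ : Store} {S S' : ℕ → Prop} (h : Adds M σ τ S) (hS : ∀ e, S e ↔ S' e) :
    Adds M σ τ S' := by
  rwa [show S' = S from funext fun e => propext (hS e).symm]

theorem Adds.of_eq {σ τ : Store} {S : ℕ → Prop} (h : Queue M σ) (hD : τ.arr .D = σ.arr .D)
    (hQ : τ.arr .Q = σ.arr .Q) (ht : τ.var .tl = σ.var .tl) (hS : ∀ e, ¬ S e) : Adds M σ τ S :=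
  ⟨Grows.of_eq h hD hQ ht, fun e he => .inl (by rwa [← hD]), fun e he => absurd he (hS e)⟩

theorem Adds.of_frame {σ σ' τ : Store} {S : ℕ → Prop} {c : Stmt} (h : Adds M σ' τ S)
    (hf : c.Frame σ σ') (hD : c.writesArr .D = false) (hQ : c.writesArr .Q = false)
    (ht : c.writesVar .tl = false) : Adds M σ τ S := by
  obtain ⟨⟨h₁, h₂, h₃, h₄⟩, h₅, h₆⟩ := h
  rw [hf.var _ ht] at h₂ h₃
  rw [hf.arr _ hQ] at h₃
  rw [hf.arr _ hD] at h₄ h₅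
  exact ⟨⟨h₁, h₂, h₃, h₄⟩, h₅, h₆⟩

theorem Queue.set {σ : Store} (h : Queue M σ) {x : Var} (hx : .tl ≠ x) (n : ℕ) :
    Queue M (σ.set x n) := h.of_eq rfl rfl (by rw [Store.set_var, if_neg hx])

theorem Adds.of_set {σ τ : Store} {S : ℕ → Prop} {x : Var} (hx : .tl ≠ x) {n : ℕ}
    (h : Adds M (σ.set x n) τ S) : Adds M σ τ S := by
  obtain ⟨⟨h₁, h₂, h₃, h₄⟩, h₅, h₆⟩ := h
  rw [Store.set_var, if_neg hx] at h₂ h₃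
  exact ⟨⟨h₁, h₂, h₃, h₄⟩, h₅, h₆⟩

theorem Adds.set_right {σ τ : Store} {S : ℕ → Prop} (h : Adds M σ τ S) {x : Var} (hx : .tl ≠ x)
    (n : ℕ) : Adds M σ (τ.set x n) S := by
  obtain ⟨⟨h₁, h₂, h₃, h₄⟩, h₅, h₆⟩ := h
  refine ⟨⟨h₁.set hx n, ?_, h₃, h₄⟩, h₅, h₆⟩
  rwa [Store.set_var, if_neg hx]

theorem Adds.of_pair {σ τ : Store} {n : ℕ} (h : Grows M σ τ)
    (hD : τ.arr .D = Function.update (σ.arr .D) n 1) : Adds M σ τ (· = n) := by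
  refine ⟨h, fun e he => ?_, ?_⟩
  · by_cases hen : e = n
    · exact .inr hen
    · rw [hD, Function.update_of_ne hen] at he; exact .inl he
  · rintro _ rfl
    rw [hD, Function.update_self]

/-- This works because the pairs added in round `i` do not depend on the store. The saturation,
where they do, needs invariants instead. -/
theorem Spec.loop_adds {x b : Var} {c : Stmt} {σ : Store} {t₀ n : ℕ} {S : ℕ → ℕ → Prop}
    (hb : σ.var b = n) (hn : n < W) (hx : Var.tl ≠ x) (hσ : Queue M σ)
    (h : ∀ i τ, i < n → (Stmt.loop x b c).Frame σ τ → Queue M τ →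
      c.Spec W B (τ.set x i) t₀ fun υ => Adds M (τ.set x i) υ (S i)) :
    (Stmt.loop x b c).Spec W B σ (n * (t₀ + 3) + 2) fun τ => Adds M σ τ fun e => ∃ i < n, S i e := by
  refine Spec.loop (T₀ := t₀) (fun j τ => Adds M σ τ fun e => ∃ i < j, S i e) (by omega)
    (Adds.of_eq hσ rfl rfl rfl (by simp)) ?_ (by rw [hb]) ?_
  · intro i τ hi hf hA
    rw [hb] at hi
    refine (h i τ hi hf hA.grows.queue).mono le_rfl fun υ _ hυ => ?_
    have hυ := hυ.of_set hx
    refine ⟨hA.grows.trans hυ.grows, fun e he => ?_, ?_⟩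
    · rcases hυ.sound e he with h | h
      · exact (hA.sound e h).imp_right fun ⟨j, hj, hS⟩ => ⟨j, by omega, hS⟩
      · exact .inr ⟨i, by omega, h⟩
    · rintro e ⟨j, hj, hS⟩
      rcases Nat.lt_succ_iff_lt_or_eq.1 hj with hj | rfl
      · exact hυ.grows.mono e (hA.complete e ⟨j, hj, hS⟩)
      · exact hυ.complete e hS
  · intro τ _ hA
    rw [hb] at hA
    exact hA.set_right hx _

theorem Tables.items_sq_ge (T : Tables) : T.items ≤ T.items * T.items := Nat.le_mul_self _

/-- The bounds needed for the phases after the construction of the tables. -/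
structure Tables.Bound (T : Tables) (U : ℕ) : Prop where
  pairs : T.items * T.items + 2 * T.len + 16 ≤ U
  atoms : ∀ x < T.nodes, T.sym (x % T.len) = 1 → T.AtomBound U x

theorem hypInner_spec (hU : B + 16 * U + 16 < W) (hT : T.Bound U) {σ : Store} {x y : ℕ}
    (h : Loaded T σ) (hq : Queue T.items σ) (hx : σ.var .x = x) (hy : σ.var .y = y)
    (hxn : x < T.nodes) (hyn : y < T.nodes) (hsx : T.sym (x % T.len) = 1)
    (har : σ.var .ar = T.tok (T.src (x + 2))) :
    hypInner.Spec W B σ (123 * T.len + 400) fun τ => Adds T.items σ τ fun e =>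
      T.sym (y % T.len) = 1 ∧ T.SameAtom x y ∧ e = (2 * x + 1) * T.items + (2 * y + 2) := by
  have h₁ := T.items_sq_ge
  have h₂ := hT.pairs
  have h₃ : T.items = 2 * T.nodes + 1 := rfl
  have h₄ := Nat.div_le_self y T.len
  have h₅ := Nat.div_mul_le_self y T.len
  have h₆ := Nat.mod_le y T.len
  refine Spec.seq (T₁ := 30) (T₂ := 123 * T.len + 370) (P₁ := fun τ => τ = σ.set .p' (y % T.len))
    (Spec.assign ?_ ?_ ?_) ?_ (by omega)
  · simp [hy, h.len]; omega
  · simp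
  · simp [hy, h.len, ← Nat.mod_eq_sub_div_mul]
  rintro _ - rfl
  have hq' := hq.set (x := .p') (by decide) (y % T.len)
  have hL := h.set (x := .p') (y % T.len) (by decide)
  have hx' : (σ.set .p' (y % T.len)).var .x = x := by simpa [Store.set_var] using hx
  have hy' : (σ.set .p' (y % T.len)).var .y = y := by simpa [Store.set_var] using hy
  have har' : (σ.set .p' (y % T.len)).var .ar = T.tok (T.src (x + 2)) := by
    simpa [Store.set_var] using har
  have hp : (σ.set .p' (y % T.len)).var .p' = y % T.len := by simp
  refine Stmt.Spec.mono (T := 123 * T.len + 370)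
    (P := fun τ => Adds T.items (σ.set .p' (y % T.len)) τ fun e =>
      T.sym (y % T.len) = 1 ∧ T.SameAtom x y ∧ e = (2 * x + 1) * T.items + (2 * y + 2)) ?_ le_rfl
    (fun τ _ hτ => hτ.of_set (by decide))
  generalize σ.set .p' (y % T.len) = σ at *
  refine Spec.ite (T' := 123 * T.len + 340) (by simp [hp]; omega) (by simp) ?_ ?_
  swap
  · intro hc
    simp [hp, hL.sym] at hc
    exact Spec.skip (by omega) (Adds.of_eq hq' rfl rfl rfl fun e he => hc he.1)
  intro hc
  simp [hp, hL.sym] at hc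
  refine Spec.seq (T₂ := 130) (compareAtoms_spec hU hL hx' hy' har' (hT.atoms x hxn hsx)
    (hT.atoms y hyn hc) (by omega) (by omega)) ?_ (by omega)
  intro τ hf hbad
  have hq₁ := hq'.of_eq (hf.arr _ (by decide)) (hf.arr _ (by decide)) (hf.var _ (by decide))
  have hL₁ := hL.of_frame hf (by decide) (by decide)
  have hx₁ : τ.var .x = x := (hf.var _ (by decide)).trans hx'
  have hy₁ : τ.var .y = y := (hf.var _ (by decide)).trans hy'
  refine Stmt.Spec.mono (T := 130) (P := fun υ => Adds T.items τ υ fun e =>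
      T.sym (y % T.len) = 1 ∧ T.SameAtom x y ∧ e = (2 * x + 1) * T.items + (2 * y + 2)) ?_ le_rfl
    (fun υ _ hυ => hυ.of_frame hf (by decide) (by decide) (by decide))
  refine Spec.ite (T' := 120) (by simp; omega) (by simp) ?_ ?_
  swap
  · intro h0
    simp at h0
    exact Spec.skip (by omega) (Adds.of_eq hq₁ rfl rfl rfl fun e he => h0 (hbad.2 he.2.1))
  intro h0
  simp at h0
  refine Spec.seq (T₁ := 20) (T₂ := 100) (P₁ := fun υ => υ = τ.set .ax (2 * x + 1))
    (Spec.assign ?_ ?_ ?_) ?_ (by omega)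
  · simp [hx₁]; omega
  · simp
  · simp [hx₁]
  rintro _ - rfl
  refine Spec.seq (T₁ := 20) (T₂ := 80)
    (P₁ := fun υ => υ = (τ.set .ax (2 * x + 1)).set .ay (2 * y + 2))
    (Spec.assign ?_ ?_ ?_) ?_ (by omega)
  · simp [Store.set_var, hy₁]; omega
  · simp
  · simp [Store.set_var, hy₁]
  rintro _ - rfl
  refine (addPair_spec hU (x := 2 * x + 1) (y := 2 * y + 2)
    ((hq₁.set (x := .ax) (by decide) _).set (x := .ay) (by decide) _)
    ((hL₁.set (x := .ax) _ (by decide)).set (x := .ay) _ (by decide)).items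
    (by simp [Store.set_var]) (by simp) (by omega) (by omega) (by omega)).mono (by omega) ?_
  rintro υ _ ⟨hg, hD⟩
  refine (((Adds.of_pair hg hD).of_set (by decide)).of_set (by decide)).congr fun e => ?_
  exact ⟨fun he => ⟨hc, hbad.1 h0, he⟩, fun he => he.2.2⟩

theorem hypBody_spec (hU : B + 16 * U + 16 < W) (hT : T.Bound U) {σ : Store} {x : ℕ}
    (h : Loaded T σ) (hq : Queue T.items σ) (hx : σ.var .x = x) (hxn : x < T.nodes) :
    hypBody.Spec W B σ (T.nodes * (123 * T.len + 403) + 100) fun τ => Adds T.items σ τ fun e =>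
      T.sym (x % T.len) = 1 ∧ ∃ y < T.nodes, T.sym (y % T.len) = 1 ∧ T.SameAtom x y ∧
        e = (2 * x + 1) * T.items + (2 * y + 2) := by
  have h₁ := T.items_sq_ge
  have h₂ := hT.pairs
  have h₃ : T.items = 2 * T.nodes + 1 := rfl
  have h₄ := Nat.div_le_self x T.len
  have h₅ := Nat.div_mul_le_self x T.len
  have h₆ := Nat.mod_le x T.len
  refine Spec.seq (T₁ := 30) (T₂ := T.nodes * (123 * T.len + 403) + 70)
    (P₁ := fun τ => τ = σ.set .p (x % T.len)) (Spec.assign ?_ ?_ ?_) ?_ (by omega)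
  · simp [hx, h.len]; omega
  · simp
  · simp [hx, h.len, ← Nat.mod_eq_sub_div_mul]
  rintro _ - rfl
  refine Spec.ite (T' := T.nodes * (123 * T.len + 403) + 50) (by simp; omega) (by simp) ?_ ?_
  swap
  · intro hc
    simp [h.sym] at hc
    exact Spec.skip (by omega) (Adds.of_set (by decide)
      (Adds.of_eq (hq.set (x := .p) (by decide) _) rfl rfl rfl fun e he => hc he.1))
  intro hc
  simp [h.sym] at hc
  have hb := hT.atoms x hxn hc
  refine Spec.seq (T₁ := 40) (T₂ := T.nodes * (123 * T.len + 403) + 2)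
    (P₁ := fun τ => τ = (σ.set .p (x % T.len)).set .ar (T.tok (T.src (x + 2))))
    (Spec.assign ?_ ?_ ?_) ?_ (by omega)
  · have := hb.arity
    simp [Store.set_var, hx, h.src]; omega
  · simp
  · simp [Store.set_var, hx, h.src, h.tok]
  rintro _ - rfl
  have hL := (h.set (x := .p) (x % T.len) (by decide)).set (x := .ar) (T.tok (T.src (x + 2)))
    (by decide)
  have hq' := (hq.set (x := .p) (by decide) (x % T.len)).set (x := .ar) (by decide)
    (T.tok (T.src (x + 2)))
  have hx' : ((σ.set .p (x % T.len)).set .ar (T.tok (T.src (x + 2)))).var .x = x := by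
    simpa [Store.set_var] using hx
  have har' : ((σ.set .p (x % T.len)).set .ar (T.tok (T.src (x + 2)))).var .ar =
    T.tok (T.src (x + 2)) := by simp
  refine Stmt.Spec.mono (Spec.loop_adds (t₀ := 123 * T.len + 400) (M := T.items)
    (S := fun y e => T.sym (y % T.len) = 1 ∧ T.SameAtom x y ∧
      e = (2 * x + 1) * T.items + (2 * y + 2)) hL.nodes (by omega) (by decide) hq' ?_)
    (by norm_num [Nat.add_assoc]) ?_
  · intro y τ hy hf hqτ
    refine hypInner_spec hU hT ((hL.of_frame hf (by decide) (by decide)).set _ (by decide))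
      (hqτ.set (by decide) _) ?_ (by simp) hxn hy hc ?_
    · rw [Store.set_var, if_neg (by decide), hf.var _ (by decide), hx']
    · rw [Store.set_var, if_neg (by decide), hf.var _ (by decide), har']
  · intro τ _ hτ
    refine ((hτ.of_set (by decide)).of_set (by decide)).congr fun e => ?_
    simp [hc]

/-- Equal atoms at different nodes are never merged; they are linked by hypotheses between all such
nodes. The comparison costs O(N² · len), which is below the cube of the number of items as soon as
`len` does not exceed that number. -/
theorem hypPhase_spec (hU : B + 16 * U + 16 < W) (hT : T.Bound U) {σ : Store}
    (h : Loaded T σ) (hq : Queue T.items σ) :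
    hypPhase.Spec W B σ (T.nodes * (T.nodes * (123 * T.len + 403) + 103) + 2) fun τ =>
      Adds T.items σ τ fun e => ∃ x < T.nodes, T.sym (x % T.len) = 1 ∧ ∃ y < T.nodes,
        T.sym (y % T.len) = 1 ∧ T.SameAtom x y ∧ e = (2 * x + 1) * T.items + (2 * y + 2) := by
  have h₁ := T.items_sq_ge
  have h₂ := hT.pairs
  have h₃ : T.items = 2 * T.nodes + 1 := rfl
  refine Spec.loop_adds h.nodes (by omega) (by decide) hq ?_
  intro x τ hx hf hqτ
  exact hypBody_spec hU hT ((h.of_frame hf (by decide) (by decide)).set _ (by decide))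
    (hqτ.set (by decide) _) (by simp) hx

theorem axBody_spec (hU : B + 16 * U + 16 < W) (hT : T.Bound U) {σ : Store} {s c : ℕ}
    (h : Loaded T σ) (hq : Queue T.items σ) (hs : σ.var .s = s) (hc : σ.var .c = c)
    (hsU : s + 1 ≤ U) (hcn : c < T.count) (ha : T.item c (T.partA (s + 1)) < T.items)
    (hb : T.item c (T.partB (s + 1)) < T.items) :
    axBody.Spec W B σ 200 fun τ => Adds T.items σ τ fun e =>
      e = T.item c (T.partA (s + 1)) * T.items + T.item c (T.partB (s + 1)) := by
  have h₁ := T.items_sq_ge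
  have h₂ := hT.pairs
  have h₃ : T.items = 2 * T.nodes + 1 := rfl
  have h₄ : c * T.len ≤ T.nodes := by
    unfold Tables.nodes; rw [Nat.mul_comm]; exact Nat.mul_le_mul_left _ hcn.le
  have hitem : ∀ n, T.item c n = if n = 0 then 0 else n + 2 * (c * T.len) := fun n => rfl
  rw [hitem] at ha hb
  have ha' : T.partA (s + 1) + 2 * (c * T.len) < T.items + 2 * T.nodes + 1 := by
    split_ifs at ha <;> omega
  have hb' : T.partB (s + 1) + 2 * (c * T.len) < T.items + 2 * T.nodes + 1 := by
    split_ifs at hb <;> omega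
  rw [← hitem] at ha hb
  refine Spec.seq (T₁ := 20) (T₂ := 180) (P₁ := fun τ => τ = σ.set .ax (T.partA (s + 1)))
    (Spec.assign ?_ ?_ ?_) ?_ (by omega)
  · simp [hs]; omega
  · simp
  · simp [hs, h.partA]
  rintro _ - rfl
  refine Spec.seq (T₁ := 40) (T₂ := 140)
    (P₁ := fun τ => τ.var .ax = T.item c (T.partA (s + 1))) ?_ ?_ (by omega)
  · rw [hitem]
    simp [Stmt.Spec, wp, Store.set_var, h.len, hc]
    refine ⟨by omega, fun h0 => by simp [h0], fun h0 => ?_⟩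
    simp [h0]; omega
  intro σ₁ hf₁ hax
  have hL₁ := (h.set (x := .ax) (T.partA (s + 1)) (by decide)).of_frame hf₁ (by decide) (by decide)
  have hs₁ : σ₁.var .s = s := (hf₁.var _ (by decide)).trans (by simpa [Store.set_var] using hs)
  have hc₁ : σ₁.var .c = c := (hf₁.var _ (by decide)).trans (by simpa [Store.set_var] using hc)
  have hq₁ : Queue T.items σ₁ := (hq.set (x := .ax) (by decide) (T.partA (s + 1))).of_eq
    (hf₁.arr _ (by decide)) (hf₁.arr _ (by decide)) (hf₁.var _ (by decide))
  refine Stmt.Spec.mono (T := 140) (P := fun τ => Adds T.items σ₁ τ fun e =>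
      e = T.item c (T.partA (s + 1)) * T.items + T.item c (T.partB (s + 1))) ?_ le_rfl
    (fun τ _ hτ => Adds.of_set (by decide)
      (hτ.of_frame hf₁ (by decide) (by decide) (by decide)))
  refine Spec.seq (T₁ := 20) (T₂ := 120) (P₁ := fun τ => τ = σ₁.set .ay (T.partB (s + 1)))
    (Spec.assign ?_ ?_ ?_) ?_ (by omega)
  · simp [hs₁]; omega
  · simp
  · simp [hs₁, hL₁.partB]
  rintro _ - rfl
  refine Spec.seq (T₁ := 40) (T₂ := 80)
    (P₁ := fun τ => τ.var .ay = T.item c (T.partB (s + 1))) ?_ ?_ (by omega)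
  · rw [hitem]
    simp [Stmt.Spec, wp, Store.set_var, hL₁.len, hc₁]
    refine ⟨by omega, fun h0 => by simp [h0], fun h0 => ?_⟩
    simp [h0]; omega
  intro σ₂ hf₂ hay
  have hL₂ := (hL₁.set (x := .ay) (T.partB (s + 1)) (by decide)).of_frame hf₂ (by decide) (by decide)
  have hq₂ : Queue T.items σ₂ := (hq₁.set (x := .ay) (by decide) (T.partB (s + 1))).of_eq
    (hf₂.arr _ (by decide)) (hf₂.arr _ (by decide)) (hf₂.var _ (by decide))
  have hax₂ : σ₂.var .ax = T.item c (T.partA (s + 1)) :=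
    (hf₂.var _ (by decide)).trans (by simpa [Store.set_var] using hax)
  refine (addPair_spec hU hq₂ hL₂.items hax₂ hay ha hb (by omega)).mono (by omega) ?_
  rintro υ _ ⟨hg, hD⟩
  exact Adds.of_set (by decide) ((Adds.of_pair hg hD).of_frame hf₂ (by decide) (by decide)
    (by decide))

theorem axPhase_spec (hU : B + 16 * U + 16 < W) (hT : T.Bound U) {σ : Store}
    (h : Loaded T σ) (hq : Queue T.items σ) (hk : T.axCount ≤ T.len) (hcount : T.count ≤ U)
    (ha : ∀ s < T.axCount, ∀ c < T.count, T.item c (T.partA (s + 1)) < T.items ∧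
      T.item c (T.partB (s + 1)) < T.items) :
    axPhase.Spec W B σ (T.count * (T.axCount * 203 + 5) + 2) fun τ =>
      Adds T.items σ τ fun e => ∃ c < T.count, ∃ s < T.axCount,
        e = T.item c (T.partA (s + 1)) * T.items + T.item c (T.partB (s + 1)) := by
  have h₂ := hT.pairs
  refine Spec.loop_adds h.count (by omega) (by decide) hq ?_
  intro c τ hc hf hqτ
  have hL := (h.of_frame hf (by decide) (by decide)).set (x := .c) c (by decide)
  have hcτ : (τ.set .c c).var .c = c := by simp
  have hqτ := hqτ.set (x := .c) (by decide) c
  generalize τ.set .c c = τ at *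
  refine Spec.loop_adds hL.axCount (by omega) (by decide) hqτ ?_
  intro s υ hs hf' hqυ
  refine axBody_spec hU hT ((hL.of_frame hf' (by decide) (by decide)).set _ (by decide))
    (hqυ.set (by decide) _) (by simp) ?_ (by omega) hc (ha s hs c hc).1 (ha s hs c hc).2
  rw [Store.set_var, if_neg (by decide), hf'.var _ (by decide), hcτ]

end EPROL

namespace EPROL

open Stmt

variable {W B U : ℕ} {T : Tables}

/-! ### Saturation -/

/-- The pairs to be found. -/
def Tables.Derivable (T : Tables) (x y : ℕ) : Prop :=
  Closure T.items T.kind T.left T.right T.dual T.Start x y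

/-- This is all the saturation needs to know about the tables: every pair it looks up is a pair of
items, and the dual is an involution, which lets a cut be found from either of its premises. -/
structure Tables.Ranges (T : Tables) : Prop where
  dual_lt : ∀ z < T.items, T.dual z < T.items
  dual_dual : ∀ z < T.items, T.dual (T.dual z) = z
  left_lt : ∀ z < T.items, T.left z < T.items
  right_lt : ∀ z < T.items, T.right z < T.items
  kind_le : ∀ z < T.items, T.kind z ≤ 2
  start_lt : ∀ x y, T.Start x y → x < T.items ∧ y < T.items

theorem Tables.Ranges.derivable_lt (hT : T.Ranges) {x y : ℕ} (h : T.Derivable x y) :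
    x < T.items ∧ y < T.items := by
  induction h with
  | base h => exact hT.start_lt _ _ h
  | symm _ ih => exact ih.symm
  | weaken hz _ ih => exact ⟨ih.1, hz⟩
  | weaken_zero hz _ ih => exact ⟨ih.1, hz⟩
  | cut _ _ ih₁ ih₂ => exact ⟨ih₁.1, ih₂.2⟩
  | both hz _ _ _ ih _ => exact ⟨ih.1, hz⟩
  | either_left hz _ _ ih => exact ⟨ih.1, hz⟩
  | either_right hz _ _ ih => exact ⟨ih.1, hz⟩

/-- Whether the pair `(x, z)` follows from a pair `(x, y)` with `dual y = yb` and pairs in `D`. -/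
def Tables.Follows (T : Tables) (D : ℕ → ℕ) (x yb w z : ℕ) : Prop :=
  0 < w + D (yb * T.items + z) ∨
    2 < T.kind z + D (x * T.items + T.left z) + D (x * T.items + T.right z)

theorem satInner_spec (hU : B + 16 * U + 16 < W) (hT : T.Ranges) (hb : T.Bound U) {σ : Store}
    {x yb w z : ℕ} (h : Loaded T σ) (hq : Queue T.items σ) (hx : σ.var .x = x) (hax : σ.var .ax = x)
    (hyb : σ.var .yb = yb) (hw : σ.var .w = w) (hz : σ.var .z = z) (hxM : x < T.items)
    (hybM : yb < T.items) (hwU : w ≤ 2) (hzM : z < T.items) :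
    satInner.Spec W B σ 200 fun τ => Adds T.items σ τ fun e =>
      e = x * T.items + z ∧ T.Follows (σ.arr .D) x yb w z := by
  have h₂ := hb.pairs
  have h₃ := pair_lt hybM hzM
  have h₄ := pair_lt hxM (hT.left_lt z hzM)
  have h₅ := pair_lt hxM (hT.right_lt z hzM)
  have h₆ := hT.left_lt z hzM
  have h₇ := hT.right_lt z hzM
  have h₈ := hT.kind_le z hzM
  have h₉ := T.items_sq_ge
  have k₁ := hq.le_one (yb * T.items + z)
  have k₂ := hq.le_one (x * T.items + T.left z)
  have k₃ := hq.le_one (x * T.items + T.right z)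
  refine Spec.seq (T₁ := 10) (T₂ := 190) (P₁ := fun τ => τ = σ.set .ay z)
    (Spec.assign trivial (by simp) (by simp [hz])) ?_ (by omega)
  rintro _ - rfl
  have hadd : T.Follows (σ.arr .D) x yb w z → addPair.Spec W B (σ.set .ay z) 60 fun τ =>
      Adds T.items σ τ fun e => e = x * T.items + z ∧ T.Follows (σ.arr .D) x yb w z := by
    intro hF
    refine (addPair_spec hU (hq.set (x := .ay) (by decide) z)
      (h.set (x := .ay) z (by decide)).items (by simpa [Store.set_var] using hax) (by simp) hxM hzM
      (by omega)).mono le_rfl ?_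
    rintro υ _ ⟨hg, hD⟩
    exact (Adds.of_set (by decide) (Adds.of_pair hg hD)).congr fun e => by simp [hF]
  refine Spec.ite (T' := 160) ?_ (by simp) ?_ ?_
  · simp [Store.set_var, hw, hyb, h.items, hz]; omega
  · intro hc
    simp [Store.set_var, hw, hyb, h.items, hz] at hc
    exact (hadd (.inl (by omega))).mono (by omega) fun _ _ h => h
  · intro hc
    simp [Store.set_var, hw, hyb, h.items, hz] at hc
    refine Spec.ite (T' := 80) ?_ (by simp) ?_ ?_
    · simp [Store.set_var, hx, h.items, hz, h.kind, h.left, h.right]; omega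
    · intro hc'
      simp [Store.set_var, hx, h.items, hz, h.kind, h.left, h.right] at hc'
      exact (hadd (.inr hc')).mono (by omega) fun _ _ h => h
    · intro hc'
      simp [Store.set_var, hx, h.items, hz, h.kind, h.left, h.right] at hc'
      refine Spec.skip (by omega) (Adds.of_eq hq rfl rfl (by simp [Store.set_var]) fun e he => ?_)
      rcases he.2 with h | h <;> omega

/-- The pair `(x, y)` number `h` of the queue has been processed. -/
structure Processed (T : Tables) (σ : Store) (h x y : ℕ) : Prop where
  symm : σ.arr .D (y * T.items + x) = 1
  weaken : x = y ∨ y = 0 → ∀ z < T.items, σ.arr .D (x * T.items + z) = 1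
  cut : ∀ j ≤ h, ∀ z < T.items, σ.arr .Q j = z * T.items + T.dual y →
    σ.arr .D (x * T.items + z) = 1
  both : ∀ z < T.items, T.kind z = 1 → ∀ i ≤ h, σ.arr .Q i = x * T.items + T.left z →
    ∀ j ≤ h, σ.arr .Q j = x * T.items + T.right z → σ.arr .D (x * T.items + z) = 1
  either : ∀ z < T.items, T.kind z = 2 → ∀ i ≤ h, (σ.arr .Q i = x * T.items + T.left z ∨
    σ.arr .Q i = x * T.items + T.right z) → σ.arr .D (x * T.items + z) = 1

/-- The clauses refer only to queue entries up to number `h`, which never change, and conclude with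
marks, which never disappear. -/
theorem Processed.mono {σ τ : Store} {h x y : ℕ} (hp : Processed T σ h x y)
    (hg : Grows T.items σ τ) (hh : h < σ.var .tl) : Processed T τ h x y := by
  have hQ : ∀ j ≤ h, τ.arr .Q j = σ.arr .Q j := fun j hj => hg.eq j (by omega)
  refine ⟨hg.mono _ hp.symm, fun hxy z hz => hg.mono _ (hp.weaken hxy z hz), ?_, ?_, ?_⟩
  · intro j hj z hz e
    rw [hQ j hj] at e
    exact hg.mono _ (hp.cut j hj z hz e)
  · intro z hz hk i hi e j hj e'
    rw [hQ i hi] at e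
    rw [hQ j hj] at e'
    exact hg.mono _ (hp.both z hz hk i hi e j hj e')
  · intro z hz hk i hi e
    rw [hQ i hi] at e
    exact hg.mono _ (hp.either z hz hk i hi e)

/-- The first `n` pairs of the queue have been processed. -/
structure SatInv (T : Tables) (n : ℕ) (σ : Store) : Prop where
  queue : Queue T.items σ
  sound : ∀ x y, x < T.items → y < T.items → σ.arr .D (x * T.items + y) = 1 → T.Derivable x y
  processed : ∀ h < n, h < σ.var .tl → ∀ x y, x < T.items → y < T.items →
    σ.arr .Q h = x * T.items + y → Processed T σ h x y

theorem pair_inj {M x y x' y' : ℕ} (hy : y < M) (hy' : y' < M) (h : x * M + y = x' * M + y') :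
    x = x' ∧ y = y' := by
  have hM : 0 < M := by omega
  have h₁ : (x * M + y) / M = x := by
    rw [Nat.mul_comm, Nat.mul_add_div hM, Nat.div_eq_of_lt hy, Nat.add_zero]
  have h₂ : (x' * M + y') / M = x' := by
    rw [Nat.mul_comm, Nat.mul_add_div hM, Nat.div_eq_of_lt hy', Nat.add_zero]
  have hx : x = x' := by rw [← h₁, ← h₂, h]
  subst hx
  exact ⟨rfl, by omega⟩

theorem exists_pair {M e : ℕ} (he : e < M * M) : ∃ x < M, ∃ y < M, e = x * M + y := by
  have hM : 0 < M := by
    by_contra h0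
    obtain rfl : M = 0 := by omega
    simp at he
  exact ⟨e / M, Nat.div_lt_of_lt_mul he, e % M, Nat.mod_lt _ hM, (Nat.div_add_mod' e M).symm⟩

/-- The entries of `D` are at most `1`. So the sum in `Tables.Follows` exceeds `2` iff both premises
are marked and the kind is `1`, or at least one is marked and the kind is `2`; with kind `0` it
never does. -/
theorem Follows.derivable (hT : T.Ranges) {D : ℕ → ℕ} {x y w z : ℕ} (hx : x < T.items)
    (hy : y < T.items) (hz : z < T.items) (hD1 : ∀ e, D e ≤ 1)
    (hD : ∀ x y, x < T.items → y < T.items → D (x * T.items + y) = 1 → T.Derivable x y)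
    (hxy : T.Derivable x y) (hw : 0 < w → ∀ z < T.items, T.Derivable x z)
    (h : T.Follows D x (T.dual y) w z) : T.Derivable x z := by
  have h₂ := hD1 (x * T.items + T.left z)
  have h₃ := hD1 (x * T.items + T.right z)
  have h₄ := hT.kind_le z hz
  have h₅ := hT.left_lt z hz
  have h₆ := hT.right_lt z hz
  rcases h with h | h
  · by_cases h0 : 0 < w
    · exact hw h0 z hz
    · have h₁ := hD1 (T.dual y * T.items + z)
      exact .cut hxy (hD _ _ (hT.dual_lt y hy) hz (by omega))
  · rcases Nat.lt_or_ge (T.kind z) 2 with hk | hk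
    · exact .both hz (by omega) (hD _ _ hx h₅ (by omega)) (hD _ _ hx h₆ (by omega))
    · by_cases hl : D (x * T.items + T.left z) = 1
      · exact .either_left hz (by omega) (hD _ _ hx h₅ hl)
      · exact .either_right hz (by omega) (hD _ _ hx h₆ (by omega))

theorem Follows.mono {D D' : ℕ → ℕ} {x yb w z : ℕ} (hD : ∀ e, D e ≤ D' e)
    (h : T.Follows D x yb w z) : T.Follows D' x yb w z := by
  have h₁ := hD (yb * T.items + z)
  have h₂ := hD (x * T.items + T.left z)
  have h₃ := hD (x * T.items + T.right z)
  exact h.imp (fun h => by omega) (fun h => by omega)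

theorem Grows.le {M : ℕ} {σ τ : Store} (h : Grows M σ τ) (hσ : Queue M σ) (e : ℕ) :
    σ.arr .D e ≤ τ.arr .D e := by
  have h₁ := hσ.le_one e
  have h₂ := h.mono e
  have : σ.arr .D e = 0 ∨ σ.arr .D e = 1 := by omega
  rcases this with h | h
  · omega
  · rw [h, h₂ h]

/-- The loop tests marks which it adds itself. Soundness is therefore shown for the current marks,
whereas the last clause only promises what follows from the marks at the start, which are still
there in every round. -/
theorem satLoop_spec (hU : B + 16 * U + 16 < W) (hT : T.Ranges) (hb : T.Bound U) {σ : Store}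
    {x y w : ℕ} (h : Loaded T σ) (hq : Queue T.items σ) (hx : σ.var .x = x) (hax : σ.var .ax = x)
    (hyb : σ.var .yb = T.dual y) (hw : σ.var .w = w) (hxM : x < T.items) (hyM : y < T.items)
    (hwU : w ≤ 2) (hxy : T.Derivable x y) (hwd : 0 < w → ∀ z < T.items, T.Derivable x z)
    (hs : ∀ x y, x < T.items → y < T.items → σ.arr .D (x * T.items + y) = 1 → T.Derivable x y) :
    (Stmt.loop .z .M satInner).Spec W B σ (T.items * 203 + 2) fun τ => Grows T.items σ τ ∧
      (∀ x y, x < T.items → y < T.items → τ.arr .D (x * T.items + y) = 1 → T.Derivable x y) ∧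
      ∀ z < T.items, T.Follows (σ.arr .D) x (T.dual y) w z → τ.arr .D (x * T.items + z) = 1 := by
  have h₂ := hb.pairs
  have h₉ := T.items_sq_ge
  refine Spec.loop (T₀ := 200) (fun n τ => Grows T.items σ τ ∧
      (∀ x y, x < T.items → y < T.items → τ.arr .D (x * T.items + y) = 1 → T.Derivable x y) ∧
      ∀ z < n, T.Follows (σ.arr .D) x (T.dual y) w z → τ.arr .D (x * T.items + z) = 1) ?_ ?_ ?_ ?_ ?_
  · rw [h.items]; omega
  · exact ⟨.refl hq, hs, fun _ hz => absurd hz (Nat.not_lt_zero _)⟩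
  · rintro z τ hz hf ⟨hg, hsτ, hF⟩
    rw [h.items] at hz
    refine (satInner_spec hU hT hb (x := x) (yb := T.dual y) (w := w) (z := z)
      ((h.of_frame hf (by decide) (by decide)).set (x := .z) z (by decide))
      (hg.queue.set (x := .z) (by decide) z) ?_ ?_ ?_ ?_ (by simp) hxM (hT.dual_lt y hyM) hwU
      hz).mono le_rfl ?_
    · rw [Store.set_var, if_neg (by decide), hf.var _ (by decide), hx]
    · rw [Store.set_var, if_neg (by decide), hf.var _ (by decide), hax]
    · rw [Store.set_var, if_neg (by decide), hf.var _ (by decide), hyb]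
    · rw [Store.set_var, if_neg (by decide), hf.var _ (by decide), hw]
    intro υ _ hA
    rw [Store.set_arr] at hA
    replace hA := hA.of_set (by decide)
    refine ⟨hg.trans hA.grows, ?_, ?_⟩
    · intro x' y' hx' hy' hD
      rcases hA.sound _ hD with h | ⟨h, hF⟩
      · exact hsτ x' y' hx' hy' h
      · obtain ⟨rfl, rfl⟩ := pair_inj hy' hz h
        exact Follows.derivable hT hx' hyM hy' hg.queue.le_one hsτ hxy hwd hF
    · intro z' hz' hF'
      rcases Nat.lt_succ_iff_lt_or_eq.1 hz' with hz' | rfl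
      · exact hA.grows.mono _ (hF z' hz' hF')
      · exact hA.complete _ ⟨rfl, Follows.mono (hg.le hq) hF'⟩
  · rw [h.items]
  · rintro τ hf ⟨hg, hsτ, hF⟩
    rw [h.items] at hF
    refine ⟨⟨hg.queue.set (by decide) _, ?_, hg.eq, hg.mono⟩, hsτ, hF⟩
    rw [Store.set_var, if_neg (by decide)]
    exact hg.tl_le

end EPROL

/-! ### Processing one pair, and completeness of the saturation. -/

namespace EPROL

open Stmt

variable {W B U : ℕ} {T : Tables}

theorem Stmt.Spec.assoc {a b c : Stmt} {σ : Store} {t₀ : ℕ} {P : Store → Prop}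
    (h : ((a ;; b) ;; c).Spec W B σ t₀ P) : (a ;; b ;; c).Spec W B σ t₀ P := by
  refine wp_mono a (fun τ t h => wp_mono b (fun υ u h => wp_mono c (fun ρ v h => ?_) h) h) h
  show t + (u + v) ≤ t₀ ∧ P ρ
  rw [← Nat.add_assoc]
  exact h

theorem Grows.of_set_set {M : ℕ} {σ τ : Store} {x : Var} {n : ℕ} (h : Grows M (σ.set x n) τ)
    (hx : .tl ≠ x) : Grows M σ τ := by
  obtain ⟨h₁, h₂, h₃, h₄⟩ := h
  rw [Store.set_var, if_neg hx] at h₂ h₃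
  exact ⟨h₁, h₂, h₃, h₄⟩

theorem Grows.of_frame {M : ℕ} {σ σ' τ : Store} {c : Stmt} (h : Grows M σ' τ)
    (hf : c.Frame σ σ') (hD : c.writesArr .D = false) (hQ : c.writesArr .Q = false)
    (ht : c.writesVar .tl = false) : Grows M σ τ := by
  obtain ⟨h₁, h₂, h₃, h₄⟩ := h
  rw [hf.var _ ht] at h₂ h₃
  rw [hf.arr _ hQ] at h₃
  rw [hf.arr _ hD] at h₄
  exact ⟨h₁, h₂, h₃, h₄⟩

theorem div_pair {M x y : ℕ} (hy : y < M) : (x * M + y) / M = x := by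
  rw [Nat.mul_comm, Nat.mul_add_div (by omega), Nat.div_eq_of_lt hy, Nat.add_zero]

theorem satBody_spec (hU : B + 16 * U + 16 < W) (hT : T.Ranges) (hb : T.Bound U) {σ : Store}
    {n : ℕ} (h : Loaded T σ) (hn : σ.var .h = n) (hnU : n ≤ U) (hI : SatInv T n σ) :
    satBody.Spec W B σ (T.items * 203 + 400) fun τ => Grows T.items σ τ ∧ SatInv T (n + 1) τ := by
  have h₂ := hb.pairs
  have h₉ := T.items_sq_ge
  obtain ⟨hq, hs, hp⟩ := hI
  refine Spec.ite (T' := T.items * 203 + 380) (by simp) (by simp) ?_ ?_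
  swap
  · intro hc
    simp [hn] at hc
    refine Spec.skip (by omega) ⟨.refl hq, hq, hs, fun i hi hit => hp i (by omega) hit⟩
  intro hc
  simp [hn] at hc
  obtain ⟨x, hx, y, hy, he⟩ := exists_pair (hq.lt _ (hq.marked n hc))
  have hpair := pair_lt hx hy
  have hxle : x * T.items ≤ x * T.items + y := Nat.le_add_right _ _
  have hDxy : σ.arr .D (x * T.items + y) = 1 := by rw [← he]; exact hq.marked n hc
  have hdxy := hs x y hx hy hDxy
  -- Reassociation groups the five assignments before `addPair` into one block.
  refine Spec.assoc (Spec.assoc (Spec.assoc (Spec.assoc (Spec.seq (T₁ := 100)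
    (T₂ := T.items * 203 + 280) (P₁ := fun τ => τ.var .x = x ∧ τ.var .y = y ∧ τ.var .ax = y ∧
      τ.var .ay = x) ?_ ?_ (by omega)))))
  · simp [Stmt.Spec, wp, Store.set_var, hn, he, h.items, div_pair hy]
    omega
  rintro σ₁ hf₁ ⟨hx₁, hy₁, hax₁, hay₁⟩
  have hL₁ := h.of_frame hf₁ (by decide) (by decide)
  have hq₁ := hq.of_eq (hf₁.arr _ (by decide)) (hf₁.arr _ (by decide)) (hf₁.var _ (by decide))
  have hD₁ : σ₁.arr .D = σ.arr .D := hf₁.arr _ (by decide)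
  refine Spec.seq (T₁ := 60) (T₂ := T.items * 203 + 220)
    (addPair_spec hU hq₁ hL₁.items hax₁ hay₁ hy hx (by omega)) ?_ (by omega)
  rintro σ₂ hf₂ ⟨hg₂, hD₂⟩
  replace hg₂ := hg₂.of_frame hf₁ (by decide) (by decide) (by decide)
  have hL₂ := hL₁.of_frame hf₂ (by decide) (by decide)
  have hx₂ : σ₂.var .x = x := (hf₂.var _ (by decide)).trans hx₁
  have hy₂ : σ₂.var .y = y := (hf₂.var _ (by decide)).trans hy₁
  have hsymm : σ₂.arr .D (y * T.items + x) = 1 := by rw [hD₂, Function.update_self]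
  have hs₂ : ∀ x y, x < T.items → y < T.items → σ₂.arr .D (x * T.items + y) = 1 →
      T.Derivable x y := by
    intro x' y' hx' hy' hD
    by_cases hxy : x' * T.items + y' = y * T.items + x
    · obtain ⟨rfl, rfl⟩ := pair_inj hy' hx hxy
      exact .symm hdxy
    · rw [hD₂, Function.update_of_ne hxy, hD₁] at hD
      exact hs x' y' hx' hy' hD
  have hxx := pair_lt hx hx
  have hone₁ := hg₂.queue.le_one (x * T.items + x)
  have hone₂ := hg₂.queue.le_one (x * T.items)
  generalize hw : σ₂.arr .D (x * T.items + x) + σ₂.arr .D (x * T.items) = w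
  refine Spec.assoc (Spec.assoc (Spec.seq (T₁ := 100)
    (T₂ := T.items * 203 + 100) (P₁ := fun τ => τ.var .x = x ∧ τ.var .yb = T.dual y ∧ τ.var .w = w ∧
      τ.var .ax = x) ?_ ?_ (by omega)))
  · simp [Stmt.Spec, wp, Store.set_var, hx₂, hy₂, hL₂.items, hL₂.dual, hw]
    omega
  rintro σ₃ hf₃ ⟨hx₃, hyb₃, hw₃, hax₃⟩
  have hL₃ := hL₂.of_frame hf₃ (by decide) (by decide)
  have hD₃ : σ₃.arr .D = σ₂.arr .D := hf₃.arr _ (by decide)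
  have hg₃ : Grows T.items σ σ₃ := hg₂.trans (Grows.of_eq hg₂.queue hD₃ (hf₃.arr _ (by decide))
    (hf₃.var _ (by decide)))
  have hx0 : T.items > 0 := by omega
  have hwd : 0 < w → ∀ z < T.items, T.Derivable x z := by
    intro hpos z hz
    by_cases h1 : σ₂.arr .D (x * T.items + x) = 1
    · exact .weaken hz (hs₂ x x hx hx h1)
    · exact .weaken_zero hz (hs₂ x 0 hx hx0 (by rw [Nat.add_zero]; omega))
  refine (satLoop_spec hU hT hb hL₃ hg₃.queue hx₃ hax₃ hyb₃ hw₃ hx hy (by omega) hdxy hwd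
    (by rw [hD₃]; exact hs₂)).mono (by omega) ?_
  rintro τ _ ⟨hg, hsτ, hF⟩
  have hgσ := hg₃.trans hg
  refine ⟨hgσ, hg.queue, hsτ, fun i hi hit x' y' hx' hy' hQ => ?_⟩
  rw [hD₃] at hF
  -- a pair which was in the queue up to number `n` when the loop started
  have hmark : ∀ j ≤ n, ∀ x' y', τ.arr .Q j = x' * T.items + y' →
      σ₂.arr .D (x' * T.items + y') = 1 := by
    intro j hj x' y' e
    rw [hgσ.eq j (by omega)] at e
    rw [← e]
    exact hg₂.mono _ (hq.marked j (by omega))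
  rcases Nat.lt_succ_iff_lt_or_eq.1 hi with hi | rfl
  · rw [hgσ.eq i (by omega)] at hQ
    exact (hp i hi (by omega) x' y' hx' hy' hQ).mono hgσ (by omega)
  rw [hgσ.eq i hc, he] at hQ
  obtain ⟨rfl, rfl⟩ := pair_inj hy hy' hQ
  refine ⟨hg.mono _ (by rw [hD₃]; exact hsymm), ?_, ?_, ?_, ?_⟩
  · intro hxy z hz
    refine hF z hz (.inl ?_)
    have : 0 < w := by
      rcases hxy with rfl | rfl
      · have := hg₂.mono _ hDxy
        omega
      · have := hg₂.mono _ hDxy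
        rw [Nat.add_zero] at this
        omega
    omega
  -- The queue entry is `(z, dual y)`, but the loop tests the reversed pair. That pair is marked: an
  -- earlier entry was reversed when it was processed, and entry `n` has been reversed just before
  -- the loop.
  · intro j hj z hz e
    have hdy := hT.dual_lt y hy
    refine hF z hz (.inl ?_)
    have : σ₂.arr .D (T.dual y * T.items + z) = 1 := by
      rw [hgσ.eq j (by omega)] at e
      rcases hj.eq_or_lt with rfl | hj
      · rw [he] at e
        obtain ⟨rfl, e₂⟩ := pair_inj hy hdy e
        rw [← e₂]; exact hsymm
      · exact hg₂.mono _ (hp j hj (by omega) z (T.dual y) hz hdy e).symm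
    omega
  · intro z hz hk j hj e j' hj' e'
    refine hF z hz (.inr ?_)
    rw [hk, hmark j hj _ _ e, hmark j' hj' _ _ e']
    omega
  · intro z hz hk j hj e
    refine hF z hz (.inr ?_)
    rcases e with e | e
    · rw [hk, hmark j hj _ _ e]; omega
    · rw [hk, hmark j hj _ _ e]; omega

theorem SatInv.set {σ : Store} {n : ℕ} (h : SatInv T n σ) {x : Var} (hx : .tl ≠ x) (m : ℕ) :
    SatInv T n (σ.set x m) := by
  obtain ⟨h₁, h₂, h₃⟩ := h
  refine ⟨h₁.set hx m, h₂, fun i hi hit x' y' hx' hy' hQ => ?_⟩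
  rw [Store.set_var, if_neg hx] at hit
  obtain ⟨k₁, k₂, k₃, k₄, k₅⟩ := h₃ i hi hit x' y' hx' hy' hQ
  exact ⟨k₁, k₂, k₃, k₄, k₅⟩

/-- When all pairs have been processed, all derivable pairs have been found. -/
theorem SatInv.complete (hT : T.Ranges) {σ : Store} (hI : SatInv T (T.items * T.items) σ)
    (h₀ : ∀ x y, T.Start x y → σ.arr .D (x * T.items + y) = 1) {x y : ℕ} (h : T.Derivable x y) :
    σ.arr .D (x * T.items + y) = 1 := by
  have htl := hI.queue.tl_le
  have hidx : ∀ {x y}, T.Derivable x y → σ.arr .D (x * T.items + y) = 1 →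
      ∃ i < σ.var .tl, σ.arr .Q i = x * T.items + y ∧ Processed T σ i x y := by
    intro x y hd hD
    obtain ⟨i, hi, hi'⟩ := hI.queue.queued _ hD
    obtain ⟨hx, hy⟩ := hT.derivable_lt hd
    exact ⟨i, hi, hi', hI.processed i (by omega) hi x y hx hy hi'⟩
  induction h with
  | base h => exact h₀ _ _ h
  | symm hd ih =>
    obtain ⟨i, hi, -, hp⟩ := hidx hd ih
    exact hp.symm
  | weaken hz hd ih =>
    obtain ⟨i, hi, -, hp⟩ := hidx hd ih
    exact hp.weaken (.inl rfl) _ hz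
  | weaken_zero hz hd ih =>
    obtain ⟨i, hi, -, hp⟩ := hidx hd ih
    exact hp.weaken (.inr rfl) _ hz
  | @cut x y z hd hd' ih ih' =>
    obtain ⟨hx, hy⟩ := hT.derivable_lt hd
    obtain ⟨hy', hz⟩ := hT.derivable_lt hd'
    obtain ⟨i, hi, hiQ, hp⟩ := hidx hd ih
    obtain ⟨_, _, _, hp'⟩ := hidx hd' ih'
    obtain ⟨j, hj, hjQ, hp''⟩ := hidx (.symm hd') hp'.symm
    -- The cut is found when the later of its premises is processed. If that is `(z, dual y)`, the
    -- involution turns it into a cut against `(x, y)` which yields `(z, x)`, and symmetry finishes.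
    rcases le_total j i with h | h
    · exact hp.cut j h z hz hjQ
    · have hzx := hp''.cut i h x hx (by rw [hT.dual_dual y hy]; exact hiQ)
      obtain ⟨_, _, _, hp₃⟩ := hidx (hI.sound z x hz hx hzx) hzx
      exact hp₃.symm
  | both hz hk hd hd' ih ih' =>
    obtain ⟨i, hi, hiQ, hp⟩ := hidx hd ih
    obtain ⟨j, hj, hjQ, hp'⟩ := hidx hd' ih'
    -- Again the later premise is the one that fires the rule.
    rcases le_total j i with h | h
    · exact hp.both _ hz hk i le_rfl hiQ j h hjQ
    · exact hp'.both _ hz hk i h hiQ j le_rfl hjQ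
  | either_left hz hk hd ih =>
    obtain ⟨i, hi, hiQ, hp⟩ := hidx hd ih
    exact hp.either _ hz hk i le_rfl (.inl hiQ)
  | either_right hz hk hd ih =>
    obtain ⟨i, hi, hiQ, hp⟩ := hidx hd ih
    exact hp.either _ hz hk i le_rfl (.inr hiQ)

theorem satPhase_spec (hU : B + 16 * U + 16 < W) (hT : T.Ranges) (hb : T.Bound U) {σ : Store}
    (h : Loaded T σ) (hq : Queue T.items σ)
    (hs : ∀ x y, x < T.items → y < T.items →
      (σ.arr .D (x * T.items + y) = 1 ↔ T.Start x y)) :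
    satPhase.Spec W B σ (T.items * T.items * (T.items * 203 + 403) + 2) fun τ =>
      (∀ e, τ.arr .D e ≤ 1) ∧ ∀ x y, x < T.items → y < T.items →
        (τ.arr .D (x * T.items + y) = 1 ↔ T.Derivable x y) := by
  have h₂ := hb.pairs
  refine Spec.loop (T₀ := T.items * 203 + 400) (fun n τ => Grows T.items σ τ ∧ SatInv T n τ)
    (by rw [h.pairs]; omega) ?_ ?_ (by rw [h.pairs]) ?_
  · exact ⟨.refl hq, hq, fun x y hx hy hD => .base ((hs x y hx hy).1 hD),
      fun _ hi => absurd hi (Nat.not_lt_zero _)⟩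
  · rintro n τ hn hf ⟨hg, hI⟩
    rw [h.pairs] at hn
    refine (satBody_spec hU hT hb ((h.of_frame hf (by decide) (by decide)).set (x := .h) n (by decide))
      (by simp) (by omega) (hI.set (by decide) n)).mono le_rfl ?_
    rintro υ _ ⟨hg', hI'⟩
    exact ⟨hg.trans (hg'.of_set_set (by decide)), hI'⟩
  · rintro τ _ ⟨hg, hI⟩
    rw [h.pairs] at hI
    refine ⟨hg.queue.le_one, fun x y hx hy => ⟨hI.sound x y hx hy, hI.complete hT ?_⟩⟩
    intro x' y' hst
    obtain ⟨hx', hy'⟩ := hT.start_lt _ _ hst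
    exact hg.mono _ ((hs x' y' hx' hy').2 hst)

end EPROL

namespace EPROL

open Stmt

variable {Sg : Signature}

/-! ### The tables are correct -/

/-- Every sequence of digits belongs to a number. -/
theorem exists_digits {m : ℕ} (d : ℕ) (t : ℕ → ℕ) (ht : ∀ j < d, t j < m) :
    ∃ c < m ^ d, ∀ j < d, c / m ^ j % m = t j := by
  induction d generalizing t with
  | zero => exact ⟨0, by simp, fun _ h => absurd h (Nat.not_lt_zero _)⟩
  | succ d ih =>
    obtain ⟨c, hc, hd⟩ := ih (fun j => t (j + 1)) fun j hj => ht (j + 1) (by omega)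
    have h₀ := ht 0 (by omega)
    have hm : 0 < m := by omega
    refine ⟨t 0 + m * c, ?_, fun j hj => ?_⟩
    · have : m * (c + 1) ≤ m * m ^ d := Nat.mul_le_mul_left _ hc
      rw [Nat.pow_succ', Nat.mul_succ] at *
      omega
    · cases j with
      | zero => rw [pow_zero, Nat.div_one, Nat.add_mul_mod_self_left, Nat.mod_eq_of_lt h₀]
      | succ j =>
        rw [Nat.pow_succ', ← Nat.div_div_eq_div_mul, Nat.add_mul_div_left _ _ hm,
          Nat.div_eq_of_lt h₀, Nat.zero_add]
        exact hd j (by omega)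

/-- The substitution `σ` replaces the variables in the list `V` by the arguments in `A` whose numbers
are the digits of `c`. It is the identity for the goal. -/
def Follows (A : List (Arg Sg)) (c i : ℕ) (V : List ℕ) (σ : ℕ → Arg Sg) : Prop :=
  ∀ v, if 0 < i then ∀ j, V[j]? = some v → A[c / A.length ^ j % A.length]? = some (σ v)
    else σ v = .var v

/-- The array `J` tells which entries of the table `src` are replaced by arguments in `A`. -/
structure Addressed (T : Tables) (U : ℕ) (J : ℕ → ℕ) (A : List (Arg Sg)) (d : ℕ) : Prop where
  self : ∀ c < T.count, ∀ p < T.len, J p = 0 → T.src (c * T.len + p) = p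
  digit : ∀ c < T.count, ∀ p < T.len, ∀ j < d, J p = j + 1 → ∃ b,
    A[c / A.length ^ j % A.length]? = some b ∧ T.ArgAt (T.src (c * T.len + p)) b
  src_lt : ∀ c < T.count, ∀ p < T.len, J p ≤ d → T.src (c * T.len + p) + 1 ≤ U
  ending : StopsFrom Sg T.tok T.ending T.len 0

section Addressed

variable {T : Tables} {U d : ℕ} {J : ℕ → ℕ} {A : List (Arg Sg)}

/-- The argument `b` comes from the code `c` alone, before any substitution is given. So every
marked node represents some formula, and the same formula is the instance under any substitution
which follows `c`. -/
theorem Addressed.exists_arg (h : Addressed T U J A d) {c i p : ℕ} {V : List ℕ} {a : Arg Sg}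
    (hV : V.length ≤ d) (hc : c < T.count) (hp : p < T.len) (ha : ArgScanned J i V p a)
    (hE : IsArg T.tok p a) : ∃ b, T.ArgAt (T.src (c * T.len + p)) b ∧
      ∀ σ, Follows A c i V σ → a.subst σ = b := by
  cases a with
  | const k =>
    refine ⟨.const k, ?_, fun _ _ => rfl⟩
    rw [h.self c hc p hp ha]; exact hE
  | var v =>
    unfold ArgScanned at ha
    split_ifs at ha with hi
    · obtain ⟨j, hj, hJ⟩ := ha
      have := (List.getElem?_eq_some_iff.1 hj).1
      obtain ⟨b, hb, hb'⟩ := h.digit c hc p hp j (by omega) hJ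
      refine ⟨b, hb', fun σ hσ => ?_⟩
      have hv := hσ v
      rw [if_pos hi] at hv
      have := hv j hj
      rw [hb] at this
      exact (Option.some.inj this).symm
    · refine ⟨.var v, ?_, fun σ hσ => ?_⟩
      · rw [h.self c hc p hp ha]; exact hE
      · have hv := hσ v
        rwa [if_neg hi] at hv

theorem at_atom {E : ℕ → ℕ} {p : ℕ} {a : Atom Sg} (h : At E p (Formula.atom a).encode) :
    E (p + 1) = a.pred ∧ E (p + 2) = Sg.arity a.pred ∧
      ∀ i : Fin (Sg.arity a.pred), IsArg E (p + 3 + 2 * i) (a.args i) := by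
  rw [Formula.encode_atom, at_cons, at_cons, at_cons] at h
  refine ⟨h.2.1, h.2.2.1, fun i => ?_⟩
  have := h.2.2.2.args i (by simp)
  simpa [IsArg] using this

/-- What is represented at the position of a scanned formula. -/
theorem Addressed.exists_rep (h : Addressed T U J A d) {c i : ℕ} {V : List ℕ} (hV : V.length ≤ d)
    (hc : c < T.count) {ψ : Formula (Atom Sg)} {p : ℕ} (hE : At T.tok p ψ.encode)
    (hp : p + ψ.encode.length ≤ T.len) (hs : Scanned T.sym J i V p ψ) :
    ∃ φ, T.Rep c p φ ∧ ∀ σ, Follows A c i V σ → ψ.subst σ = φ := by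
  induction ψ generalizing p with
  | atom a =>
    obtain ⟨hk, -, h₁, h₂, h₃⟩ := hs
    obtain ⟨e₁, e₂, e₃⟩ := at_atom hE
    rw [Formula.length_encode_atom] at hp
    have H := fun j : Fin (Sg.arity a.pred) => h.exists_arg hV hc (by have := j.2; omega) (h₃ j) (e₃ j)
    choose b hb hb' using H
    refine ⟨.atom ⟨a.pred, b⟩, ⟨by omega, hk, ?_, ?_, fun j => ?_⟩, fun σ hσ => ?_⟩
    · rw [Nat.add_assoc, h.self c hc _ (by omega) h₁, e₁]
    · rw [Nat.add_assoc, h.self c hc _ (by omega) h₂, e₂]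
    · have := hb j
      rwa [← Nat.add_assoc, ← Nat.add_assoc] at this
    · rw [Formula.subst, Atom.subst]
      congr 2
      funext j
      exact hb' j σ hσ
  | neg ψ ih =>
    rw [Formula.encode_neg, at_cons] at hE
    rw [Formula.encode_neg, List.length_cons] at hp
    obtain ⟨φ, hφ, hφ'⟩ := ih hE.2 (by omega) hs.2
    exact ⟨.neg φ, ⟨by omega, hs.1, hφ⟩, fun σ hσ => by rw [Formula.subst, hφ' σ hσ]⟩
  | conj ψ₁ ψ₂ ih₁ ih₂ =>
    rw [Formula.encode_conj, at_cons, at_append] at hE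
    rw [Formula.encode_conj, List.length_cons, List.length_append] at hp
    obtain ⟨φ₁, h₁, h₁'⟩ := ih₁ hE.2.1 (by omega) hs.2.1
    obtain ⟨φ₂, h₂, h₂'⟩ := ih₂ hE.2.2 (by omega) hs.2.2
    have he := h.ending (p + 1) (Nat.zero_le _) ψ₁ hE.2.1 (by omega)
    exact ⟨.conj φ₁ φ₂, ⟨by omega, hs.1, h₁, he ▸ h₂⟩,
      fun σ hσ => by rw [Formula.subst, h₁' σ hσ, h₂' σ hσ]⟩
  | disj ψ₁ ψ₂ ih₁ ih₂ =>
    rw [Formula.encode_disj, at_cons, at_append] at hE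
    rw [Formula.encode_disj, List.length_cons, List.length_append] at hp
    obtain ⟨φ₁, h₁, h₁'⟩ := ih₁ hE.2.1 (by omega) hs.2.1
    obtain ⟨φ₂, h₂, h₂'⟩ := ih₂ hE.2.2 (by omega) hs.2.2
    have he := h.ending (p + 1) (Nat.zero_le _) ψ₁ hE.2.1 (by omega)
    exact ⟨.disj φ₁ φ₂, ⟨by omega, hs.1, h₁, he ▸ h₂⟩,
      fun σ hσ => by rw [Formula.subst, h₁' σ hσ, h₂' σ hσ]⟩

theorem Addressed.exists_partRep (h : Addressed T U J A d) {c i n : ℕ} {V : List ℕ}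
    (hV : V.length ≤ d) (hc : c < T.count) {Γ : Option (Annotated (Atom Sg))}
    (hs : PartScanned T.tok T.sym J T.len i V n Γ) :
    ∃ Δ, T.PartRep c n Δ ∧ ∀ σ, Follows A c i V σ → Γ.map (Annotated.subst σ) = Δ := by
  rcases Γ with _ | (ψ | ψ)
  · exact ⟨none, hs, fun _ _ => rfl⟩
  · obtain ⟨p, rfl, hE, hp, hs⟩ := hs
    obtain ⟨φ, hφ, hφ'⟩ := h.exists_rep hV hc hE hp hs
    exact ⟨some (.L φ), ⟨p, rfl, hφ⟩, fun σ hσ => by rw [← hφ' σ hσ]; rfl⟩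
  · obtain ⟨p, rfl, hE, hp, hs⟩ := hs
    obtain ⟨φ, hφ, hφ'⟩ := h.exists_rep hV hc hE hp hs
    exact ⟨some (.R φ), ⟨p, rfl, hφ⟩, fun σ hσ => by rw [← hφ' σ hσ]; rfl⟩

theorem Addressed.partRep (h : Addressed T U J A d) {c i n : ℕ} {V : List ℕ}
    (hV : V.length ≤ d) (hc : c < T.count) {Γ : Option (Annotated (Atom Sg))}
    (hs : PartScanned T.tok T.sym J T.len i V n Γ) {σ : ℕ → Arg Sg} (hσ : Follows A c i V σ) :
    T.PartRep c n (Γ.map (Annotated.subst σ)) := by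
  obtain ⟨Δ, hΔ, hΔ'⟩ := h.exists_partRep hV hc hs
  rwa [hΔ' σ hσ]

/-- A mark `1` comes from a scanned atom. Its predicate symbol and arity are read in place, since
substitution does not touch them, and its arguments at recorded positions. -/
theorem Addressed.atomBound (h : Addressed T U J A d) (hU : T.len ≤ U) {c p : ℕ} (hc : c < T.count)
    (hm : Marks Sg T.tok T.sym J T.len d) (hp : p < T.len) (hs : T.sym p = 1) :
    T.AtomBound U (c * T.len + p) := by
  obtain ⟨i, V, ψ, hV, hE, hle, hψ⟩ := hm p hp (by omega)
  cases ψ with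
  | neg _ | conj _ _ | disj _ _ => exact absurd (hs.symm.trans hψ.1) (by decide)
  | atom a =>
    obtain ⟨-, -, h₁, h₂, h₃⟩ := hψ
    obtain ⟨e₁, e₂, e₃⟩ := at_atom hE
    rw [Formula.length_encode_atom] at hle
    have s₁ := h.self c hc (p + 1) (by omega) h₁
    have s₂ := h.self c hc (p + 2) (by omega) h₂
    rw [← Nat.add_assoc] at s₁ s₂
    refine ⟨by omega, by omega, by rw [s₂, e₂]; omega, fun j hj => ?_⟩
    rw [s₂, e₂] at hj
    have := h.src_lt c hc (p + 3 + 2 * j) (by omega) ((h₃ ⟨j, hj⟩).le_length.trans hV)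
    rwa [← Nat.add_assoc, ← Nat.add_assoc] at this

end Addressed

theorem Formula.subst_var (φ : Formula (Atom Sg)) : φ.subst Arg.var = φ := by
  induction φ with
  | atom a =>
    rw [Formula.subst, Atom.subst]
    congr 2
    funext i
    cases a.args i <;> rfl
  | neg φ ih => rw [Formula.subst, ih]
  | conj φ ψ ih₁ ih₂ => rw [Formula.subst, ih₁, ih₂]
  | disj φ ψ ih₁ ih₂ => rw [Formula.subst, ih₁, ih₂]

theorem optSubst_var (Γ : Option (Annotated (Atom Sg))) : Γ.map (Annotated.subst Arg.var) = Γ := by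
  rcases Γ with _ | (φ | φ)
  · rfl
  · exact congrArg (fun φ => some (Annotated.L φ)) φ.subst_var
  · exact congrArg (fun φ => some (Annotated.R φ)) φ.subst_var

/-- A function on arguments which fixes all constants of a formula can be moved into a
substitution. -/
theorem Formula.map_subst {f : Arg Sg → Arg Sg} {σ : ℕ → Arg Sg} {φ : Formula (Atom Sg)}
    (h : ∀ c, Arg.const c ∈ φ.argList → f (.const c) = .const c) :
    (φ.subst σ).map (Atom.mapArgs f) = φ.subst fun v => f (σ v) := by
  induction φ with
  | atom a =>
    simp only [Formula.subst, Formula.map, Atom.subst, Atom.mapArgs]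
    congr 2
    funext i
    have hi : a.args i ∈ (Formula.atom a).argList := List.mem_ofFn.2 ⟨i, rfl⟩
    cases e : a.args i with
    | var v => rfl
    | const c => rw [e] at hi; exact h c hi
  | neg φ ih => simp only [Formula.subst, Formula.map, ih h]
  | conj φ ψ ih₁ ih₂ =>
    simp only [Formula.subst, Formula.map, ih₁ fun c hc => h c (List.mem_append_left _ hc),
      ih₂ fun c hc => h c (List.mem_append_right _ hc)]
  | disj φ ψ ih₁ ih₂ =>
    simp only [Formula.subst, Formula.map, ih₁ fun c hc => h c (List.mem_append_left _ hc),
      ih₂ fun c hc => h c (List.mem_append_right _ hc)]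

theorem optMap_subst {f : Arg Sg → Arg Sg} {σ : ℕ → Arg Sg} {Γ : Option (Annotated (Atom Sg))}
    (h : ∀ c, Arg.const c ∈ optArgs Γ → f (.const c) = .const c) :
    (Γ.map (Annotated.subst σ)).map (Annotated.map (Atom.mapArgs f)) =
      Γ.map (Annotated.subst fun v => f (σ v)) := by
  rcases Γ with _ | (φ | φ)
  · rfl
  · exact congrArg (fun φ => some (Annotated.L φ)) (Formula.map_subst h)
  · exact congrArg (fun φ => some (Annotated.R φ)) (Formula.map_subst h)

theorem Formula.map_eq_self {f : Arg Sg → Arg Sg} {φ : Formula (Atom Sg)}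
    (h : ∀ a ∈ φ.argList, f a = a) : φ.map (Atom.mapArgs f) = φ := by
  induction φ with
  | atom a =>
    simp only [Formula.map, Atom.mapArgs]
    congr 2
    funext i
    exact h _ (List.mem_ofFn.2 ⟨i, rfl⟩)
  | neg φ ih => simp only [Formula.map, ih h]
  | conj φ ψ ih₁ ih₂ =>
    simp only [Formula.map, ih₁ fun c hc => h c (List.mem_append_left _ hc),
      ih₂ fun c hc => h c (List.mem_append_right _ hc)]
  | disj φ ψ ih₁ ih₂ =>
    simp only [Formula.map, ih₁ fun c hc => h c (List.mem_append_left _ hc),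
      ih₂ fun c hc => h c (List.mem_append_right _ hc)]

theorem optMap_eq_self {f : Arg Sg → Arg Sg} {Γ : Option (Annotated (Atom Sg))}
    (h : ∀ a ∈ optArgs Γ, f a = a) : Γ.map (Annotated.map (Atom.mapArgs f)) = Γ := by
  rcases Γ with _ | (φ | φ)
  · rfl
  · exact congrArg (fun φ => some (Annotated.L φ)) (Formula.map_eq_self h)
  · exact congrArg (fun φ => some (Annotated.R φ)) (Formula.map_eq_self h)

/-- The arguments in the goal and the axioms. -/
def Instance.args (I : Instance Sg) : List (Arg Sg) :=
  I.goal.argList ++ I.axs.flatMap Sequent.argList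

/-- The scanned sequents are those of the instance `I`. -/
structure Parsed (T : Tables) (J : ℕ → ℕ) (d : ℕ) (I : Instance Sg) : Prop where
  axCount : T.axCount = I.axs.length
  count : T.count = I.args.length ^ d
  count_pos : 0 < T.count
  goal : SeqScanned T.tok T.sym J T.len 0 (T.partA 0) (T.partB 0) I.goal
  axs : ∀ j (h : j < I.axs.length), SeqScanned T.tok T.sym J T.len (j + 1)
    (T.partA (j + 1)) (T.partB (j + 1)) I.axs[j]
  length_le : ∀ j (h : j < I.axs.length), (I.axs[j].varList (j + 1)).length ≤ d
  marks : Marks Sg T.tok T.sym J T.len d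

section Parsed

variable {T : Tables} {U d : ℕ} {J : ℕ → ℕ} {I : Instance Sg}

theorem Parsed.genuine (h : Parsed T J d I) (ha : Addressed T U J I.args d) {c p : ℕ}
    (hc : c < T.count) (hp : p < T.len) (hs : T.sym p ≠ 0) :
    ∃ φ : Formula (Atom Sg), T.Rep c p φ := by
  obtain ⟨i, V, ψ, hV, hE, hle, hψ⟩ := h.marks p hp hs
  obtain ⟨φ, hφ, -⟩ := ha.exists_rep hV hc hE hle hψ
  exact ⟨φ, hφ⟩

theorem Parsed.goal_partRep (h : Parsed T J d I) (ha : Addressed T U J I.args d) :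
    T.PartRep 0 (T.partA 0) I.goal.fst ∧ T.PartRep 0 (T.partB 0) I.goal.snd := by
  have hV : (I.goal.varList 0).length ≤ d := by rw [Sequent.varList, addVars_zero]; exact Nat.zero_le _
  have hf : Follows I.args 0 0 (I.goal.varList 0) Arg.var := fun v => by simp
  have h₁ := ha.partRep hV h.count_pos h.goal.1 hf
  have h₂ := ha.partRep hV h.count_pos h.goal.2 hf
  rw [optSubst_var] at h₁ h₂
  exact ⟨h₁, h₂⟩

theorem Parsed.ax_sound (h : Parsed T J d I) (ha : Addressed T U J I.args d) {s c : ℕ}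
    (hs : s < T.axCount) (hc : c < T.count) : ∃ S ∈ I.axs, ∃ σ : ℕ → Arg Sg,
      T.PartRep c (T.partA (s + 1)) (S.fst.map (Annotated.subst σ)) ∧
      T.PartRep c (T.partB (s + 1)) (S.snd.map (Annotated.subst σ)) := by
  rw [h.axCount] at hs
  have hV := h.length_le s hs
  have hnd : (I.axs[s].varList (s + 1)).Nodup := nodup_addVars List.nodup_nil _
  -- The variable at place `j` of the list gets the argument named by digit `j`. Values at other
  -- variables do not matter, and the default is never used for a variable in the list.
  have hf : Follows I.args c (s + 1) (I.axs[s].varList (s + 1)) fun v =>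
      (I.args[c / I.args.length ^ (I.axs[s].varList (s + 1)).idxOf v % I.args.length]?).getD
        (.var 0) := by
    intro v
    rw [if_pos (by omega)]
    intro j hj
    obtain ⟨hj', rfl⟩ := List.getElem?_eq_some_iff.1 hj
    dsimp only
    rw [hnd.idxOf_getElem j hj']
    -- The list has an entry, so `d` is positive, and without arguments the number of substitutions
    -- would be zero.
    have hpos : 0 < I.args.length := by
      by_contra h0
      have := h.count_pos
      rw [h.count, Nat.eq_zero_of_not_pos h0, zero_pow (by omega)] at this
      exact absurd this (lt_irrefl 0)
    rw [List.getElem?_eq_getElem (Nat.mod_lt _ hpos)]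
    rfl
  exact ⟨_, List.getElem_mem hs, _, ha.partRep hV hc (h.axs s hs).1 hf,
    ha.partRep hV hc (h.axs s hs).2 hf⟩

-- The map `f` fixes the arguments of the instance and sends all others to one of them. As it fixes
-- the constants of an axiom, it can be pushed into the substitution; the digits of the resulting
-- code name the arguments `f (σ v)`.
open Classical in
theorem Parsed.ax_complete (h : Parsed T J d I) (ha : Addressed T U J I.args d) :
    ∃ f : Arg Sg → Arg Sg,
      I.goal.fst.map (Annotated.map (Atom.mapArgs f)) = I.goal.fst ∧
      I.goal.snd.map (Annotated.map (Atom.mapArgs f)) = I.goal.snd ∧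
      ∀ S ∈ I.axs, ∀ σ : ℕ → Arg Sg, ∃ s < T.axCount, ∃ c < T.count,
        T.PartRep c (T.partA (s + 1))
          ((S.fst.map (Annotated.subst σ)).map (Annotated.map (Atom.mapArgs f))) ∧
        T.PartRep c (T.partB (s + 1))
          ((S.snd.map (Annotated.subst σ)).map (Annotated.map (Atom.mapArgs f))) := by
  obtain ⟨f, hfix, hmem⟩ : ∃ f : Arg Sg → Arg Sg, (∀ a ∈ I.args, f a = a) ∧
      (I.args ≠ [] → ∀ a, f a ∈ I.args) := by
    -- Any fixed argument would do as the common value. Without arguments there is no variable to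
    -- replace, and `headD` makes `f` the identity.
    refine ⟨fun a => if a ∈ I.args then a else I.args.headD a, fun a h => if_pos h, fun hne a => ?_⟩
    dsimp only
    split_ifs with h
    · exact h
    · obtain ⟨b, l, e⟩ := List.exists_cons_of_ne_nil hne
      rw [e]; exact List.mem_cons_self
  refine ⟨f, optMap_eq_self fun a h => ?_, optMap_eq_self fun a h => ?_, fun S hS σ => ?_⟩
  · exact hfix a (List.mem_append_left _ (List.mem_append_left _ h))
  · exact hfix a (List.mem_append_left _ (List.mem_append_right _ h))
  have hSA : ∀ a ∈ S.argList, a ∈ I.args := fun a h =>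
    List.mem_append_right _ (List.mem_flatMap.2 ⟨S, hS, h⟩)
  obtain ⟨s, hs, rfl⟩ := List.getElem_of_mem hS
  have hV := h.length_le s hs
  -- An axiom may have fewer than `d` variables; the superfluous digits are set to `0`, which is a
  -- digit because `d` is positive and the number of substitutions is not zero.
  have hex : ∀ j : ℕ, ∃ t : ℕ, (j < d → t < I.args.length) ∧
      ∀ v, (I.axs[s].varList (s + 1))[j]? = some v → I.args[t]? = some (f (σ v)) := by
    intro j
    by_cases hj : j < (I.axs[s].varList (s + 1)).length
    · have hv := List.getElem_mem hj
      have hne : I.args ≠ [] := by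
        rcases mem_addVars hv with h | h
        · exact absurd h List.not_mem_nil
        · exact List.ne_nil_of_mem (hSA _ h)
      obtain ⟨t, ht, ht'⟩ := List.getElem_of_mem (hmem hne (σ (I.axs[s].varList (s + 1))[j]))
      refine ⟨t, fun _ => ht, fun v hv => ?_⟩
      obtain ⟨_, rfl⟩ := List.getElem?_eq_some_iff.1 hv
      rw [List.getElem?_eq_getElem ht, ht']
    · refine ⟨0, fun hjd => ?_, fun v hv => ?_⟩
      · by_contra h0
        have := h.count_pos
        rw [h.count, Nat.eq_zero_of_not_pos h0, zero_pow (by omega)] at this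
        exact absurd this (lt_irrefl 0)
      · exact absurd (List.getElem?_eq_some_iff.1 hv).1 hj
  choose t ht ht' using hex
  obtain ⟨c, hc, hc'⟩ := exists_digits d t ht
  rw [← h.count] at hc
  have hf : Follows I.args c (s + 1) (I.axs[s].varList (s + 1)) fun v => f (σ v) := by
    intro v
    rw [if_pos (by omega)]
    intro j hj
    rw [hc' j ((List.getElem?_eq_some_iff.1 hj).1.trans_le hV)]
    exact ht' j v hj
  refine ⟨s, by rw [h.axCount]; exact hs, c, hc, ?_, ?_⟩
  · rw [optMap_subst fun k hk => hfix _ (hSA _ (List.mem_append_left _ hk))]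
    exact ha.partRep hV hc (h.axs s hs).1 hf
  · rw [optMap_subst fun k hk => hfix _ (hSA _ (List.mem_append_right _ hk))]
    exact ha.partRep hV hc (h.axs s hs).2 hf

end Parsed

end EPROL

/-! ### From the store to correct tables. -/

namespace EPROL

open Stmt

variable {Sg : Signature}

/-- The tables in a store. -/
def Store.tables (σ : Store) : Tables where
  len := σ.var .len
  count := σ.var .CN
  axCount := σ.var .k
  tok := σ.arr .E
  ending := σ.arr .END
  sym := σ.arr .KD
  src := σ.arr .G
  kind := σ.arr .IK
  left := σ.arr .IA
  right := σ.arr .IB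
  dual := σ.arr .BAR
  partA := σ.arr .AXA
  partB := σ.arr .AXB

section Correctness

variable {U m d : ℕ} {A : List (Arg Sg)} {σ : Store} {I : Instance Sg}

theorem addressed_of_nodeTables (hN : NodeTables σ.tables.len A.length σ.tables.nodes σ)
    (hP : ∀ j ≤ d, σ.arr .POW j = A.length ^ j) (hA : d ≠ 0 → 0 < A.length)
    (hR : ∀ i (h : i < A.length), IsArg (σ.arr .E) (σ.arr .T i) A[i] ∧ σ.arr .T i + 1 ≤ U)
    (hU : σ.tables.len ≤ U) (hE : StopsFrom Sg (σ.arr .E) (σ.arr .END) (σ.var .len) 0) :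
    Addressed σ.tables U (σ.arr .J) A d := by
  have hsrc : ∀ c < σ.tables.count, ∀ p < σ.tables.len, σ.tables.src (c * σ.tables.len + p) =
      if σ.arr .J p = 0 then p else σ.arr .T (c / σ.arr .POW (σ.arr .J p - 1) % A.length) := by
    intro c hc p hp
    have := hN.src _ (Tables.node_lt hc hp)
    rwa [srcAt, Tables.node_mod hp, Tables.node_div hp] at this
  refine ⟨fun c hc p hp h => ?_, fun c hc p hp j hj h => ?_, fun c hc p hp h => ?_, hE⟩
  · rw [hsrc c hc p hp, if_pos h]
  · have hlt := Nat.mod_lt (c / A.length ^ j) (hA (by omega))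
    refine ⟨_, List.getElem?_eq_getElem hlt, ?_⟩
    rw [hsrc c hc p hp, if_neg (by omega), h, Nat.add_sub_cancel, hP j hj.le]
    exact (hR _ hlt).1
  · rw [hsrc c hc p hp]
    split_ifs with h₀
    · omega
    · rw [hP _ (by omega)]
      exact (hR _ (Nat.mod_lt _ (hA (by omega)))).2

theorem correct_of_parsed (hP : Parsed σ.tables (σ.arr .J) d I)
    (hA : Addressed σ.tables U (σ.arr .J) I.args d)
    (hN : NodeTables σ.tables.len m σ.tables.nodes σ) : σ.tables.Correct I where
  genuine c hc p hp hs := hP.genuine hA hc hp hs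
  kind_zero := (hN.rest 0 (.inl rfl)).1
  dual_zero := hN.dual_zero
  dual_left x hx := (hN.dual x hx).1
  dual_right x hx := (hN.dual x hx).2
  kind_le x hx hs := by
    constructor
    · refine (hN.rest (2 * x + 1) (.inr (.inr ⟨by omega, ?_⟩))).1
      rw [show (2 * x + 1 - 1) / 2 = x by omega]; exact hs
    · refine (hN.rest (2 * x + 2) (.inr (.inr ⟨by omega, ?_⟩))).1
      rw [show (2 * x + 2 - 1) / 2 = x by omega]; exact hs
  neg_left x hx hs := ⟨(hN.neg x hx hs).1.1, (hN.neg x hx hs).2.1.1, (hN.neg x hx hs).2.2.1⟩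
  neg_right x hx hs := ⟨(hN.neg x hx hs).1.2, (hN.neg x hx hs).2.1.2, (hN.neg x hx hs).2.2.2⟩
  bin_left x hx hs := ⟨(hN.bin x hx hs).1.1, (hN.bin x hx hs).2.1.1, (hN.bin x hx hs).2.2.1⟩
  bin_right x hx hs := ⟨(hN.bin x hx hs).1.2, (hN.bin x hx hs).2.1.2, (hN.bin x hx hs).2.2.2⟩
  count_pos := hP.count_pos
  goal_fst := (hP.goal_partRep hA).1
  goal_snd := (hP.goal_partRep hA).2
  ax_sound _ hs _ hc := hP.ax_sound hA hs hc
  ax_complete := hP.ax_complete hA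

end Correctness

section Ranges

variable {T : Tables} {I : Instance Sg}

theorem Tables.Correct.item_lt (hT : T.Correct I) {s c : ℕ} (hs : s < T.axCount) (hc : c < T.count) :
    T.item c (T.partA (s + 1)) < T.items ∧ T.item c (T.partB (s + 1)) < T.items := by
  obtain ⟨S, -, σ, h₁, h₂⟩ := hT.ax_sound s hs c hc
  exact ⟨(Tables.Denotes.of_partRep hc h₁).lt, (Tables.Denotes.of_partRep hc h₂).lt⟩

/-- The premises of a compound formula belong to subformulas represented under the same
substitution, so they are items again. Atoms and items without a formula have premises `0` by `h₀`.
-/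
theorem Tables.Correct.ranges (hT : T.Correct I) (h₀ : ∀ z, z = 0 ∨ z ≤ 2 * T.nodes ∧
    T.sym ((z - 1) / 2 % T.len) < 2 → T.left z = 0 ∧ T.right z = 0) : T.Ranges := by
  have hcases : ∀ z < T.items, z = 0 ∨ ∃ x < T.nodes, z = 2 * x + 1 ∨ z = 2 * x + 2 := by
    intro z hz
    unfold Tables.items at hz
    rcases Nat.eq_zero_or_pos z with rfl | h
    · exact .inl rfl
    · exact .inr ⟨(z - 1) / 2, by omega, by omega⟩
  have hpos : 0 < T.items := Nat.succ_pos _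
  have hmain : ∀ z < T.items, T.left z < T.items ∧ T.right z < T.items ∧ T.kind z ≤ 2 := by
    intro z hz
    rcases hcases z hz with rfl | ⟨x, hx, hzx⟩
    · have := h₀ 0 (.inl rfl)
      rw [this.1, this.2, hT.kind_zero]
      exact ⟨hpos, hpos, by omega⟩
    obtain ⟨c, p, hc, hp, rfl⟩ := Tables.exists_node hx
    have hm := Tables.node_mod (T := T) (c := c) hp
    have hd := Tables.node_div (T := T) (c := c) hp
    by_cases hs : T.sym p < 2
    · have hz2 : (z - 1) / 2 = c * T.len + p := by omega
      have := h₀ z (.inr ⟨by unfold Tables.items at hz; omega, by rw [hz2, hm]; exact hs⟩)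
      have hk := hT.kind_le _ hx (by rw [hm]; exact hs)
      rw [this.1, this.2]
      refine ⟨hpos, hpos, ?_⟩
      rcases hzx with rfl | rfl
      · rw [hk.1]; omega
      · rw [hk.2]; omega
    obtain ⟨φ, hφ⟩ := hT.genuine c hc p hp (by omega)
    have hbin : ∀ ψ χ : Formula (Atom Sg), 2 < T.sym p → T.sym p ≤ 4 → T.Rep c (p + 1) ψ →
        T.Rep c (T.ending (p + 1)) χ → T.left z < T.items ∧ T.right z < T.items ∧ T.kind z ≤ 2 := by
      intro ψ χ hs₁ hs₂ hψ hχ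
      have h₁ := Tables.node_lt hc hψ.lt
      have h₂ := Tables.node_lt hc hχ.lt
      unfold Tables.items
      rcases hzx with rfl | rfl
      · obtain ⟨k₁, k₂, k₃⟩ := hT.bin_left _ hx (by rw [hm]; exact hs₁)
        rw [k₁, k₂, k₃, hm, hd]
        omega
      · obtain ⟨k₁, k₂, k₃⟩ := hT.bin_right _ hx (by rw [hm]; exact hs₁)
        rw [k₁, k₂, k₃, hm, hd]
        omega
    cases φ with
    | atom a => exact absurd hφ.2.1 (by omega)
    | neg φ =>
      have h₁ := Tables.node_lt hc hφ.2.2.lt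
      unfold Tables.items
      rcases hzx with rfl | rfl
      · obtain ⟨k₁, k₂, k₃⟩ := hT.neg_left _ hx (by rw [hm]; exact hφ.2.1)
        rw [k₁, k₂, k₃]
        omega
      · obtain ⟨k₁, k₂, k₃⟩ := hT.neg_right _ hx (by rw [hm]; exact hφ.2.1)
        rw [k₁, k₂, k₃]
        omega
    | conj φ ψ => exact hbin φ ψ (by rw [hφ.2.1]; omega) (by rw [hφ.2.1]; omega) hφ.2.2.1 hφ.2.2.2
    | disj φ ψ => exact hbin φ ψ (by rw [hφ.2.1]; omega) (by rw [hφ.2.1]) hφ.2.2.1 hφ.2.2.2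
  have hdual : ∀ z < T.items, T.dual z < T.items ∧ T.dual (T.dual z) = z := by
    intro z hz
    rcases hcases z hz with rfl | ⟨x, hx, rfl | rfl⟩
    · rw [hT.dual_zero, hT.dual_zero]; exact ⟨hpos, rfl⟩
    · rw [hT.dual_left x hx, hT.dual_right x hx]; unfold Tables.items; omega
    · rw [hT.dual_right x hx, hT.dual_left x hx]; unfold Tables.items; omega
  refine ⟨fun z hz => (hdual z hz).1, fun z hz => (hdual z hz).2, fun z hz => (hmain z hz).1,
    fun z hz => (hmain z hz).2.1, fun z hz => (hmain z hz).2.2, ?_⟩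
  rintro x y (⟨x', hx', y', hy', -, -, -, rfl, rfl⟩ | ⟨s, hs, c, hc, rfl, rfl⟩)
  · unfold Tables.items; omega
  · exact hT.item_lt hs hc

end Ranges

/-! ### Sizes -/

theorem Formula.card_vars_le (φ : Formula (Atom Sg)) : φ.vars.card ≤ φ.argList.length := by
  induction φ with
  | atom a =>
    refine Finset.card_biUnion_le.trans ?_
    rw [Formula.argList, List.length_ofFn]
    refine (Finset.sum_le_card_nsmul _ _ 1 fun i _ => ?_).trans (by simp)
    cases a.args i <;> simp [Arg.vars]
  | neg φ ih => exact ih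
  | conj φ ψ ih₁ ih₂ =>
    rw [Formula.argList, List.length_append]
    exact (Finset.card_union_le _ _).trans (Nat.add_le_add ih₁ ih₂)
  | disj φ ψ ih₁ ih₂ =>
    rw [Formula.argList, List.length_append]
    exact (Finset.card_union_le _ _).trans (Nat.add_le_add ih₁ ih₂)

theorem card_optVars_le (Γ : Option (Annotated (Atom Sg))) :
    (optVars Γ).card ≤ (optArgs Γ).length := by
  rcases Γ with _ | (φ | φ)
  · exact le_rfl
  · exact φ.card_vars_le
  · exact φ.card_vars_le

theorem Sequent.degree_le (S : Sequent (Atom Sg)) : S.degree ≤ S.argList.length := by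
  rw [Sequent.argList, List.length_append]
  exact (Finset.card_union_le _ _).trans
    (Nat.add_le_add (card_optVars_le _) (card_optVars_le _))

/-- In particular the degree vanishes when there are no arguments, so the number of substitutions is
then 0^0 = 1 and never zero. -/
theorem Instance.degree_le_length_args (I : Instance Sg) : I.degree ≤ I.args.length := by
  rw [Instance.args, List.length_append]
  refine le_trans ?_ (Nat.le_add_left _ _)
  unfold Instance.degree
  induction I.axs with
  | nil => exact le_rfl
  | cons S l ih =>
    rw [List.map_cons, List.foldr_cons, List.flatMap_cons, List.length_append]
    have := S.degree_le
    omega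

theorem Formula.length_argList_le_size (φ : Formula (Atom Sg)) : φ.argList.length ≤ φ.size := by
  induction φ with
  | atom a => rw [Formula.argList, List.length_ofFn, Formula.size]; omega
  | neg φ ih => rw [Formula.argList, Formula.size]; omega
  | conj φ ψ ih₁ ih₂ => rw [Formula.argList, Formula.size, List.length_append]; omega
  | disj φ ψ ih₁ ih₂ => rw [Formula.argList, Formula.size, List.length_append]; omega

theorem Formula.length_encode_le (φ : Formula (Atom Sg)) : φ.encode.length ≤ 3 * φ.size := by
  induction φ with
  | atom a => rw [Formula.length_encode_atom, Formula.size]; omega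
  | neg φ ih => rw [Formula.encode_neg, Formula.size, List.length_cons]; omega
  | conj φ ψ ih₁ ih₂ =>
    rw [Formula.encode_conj, Formula.size, List.length_cons, List.length_append]; omega
  | disj φ ψ ih₁ ih₂ =>
    rw [Formula.encode_disj, Formula.size, List.length_cons, List.length_append]; omega

theorem length_optArgs_le (Γ : Option (Annotated (Atom Sg))) : (optArgs Γ).length ≤ optSize Γ := by
  rcases Γ with _ | (φ | φ)
  · exact le_rfl
  · exact φ.length_argList_le_size
  · exact φ.length_argList_le_size

theorem length_optEncode_le (Γ : Option (Annotated (Atom Sg))) :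
    (optEncode Γ).length ≤ 1 + 3 * optSize Γ := by
  rcases Γ with _ | (φ | φ)
  · exact le_rfl
  · have := φ.length_encode_le
    simp only [optEncode, Annotated.encode_eq, optSize, Annotated.size, List.length_cons,
      Annotated.formula]
    omega
  · have := φ.length_encode_le
    simp only [optEncode, Annotated.encode_eq, optSize, Annotated.size, List.length_cons,
      Annotated.formula]
    omega

theorem Sequent.length_argList_le (S : Sequent (Atom Sg)) : S.argList.length ≤ S.size := by
  have h₁ := length_optArgs_le S.fst
  have h₂ := length_optArgs_le S.snd
  rw [Sequent.argList, List.length_append, Sequent.size]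
  omega

theorem Sequent.length_encode_le (S : Sequent (Atom Sg)) : S.encode.length ≤ 3 * S.size := by
  have h₁ := length_optEncode_le S.fst
  have h₂ := length_optEncode_le S.snd
  rw [Sequent.encode, List.length_append, Sequent.size]
  omega

theorem Instance.size_pos (I : Instance Sg) : 0 < I.size := by
  rw [Instance.size, Sequent.size]; omega

theorem Instance.length_args_le (I : Instance Sg) : I.args.length ≤ I.size := by
  have h₀ := I.goal.length_argList_le
  have h : (I.axs.flatMap Sequent.argList).length ≤ (I.axs.map Sequent.size).sum := by
    induction I.axs with
    | nil => exact le_rfl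
    | cons S l ih =>
      have := S.length_argList_le
      rw [List.flatMap_cons, List.length_append, List.map_cons, List.sum_cons]
      omega
  rw [Instance.args, List.length_append, Instance.size]
  omega

theorem Instance.length_encode_le (I : Instance Sg) : I.encode.length ≤ 4 * I.size := by
  have h₀ := I.goal.length_encode_le
  have h₁ := I.size_pos
  have h : (I.axs.flatMap Sequent.encode).length ≤ 3 * (I.axs.map Sequent.size).sum := by
    induction I.axs with
    | nil => exact le_rfl
    | cons S l ih =>
      have := S.length_encode_le
      rw [List.flatMap_cons, List.length_append, List.map_cons, List.sum_cons]
      omega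
  simp only [Instance.size, Instance.encode, List.length_append, List.length_cons,
    List.length_nil] at *
  omega

end EPROL

namespace EPROL

open Stmt

variable {Sg : Signature} {W B U : ℕ}

/-! ### The decision program is correct -/

theorem le_cube {M : ℕ} (hM : 1 ≤ M) : M ≤ M * M * M ∧ M * M ≤ M * M * M := by
  have h₁ : 1 * M ≤ M * M := Nat.mul_le_mul_right _ hM
  have h₂ : M * M * 1 ≤ M * M * M := Nat.mul_le_mul_left _ hM
  rw [Nat.one_mul] at h₁
  rw [Nat.mul_one] at h₂
  exact ⟨h₁.trans h₂, h₂⟩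

theorem hyp_cost_le {M n l : ℕ} (hn : n ≤ M) (hl : l ≤ M) (hM : 1 ≤ M) :
    n * (n * (123 * l + 403) + 103) + 2 ≤ 631 * (M * M * M) := by
  obtain ⟨h₁, h₂⟩ := le_cube hM
  calc _ ≤ M * (M * (123 * M + 403) + 103) + 2 := by gcongr
    _ = 123 * (M * M * M) + 403 * (M * M) + 103 * M + 2 := by ring
    _ ≤ _ := by
      generalize M * M * M = X at *
      generalize M * M = Y at *
      omega

theorem ax_cost_le {M n l : ℕ} (hn : n ≤ M) (hl : l ≤ M) (hM : 1 ≤ M) :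
    n * (l * 203 + 5) + 2 ≤ 210 * (M * M * M) := by
  obtain ⟨h₁, h₂⟩ := le_cube hM
  calc _ ≤ M * (M * 203 + 5) + 2 := by gcongr
    _ = 203 * (M * M) + 5 * M + 2 := by ring
    _ ≤ _ := by
      generalize M * M * M = X at *
      generalize M * M = Y at *
      omega

theorem sat_cost_le {M : ℕ} (hM : 1 ≤ M) :
    M * M * (M * 203 + 403) + 2 ≤ 608 * (M * M * M) := by
  obtain ⟨h₁, h₂⟩ := le_cube hM
  calc _ = 203 * (M * M * M) + 403 * (M * M) + 2 := by ring
    _ ≤ _ := by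
      generalize M * M * M = X at *
      generalize M * M = Y at *
      omega

/-- The phases describe pairs by single numbers; since all items are below the base, the two items
can be recovered. -/
theorem Tables.start_pair {T : Tables} (hT : T.Ranges) {x y : ℕ} (hy : y < T.items) :
    T.Start x y ↔
    (∃ x' < T.nodes, T.sym (x' % T.len) = 1 ∧ ∃ y' < T.nodes, T.sym (y' % T.len) = 1 ∧
      T.SameAtom x' y' ∧ x * T.items + y = (2 * x' + 1) * T.items + (2 * y' + 2)) ∨
    ∃ c < T.count, ∃ s < T.axCount, x * T.items + y =
      T.item c (T.partA (s + 1)) * T.items + T.item c (T.partB (s + 1)) := by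
  constructor
  · rintro (⟨x', hx', y', hy', h₁, h₂, h₃, rfl, rfl⟩ | ⟨s, hs, c, hc, rfl, rfl⟩)
    · exact .inl ⟨x', hx', h₁, y', hy', h₂, h₃, rfl⟩
    · exact .inr ⟨c, hc, s, hs, rfl⟩
  · rintro (⟨x', hx', h₁, y', hy', h₂, h₃, e⟩ | ⟨c, hc, s, hs, e⟩)
    · have h : T.Start (2 * x' + 1) (2 * y' + 2) := .inl ⟨x', hx', y', hy', h₁, h₂, h₃, rfl, rfl⟩
      obtain ⟨rfl, rfl⟩ := pair_inj hy (hT.start_lt _ _ h).2 e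
      exact h
    · have h : T.Start (T.item c (T.partA (s + 1))) (T.item c (T.partB (s + 1))) :=
        .inr ⟨s, hs, c, hc, rfl, rfl⟩
      obtain ⟨rfl, rfl⟩ := pair_inj hy (hT.start_lt _ _ h).2 e
      exact h

/-- From correct tables the program computes the answer. -/
theorem answer_spec (hU : B + 16 * U + 16 < W) {T : Tables} {I : Instance Sg} (hT : T.Correct I)
    (hr : T.Ranges) (hb : T.Bound U) {σ : Store} (h : Loaded T σ) (hD : ∀ e, σ.arr .D e = 0)
    (htl : σ.var .tl = 0) (hax : T.axCount ≤ T.len) (hcount : T.count ≤ T.nodes)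
    (hlen : T.len ≤ T.items) :
    (hypPhase ;; axPhase ;; satPhase ;; answerPhase).Spec W B σ
      (1500 * (T.items * T.items * T.items)) fun τ =>
        τ.var .len ≤ 1 ∧ (τ.var .len = 1 ↔ I.Valid) := by
  have hM : T.items = 2 * T.nodes + 1 := rfl
  have hMM := T.items_sq_ge
  have hpos := (le_cube (M := T.items) (by omega)).1
  have c₁ := hyp_cost_le (M := T.items) (n := T.nodes) (l := T.len) (by omega) hlen (by omega)
  have c₂ := ax_cost_le (M := T.items) (n := T.count) (l := T.axCount) (by omega) (by omega) (by omega)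
  have c₃ := sat_cost_le (M := T.items) (by omega)
  have hpairs := hb.pairs
  obtain ⟨X, hX⟩ : ∃ X, T.items * T.items * T.items = X := ⟨_, rfl⟩
  rw [hX] at hpos c₁ c₂ c₃ ⊢
  have hq : Queue T.items σ :=
    ⟨fun e => by rw [hD]; omega, fun e he => by rw [hD] at he; omega,
      fun e he => by rw [hD] at he; omega, fun i hi => by omega, fun i hi => by omega⟩
  -- Of the budget of `1500 * X`, the hypotheses take at most `631 * X`, the axioms `210 * X` and
  -- the saturation `608 * X`; the rest pays for the answer.
  refine Spec.seq (hypPhase_spec hU hb h hq) ?_ (T₂ := 850 * X)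
    ((Nat.add_le_add_right c₁ _).trans (by rw [← Nat.add_mul]; exact Nat.mul_le_mul_right _ (by decide)))
  intro σ₁ hf₁ ha₁
  have h₁ := h.of_frame hf₁ (by decide) (by decide)
  refine Spec.seq (axPhase_spec hU hb h₁ ha₁.grows.queue hax (by omega)
    fun s hs c hc => hT.item_lt hs hc) ?_ (T₂ := 640 * X)
    ((Nat.add_le_add_right c₂ _).trans (by rw [← Nat.add_mul]))
  intro σ₂ hf₂ ha₂
  have h₂ := h₁.of_frame hf₂ (by decide) (by decide)
  refine Spec.seq (satPhase_spec hU hr hb h₂ ha₂.grows.queue ?_) ?_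
    (T₂ := 30 * X)
    ((Nat.add_le_add_right c₃ _).trans (by rw [← Nat.add_mul]; exact Nat.mul_le_mul_right _ (by decide)))
  · intro x y hx hy
    rw [T.start_pair hr hy]
    constructor
    · intro he
      rcases ha₂.sound _ he with he | he
      · rcases ha₁.sound _ he with he | he
        · rw [hD] at he; omega
        · exact .inl he
      · exact .inr he
    · rintro (he | he)
      · exact ha₂.grows.mono _ (ha₁.complete _ he)
      · exact ha₂.complete _ he
  rintro σ₃ hf₃ ⟨hle, hd⟩
  have h₃ := h₂.of_frame hf₃ (by decide) (by decide)
  have hg : ∀ n, T.item 0 n = n := fun n => by unfold Tables.item; split_ifs <;> omega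
  have ha := (Tables.Denotes.of_partRep hT.count_pos hT.goal_fst).lt
  have hb' := (Tables.Denotes.of_partRep hT.count_pos hT.goal_snd).lt
  rw [hg] at ha hb'
  have hp := pair_lt ha hb'
  have hd := (hd _ _ ha hb').trans hT.closure_iff_valid
  refine Spec.assign ?_ ?_ ?_
  · simp [h₃.partA, h₃.partB, h₃.items]
    omega
  · simp; omega
  · simpa [h₃.partA, h₃.partB, h₃.items] using ⟨hle _, hd⟩

/-- The tables are ready in the store `σ`. -/
structure Ready (U : ℕ) (I : Instance Sg) (N : ℕ) (σ : Store) : Prop where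
  correct : σ.tables.Correct I
  ranges : σ.tables.Ranges
  bound : σ.tables.Bound U
  loaded : Loaded σ.tables σ
  unmarked : ∀ e, σ.arr .D e = 0
  tl : σ.var .tl = 0
  axCount_le : σ.tables.axCount ≤ σ.tables.len
  count_le : σ.tables.count ≤ σ.tables.nodes
  len_le : σ.tables.len ≤ σ.tables.items
  nodes_le : σ.tables.nodes ≤ N

theorem Marks.le_four {E KD J : ℕ → ℕ} {hi d : ℕ} (h : Marks Sg E KD J hi d) {r : ℕ} (hr : r < hi) :
    KD r ≤ 4 := by
  by_cases h0 : KD r = 0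
  · omega
  obtain ⟨i, V, ψ, -, -, -, hs⟩ := h r hr h0
  cases ψ with
  | atom a => rw [hs.1]; omega
  | neg ψ => rw [hs.1]; omega
  | conj ψ₁ ψ₂ => rw [hs.1]; omega
  | disj ψ₁ ψ₂ => rw [hs.1]

theorem Instance.start_length (I : Instance Sg) : I.start I.axs.length = I.encode.length := by
  simp only [Instance.start, Instance.encode, List.take_length, List.length_append,
    List.length_cons, List.length_nil]

theorem Instance.length_axs_lt (I : Instance Sg) : I.axs.length < I.encode.length := by
  have := length_le_flatMap_encode I.axs
  have := I.goal.length_encode_pos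
  simp only [Instance.encode, List.length_append, List.length_cons, List.length_nil]
  omega

/-- The program works with the number `d` it has found, which is only known to be at most the
degree; a power of a positive number is monotone in the exponent, and with no arguments both
exponents are zero. -/
theorem Instance.pow_args_le (I : Instance Sg) {d : ℕ} (hd : d ≤ I.degree) :
    0 < I.args.length ^ d ∧ I.args.length ^ d ≤ I.args.length ^ I.degree := by
  have := I.degree_le_length_args
  rcases Nat.eq_zero_or_pos I.args.length with h | h
  · rw [show I.degree = 0 by omega, show d = 0 by omega]; simp
  · exact ⟨Nat.pow_pos h, Nat.pow_le_pow_right h hd⟩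

/-- The rest of the program is a parameter `c`, as sequencing associates to the right; `Ready` is
the only interface between parsing and saturation. The number `N` is computed from the degree and
bounds the actual number of nodes. -/
theorem prepare_spec (hU : B + 16 * U + 16 < W) {I : Instance Sg} {len N t : ℕ}
    (hlen : I.encode.length = len) (hN : len * I.args.length ^ I.degree = N)
    (hNU : (2 * N + 1) * (2 * N + 1) + 3 * len + I.args.length + 16 ≤ U) {c : Stmt}
    {P : Store → Prop} (hc : ∀ τ, Ready U I N τ → τ.var .len = len → c.Spec W B τ t P) :
    (stopPhase ;; scanPhase ;; powPhase ;; nodePhase ;; c).Spec W B (Store.init I.encode)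
      ((len + 1) * (40 * (len * len) + 1200 * len + 700) + 103 * len + 40 * I.args.length + 503 * N +
        t + 200) P := by
  have hlt := I.length_axs_lt
  have hdeg := I.degree_le_length_args
  have hSq : 2 * N + 1 ≤ (2 * N + 1) * (2 * N + 1) := Nat.le_mul_self _
  have hlN : len ≤ N := by
    rw [← hN]; exact Nat.le_mul_of_pos_right _ (I.pow_args_le le_rfl).1
  have hl₀ : (Store.init I.encode).var .len = len := by simp [Store.init, hlen]
  have hE₀ : At ((Store.init I.encode).arr .E) 0 I.encode := by
    intro i hi
    simp [Store.init, hi]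
  have hv₀ : ∀ x, x ≠ .len → (Store.init I.encode).var x = 0 := fun x hx => by
    simp [Store.init, hx]
  have ha₀ : ∀ a, a ≠ .E → ∀ r, (Store.init I.encode).arr a r = 0 := fun a ha r => by
    simp [Store.init, ha]
  generalize Store.init I.encode = σ₀ at *
  generalize hE : σ₀.arr .E = E at *
  refine Spec.seq (stopPhase_spec (Sg := Sg) hU (by omega) (ha₀ _ (by decide))) ?_ (T₂ :=
    (len + 1) * (40 * (len * len) + 1200 * len + 700) + 40 * I.args.length + 503 * N + t + 190)
    (by omega)
  rintro σ₁ hf₁ ⟨hEND, hends⟩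
  rw [hl₀] at hEND hends
  rw [hE] at hends
  have hE₁ : σ₁.arr .E = E := (hf₁.arr _ (by decide)).trans hE
  have hl₁ : σ₁.var .len = len := (hf₁.var _ (by decide)).trans hl₀
  refine Spec.seq (scanPhase_spec hU hlen hE₁ hE₀ hl₁ hends (by omega) ?_ ?_ ?_ ?_ ?_) ?_ (T₂ :=
    40 * I.args.length + 503 * N + t + 190) (by omega)
  · rw [hf₁.var _ (by decide)]; exact hv₀ _ (by decide)
  · rw [hf₁.var _ (by decide)]; exact hv₀ _ (by decide)
  · rw [hf₁.var _ (by decide)]; exact hv₀ _ (by decide)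
  · intro r; rw [hf₁.arr _ (by decide)]; exact ha₀ _ (by decide) r
  · intro r; rw [hf₁.arr _ (by decide)]; exact ha₀ _ (by decide) r
  rintro σ₂ hf₂ ⟨hI, hk₂⟩
  obtain ⟨⟨hE₂, -, ⟨hm₂, hrec⟩, hJ, hun, -⟩, hgoal, haxs, hmarks, hVd, hd⟩ := hI
  rw [List.take_length] at hm₂
  simp only [List.take_length] at hrec
  simp only [I.start_length, hlen] at hgoal haxs hmarks hun
  change σ₂.var .m = I.args.length at hm₂
  change ∀ i (h : i < I.args.length), IsArg E (σ₂.arr .T i) I.args[i] ∧ _ at hrec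
  have hl₂ : σ₂.var .len = len := (hf₂.var _ (by decide)).trans hl₁
  obtain ⟨hpos, hpow⟩ := I.pow_args_le hd
  have hN₂ : len * I.args.length ^ σ₂.var .d ≤ N := by
    rw [← hN]; exact Nat.mul_le_mul_left _ hpow
  have hKD : ∀ r, σ₂.arr .KD r ≤ U := by
    intro r
    by_cases hr : r < len
    · have := hmarks.le_four hr; omega
    · rw [(hun r (by omega)).2]; exact Nat.zero_le _
  refine Spec.seq (powPhase_spec hU hl₂ hm₂ rfl (by omega) ?_ ?_) ?_ (T₂ := 503 * N + t + 90)
    (by omega)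
  · intro j hj
    have h₁ := (I.pow_args_le (hj.trans hd)).2
    have h₂ : 1 * I.args.length ^ I.degree ≤ len * I.args.length ^ I.degree :=
      Nat.mul_le_mul_right _ (by omega)
    omega
  · have : (2 * (len * I.args.length ^ σ₂.var .d) + 1) * (2 * (len * I.args.length ^ σ₂.var .d) + 1) ≤
        (2 * N + 1) * (2 * N + 1) := Nat.mul_le_mul (by omega) (by omega)
    omega
  rintro σ₃ hf₃ ⟨hPOW, hCN, hN₃, hM₃, hMM₃⟩
  generalize hn : len * I.args.length ^ σ₂.var .d = n at *
  have hm₃ : σ₃.var .m = I.args.length := (hf₃.var _ (by decide)).trans hm₂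
  have hl₃ : σ₃.var .len = len := (hf₃.var _ (by decide)).trans hl₂
  have hz : ∀ a ∈ ([.IK, .IA, .IB, .BAR, .D] : List Arr), ∀ r, σ₃.arr a r = 0 := by
    intro a ha r
    simp only [List.mem_cons, List.not_mem_nil, or_false] at ha
    rcases ha with rfl | rfl | rfl | rfl | rfl <;>
    rw [hf₃.arr _ (by decide), hf₂.arr _ (by decide), hf₁.arr _ (by decide)] <;>
    exact ha₀ _ (by decide) r
  refine Spec.seq (nodePhase_spec hU hN₃ hm₃ hl₃ ?_ (by omega) ?_ ?_ ?_ ?_) ?_ (T₂ := t) (by omega)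
  · rw [hf₃.arr _ (by decide)]; exact hJ
  · rw [hf₃.arr _ (by decide), hf₂.arr _ (by decide)]; exact hEND
  · rw [hf₃.arr _ (by decide)]; exact hKD
  · exact fun r => ⟨hz _ (by simp) r, hz _ (by simp) r, hz _ (by simp) r⟩
  · exact hz _ (by simp) 0
  intro σ₄ hf₄ hnode
  have hl₄ : σ₄.tables.len = len := (hf₄.var _ (by decide)).trans hl₃
  have hcount₄ : σ₄.tables.count = I.args.length ^ σ₂.var .d := (hf₄.var _ (by decide)).trans hCN
  have hnodes₄ : σ₄.tables.nodes = n := by rw [Tables.nodes, hl₄, hcount₄, hn]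
  have hk₄ : σ₄.tables.axCount = I.axs.length :=
    ((hf₄.var _ (by decide)).trans (hf₃.var _ (by decide))).trans hk₂
  have hE₄ : σ₄.arr .E = E := ((hf₄.arr _ (by decide)).trans (hf₃.arr _ (by decide))).trans hE₂
  have hJ₄ : σ₄.arr .J = σ₂.arr .J := (hf₄.arr _ (by decide)).trans (hf₃.arr _ (by decide))
  have hK₄ : σ₄.arr .KD = σ₂.arr .KD := (hf₄.arr _ (by decide)).trans (hf₃.arr _ (by decide))
  have hT₄ : σ₄.arr .T = σ₂.arr .T := (hf₄.arr _ (by decide)).trans (hf₃.arr _ (by decide))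
  have hA₄ : σ₄.arr .AXA = σ₂.arr .AXA := (hf₄.arr _ (by decide)).trans (hf₃.arr _ (by decide))
  have hB₄ : σ₄.arr .AXB = σ₂.arr .AXB := (hf₄.arr _ (by decide)).trans (hf₃.arr _ (by decide))
  have hEND₄ : σ₄.arr .END = σ₁.arr .END :=
    ((hf₄.arr _ (by decide)).trans (hf₃.arr _ (by decide))).trans (hf₂.arr _ (by decide))
  have hPOW₄ : σ₄.arr .POW = σ₃.arr .POW := hf₄.arr _ (by decide)
  have hparsed : Parsed σ₄.tables (σ₄.arr .J) (σ₂.var .d) I := by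
    refine ⟨hk₄, hcount₄, by rw [hcount₄]; exact hpos, ?_, ?_, ?_, ?_⟩
    · rw [hl₄]
      simpa only [Store.tables, hE₄, hJ₄, hK₄, hA₄, hB₄] using hgoal
    · intro j hj
      rw [hl₄]
      simpa only [Store.tables, hE₄, hJ₄, hK₄, hA₄, hB₄] using haxs j hj hj
    · exact fun j hj => hVd j hj hj
    · rw [hl₄]
      simpa only [Store.tables, hE₄, hJ₄, hK₄] using hmarks
  have hnode' : NodeTables σ₄.tables.len I.args.length σ₄.tables.nodes σ₄ := by
    rw [hl₄, hnodes₄]; exact hnode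
  have haddr : Addressed σ₄.tables U (σ₄.arr .J) I.args (σ₂.var .d) := by
    refine addressed_of_nodeTables hnode' ?_ (by omega) ?_ (by rw [hl₄]; omega) ?_
    · rw [hPOW₄]; exact hPOW
    · rw [hE₄, hT₄]; exact hrec
    · rw [hE₄, hEND₄]; rw [show σ₄.var .len = len from hl₄]; exact hends
  have hcorrect := correct_of_parsed hparsed haddr hnode'
  have hitems : σ₄.tables.items = 2 * n + 1 := by rw [Tables.items, hnodes₄]
  refine hc σ₄ ⟨hcorrect, hcorrect.ranges ?_, ⟨?_, ?_⟩, ?_, ?_, ?_, ?_, ?_, ?_, ?_⟩ hl₄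
  · rintro z (rfl | hz)
    · exact (hnode'.rest 0 (.inl rfl)).2
    · exact (hnode'.rest z (.inr (.inr hz))).2
  · have : (2 * n + 1) * (2 * n + 1) ≤ (2 * N + 1) * (2 * N + 1) :=
      Nat.mul_le_mul (by omega) (by omega)
    rw [hitems, hl₄]
    omega
  · intro x hx hs
    obtain ⟨c, p, hc, hp, rfl⟩ := Tables.exists_node hx
    rw [Tables.node_mod hp] at hs
    exact haddr.atomBound (by rw [hl₄]; omega) hc hparsed.marks hp hs
  · refine ⟨rfl, rfl, ?_, ?_, ?_, rfl, rfl, rfl, rfl, rfl, rfl, rfl, rfl, rfl, rfl⟩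
    · rw [hnodes₄, hf₄.var _ (by decide), hN₃]
    · rw [hitems, hf₄.var _ (by decide), hM₃]
    · rw [hitems, hf₄.var _ (by decide), hMM₃]
  · intro e; rw [hf₄.arr _ (by decide)]; exact hz _ (by simp) e
  · rw [hf₄.var _ (by decide), hf₃.var _ (by decide), hf₂.var _ (by decide), hf₁.var _ (by decide)]
    exact hv₀ _ (by decide)
  · rw [hk₄, hl₄]; omega
  · rw [hcount₄, hnodes₄, ← hn]; exact Nat.le_mul_of_pos_left _ (by omega)
  · rw [hl₄, hitems, ← hn]
    have := Nat.le_mul_of_pos_right len hpos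
    omega
  · rw [hnodes₄]; exact hN₂

theorem decideProgram_spec (hU : B + 16 * U + 16 < W) {I : Instance Sg} {len N : ℕ}
    (hlen : I.encode.length = len) (hN : len * I.args.length ^ I.degree = N)
    (hNU : (2 * N + 1) * (2 * N + 1) + 3 * len + I.args.length + 16 ≤ U) :
    decideProgram.Spec W B (Store.init I.encode)
      ((len + 1) * (40 * (len * len) + 1200 * len + 700) + 103 * len + 40 * I.args.length + 503 * N +
        1500 * ((2 * N + 1) * (2 * N + 1) * (2 * N + 1)) + 200)
      fun τ => τ.var .len ≤ 1 ∧ (τ.var .len = 1 ↔ I.Valid) := by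
  refine prepare_spec hU hlen hN hNU fun τ h _ => ?_
  refine (answer_spec hU h.correct h.ranges h.bound h.loaded h.unmarked h.tl h.axCount_le h.count_le
    h.len_le).mono ?_ fun _ _ h => h
  have hle : τ.tables.items ≤ 2 * N + 1 := by
    have := h.nodes_le
    unfold Tables.items
    omega
  exact Nat.mul_le_mul_left _ (Nat.mul_le_mul (Nat.mul_le_mul hle hle) hle)

end EPROL

/-! ### Numerical bounds and the conclusion. -/

namespace EPROL

open Stmt

variable {Sg : Signature}

/-- Here `X` is n^(d+1). Replacing suitable summands `1` by `X` leaves a cubic polynomial in `X`,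
whose coefficients add up to less than `1200000`. The first terms are the cost of copying the input.
-/
theorem time_le {l m N X : ℕ} (hX : 1 ≤ X) (hl : l ≤ 4 * X) (hm : m ≤ X) (hN : N ≤ 4 * X) :
    6 * l + 5 + ((l + 1) * (40 * (l * l) + 1200 * l + 700) + 103 * l + 40 * m + 503 * N +
      1500 * ((2 * N + 1) * (2 * N + 1) * (2 * N + 1)) + 200) ≤ 1200000 * (X * X * X) := by
  obtain ⟨h₁, h₂⟩ := le_cube hX
  calc _ ≤ 6 * (4 * X) + 5 + ((4 * X + X) *
        (40 * (4 * X * (4 * X)) + 1200 * (4 * X) + 700) + 103 * (4 * X) + 40 * X + 503 * (4 * X) +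
        1500 * ((2 * (4 * X) + X) * (2 * (4 * X) + X) * (2 * (4 * X) + X)) + 200) := by gcongr
    _ = 1096700 * (X * X * X) + 24000 * (X * X) + 5988 * X + 205 := by ring
    _ ≤ _ := by
      generalize X * X * X = Z at *
      generalize X * X = Y at *
      omega

/-- The left side dominates both address bounds: that of the copying loop, and that of sixteen
interleaved arrays placed after the input with indices up to the chosen `U`. -/
theorem space_le {l m N X : ℕ} (hX : 1 ≤ X) (hl : l ≤ 4 * X) (hm : m ≤ X) (hN : N ≤ 4 * X) :
    17 * l + 16 * ((2 * N + 1) * (2 * N + 1) + 3 * l + m + 16) + 16 < 2048 * (X * X) := by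
  have h : 1 * X ≤ X * X := Nat.mul_le_mul_right _ hX
  calc _ ≤ 17 * (4 * X) + 16 * ((2 * (4 * X) + X) * (2 * (4 * X) + X) + 3 * (4 * X) + X + 16) + 16 := by
        gcongr
    _ = 1296 * (X * X) + 276 * X + 272 := by ring
    _ < _ := by
      generalize X * X = Y at *
      omega

theorem Instance.nodes_le (I : Instance Sg) :
    I.encode.length * I.args.length ^ I.degree ≤ 4 * I.size ^ (I.degree + 1) := by
  calc _ ≤ 4 * I.size * I.size ^ I.degree :=
        Nat.mul_le_mul I.length_encode_le (Nat.pow_le_pow_left I.length_args_le _)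
    _ = _ := by ring

theorem Instance.size_le_pow (I : Instance Sg) : I.size ≤ I.size ^ (I.degree + 1) :=
  Nat.le_self_pow (by omega) _

/-- Since 2048 = 2^11 and (n+1)^(d+1) is at least `2`, the constant is absorbed by eleven such
factors; with the two factors already there this makes thirteen. -/
theorem Instance.word_bound (I : Instance Sg) :
    2048 * (I.size ^ (I.degree + 1) * I.size ^ (I.degree + 1)) ≤
      (I.size + 1) ^ (13 * (I.degree + 1)) := by
  have h₁ := I.size_pos
  have h₂ : 2 ≤ (I.size + 1) ^ (I.degree + 1) :=
    le_trans (by omega) (Nat.le_self_pow (by omega) (I.size + 1))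
  have h₃ : I.size ^ (I.degree + 1) ≤ (I.size + 1) ^ (I.degree + 1) :=
    Nat.pow_le_pow_left (by omega) _
  calc _ ≤ ((I.size + 1) ^ (I.degree + 1)) ^ 11 *
        ((I.size + 1) ^ (I.degree + 1) * (I.size + 1) ^ (I.degree + 1)) :=
        Nat.mul_le_mul (le_trans (by norm_num) (Nat.pow_le_pow_left h₂ 11)) (Nat.mul_le_mul h₃ h₃)
    _ = _ := by ring

end EPROL

theorem mainTheorem9 :
    ∃ (p : EPROL.Cmd) (C k : ℕ), ∀ (Sg : EPROL.Signature) (I : EPROL.Instance Sg) (w : ℕ),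
      (I.size + 1) ^ (k * (I.degree + 1)) ≤ 2 ^ w →
      (∀ x ∈ I.encode, x < 2 ^ w) →
      ∃ (t : ℕ) (s : EPROL.State),
        EPROL.Exec w p (EPROL.State.init I.encode) t s ∧
        t ≤ C * I.size ^ (3 * (I.degree + 1)) ∧
        ((I.Valid ∧ s.reg 0 = 1) ∨ (¬ I.Valid ∧ s.reg 0 = 0)) := by
  refine ⟨.seq EPROL.copyCode EPROL.decideProgram.code, 1200000, 13, fun Sg I w hw hin => ?_⟩
  have hX : 1 ≤ I.size ^ (I.degree + 1) := Nat.pow_pos I.size_pos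
  have hn := I.size_le_pow
  have hl : I.encode.length ≤ 4 * I.size ^ (I.degree + 1) :=
    I.length_encode_le.trans (Nat.mul_le_mul_left _ hn)
  have hm := I.length_args_le.trans hn
  have ht := EPROL.time_le hX hl hm I.nodes_le
  have hs := ((EPROL.space_le hX hl hm I.nodes_le).trans_le I.word_bound).trans_le hw
  obtain ⟨t₁, s₁, h₁, ht₁, hr₁⟩ := EPROL.exec_copyCode (input := I.encode) (by omega) hin
  have hspec := EPROL.decideProgram_spec (W := 2 ^ w) (B := I.encode.length) (I := I)
    (U := (2 * (I.encode.length * I.args.length ^ I.degree) + 1) *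
      (2 * (I.encode.length * I.args.length ^ I.degree) + 1) + 3 * I.encode.length +
        I.args.length + 16)
    ((Nat.add_le_add_right (Nat.add_le_add_right (Nat.le_mul_of_pos_left _ (by decide)) _) _).trans_lt
      hs) rfl rfl le_rfl
  obtain ⟨s₂, σ, t₂, h₂, hr₂, -, ht₂, hle, hiff⟩ :=
    EPROL.Stmt.exec_code _ EPROL.decideProgram_wf hr₁ hspec
  refine ⟨_, s₂, .seq h₁ h₂, ?_, ?_⟩
  · rw [show 3 * (I.degree + 1) = I.degree + 1 + (I.degree + 1) + (I.degree + 1) by ring,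
      pow_add, pow_add]
    exact (Nat.add_le_add ht₁ ht₂).trans ht
  -- The variable `len` is register `0`, and its final value is `0` or `1`.
  · have h₀ : s₂.reg 0 = σ.var .len := hr₂.var .len
    rw [h₀]
    by_cases hv : I.Valid
    · exact .inl ⟨hv, hiff.2 hv⟩
    · refine .inr ⟨hv, ?_⟩
      have : σ.var .len ≠ 1 := fun h => hv (hiff.1 h)
      omega
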